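/- **Setting.** Let $D\subset\mathbb R^3$ be open, $\chi_D$ its indicator function, $I\subset\mathbb R$ an open set of times, $\sigma,m,R,T_w>0$, $\theta(x)=1$ for $x\ge0$ and $\theta(x)=0$ for $x<0$; repeated indices are summed, the argument $t$ is suppressed. For $\boldsymbol\alpha\in\mathbb S^2$ and $\boldsymbol\xi,\boldsymbol\xi_*\in\mathbb R^3$ put $V_\alpha=(\boldsymbol\xi_*-\boldsymbol\xi)\cdot\boldsymbol\alpha$, $\boldsymbol\xi'=\boldsymbol\xi+V_\alpha\boldsymbol\alpha$, $\boldsymbol\xi'_*=\boldsymbol\xi_*-V_\alpha\boldsymbol\alpha$. For $f=f(t,\boldsymbol X,\boldsymbol\xi)$ write $\langle\cdot\rangle=\int_{\mathbb R^3}\cdot\,d\boldsymbol\xi$, $f=f(\cdot,\boldsymbol\xi)$, $f_*=f(\cdot,\boldsymbol\xi_*)$, $f'=f(\cdot,\boldsymbol\xi')$, $f'_*=f(\cdot,\boldsymbol\xi'_*)$, $\rho=\langle f\rangle$, $v_i=\rho^{-1}\langle\xi_if\rangle$, and $$\mathcal R(\boldsymbol X)=\frac1m\int_D\rho(\boldsymbol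 Y)\theta(\sigma-|\boldsymbol Y-\boldsymbol X|)\,d\boldsymbol Y,\qquad g(\boldsymbol X,\boldsymbol Y)=[\mathcal S(\mathcal R(\boldsymbol X))+\mathcal S(\mathcal R(\boldsymbol Y))]\chi_D(\boldsymbol X)\chi_D(\boldsymbol Y).$$ The Enskog--Vlasov equation is, in $I\times D\times\mathbb R^3$, $$\frac{\partial f}{\partial t}+\xi_i\frac{\partial f}{\partial X_i}+F_i\frac{\partial f}{\partial\xi_i}=\frac{\sigma^2}{m}\int\big[g(\boldsymbol X+\sigma\boldsymbol\alpha,\boldsymbol X)f'_*(\boldsymbol X+\sigma\boldsymbol\alpha)f'(\boldsymbol X)-g(\boldsymbol X-\sigma\boldsymbol\alpha,\boldsymbol X)f_*(\boldsymbol X-\sigma\boldsymbol\alpha)f(\boldsymbol X)\big]V_\alpha\theta(V_\alpha)\,d\Omega(\boldsymbol\alpha)d\boldsymbol\xi_*,$$ $$F_i=-\int_D\frac{\partial}{\partial X_i}\Phi(|\boldsymbol Y-\boldsymbol X|)\rho(\boldsymbol Y)\,d\boldsymbol Y.$$ **Assumptions.** (a) $\mathcal S$ is continuous and non-negative on an interval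 $A\ni0$, and $\mathcal R(t,\boldsymbol X)\in A$ for $t\in I$, $\boldsymbol X\in\overline D$. (b) $\Phi$ is $C^1$ on $(0,\infty)$ with $\Phi'\ge0$, and $(1+|\boldsymbol r|)(|\Phi(|\boldsymbol r|)|+|\Phi'(|\boldsymbol r|)|)$ is integrable over $\boldsymbol r\in D-D$. (c) $f$ is positive and $C^1$ on $I\times D\times\mathbb R^3$; on $K\times D$, for each compact $K\subset I$, $f$ and $|\partial_tf|$ have a common majorant that depends on $\boldsymbol\xi$ only and is integrable; for each compact $K\subset I$ and each bounded part $B$ of $D$ there are $k\in\mathbb N$, $C$ and $M(\boldsymbol\xi)$ with $\int(1+|\boldsymbol\xi|)^{k+3}M\,d\boldsymbol\xi<\infty$, $f\le M$ and $|\ln f|\le C(1+|\boldsymbol\xi|)^k$ on $K\times B$; and for compact $L\subset D$ there are such $k,C,M$ with $|\nabla_{t,\boldsymbol X,\boldsymbol\xi}f|\le M$ and $|\ln f|\le C(1+|\boldsymbol\xi|)^k$ on $K\times L$. (d) $\partial D$ is impermeable: $\rho v_in_i=0$ on $\partial D$, in the weak sense $\int_D[\rho v_i\,\partial_i\psi+\psi\,\partial_i(\rho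 v_i)]d\boldsymbol X=0$ for all $t\in I$, $\psi\in C_c^\infty(\mathbb R^3)$ (no condition if $D=\mathbb R^3$). (e) $f$ solves the Enskog--Vlasov equation. **Quantities.** With $\boldsymbol c=\boldsymbol\xi-\boldsymbol v(\boldsymbol X)$, $\boldsymbol c_*=\boldsymbol\xi_*-\boldsymbol v(\boldsymbol X)$, $\boldsymbol X^s=\boldsymbol X+s\boldsymbol\alpha$, let $e^{(k)}=\frac1{2\rho}\langle|\boldsymbol c|^2f\rangle$, $p^{(k)}_{ij}=\langle c_ic_jf\rangle$, $q^{(k)}_i=\frac12\langle c_i|\boldsymbol c|^2f\rangle$, $$p^{(c)}_{ij}=\frac{\sigma^2}{2m}\int\!\!\int_0^\sigma\alpha_i\alpha_jV_\alpha^2\theta(V_\alpha)g(\boldsymbol X^{\lambda},\boldsymbol X^{\lambda-\sigma})f_*(\boldsymbol X^{\lambda-\sigma})f(\boldsymbol X^{\lambda})\,d\lambda\,d\Omega\,d\boldsymbol\xi_*d\boldsymbol\xi,$$ $$q^{(c)}_i=\frac{\sigma^2}{4m}\int\!\!\int_0^\sigma\alpha_i[(\boldsymbol c+\boldsymbol c_*)\cdot\boldsymbol\alpha]V_\alpha^2\theta(V_\alpha)g(\boldsymbol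 X^{\lambda},\boldsymbol X^{\lambda-\sigma})f_*(\boldsymbol X^{\lambda-\sigma})f(\boldsymbol X^{\lambda})\,d\lambda\,d\Omega\,d\boldsymbol\xi_*d\boldsymbol\xi,$$ $$p^{(v)}_{ij}=-\frac12\int_{\mathbb R^3}\frac{r_ir_j}{|\boldsymbol r|}\Phi'(|\boldsymbol r|)\int_0^1(\rho\chi_D)(\boldsymbol X+\lambda\boldsymbol r)(\rho\chi_D)(\boldsymbol X+(\lambda-1)\boldsymbol r)\,d\lambda\,d\boldsymbol r,\qquad e^{(v)}=\frac12\int_D\Phi(|\boldsymbol Y-\boldsymbol X|)\rho(\boldsymbol Y)\,d\boldsymbol Y,$$ $$q^{(v)}_i=(\rho e^{(v)}\delta_{ij}-p^{(v)}_{ij})v_j+\frac12\int_{\mathbb R^3}\int_0^1r_i\Phi(|\boldsymbol r|)\Big(\frac{\partial\rho}{\partial t}\chi_D\Big)(\boldsymbol X+(\lambda-1)\boldsymbol r)\,(\rho\chi_D)(\boldsymbol X+\lambda\boldsymbol r)\,d\lambda\,d\boldsymbol r,$$ $$H^{(c)}=\rho\int_0^{\mathcal R}\mathcal S(x)\,dx,\qquad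 H=\langle f\ln f\rangle+H^{(c)},\qquad J^H_i=\langle\xi_if\ln f\rangle+J^{(k)}_i+J^{(c)}_i,$$ $$J^{(k)}_i=\frac{\sigma^3}{2m}\int\!\!\int_0^1\alpha_i\,g(\boldsymbol X^{\tau\sigma},\boldsymbol X^{(\tau-1)\sigma})\ln\frac{f'(\boldsymbol X^{\tau\sigma})}{f(\boldsymbol X^{\tau\sigma})}f(\boldsymbol X^{\tau\sigma})f_*(\boldsymbol X^{(\tau-1)\sigma})V_\alpha\theta(V_\alpha)\,d\tau\,d\Omega\,d\boldsymbol\xi_*d\boldsymbol\xi,$$ $$J^{(c)}_i=H^{(c)}v_i-\frac{\sigma^3}{2m}\int_{\mathbb S^2}\int_0^1[v_j(\boldsymbol X^{\tau\sigma})-v_j(\boldsymbol X^{(\tau-1)\sigma})](\rho\chi_D)(\boldsymbol X^{\tau\sigma})(\rho\chi_D)(\boldsymbol X^{(\tau-1)\sigma})\mathcal S(\mathcal R(\boldsymbol X^{\tau\sigma}))\alpha_i\alpha_j\,d\tau\,d\Omega,$$ and, with $f_w=\exp(-|\boldsymbol\xi|^2/(2RT_w))$, $$F=RT_w\Big(\Big\langle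 f\ln\frac f{f_w}\Big\rangle+H^{(c)}\Big),\qquad J^F_i=RT_wJ^H_i+\rho v_i\big(e^{(k)}+\tfrac12|\boldsymbol v|^2\big)+(p^{(k)}_{ij}+p^{(c)}_{ij})v_j+q^{(k)}_i+q^{(c)}_i,$$ $$\widetilde F=F+\rho e^{(v)},\qquad J^{\widetilde F}_i=J^F_i+p^{(v)}_{ij}v_j+q^{(v)}_i+\rho e^{(v)}v_i.$$ **Theorem.** In $I\times D$, $$\frac{\partial H}{\partial t}+\frac{\partial J^H_i}{\partial X_i}\le0\qquad\text{and}\qquad\frac{\partial\widetilde F}{\partial t}+\frac{\partial J^{\widetilde F}_i}{\partial X_i}\le0 .$$ In both cases the density and the flux are locally integrable, the inequality holds in the sense of distributions, and it holds pointwise with classical derivatives at every $(t,\boldsymbol X)$ at which the density and the flux are differentiable as functions of $(t,\boldsymbol X)$. Moreover, for every open $U\subset I\times D$, equality holds in the first inequality in the sense of distributions on $U$ if and only if $f'_*(\boldsymbol X-\sigma\boldsymbol\alpha)f'(\boldsymbol X)=f(\boldsymbol X)f_*(\boldsymbol X-\sigma\boldsymbol\alpha)$ for all $(t,\boldsymbol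 X)\in U$, $\boldsymbol\alpha\in\mathbb S^2$, $\boldsymbol\xi,\boldsymbol\xi_*\in\mathbb R^3$ with $g(\boldsymbol X,\boldsymbol X-\sigma\boldsymbol\alpha)\ne0$. -/

import Mathlib

open MeasureTheory Set

/-- Physical space and velocity space. -/
abbrev E3 : Type := EuclideanSpace ℝ (Fin 3)

/-- The unit sphere of directions. -/
abbrev S2 : Type := Metric.sphere (0 : E3) 1

/-- The solid angle measure on the unit sphere (total mass `4 π`). -/
noncomputable def solidAngle : Measure S2 := (volume : Measure E3).toSphere

/-- Partial derivative in the `i`-th coordinate direction of three-dimensional space. -/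
noncomputable def pd (i : Fin 3) (u : E3 → ℝ) (X : E3) : ℝ :=
  fderiv ℝ u X (EuclideanSpace.single i 1)

/-- Heaviside function, equal to one at the origin. -/
noncomputable def heavi (x : ℝ) : ℝ := if 0 ≤ x then 1 else 0

/-- `V_α = (ξ_* - ξ) · α`. -/
noncomputable def relV (α : S2) (ξ ξs : E3) : ℝ := inner ℝ (ξs - ξ) (α : E3)

/-- Post-collisional velocity `ξ + V_α α`. -/
noncomputable def post (α : S2) (ξ ξs : E3) : E3 := ξ + relV α ξ ξs • (α : E3)

/-- Post-collisional velocity `ξ_* - V_α α` of the partner. -/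
noncomputable def postStar (α : S2) (ξ ξs : E3) : E3 := ξs - relV α ξ ξs • (α : E3)

/-- The data of the model: the domain `D` of the molecular centers, the diameter `σ` and mass `m`
of a molecule, the function `S` in the Enskog factor, the potential `Φ` of the Vlasov term, the
specific gas constant `Rg` and the temperature `Tw` of the heat bath. -/
structure Gas where
  D : Set E3
  σ : ℝ
  m : ℝ
  S : ℝ → ℝ
  Φ : ℝ → ℝ
  Rg : ℝ
  Tw : ℝ

namespace Gas

variable (G : Gas) (f : ℝ → E3 → E3 → ℝ)

/-! ### Macroscopic quantities and the Enskog factor -/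

/-- Indicator function of the domain. -/
noncomputable def chi (X : E3) : ℝ := Set.indicator G.D (fun _ => (1 : ℝ)) X

/-- Density. -/
noncomputable def rho (t : ℝ) (X : E3) : ℝ := ∫ ξ, f t X ξ

/-- Flow velocity. -/
noncomputable def vel (t : ℝ) (X : E3) : E3 :=
  WithLp.toLp 2 (fun i => (1 / rho f t X) * ∫ ξ : E3, ξ i * f t X ξ)

/-- `ℛ`, the number of molecular centers within the distance `σ`. -/
noncomputable def crowd (t : ℝ) (X : E3) : ℝ :=
  (1 / G.m) * ∫ Y in G.D, rho f t Y * heavi (G.σ - ‖Y - X‖)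

/-- The Enskog factor, cut off outside the domain. -/
noncomputable def g (t : ℝ) (X Y : E3) : ℝ :=
  (G.S (G.crowd f t X) + G.S (G.crowd f t Y)) * G.chi X * G.chi Y

/-! ### The Enskog--Vlasov equation -/

/-- Gain term of the collision integral. -/
noncomputable def gain (t : ℝ) (X ξ : E3) : ℝ :=
  G.σ ^ 2 / G.m * ∫ ξs : E3, ∫ α : S2,
    G.g f t (X + G.σ • (α : E3)) X * f t (X + G.σ • (α : E3)) (postStar α ξ ξs)
      * f t X (post α ξ ξs) * (relV α ξ ξs * heavi (relV α ξ ξs)) ∂solidAngle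

/-- Loss term of the collision integral. -/
noncomputable def loss (t : ℝ) (X ξ : E3) : ℝ :=
  G.σ ^ 2 / G.m * ∫ ξs : E3, ∫ α : S2,
    G.g f t (X - G.σ • (α : E3)) X * f t (X - G.σ • (α : E3)) ξs
      * f t X ξ * (relV α ξ ξs * heavi (relV α ξ ξs)) ∂solidAngle

/-- The `i`-th component of the self-consistent force of the Vlasov term. -/
noncomputable def force (t : ℝ) (X : E3) (i : Fin 3) : ℝ :=
  -∫ Y in G.D, pd i (fun Z => G.Φ ‖Y - Z‖) X * rho f t Y

/-- `f` satisfies the Enskog--Vlasov equation in `D` during the times `I`. -/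
def SolvesEnskogVlasov (I : Set ℝ) : Prop :=
  ∀ t ∈ I, ∀ X ∈ G.D, ∀ ξ : E3,
    deriv (fun s => f s X ξ) t + ∑ i, ξ i * pd i (fun Y => f t Y ξ) X
      + ∑ i, G.force f t X i * pd i (fun η => f t X η) ξ
      = G.gain f t X ξ - G.loss f t X ξ

/-- The boundary of `D` is impermeable: the normal component of `ρ v` vanishes on `∂D`. The normal
trace is taken in the usual weak sense (Green's formula without boundary term), so that no
smoothness of `∂D` is needed; there is no condition when `D` is the whole space. -/
def Impermeable (I : Set ℝ) : Prop :=
  ∀ t ∈ I, ∀ ψ : E3 → ℝ, ContDiff ℝ (⊤ : ℕ∞) ψ → HasCompactSupport ψ →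
    ∫ X in G.D, ((∑ i, rho f t X * vel f t X i * pd i ψ X)
      + ψ X * ∑ i, pd i (fun Y => rho f t Y * vel f t Y i) X) = 0

/-- Regularity and velocity decay that give a meaning to the moments of a solution: `f` is positive
and continuously differentiable, `f` and `∂f/∂t` have a velocity-integrable majorant, `log f` grows
at most like some power `k` of the speed and `f` has finite moments of order `k + 3`, locally
uniformly up to the boundary; the derivatives have such moments locally uniformly inside. -/
structure Regular (I : Set ℝ) : Prop where
  smooth : ContDiffOn ℝ 1 (fun z : ℝ × E3 × E3 => f z.1 z.2.1 z.2.2) (I ×ˢ G.D ×ˢ univ)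
  pos : ∀ t ∈ I, ∀ X ∈ G.D, ∀ ξ, 0 < f t X ξ
  bounded : ∀ K : Set ℝ, IsCompact K → K ⊆ I → ∃ M : E3 → ℝ, Integrable M ∧
    ∀ t ∈ K, ∀ X ∈ G.D, ∀ ξ, f t X ξ ≤ M ξ ∧ |deriv (fun s => f s X ξ) t| ≤ M ξ
  decay : ∀ K : Set ℝ, IsCompact K → K ⊆ I → ∀ r : ℝ, ∃ (k : ℕ) (C : ℝ) (M : E3 → ℝ),
    Integrable (fun ξ => (1 + ‖ξ‖) ^ (k + 3) * M ξ) ∧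
    ∀ t ∈ K, ∀ X ∈ G.D, ‖X‖ ≤ r → ∀ ξ,
      f t X ξ ≤ M ξ ∧ |Real.log (f t X ξ)| ≤ C * (1 + ‖ξ‖) ^ k
  decay_deriv : ∀ K : Set ℝ, IsCompact K → K ⊆ I → ∀ L : Set E3, IsCompact L → L ⊆ G.D →
    ∃ (k : ℕ) (C : ℝ) (M : E3 → ℝ),
    Integrable (fun ξ => (1 + ‖ξ‖) ^ (k + 3) * M ξ) ∧
    ∀ t ∈ K, ∀ X ∈ L, ∀ ξ,
      ‖fderiv ℝ (fun z : ℝ × E3 × E3 => f z.1 z.2.1 z.2.2) (t, X, ξ)‖ ≤ M ξ ∧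
        |Real.log (f t X ξ)| ≤ C * (1 + ‖ξ‖) ^ k

/-! ### Energy, stress and heat flow -/

/-- Kinetic part of the specific internal energy. -/
noncomputable def ek (t : ℝ) (X : E3) : ℝ :=
  1 / (2 * rho f t X) * ∫ ξ, ‖ξ - vel f t X‖ ^ 2 * f t X ξ

/-- Kinetic part of the stress tensor. -/
noncomputable def pk (t : ℝ) (X : E3) (i j : Fin 3) : ℝ :=
  ∫ ξ : E3, (ξ i - vel f t X i) * (ξ j - vel f t X j) * f t X ξ

/-- Kinetic part of the heat-flow vector. -/
noncomputable def qk (t : ℝ) (X : E3) (i : Fin 3) : ℝ :=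
  1 / 2 * ∫ ξ : E3, (ξ i - vel f t X i) * ‖ξ - vel f t X‖ ^ 2 * f t X ξ

/-- Collisional part of the stress tensor. -/
noncomputable def pc (t : ℝ) (X : E3) (i j : Fin 3) : ℝ :=
  G.σ ^ 2 / (2 * G.m) * ∫ ξ : E3, ∫ ξs : E3, ∫ α : S2, (∫ l in (0 : ℝ)..G.σ,
    (α : E3) i * (α : E3) j * (relV α ξ ξs) ^ 2 * heavi (relV α ξ ξs)
      * G.g f t (X + l • (α : E3)) (X + (l - G.σ) • (α : E3))
      * f t (X + (l - G.σ) • (α : E3)) ξs * f t (X + l • (α : E3)) ξ) ∂solidAngle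

/-- Collisional part of the heat-flow vector. -/
noncomputable def qc (t : ℝ) (X : E3) (i : Fin 3) : ℝ :=
  G.σ ^ 2 / (4 * G.m) * ∫ ξ : E3, ∫ ξs : E3, ∫ α : S2, (∫ l in (0 : ℝ)..G.σ,
    (α : E3) i * inner ℝ ((ξ - vel f t X) + (ξs - vel f t X)) (α : E3)
      * (relV α ξ ξs) ^ 2 * heavi (relV α ξ ξs)
      * G.g f t (X + l • (α : E3)) (X + (l - G.σ) • (α : E3))
      * f t (X + (l - G.σ) • (α : E3)) ξs * f t (X + l • (α : E3)) ξ) ∂solidAngle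

/-- Vlasov part of the stress tensor. -/
noncomputable def pv (t : ℝ) (X : E3) (i j : Fin 3) : ℝ :=
  -(1 / 2) * ∫ r : E3, r i * r j / ‖r‖ * deriv G.Φ ‖r‖ * ∫ l in (0 : ℝ)..1,
    rho f t (X + l • r) * G.chi (X + l • r)
      * rho f t (X + (l - 1) • r) * G.chi (X + (l - 1) • r)

/-- Vlasov part of the specific internal energy. -/
noncomputable def ev (t : ℝ) (X : E3) : ℝ :=
  1 / 2 * ∫ Y in G.D, G.Φ ‖Y - X‖ * rho f t Y

/-- Vlasov part of the heat-flow vector. -/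
noncomputable def qv (t : ℝ) (X : E3) (i : Fin 3) : ℝ :=
  (∑ j, ((if i = j then rho f t X * G.ev f t X else 0) - G.pv f t X i j) * vel f t X j)
  + 1 / 2 * ∫ r : E3, ∫ l in (0 : ℝ)..1,
      r i * G.Φ ‖r‖ * deriv (fun s => rho f s (X + (l - 1) • r)) t * rho f t (X + l • r)
        * G.chi (X + (l - 1) • r) * G.chi (X + l • r)

/-! ### The local H function, the local free energy and their fluxes -/

/-- Kinetic part of the H function. -/
noncomputable def Hk (t : ℝ) (X : E3) : ℝ := ∫ ξ, f t X ξ * Real.log (f t X ξ)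

/-- Collisional part of the H function. -/
noncomputable def Hc (t : ℝ) (X : E3) : ℝ :=
  rho f t X * ∫ x in (0 : ℝ)..(G.crowd f t X), G.S x

/-- The local H function. -/
noncomputable def H (t : ℝ) (X : E3) : ℝ := Hk f t X + G.Hc f t X

/-- The flux `J^(k)`. -/
noncomputable def Jk (t : ℝ) (X : E3) (i : Fin 3) : ℝ :=
  G.σ ^ 3 / (2 * G.m) * ∫ ξ : E3, ∫ ξs : E3, ∫ α : S2, (∫ τ in (0 : ℝ)..1,
    (α : E3) i * G.g f t (X + (τ * G.σ) • (α : E3)) (X + ((τ - 1) * G.σ) • (α : E3))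
      * (Real.log (f t (X + (τ * G.σ) • (α : E3)) (post α ξ ξs)
            / f t (X + (τ * G.σ) • (α : E3)) ξ)
          * f t (X + (τ * G.σ) • (α : E3)) ξ * f t (X + ((τ - 1) * G.σ) • (α : E3)) ξs)
      * (relV α ξ ξs * heavi (relV α ξ ξs))) ∂solidAngle

/-- The flux `J^(c)`. -/
noncomputable def Jc (t : ℝ) (X : E3) (i : Fin 3) : ℝ :=
  G.Hc f t X * vel f t X i
  - G.σ ^ 3 / (2 * G.m) * ∫ α : S2, (∫ τ in (0 : ℝ)..1,
      (∑ j, (vel f t (X + (τ * G.σ) • (α : E3)) j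
          - vel f t (X + ((τ - 1) * G.σ) • (α : E3)) j) * (α : E3) j)
        * rho f t (X + (τ * G.σ) • (α : E3)) * rho f t (X + ((τ - 1) * G.σ) • (α : E3))
        * G.S (G.crowd f t (X + (τ * G.σ) • (α : E3)))
        * G.chi (X + ((τ - 1) * G.σ) • (α : E3)) * G.chi (X + (τ * G.σ) • (α : E3))
        * (α : E3) i) ∂solidAngle

/-- The flux `J^H` of the local H function. -/
noncomputable def JH (t : ℝ) (X : E3) (i : Fin 3) : ℝ :=
  (∫ ξ : E3, ξ i * f t X ξ * Real.log (f t X ξ)) + G.Jk f t X i + G.Jc f t X i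

/-- The reference Maxwellian of the heat bath (up to a constant factor). -/
noncomputable def fw (ξ : E3) : ℝ := Real.exp (-‖ξ‖ ^ 2 / (2 * G.Rg * G.Tw))

/-- The local free energy without the potential energy. -/
noncomputable def F (t : ℝ) (X : E3) : ℝ :=
  G.Rg * G.Tw * ((∫ ξ, f t X ξ * Real.log (f t X ξ / G.fw ξ)) + G.Hc f t X)

/-- The flux `J^F`, with the kinetic and collisional parts of stress and heat flow. -/
noncomputable def JF (t : ℝ) (X : E3) (i : Fin 3) : ℝ :=
  G.Rg * G.Tw * G.JH f t X i
  + rho f t X * vel f t X i * (ek f t X + 1 / 2 * ‖vel f t X‖ ^ 2)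
  + (∑ j, (pk f t X i j + G.pc f t X i j) * vel f t X j)
  + (qk f t X i + G.qc f t X i)

/-- The local free energy with the potential energy of the Vlasov term. -/
noncomputable def Ftilde (t : ℝ) (X : E3) : ℝ := G.F f t X + rho f t X * G.ev f t X

/-- The flux of the local free energy with the contributions of the Vlasov term. -/
noncomputable def JFtilde (t : ℝ) (X : E3) (i : Fin 3) : ℝ :=
  G.JF f t X i + (∑ j, G.pv f t X i j * vel f t X j) + G.qv f t X i
  + rho f t X * G.ev f t X * vel f t X i

end Gas

/-! ### Local balance inequalities -/

/-- Smooth test functions with compact support in the space-time set `U`. -/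
structure IsTest (U : Set (ℝ × E3)) (φ : ℝ × E3 → ℝ) : Prop where
  smooth : ContDiff ℝ (⊤ : ℕ∞) φ
  compact : HasCompactSupport φ
  supp : tsupport φ ⊆ U

/-- `∬ (h ∂φ/∂t + J_i ∂φ/∂X_i) dX dt`, that is, minus the distribution `∂h/∂t + ∂J_i/∂X_i`
applied to `φ`. -/
noncomputable def pairing (h : ℝ → E3 → ℝ) (J : ℝ → E3 → Fin 3 → ℝ) (φ : ℝ × E3 → ℝ) : ℝ :=
  ∫ z : ℝ × E3, (h z.1 z.2 * deriv (fun s => φ (s, z.2)) z.1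
    + ∑ i, J z.1 z.2 i * pd i (fun Y => φ (z.1, Y)) z.2)

/-- `∂h/∂t + ∂J_i/∂X_i = 0` in `U`, in the sense of distributions. -/
def BalanceEq (U : Set (ℝ × E3)) (h : ℝ → E3 → ℝ) (J : ℝ → E3 → Fin 3 → ℝ) : Prop :=
  ∀ φ, IsTest U φ → pairing h J φ = 0

/-- `∂h/∂t + ∂J_i/∂X_i ≤ 0` in `U`: the density and the flux are locally integrable, the inequality
holds in the sense of distributions, and it holds pointwise with classical derivatives wherever the
density and the flux are differentiable. -/
structure BalanceLE (U : Set (ℝ × E3)) (h : ℝ → E3 → ℝ) (J : ℝ → E3 → Fin 3 → ℝ) : Prop where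
  density_int : LocallyIntegrableOn (fun z : ℝ × E3 => h z.1 z.2) U
  flux_int : ∀ i, LocallyIntegrableOn (fun z : ℝ × E3 => J z.1 z.2 i) U
  weak : ∀ φ, IsTest U φ → (∀ z, 0 ≤ φ z) → 0 ≤ pairing h J φ
  classical : ∀ t X, (t, X) ∈ U →
    DifferentiableAt ℝ (fun z : ℝ × E3 => h z.1 z.2) (t, X) →
    (∀ i, DifferentiableAt ℝ (fun z : ℝ × E3 => J z.1 z.2 i) (t, X)) →
    deriv (fun s => h s X) t + ∑ i, pd i (fun Y => J t Y i) X ≤ 0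

/-! The argument rests on the weak form of the collision operator. Weighted with ψ and integrated
over ξ, it equals σ²/m ∫ T with T = (ψ' − ψ) g f f_* Vθ(V), the amount of ψ transferred to the
molecule at X by a partner at X − σα (`CollWeight.integral_collision`). Let T* be the amount
received by the partner. Exchange of the partners together with α → −α shows that the integral of T*
is the integral of T taken at X + σα. Hence T − T* is a difference of translates, that is, the
divergence of a mean over the segment joining the centres (`integral_mul_sub_translate`,
`KernelBdd.integral_flux`). In T = ½(T + T*) + ½(T − T*) only the symmetric half is a true
production; the other half becomes a flux.

Entropy: take ψ = ln f + 1. The force drops out because it does not depend on ξ. The inequality x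
ln(y/x) ≤ y − x with x = f f_* and y = f'f'_* bounds T + T* by g (f'f'_* − f f_*) Vθ(V), and the
deficit is `diss` ≥ 0. The collision is a measure preserving involution with V → −V, so the integral
of this bound is −∫ g f f_* V. Being linear in V, it depends on f only through ρ and ρv, and it
equals ∫ P(X) + ∫ P(X + σα), where P is `potKernel` (`integral_transfer_log`).

These terms have no sign, and H^(c) is made to cancel them. By conservation of mass, ρ(∂_t + v·∇)ℛ
is an integral over the sphere of radius σ of the relative flow, so H^(c), convected with v, has
production −σ²/m ∫ P (`integral_Hc`). What remains is half the difference of P and its translate,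
again a divergence, which enters J^(c). Altogether the distribution ∂_t H + div J^H equals
−`production` (`pairing_entropy`).

The analytic difficulty is that ℛ counts molecules with a sharp indicator function and a density cut
off at ∂D, so the classical chain rule is not available for it. The ball is replaced by a smooth
weight `edge`, mass conservation is tested up to the wall by means of impermeability, and the limit
is taken after integration against a test function, where the gradient of `edge` tends to a surface
measure (`tendsto_integral_fderiv_edge`). Classical inequalities follow from weak ones by
concentrating the test function at a point of differentiability (`sum_fderiv_nonpos_of_weak`).

Free energy: it is RT_w H plus the total energy. Kinetic energy is conserved in each collision, so
T* = −T and its transfer is a pure divergence; the power of the Vlasov force is compensated by the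
potential energy up to a divergence (`integral_potential_energy`). Therefore the free energy balance
is RT_w times that of H (`pairing_freeEnergy`).

Equality: a vanishing distribution forces `production` = 0 almost everywhere. A violation of
detailed balance with V > 0 would persist in a neighbourhood and make the production positive there;
V < 0 reduces to V > 0 by the involution, and V = 0 is trivial (`balanceEq_iff`). -/

namespace EnskogVlasov

open Filter Topology

/-! ### Translation invariance: derivatives of zero mean, and differences of translates as
divergences. -/

section Translation

variable {P : Type*} [NormedAddCommGroup P] [NormedSpace ℝ P] [FiniteDimensional ℝ P]
  [MeasurableSpace P] [BorelSpace P] (ν : Measure P) [ν.IsAddHaarMeasure]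

/-- On each fibre the map is a translation, so no regularity of `e` beyond measurability is needed.
-/
theorem measurePreserving_shear {Ω : Type*} [MeasurableSpace Ω] (μ : Measure Ω) [SFinite μ]
    (e : Ω → P) (he : Measurable e) :
    MeasurePreserving (fun p : Ω × P => (p.1, p.2 + e p.1)) (μ.prod ν) (μ.prod ν) :=
  (MeasurePreserving.id μ).skew_product (g := fun w z => z + e w)
    (by fun_prop) (Eventually.of_forall fun w => (measurePreserving_add_right ν (e w)).map_eq)

/-- The integral of a directional derivative vanishes; the derivative need only exist along
almost every line. -/
theorem integral_eq_zero_of_hasDerivAt_line (h h' : P → ℝ) (v : P) (hi : Integrable h ν)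
    (hi' : Integrable h' ν)
    (hd : ∀ᵐ z ∂ν, ∀ τ : ℝ, HasDerivAt (fun s : ℝ => h (z + s • v)) (h' (z + τ • v)) τ) :
    ∫ z, h' z ∂ν = 0 := by
  -- Averaging over the unit segment in direction `v` leaves ∫ h' unchanged by translation
  -- invariance, while on each line the average is h(z + v) − h(z). Integrability alone suffices;
  -- compact support is not required.
  set I : Measure ℝ := volume.restrict (Ioc 0 1)
  have h1 : Integrable (fun p : ℝ × P => h' p.2) (I.prod ν) := hi'.comp_snd I
  have h2 : Integrable (fun p : ℝ × P => h' (p.2 + p.1 • v)) (I.prod ν) :=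
    (measurePreserving_shear ν I (fun τ : ℝ => τ • v) (by fun_prop)).integrable_comp_of_integrable h1
  have h3 := integral_integral_swap (f := fun (τ : ℝ) z => h' (z + τ • v)) h2
  have h4 : ∀ τ : ℝ, ∫ z, h' (z + τ • v) ∂ν = ∫ z, h' z ∂ν := fun τ =>
    integral_add_right_eq_self h' (τ • v)
  simp only [h4] at h3
  have h5 : ∫ z, (∫ τ, h' (z + τ • v) ∂I) ∂ν = ∫ z, (h (z + v) - h z) ∂ν := by
    refine integral_congr_ae ?_
    filter_upwards [hd, h2.prod_left_ae] with z hz hz2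
    have := intervalIntegral.integral_eq_sub_of_hasDerivAt (a := 0) (b := 1)
      (f := fun s : ℝ => h (z + s • v)) (f' := fun τ => h' (z + τ • v)) (fun τ _ => hz τ)
      ((intervalIntegrable_iff_integrableOn_Ioc_of_le zero_le_one).2 hz2)
    rw [intervalIntegral.integral_of_le zero_le_one] at this
    simpa using this
  rw [h5, integral_sub (hi.comp_add_right v) hi, integral_add_right_eq_self, sub_self] at h3
  simpa [I] using h3

/-- A difference of translates is the divergence of the mean over the translation segment. -/
theorem integral_mul_sub_translate {Ω : Type*} [MeasurableSpace Ω] (μ : Measure Ω) [SFinite μ]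
    (d : Ω → P) (hd : Measurable d) (a : P → Ω → ℝ)
    (ha : Measurable fun p : P × Ω => a p.1 p.2) (φ : P → ℝ) (hφ : ContDiff ℝ 1 φ)
    (hc : HasCompactSupport φ) (B : Ω → ℝ) (hB : Integrable B μ)
    (hdB : Integrable (fun w => ‖d w‖ * B w) μ)
    (hbd : ∀ z ∈ tsupport φ, ∀ w, ∀ τ ∈ Icc (0 : ℝ) 1, |a (z + τ • d w) w| ≤ B w) :
    ∫ z, φ z * ((∫ w, a z w ∂μ) - ∫ w, a (z + d w) w ∂μ) ∂ν
      = ∫ z, (∫ w, (∫ τ in (0 : ℝ)..1, fderiv ℝ φ z (d w) * a (z + τ • d w) w) ∂μ) ∂ν := by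
  set I : Measure ℝ := volume.restrict (Ioc 0 1)
  have hφ' : Continuous (fderiv ℝ φ) := hφ.continuous_fderiv one_ne_zero
  have hc' : HasCompactSupport (fderiv ℝ φ) := hc.fderiv ℝ
  have hiφ : Integrable φ ν := hφ.continuous.integrable_of_hasCompactSupport hc
  have hiφ' : Integrable (fun z => ‖fderiv ℝ φ z‖) ν :=
    (hφ'.integrable_of_hasCompactSupport hc').norm
  have hsupp : ∀ z ∉ tsupport φ, φ z = 0 := fun z hz => image_eq_zero_of_notMem_tsupport hz
  have hsupp' : ∀ z ∉ tsupport φ, fderiv ℝ φ z = 0 := fun z hz =>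
    image_eq_zero_of_notMem_tsupport fun h => hz (tsupport_fderiv_subset ℝ h)
  have hmf : Measurable fun p : P × P => fderiv ℝ φ p.1 p.2 := by
    have : Continuous fun p : P × P => fderiv ℝ φ p.1 p.2 := by fun_prop
    exact this.measurable
  have hIcc : ∀ᵐ τ ∂I, τ ∈ Icc (0 : ℝ) 1 := by
    filter_upwards [ae_restrict_mem measurableSet_Ioc] with τ hτ using Ioc_subset_Icc_self hτ
  -- joint integrability in the order `z, (w, τ)`
  have hI1 : Integrable (fun p : P × (Ω × ℝ) =>
      fderiv ℝ φ p.1 (d p.2.1) * a (p.1 + p.2.2 • d p.2.1) p.2.1) (ν.prod (μ.prod I)) := by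
    have hdom : Integrable (fun p : P × (Ω × ℝ) => ‖fderiv ℝ φ p.1‖ * (‖d p.2.1‖ * B p.2.1))
        (ν.prod (μ.prod I)) := hiφ'.mul_prod (hdB.comp_fst I)
    refine hdom.mono' ?_ ?_
    · refine Measurable.aestronglyMeasurable ?_
      refine Measurable.mul (hmf.comp (measurable_fst.prodMk (hd.comp (by fun_prop)))) ?_
      exact ha.comp (f := fun p : P × (Ω × ℝ) => (p.1 + p.2.2 • d p.2.1, p.2.1)) (by fun_prop)
    · have : ∀ᵐ p ∂(ν.prod (μ.prod I)), p.2.2 ∈ Icc (0 : ℝ) 1 :=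
        (Measure.quasiMeasurePreserving_snd.comp Measure.quasiMeasurePreserving_snd).ae hIcc
      filter_upwards [this] with p hp
      by_cases hz : p.1 ∈ tsupport φ
      · rw [Real.norm_eq_abs, abs_mul, ← mul_assoc]
        gcongr
        · exact (fderiv ℝ φ p.1).le_opNorm _
        · exact hbd _ hz _ _ hp
      · simp [hsupp' _ hz]
  -- The same function with `z` as the last variable, the order in which the shear in `z` acts on
  -- fibres.
  have hI2 : Integrable (fun p : Ω × (ℝ × P) =>
      fderiv ℝ φ p.2.2 (d p.1) * a (p.2.2 + p.2.1 • d p.1) p.1) (μ.prod (I.prod ν)) := by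
    have hdom : Integrable (fun p : Ω × (ℝ × P) => (‖d p.1‖ * B p.1) * ‖fderiv ℝ φ p.2.2‖)
        (μ.prod (I.prod ν)) := hdB.mul_prod (hiφ'.comp_snd I)
    refine hdom.mono' ?_ ?_
    · refine Measurable.aestronglyMeasurable ?_
      refine Measurable.mul (hmf.comp
        (f := fun p : Ω × (ℝ × P) => (p.2.2, d p.1)) (by fun_prop)) ?_
      exact ha.comp (f := fun p : Ω × (ℝ × P) => (p.2.2 + p.2.1 • d p.1, p.1)) (by fun_prop)
    · have : ∀ᵐ p ∂(μ.prod (I.prod ν)), p.2.1 ∈ Icc (0 : ℝ) 1 :=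
        (Measure.quasiMeasurePreserving_fst.comp Measure.quasiMeasurePreserving_snd).ae hIcc
      filter_upwards [this] with p hp
      by_cases hz : p.2.2 ∈ tsupport φ
      · rw [Real.norm_eq_abs, abs_mul]
        calc _ ≤ (‖fderiv ℝ φ p.2.2‖ * ‖d p.1‖) * B p.1 := by
              gcongr
              · exact (fderiv ℝ φ _).le_opNorm _
              · exact hbd _ hz _ _ hp
          _ = _ := by ring
      · simp [hsupp' _ hz]
  -- the shear
  have hI3 : Integrable (fun p : Ω × (ℝ × P) =>
      fderiv ℝ φ (p.2.2 - p.2.1 • d p.1) (d p.1) * a p.2.2 p.1) (μ.prod (I.prod ν)) := by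
    have hmp : MeasurePreserving (fun p : Ω × (ℝ × P) => (p.1, (p.2.1, p.2.2 + -(p.2.1 • d p.1))))
        (μ.prod (I.prod ν)) (μ.prod (I.prod ν)) :=
      (MeasurePreserving.id μ).skew_product
        (g := fun w (q : ℝ × P) => (q.1, q.2 + -(q.1 • d w))) (by fun_prop)
        (Eventually.of_forall fun w =>
          (measurePreserving_shear ν I (fun τ : ℝ => -(τ • d w)) (by fun_prop)).map_eq)
    refine (hmp.integrable_comp_of_integrable hI2).congr (Eventually.of_forall fun p => ?_)
    simp [sub_eq_add_neg]
  have e1 : ∫ z, (∫ w, (∫ τ in (0 : ℝ)..1, fderiv ℝ φ z (d w) * a (z + τ • d w) w) ∂μ) ∂ν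
      = ∫ z, (∫ q, fderiv ℝ φ z (d q.1) * a (z + q.2 • d q.1) q.1 ∂(μ.prod I)) ∂ν := by
    refine integral_congr_ae ?_
    filter_upwards [hI1.prod_right_ae] with z hz
    rw [integral_prod _ hz]
    simp only [intervalIntegral.integral_of_le zero_le_one]
    rfl
  have e2 : ∫ z, (∫ q, fderiv ℝ φ z (d q.1) * a (z + q.2 • d q.1) q.1 ∂(μ.prod I)) ∂ν
      = ∫ w, (∫ τ, (∫ z, fderiv ℝ φ z (d w) * a (z + τ • d w) w ∂ν) ∂I) ∂μ := by
    rw [integral_integral_swap hI1, integral_prod _ hI1.integral_prod_right]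
  have hK1 : Integrable (fun p : P × Ω => φ p.1 * a p.1 p.2) (ν.prod μ) := by
    refine (hiφ.norm.mul_prod hB).mono' ((hφ.continuous.measurable.comp measurable_fst).mul
      ha).aestronglyMeasurable (Eventually.of_forall fun p => ?_)
    by_cases hz : p.1 ∈ tsupport φ
    · rw [Real.norm_eq_abs, abs_mul]
      gcongr
      · exact le_rfl
      · simpa using hbd _ hz p.2 0 (by simp)
    · simp [hsupp _ hz]
  have hK2 : Integrable (fun p : P × Ω => φ p.1 * a (p.1 + d p.2) p.2) (ν.prod μ) := by
    refine (hiφ.norm.mul_prod hB).mono' ((hφ.continuous.measurable.comp measurable_fst).mul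
      (ha.comp (f := fun p : P × Ω => (p.1 + d p.2, p.2)) (by fun_prop))).aestronglyMeasurable
      (Eventually.of_forall fun p => ?_)
    by_cases hz : p.1 ∈ tsupport φ
    · rw [Real.norm_eq_abs, abs_mul]
      gcongr
      · exact le_rfl
      · simpa using hbd _ hz p.2 1 (by simp)
    · simp [hsupp _ hz]
  have e3 : ∫ w, (∫ τ, (∫ z, fderiv ℝ φ z (d w) * a (z + τ • d w) w ∂ν) ∂I) ∂μ
      = ∫ w, (∫ z, (φ z * a z w - φ z * a (z + d w) w) ∂ν) ∂μ := by
    refine integral_congr_ae ?_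
    filter_upwards [hI3.prod_right_ae, hK1.prod_left_ae, hK2.prod_left_ae] with w hw hw1 hw2
    -- The shift is moved from `a`, which is only measurable, to φ. The integrand in τ is then the
    -- derivative of −φ(z − τ d), and integration over the segment gives φ(z) − φ(z − d).
    have s1 : ∀ τ : ℝ, ∫ z, fderiv ℝ φ z (d w) * a (z + τ • d w) w ∂ν
        = ∫ z, fderiv ℝ φ (z - τ • d w) (d w) * a z w ∂ν := fun τ => by
      rw [← integral_add_right_eq_self (μ := ν)
        (fun z => fderiv ℝ φ (z - τ • d w) (d w) * a z w) (τ • d w)]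
      simp
    simp only [s1]
    rw [integral_integral_swap hw, integral_sub hw1 hw2,
      ← integral_sub_right_eq_self (μ := ν) (fun z => φ z * a (z + d w) w) (d w),
      ← integral_sub hw1 (hw2.comp_sub_right (d w))]
    refine integral_congr_ae (Eventually.of_forall fun z => ?_)
    have hFTC := intervalIntegral.integral_eq_sub_of_hasDerivAt (a := 0) (b := 1)
      (f := fun s : ℝ => -φ (z - s • d w)) (f' := fun s => fderiv ℝ φ (z - s • d w) (d w))
      (fun s _ => by
        have h1 : HasDerivAt (fun s : ℝ => z - s • d w) (-d w) s := by
          simpa using ((hasDerivAt_id s).smul_const (d w)).const_sub z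
        have h2 := ((hφ.differentiable one_ne_zero) (z - s • d w)).hasFDerivAt.comp_hasDerivAt s h1
        rw [map_neg] at h2
        have h3 := h2.fun_neg
        rw [neg_neg] at h3
        exact h3)
      (by
        refine Continuous.intervalIntegrable ?_ _ _
        fun_prop)
    rw [intervalIntegral.integral_of_le zero_le_one] at hFTC
    simp only [sub_add_cancel]
    rw [integral_mul_const, hFTC]
    simp
    ring
  have hK3 := hK1.sub hK2
  rw [e1, e2, e3, ← integral_integral_swap (f := fun z w => φ z * a z w - φ z * a (z + d w) w) hK3]
  refine integral_congr_ae ?_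
  filter_upwards [hK1.prod_right_ae, hK2.prod_right_ae] with z h1 h2
  rw [integral_sub h1 h2, integral_const_mul, integral_const_mul, mul_sub]

end Translation

end EnskogVlasov

namespace EnskogVlasov

open Filter Topology

/-! ### Differentiation of parameter integrals. -/

section ParameterIntegral

variable {P : Type*} [NormedAddCommGroup P] [NormedSpace ℝ P]

theorem contDiffOn_one_of_hasFDerivAt {U : Set P} (hU : IsOpen U) {m : P → ℝ} {m' : P → P →L[ℝ] ℝ}
    (hd : ∀ z ∈ U, HasFDerivAt m (m' z) z) (hc : ContinuousOn m' U) : ContDiffOn ℝ 1 m U := by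
  rw [show (1 : WithTop ℕ∞) = 0 + 1 from rfl, contDiffOn_succ_iff_fderiv_of_isOpen hU]
  refine ⟨fun z hz => (hd z hz).differentiableAt.differentiableWithinAt, by simp, ?_⟩
  rw [contDiffOn_zero]
  exact hc.congr fun z hz => (hd z hz).fderiv

/-- Dominated convergence is used twice, for differentiability and for continuity of the derivative.
A local majorant is needed for `Θ'` only; the mean value inequality controls the increments of `Θ`.
-/
theorem hasFDerivAt_continuousOn_integral {Y : Type*} [MeasurableSpace Y] {μ : Measure Y}
    {U : Set P} {Θ : P → Y → ℝ} {Θ' : P → Y → P →L[ℝ] ℝ} (hU : IsOpen U)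
    (hi : ∀ z ∈ U, Integrable (Θ z) μ) (hm' : ∀ z ∈ U, AEStronglyMeasurable (Θ' z) μ)
    (hd : ∀ᵐ y ∂μ, ∀ z ∈ U, HasFDerivAt (fun z => Θ z y) (Θ' z y) z)
    (hc : ∀ᵐ y ∂μ, ContinuousOn (fun z => Θ' z y) U)
    (hb : ∀ z ∈ U, ∃ V ∈ 𝓝 z, ∃ B : Y → ℝ, Integrable B μ ∧ ∀ᵐ y ∂μ, ∀ z ∈ V, ‖Θ' z y‖ ≤ B y) :
    (∀ z ∈ U, HasFDerivAt (fun z => ∫ y, Θ z y ∂μ) (∫ y, Θ' z y ∂μ) z) ∧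
      ContinuousOn (fun z => ∫ y, Θ' z y ∂μ) U := by
  refine ⟨fun z hz => ?_, fun z hz => ?_⟩
  · obtain ⟨V, hV, B, hB, hVB⟩ := hb z hz
    refine hasFDerivAt_integral_of_dominated_of_fderiv_le (s := V ∩ U) (bound := B)
      (inter_mem hV (hU.mem_nhds hz)) ?_ (hi z hz) (hm' z hz) ?_ hB ?_
    · filter_upwards [hU.mem_nhds hz] with y hy using (hi y hy).aestronglyMeasurable
    · filter_upwards [hVB] with y hy x hx using hy x hx.1
    · filter_upwards [hd] with y hy x hx using hy x hx.2
  · obtain ⟨V, hV, B, hB, hVB⟩ := hb z hz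
    refine ContinuousAt.continuousWithinAt ?_
    refine continuousAt_of_dominated (bound := B) ?_ ?_ hB ?_
    · filter_upwards [hU.mem_nhds hz] with y hy using hm' y hy
    · filter_upwards [hV] with x hx
      filter_upwards [hVB] with y hy using hy x hx
    · filter_upwards [hc] with y hy using hy.continuousAt (hU.mem_nhds hz)

end ParameterIntegral

/-! ### Test functions, integration by parts, and the passage from weak to classical inequalities.
-/

section TestFunctions

set_option linter.unusedSectionVars false

variable {P : Type*} [NormedAddCommGroup P] [NormedSpace ℝ P]

theorem contDiff_mul_of_tsupport_subset {U : Set P} (hU : IsOpen U) {φ u : P → ℝ}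
    (hφ : ContDiff ℝ 1 φ) (hs : tsupport φ ⊆ U) (hu : ContDiffOn ℝ 1 u U) :
    ContDiff ℝ 1 (fun z => φ z * u z) := by
  rw [contDiff_iff_contDiffAt]
  intro z
  by_cases hz : z ∈ tsupport φ
  · exact hφ.contDiffAt.mul (hu.contDiffAt (hU.mem_nhds (hs hz)))
  · refine (contDiffAt_const (c := (0 : ℝ))).congr_of_eventuallyEq ?_
    filter_upwards [(isClosed_tsupport φ).isOpen_compl.mem_nhds hz] with y hy
    simp [image_eq_zero_of_notMem_tsupport hy]

theorem continuous_mul_of_tsupport_subset {U : Set P} (hU : IsOpen U) {φ u : P → ℝ}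
    (hφ : Continuous φ) (hs : tsupport φ ⊆ U) (hu : ContinuousOn u U) :
    Continuous (fun z => φ z * u z) := by
  rw [continuous_iff_continuousAt]
  intro z
  by_cases hz : z ∈ tsupport φ
  · exact hφ.continuousAt.mul (hu.continuousAt (hU.mem_nhds (hs hz)))
  · refine (continuousAt_const (y := (0 : ℝ))).congr ?_
    filter_upwards [(isClosed_tsupport φ).isOpen_compl.mem_nhds hz] with y hy
    simp [image_eq_zero_of_notMem_tsupport hy]

theorem tsupport_mul_subset {φ u : P → ℝ} : tsupport (fun z => φ z * u z) ⊆ tsupport φ :=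
  closure_mono fun z hz h => hz (by simp [h])

variable [FiniteDimensional ℝ P] [MeasurableSpace P] [BorelSpace P] (ν : Measure P)

theorem integrable_mul_of_locallyIntegrableOn [IsFiniteMeasureOnCompacts ν] {U : Set P}
    {φ u : P → ℝ} (hφ : Continuous φ) (hc : HasCompactSupport φ) (hs : tsupport φ ⊆ U)
    (hu : LocallyIntegrableOn u U ν) : Integrable (fun z => u z * φ z) ν := by
  have h1 : IntegrableOn u (tsupport φ) ν := hu.integrableOn_compact_subset hs hc
  have h2 := h1.mul_continuousOn hφ.continuousOn hc
  rwa [integrableOn_iff_integrable_of_support_subset] at h2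
  intro z hz
  by_contra h
  exact hz (by simp [image_eq_zero_of_notMem_tsupport h])

theorem integrable_mul_of_bdd [IsFiniteMeasureOnCompacts ν] {φ u : P → ℝ} (hφ : Continuous φ)
    (hc : HasCompactSupport φ) (hm : AEStronglyMeasurable u ν)
    (C : ℝ) (hC : ∀ z ∈ tsupport φ, |u z| ≤ C) : Integrable (fun z => φ z * u z) ν := by
  have hi : Integrable φ ν := hφ.integrable_of_hasCompactSupport hc
  refine (hi.norm.const_mul C).mono' (hφ.aestronglyMeasurable.mul hm) (Eventually.of_forall ?_)
  intro z
  by_cases hz : z ∈ tsupport φ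
  · rw [norm_mul, mul_comm]
    gcongr
    exact hC z hz
  · simp [image_eq_zero_of_notMem_tsupport hz]

variable [ν.IsAddHaarMeasure]

theorem integral_fderiv_eq_zero {h : P → ℝ} (hh : ContDiff ℝ 1 h) (hc : HasCompactSupport h)
    (v : P) : ∫ z, fderiv ℝ h z v ∂ν = 0 := by
  have hcont : Continuous (fun z => fderiv ℝ h z v) :=
    (hh.continuous_fderiv one_ne_zero).clm_apply continuous_const
  have hcomp : HasCompactSupport (fun z => fderiv ℝ h z v) := hc.fderiv_apply ℝ v
  refine integral_eq_zero_of_hasDerivAt_line ν h _ v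
    (hh.continuous.integrable_of_hasCompactSupport hc)
    (hcont.integrable_of_hasCompactSupport hcomp) (Eventually.of_forall fun z τ => ?_)
  have h1 : HasDerivAt (fun s : ℝ => z + s • v) v τ := by
    simpa using ((hasDerivAt_id τ).smul_const v).const_add z
  exact ((hh.differentiable one_ne_zero) (z + τ • v)).hasFDerivAt.comp_hasDerivAt τ h1

/-- The product φu vanishes near every point outside the support of φ, so it is C¹ on the whole
space although `u` is C¹ in `U` only, and no boundary term arises. -/
theorem integral_by_parts {U : Set P} (hU : IsOpen U) {φ u : P → ℝ} (hφ : ContDiff ℝ 1 φ)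
    (hc : HasCompactSupport φ) (hs : tsupport φ ⊆ U) (hu : ContDiffOn ℝ 1 u U) (v : P) :
    Integrable (fun z => φ z * fderiv ℝ u z v) ν ∧ Integrable (fun z => u z * fderiv ℝ φ z v) ν ∧
    ∫ z, u z * fderiv ℝ φ z v ∂ν = -∫ z, φ z * fderiv ℝ u z v ∂ν := by
  have hcd := contDiff_mul_of_tsupport_subset hU hφ hs hu
  have h0 := integral_fderiv_eq_zero ν hcd (hc.mul_right) v
  have hi1 : Integrable (fun z => φ z * fderiv ℝ u z v) ν := by
    refine (continuous_mul_of_tsupport_subset hU hφ.continuous hs ?_).integrable_of_hasCompactSupport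
      hc.mul_right
    exact (hu.continuousOn_fderiv_of_isOpen hU le_rfl).clm_apply continuousOn_const
  have hφ' : Continuous (fun z => fderiv ℝ φ z v) :=
    (hφ.continuous_fderiv one_ne_zero).clm_apply continuous_const
  have hs' : tsupport (fun z => fderiv ℝ φ z v) ⊆ U :=
    (tsupport_fderiv_apply_subset ℝ v).trans hs
  have hi2 : Integrable (fun z => u z * fderiv ℝ φ z v) ν :=
    integrable_mul_of_locallyIntegrableOn ν hφ' (hc.fderiv_apply ℝ v) hs'
      (hu.continuousOn.locallyIntegrableOn hU.measurableSet)
  refine ⟨hi1, hi2, ?_⟩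
  have h1 : ∀ z, fderiv ℝ (fun z => φ z * u z) z v = u z * fderiv ℝ φ z v + φ z * fderiv ℝ u z v := by
    intro z
    by_cases hz : z ∈ tsupport φ
    · rw [fderiv_fun_mul (hφ.differentiable one_ne_zero z)
        ((hu.contDiffAt (hU.mem_nhds (hs hz))).differentiableAt one_ne_zero)]
      simp
      ring
    · have e : (fun z => φ z * u z) =ᶠ[𝓝 z] fun _ => 0 := by
        filter_upwards [(isClosed_tsupport φ).isOpen_compl.mem_nhds hz] with y hy
        simp [image_eq_zero_of_notMem_tsupport hy]
      rw [e.fderiv_eq, image_eq_zero_of_notMem_tsupport hz,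
        image_eq_zero_of_notMem_tsupport fun h => hz (tsupport_fderiv_subset ℝ h)]
      simp
  simp only [h1] at h0
  rw [integral_add hi2 hi1] at h0
  linarith

/-- A weak differential inequality holds classically at points of differentiability. -/
theorem sum_fderiv_nonpos_of_weak {ι : Type*} [Fintype ι] {U : Set P} (hU : IsOpen U)
    (h : ι → P → ℝ) (v : ι → P) (hl : ∀ k, LocallyIntegrableOn (h k) U ν)
    (hw : ∀ φ : P → ℝ, ContDiff ℝ (⊤ : ℕ∞) φ → HasCompactSupport φ → tsupport φ ⊆ U →
      (∀ z, 0 ≤ φ z) → 0 ≤ ∫ z, ∑ k, h k z * fderiv ℝ φ z (v k) ∂ν)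
    {z₀ : P} (hz : z₀ ∈ U) (hd : ∀ k, DifferentiableAt ℝ (h k) z₀) :
    ∑ k, fderiv ℝ (h k) z₀ (v k) ≤ 0 := by
  let b : ContDiffBump (0 : P) := ⟨1, 2, one_pos, one_lt_two⟩
  have hbC : ContDiff ℝ 1 b := b.contDiff
  have hbc : HasCompactSupport b := b.hasCompactSupport
  set N : ℝ := ∫ y, b y ∂ν with hN
  have hNpos : 0 < N := b.integral_pos
  set M : ℝ := ∑ k, ‖v k‖ * ∫ y, ‖fderiv ℝ b y‖ ∂ν with hM
  have hM0 : 0 ≤ M := by positivity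
  set L := ∑ k, fderiv ℝ (h k) z₀ (v k) with hL
  suffices hkey : ∀ η > 0, L * N ≤ 2 * η * M by
    by_contra! hpos
    -- With this η the bound reads LN ≤ LN · M/(2(M + 1)), and the last factor is less than one. The
    -- summand 1 covers M = 0.
    have := hkey (L * N / (4 * (M + 1))) (by positivity)
    have h2 : 2 * (L * N / (4 * (M + 1))) * M = L * N * (M / (2 * (M + 1))) := by
      field_simp
      ring
    rw [h2] at this
    have h3 : M / (2 * (M + 1)) < 1 := by
      rw [div_lt_one (by positivity)]
      linarith
    nlinarith [mul_pos hpos hNpos]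
  intro η hη
  -- a small radius
  have hsmall : ∀ k, ∀ᶠ z in 𝓝 z₀, |h k z - h k z₀ - fderiv ℝ (h k) z₀ (z - z₀)| ≤ η * ‖z - z₀‖ :=
    fun k => (hd k).hasFDerivAt.isLittleO.bound hη
  have hev : ∀ᶠ z in 𝓝 z₀, z ∈ U ∧
      ∀ k, |h k z - h k z₀ - fderiv ℝ (h k) z₀ (z - z₀)| ≤ η * ‖z - z₀‖ :=
    Filter.Eventually.and (hU.mem_nhds hz) (eventually_all.2 hsmall)
  obtain ⟨δ, hδ, hball⟩ := Metric.eventually_nhds_iff_ball.1 hev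
  -- The bump has outer radius 2, so its rescaled support lies in the ball of radius 2ε = δ/2, where
  -- the Taylor estimate is available.
  set ε := δ / 4 with hε
  have hε0 : 0 < ε := by positivity
  set φ : P → ℝ := fun z => b (ε⁻¹ • (z - z₀)) with hφ
  have hφC : ContDiff ℝ (⊤ : ℕ∞) φ := b.contDiff.comp (by fun_prop)
  have hφ1 : ContDiff ℝ 1 φ := hφC.of_le (by exact_mod_cast le_top)
  have hsub : tsupport φ ⊆ Metric.closedBall z₀ (2 * ε) := by
    refine closure_minimal (fun z hz => ?_) Metric.isClosed_closedBall
    have : ε⁻¹ • (z - z₀) ∈ Function.support b := hz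
    rw [b.support_eq, Metric.mem_ball, dist_zero_right, norm_smul, norm_inv, Real.norm_of_nonneg hε0.le,
      inv_mul_lt_iff₀ hε0] at this
    rw [Metric.mem_closedBall, dist_eq_norm]
    have h2 : b.rOut = 2 := rfl
    rw [h2] at this
    linarith
  have hsubb : Metric.closedBall z₀ (2 * ε) ⊆ Metric.ball z₀ δ :=
    Metric.closedBall_subset_ball (by linarith)
  have hφc : HasCompactSupport φ :=
    HasCompactSupport.of_support_subset_isCompact (isCompact_closedBall z₀ (2 * ε))
      ((subset_tsupport φ).trans hsub)
  have hφU : tsupport φ ⊆ U := fun z hz => (hball z (hsubb (hsub hz))).1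
  have hder : ∀ z, fderiv ℝ φ z = ε⁻¹ • fderiv ℝ b (ε⁻¹ • (z - z₀)) := by
    intro z
    have h1 : HasFDerivAt (fun z : P => ε⁻¹ • (z - z₀)) (ε⁻¹ • ContinuousLinearMap.id ℝ P) z :=
      ((hasFDerivAt_id z).sub_const z₀).const_smul ε⁻¹
    have h2 := ((hbC.differentiable one_ne_zero) (ε⁻¹ • (z - z₀))).hasFDerivAt.comp z h1
    have h3 := h2.fderiv
    ext w
    rw [show φ = b ∘ fun z : P => ε⁻¹ • (z - z₀) from rfl, h3]
    simp
  set n := Module.finrank ℝ P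
  have hscale : ∀ F : P → ℝ, ∫ z, F (ε⁻¹ • (z - z₀)) ∂ν = ε ^ n * ∫ y, F y ∂ν := by
    intro F
    rw [integral_sub_right_eq_self (fun z => F (ε⁻¹ • z)) z₀,
      Measure.integral_comp_inv_smul_of_nonneg ν F hε0.le, smul_eq_mul]
  have hφ' : ∀ k, Continuous (fun z => fderiv ℝ φ z (v k)) := fun k =>
    (hφ1.continuous_fderiv one_ne_zero).clm_apply continuous_const
  have hint : ∀ k, Integrable (fun z => h k z * fderiv ℝ φ z (v k)) ν := fun k =>
    integrable_mul_of_locallyIntegrableOn ν (hφ' k) (hφc.fderiv_apply ℝ (v k))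
      ((tsupport_fderiv_apply_subset ℝ (v k)).trans hφU) (hl k)
  have hpos := hw φ hφC hφc hφU (fun z => b.nonneg)
  rw [integral_finsetSum _ fun k _ => hint k] at hpos
  have hk : ∀ k, ∫ z, h k z * fderiv ℝ φ z (v k) ∂ν
      ≤ ε ^ n * (-(fderiv ℝ (h k) z₀ (v k)) * N + 2 * η * (‖v k‖ * ∫ y, ‖fderiv ℝ b y‖ ∂ν)) := by
    intro k
    -- The first-order Taylor polynomial is integrated by parts exactly. The remainder is at most
    -- 2ηε on the support of φ and the gradient of φ has size 1/ε, so the powers of ε cancel and an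
    -- error proportional to η is left.
    set aff : P → ℝ := fun z => h k z₀ + fderiv ℝ (h k) z₀ (z - z₀) with haff
    have haC : ContDiff ℝ 1 aff := by fun_prop
    obtain ⟨-, hi2, hibp⟩ := integral_by_parts ν isOpen_univ hφ1 hφc (subset_univ _)
      haC.contDiffOn (v k)
    have had : ∀ z, fderiv ℝ aff z = fderiv ℝ (h k) z₀ := by
      intro z
      have : HasFDerivAt aff (fderiv ℝ (h k) z₀) z := by
        have h1 := (((fderiv ℝ (h k) z₀).hasFDerivAt.comp z
          ((hasFDerivAt_id z).sub_const z₀)).const_add (h k z₀))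
        rwa [ContinuousLinearMap.comp_id] at h1
      exact this.fderiv
    simp only [had, integral_mul_const] at hibp
    have hφint : ∫ z, φ z ∂ν = ε ^ n * N := hscale b
    rw [hφint] at hibp
    have hi3 := (hint k).sub hi2
    have hrem : ∫ z, (h k z * fderiv ℝ φ z (v k) - aff z * fderiv ℝ φ z (v k)) ∂ν
        ≤ ∫ z, 2 * η * ‖v k‖ * ‖fderiv ℝ b (ε⁻¹ • (z - z₀))‖ ∂ν := by
      have hb1 : Integrable (fun y => ‖fderiv ℝ b y‖) ν :=
        ((hbC.continuous_fderiv one_ne_zero).integrable_of_hasCompactSupport (hbc.fderiv ℝ)).norm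
      refine integral_mono hi3 (Integrable.const_mul ?_ _) fun z => ?_
      · exact (hb1.comp_smul (inv_ne_zero hε0.ne')).comp_sub_right z₀
      · simp only
        rw [← sub_mul]
        by_cases hz : z ∈ tsupport φ
        · have hzb := hsub hz
          rw [Metric.mem_closedBall, dist_eq_norm] at hzb
          refine (le_abs_self _).trans ?_
          rw [abs_mul, hder]
          have e1 : |h k z - aff z| ≤ η * (2 * ε) := by
            have := (hball z (hsubb (hsub hz))).2 k
            rw [haff]
            calc _ = |h k z - h k z₀ - fderiv ℝ (h k) z₀ (z - z₀)| := by ring_nf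
              _ ≤ η * ‖z - z₀‖ := this
              _ ≤ _ := by gcongr
          have e2 : |(ε⁻¹ • fderiv ℝ b (ε⁻¹ • (z - z₀))) (v k)|
              ≤ ε⁻¹ * (‖fderiv ℝ b (ε⁻¹ • (z - z₀))‖ * ‖v k‖) := by
            rw [smul_apply, smul_eq_mul, abs_mul, abs_of_pos (inv_pos.2 hε0)]
            gcongr
            exact (fderiv ℝ b _).le_opNorm _
          calc _ ≤ (η * (2 * ε)) * (ε⁻¹ * (‖fderiv ℝ b (ε⁻¹ • (z - z₀))‖ * ‖v k‖)) := by gcongr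
            _ = _ := by
              field_simp
        · rw [image_eq_zero_of_notMem_tsupport fun h => hz (tsupport_fderiv_subset ℝ h)]
          simp only [zero_apply, mul_zero]
          positivity
    rw [integral_sub (hint k) hi2, hibp, integral_const_mul,
      hscale (fun y => ‖fderiv ℝ b y‖)] at hrem
    linarith
  have hsum := hpos.trans (Finset.sum_le_sum fun k _ => hk k)
  rw [← Finset.mul_sum, Finset.sum_add_distrib, ← Finset.sum_mul, ← Finset.mul_sum,
    Finset.sum_neg_distrib] at hsum
  have := nonneg_of_mul_nonneg_right hsum (by positivity)
  linarith

end TestFunctions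

end EnskogVlasov

namespace EnskogVlasov

open Filter Topology
open scoped Pointwise

/-- A change of variables for maps not known to be embeddings: measurability of `g` takes the place
of injectivity. -/
theorem MeasurePreserving.integral_comp_of_aestronglyMeasurable {α β : Type*} [MeasurableSpace α]
    [MeasurableSpace β] {μ : Measure α} {ν : Measure β} {T : α → β} (hT : MeasurePreserving T μ ν)
    {g : β → ℝ} (hg : AEStronglyMeasurable g ν) : ∫ x, g (T x) ∂μ = ∫ y, g y ∂ν := by
  rw [← hT.map_eq, integral_map hT.measurable.aemeasurable (by rwa [hT.map_eq])]

instance : (volume : Measure (E3 × E3)).IsAddHaarMeasure := Measure.prod.instIsAddHaarMeasure _ _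

instance : (volume : Measure (ℝ × E3)).IsAddHaarMeasure := Measure.prod.instIsAddHaarMeasure _ _

/-! ### The solid angle: reflection and polar coordinates. -/

section Sphere

instance : IsFiniteMeasure solidAngle := by unfold solidAngle; infer_instance

instance : solidAngle.IsOpenPosMeasure := by unfold solidAngle; infer_instance

theorem norm_dir (α : S2) : ‖(α : E3)‖ = 1 := by simp

/-- The solid angle of a set is three times the volume of the cone over it, and x ↦ −x preserves
volume and maps cones to cones. -/
theorem measurePreserving_neg_sphere :
    MeasurePreserving (fun α : S2 => -α) solidAngle solidAngle := by
  have hm : Measurable (fun α : S2 => -α) := continuous_neg.measurable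
  refine ⟨hm, ?_⟩
  ext s hs
  rw [Measure.map_apply hm hs, solidAngle, Measure.toSphere_apply' _ hs,
    Measure.toSphere_apply' _ (hm hs)]
  congr 1
  rw [← Measure.measure_neg (volume : Measure E3) (Ioo (0 : ℝ) 1 • (Subtype.val '' s))]
  congr 1
  ext x
  simp only [Set.mem_neg, Set.mem_smul, Set.mem_image, Set.mem_preimage]
  constructor
  · rintro ⟨r, hr, _, ⟨α, hα, rfl⟩, rfl⟩
    exact ⟨r, hr, _, ⟨-α, hα, rfl⟩, by simp⟩
  · rintro ⟨r, hr, _, ⟨α, hα, rfl⟩, h⟩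
    exact ⟨r, hr, _, ⟨-α, by simpa using hα, rfl⟩, by simp [h]⟩

theorem integral_neg_sphere (g : S2 → ℝ) :
    ∫ α, g (-α) ∂solidAngle = ∫ α, g α ∂solidAngle :=
  measurePreserving_neg_sphere.integral_comp
    (Homeomorph.neg S2).measurableEmbedding g

theorem integral_eq_integral_sphere {F : E3 → ℝ} (hF : Integrable F) :
    ∫ x, F x = ∫ α : S2, (∫ s in Ioi (0 : ℝ), s ^ 2 * F (s • (α : E3))) ∂solidAngle := by
  have hdim : Module.finrank ℝ E3 = 3 := by simp
  have hmp := (volume : Measure E3).measurePreserving_homeomorphUnitSphereProd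
  rw [hdim] at hmp
  have hemb := (homeomorphUnitSphereProd E3).measurableEmbedding
  set G : S2 × Ioi (0 : ℝ) → ℝ := fun q => F (q.2.1 • (q.1 : E3)) with hG
  have hGF : ∀ x : ({0}ᶜ : Set E3), G (homeomorphUnitSphereProd E3 x) = F x := by
    intro x
    have hx : ‖(x : E3)‖ ≠ 0 := norm_ne_zero_iff.2 x.2
    simp [hG, smul_smul, hx]
  have hGi : Integrable G ((volume : Measure E3).toSphere.prod (Measure.volumeIoiPow 2)) := by
    rw [← hmp.integrable_comp_emb hemb]
    have h1 : Integrable (fun x : ({0}ᶜ : Set E3) => F x) (volume.comap Subtype.val) := by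
      have := (integrableOn_iff_comap_subtypeVal (measurableSet_singleton (0 : E3)).compl
        (f := F) (μ := volume)).1 hF.integrableOn
      exact this
    exact h1.congr (Eventually.of_forall fun x => (hGF x).symm)
  calc ∫ x, F x = ∫ x : ({0}ᶜ : Set E3), F x ∂(volume.comap Subtype.val) := by
        rw [integral_subtype_comap (measurableSet_singleton _).compl F, restrict_compl_singleton]
    _ = ∫ x : ({0}ᶜ : Set E3), G (homeomorphUnitSphereProd E3 x) ∂(volume.comap Subtype.val) := by
        simp only [hGF]
    _ = ∫ q, G q ∂((volume : Measure E3).toSphere.prod (Measure.volumeIoiPow 2)) :=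
        hmp.integral_comp hemb G
    _ = ∫ α : S2, (∫ s, G (α, s) ∂(Measure.volumeIoiPow 2)) ∂solidAngle := integral_prod _ hGi
    _ = _ := by
        refine integral_congr_ae (Eventually.of_forall fun α => ?_)
        simp only [Measure.volumeIoiPow, ENNReal.ofReal, hG]
        rw [integral_withDensity_eq_integral_smul,
          integral_subtype_comap measurableSet_Ioi
            fun a : ℝ => Real.toNNReal (a ^ 2) • F (a • (α : E3))]
        · refine setIntegral_congr_fun measurableSet_Ioi fun x hx => ?_
          simp only [NNReal.smul_def, smul_eq_mul]
          rw [Real.coe_toNNReal _ (by positivity)]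
        · exact (measurable_subtype_coe.pow_const _).real_toNNReal

end Sphere

/-! ### The kinematics of a collision and its symmetries. -/

section Collisions

/-- Velocity pairs together with a direction of impact, written `(ξ, ξ_*, α)`. -/
abbrev Coll : Type := E3 × E3 × S2

/-- The measure `dξ dξ_* dΩ(α)`. -/
noncomputable def collMeasure : Measure Coll :=
  (volume : Measure E3).prod ((volume : Measure E3).prod solidAngle)

instance : SFinite ((volume : Measure E3).prod solidAngle) := Measure.prod.instSFinite

instance : SFinite collMeasure :=
  Measure.prod.instSFinite

instance : ((volume : Measure E3).prod solidAngle).IsOpenPosMeasure :=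
  Measure.prod.instIsOpenPosMeasure

instance : collMeasure.IsOpenPosMeasure := Measure.prod.instIsOpenPosMeasure

theorem inner_dir_self (α : S2) : inner ℝ (α : E3) (α : E3) = (1 : ℝ) := by
  rw [real_inner_self_eq_norm_sq, norm_dir]; norm_num

/-- For fixed α the collision reflects the relative velocity in the plane orthogonal to α. Hence V
changes sign, and applying the collision twice restores both velocities. -/
theorem relV_post (α : S2) (ξ ξs : E3) :
    relV α (post α ξ ξs) (postStar α ξ ξs) = -relV α ξ ξs := by
  have : postStar α ξ ξs - post α ξ ξs = (ξs - ξ) - (2 * relV α ξ ξs) • (α : E3) := by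
    simp only [post, postStar, two_mul, add_smul]; abel
  rw [relV, this, inner_sub_left, inner_smul_left, inner_dir_self]
  simp only [relV, conj_trivial]; ring

theorem post_post (α : S2) (ξ ξs : E3) : post α (post α ξ ξs) (postStar α ξ ξs) = ξ := by
  rw [post, relV_post, post]; simp

theorem postStar_post (α : S2) (ξ ξs : E3) : postStar α (post α ξ ξs) (postStar α ξ ξs) = ξs := by
  rw [postStar, relV_post, postStar]; simp

theorem relV_swap (α : S2) (ξ ξs : E3) : relV (-α) ξs ξ = relV α ξ ξs := by
  simp only [relV, Metric.sphere, coe_neg_sphere, inner_neg_right]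
  rw [← inner_neg_left]; simp

theorem relV_neg (α : S2) (ξ ξs : E3) : relV (-α) ξ ξs = -relV α ξ ξs := by
  simp only [relV, coe_neg_sphere, inner_neg_right]

theorem post_neg (α : S2) (ξ ξs : E3) : post (-α) ξ ξs = post α ξ ξs := by
  simp [post, relV_neg]

theorem post_swap (α : S2) (ξ ξs : E3) : post (-α) ξs ξ = postStar α ξ ξs := by
  rw [post, relV_swap]; simp [postStar, sub_eq_add_neg]

theorem abs_relV_le (α : S2) (ξ ξs : E3) : |relV α ξ ξs| ≤ ‖ξ‖ + ‖ξs‖ := by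
  refine (abs_real_inner_le_norm _ _).trans ?_
  rw [norm_dir, mul_one, add_comm]
  exact norm_sub_le _ _

theorem norm_sq_post (α : S2) (ξ ξs : E3) :
    ‖post α ξ ξs‖ ^ 2 = ‖ξ‖ ^ 2 + relV α ξ ξs * inner ℝ (ξ + ξs) (α : E3) := by
  rw [post, norm_add_sq_real, norm_smul, norm_dir, inner_smul_right]
  simp only [relV, inner_sub_left, inner_add_left, Real.norm_eq_abs, mul_one, sq_abs]
  ring

theorem norm_sq_postStar (α : S2) (ξ ξs : E3) :
    ‖postStar α ξ ξs‖ ^ 2 = ‖ξs‖ ^ 2 - relV α ξ ξs * inner ℝ (ξ + ξs) (α : E3) := by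
  rw [← post_swap, norm_sq_post, relV_swap]
  simp [add_comm, coe_neg_sphere, inner_neg_right, sub_eq_add_neg]

/-- Conservation of energy: |ξ'|² + |ξ'_*|² = |ξ|² + |ξ_*|² ≤ (|ξ| + |ξ_*|)². Growth bounds at
post-collisional velocities thus reduce to moments in the incoming ones. -/
theorem norm_post_le (α : S2) (ξ ξs : E3) : ‖post α ξ ξs‖ ≤ ‖ξ‖ + ‖ξs‖ := by
  refine abs_le_of_sq_le_sq' ?_ (by positivity) |>.2
  have h1 := norm_sq_post α ξ ξs
  have h2 := norm_sq_postStar α ξ ξs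
  nlinarith [sq_nonneg ‖postStar α ξ ξs‖, norm_nonneg ξ, norm_nonneg ξs,
    mul_nonneg (norm_nonneg ξ) (norm_nonneg ξs)]

theorem norm_postStar_le (α : S2) (ξ ξs : E3) : ‖postStar α ξ ξs‖ ≤ ‖ξ‖ + ‖ξs‖ := by
  rw [← post_swap, add_comm]
  exact norm_post_le _ _ _

theorem continuous_relV : Continuous fun w : Coll => relV w.2.2 w.1 w.2.1 := by
  unfold relV; fun_prop

theorem continuous_post : Continuous fun w : Coll => post w.2.2 w.1 w.2.1 := by
  unfold post
  have := continuous_relV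
  fun_prop

theorem continuous_postStar : Continuous fun w : Coll => postStar w.2.2 w.1 w.2.1 := by
  unfold postStar
  have := continuous_relV
  fun_prop

theorem measurable_heavi : Measurable heavi := by
  unfold heavi
  exact Measurable.ite measurableSet_Ici measurable_const measurable_const

/-- `V θ(V)`. -/
noncomputable def rate (w : Coll) : ℝ :=
  relV w.2.2 w.1 w.2.1 * heavi (relV w.2.2 w.1 w.2.1)

/-- The factor x removes the jump of θ at the origin, so the collision rate is continuous. -/
theorem mul_heavi_eq_max (x : ℝ) : x * heavi x = max x 0 := by
  unfold heavi
  split_ifs with h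
  · rw [max_eq_left h, mul_one]
  · rw [max_eq_right (not_le.1 h).le, mul_zero]

theorem rate_eq_max (w : Coll) : rate w = max (relV w.2.2 w.1 w.2.1) 0 := mul_heavi_eq_max _

theorem rate_nonneg (w : Coll) : 0 ≤ rate w := by rw [rate_eq_max]; exact le_max_right _ _

theorem rate_le (w : Coll) : rate w ≤ ‖w.1‖ + ‖w.2.1‖ := by
  rw [rate_eq_max]
  exact max_le ((le_abs_self _).trans (abs_relV_le _ _ _)) (by positivity)

theorem continuous_rate : Continuous rate := by
  have : rate = fun w => max (relV w.2.2 w.1 w.2.1) 0 := funext rate_eq_max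
  rw [this]
  exact continuous_relV.max continuous_const

/-- The collision transformation `(ξ, ξ_*, α) ↦ (ξ', ξ'_*, α)`. -/
noncomputable def collide (w : Coll) : Coll :=
  (post w.2.2 w.1 w.2.1, postStar w.2.2 w.1 w.2.1, w.2.2)

/-- Exchange of the partners, `(ξ, ξ_*, α) ↦ (ξ_*, ξ, -α)`. -/
noncomputable def swapPartners (w : Coll) : Coll := (w.2.1, w.1, -w.2.2)

/-- Reversal of the direction of impact. -/
noncomputable def flipDir (w : Coll) : Coll := (w.1, w.2.1, -w.2.2)

/-- The map is linear and an involution, so its determinant squares to one and has absolute value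
one. -/
theorem measurePreserving_collide_fixed (α : S2) :
    MeasurePreserving (fun p : E3 × E3 => (post α p.1 p.2, postStar α p.1 p.2))
      volume volume := by
  let L : E3 × E3 →ₗ[ℝ] E3 × E3 :=
    { toFun := fun p => (post α p.1 p.2, postStar α p.1 p.2)
      map_add' := fun p q => by
        simp only [post, postStar, relV, Prod.fst_add, Prod.snd_add, Prod.mk_add_mk,
          inner_sub_left, inner_add_left, Prod.mk.injEq]
        constructor <;> module
      map_smul' := fun c p => by
        simp only [post, postStar, relV, Prod.smul_fst, Prod.smul_snd, Prod.smul_mk,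
          inner_sub_left, inner_smul_left, Prod.mk.injEq, RingHom.id_apply, conj_trivial]
        constructor <;> module }
  have hLL : L ∘ₗ L = LinearMap.id := by
    apply LinearMap.ext
    intro p
    exact Prod.ext (post_post α p.1 p.2) (postStar_post α p.1 p.2)
  have hdet : LinearMap.det L * LinearMap.det L = 1 := by
    rw [← LinearMap.det_comp, hLL, LinearMap.det_id]
  have habs : |(LinearMap.det L)⁻¹| = 1 := by
    rcases mul_self_eq_one_iff.1 hdet with h | h <;> simp [h]
  have hne : LinearMap.det L ≠ 0 := fun h => by simp [h] at hdet
  refine ⟨L.continuous_of_finiteDimensional.measurable, ?_⟩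
  have := Measure.map_linearMap_addHaar_eq_smul_addHaar (volume : Measure (E3 × E3)) hne
  rw [habs] at this
  rw [ENNReal.ofReal_one, one_smul] at this
  exact this

theorem measurePreserving_swapPartners :
    MeasurePreserving swapPartners collMeasure collMeasure := by
  have h1 := measurePreserving_prodAssoc (volume : Measure E3) (volume : Measure E3) solidAngle
  have h2 := (Measure.measurePreserving_swap (μ := (volume : Measure E3))
    (ν := (volume : Measure E3))).prod measurePreserving_neg_sphere
  exact (h1.comp h2).comp (h1.symm _)

theorem measurePreserving_flipDir :
    MeasurePreserving flipDir collMeasure collMeasure :=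
  (MeasurePreserving.id _).prod ((MeasurePreserving.id _).prod measurePreserving_neg_sphere)

theorem measurePreserving_collide :
    MeasurePreserving collide collMeasure collMeasure := by
  have h1 := measurePreserving_prodAssoc (volume : Measure E3) (volume : Measure E3) solidAngle
  have h2 := Measure.measurePreserving_swap (μ := solidAngle)
    (ν := (volume : Measure E3).prod (volume : Measure E3))
  have h2' := Measure.measurePreserving_swap (ν := solidAngle)
    (μ := (volume : Measure E3).prod (volume : Measure E3))
  have h3 : MeasurePreserving
      (fun p : S2 × (E3 × E3) => (p.1, (post p.1 p.2.1 p.2.2, postStar p.1 p.2.1 p.2.2)))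
      (solidAngle.prod ((volume : Measure E3).prod (volume : Measure E3)))
      (solidAngle.prod ((volume : Measure E3).prod (volume : Measure E3))) := by
    refine (MeasurePreserving.id solidAngle).skew_product
      (g := fun (α : S2) (p : E3 × E3) => (post α p.1 p.2, postStar α p.1 p.2)) ?_
      (Eventually.of_forall fun α => (measurePreserving_collide_fixed α).map_eq)
    have : Continuous fun q : S2 × (E3 × E3) => ((q.2.1, q.2.2, q.1) : Coll) := by fun_prop
    exact ((continuous_post.comp this).prodMk (continuous_postStar.comp this)).measurable
  exact ((h1.comp h2).comp h3).comp (h2'.comp (h1.symm _))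

end Collisions

end EnskogVlasov

/-! ### The standing assumptions and the admissible velocity weights. -/

namespace EnskogVlasov

open Filter Topology

/-- The coordinate directions of `E3`. -/
noncomputable abbrev basisVec (i : Fin 3) : E3 := EuclideanSpace.single i 1

/-- Space-time domain. -/
abbrev spaceTime (G : Gas) (I : Set ℝ) : Set (ℝ × E3) := I ×ˢ G.D

/-- The distribution function on phase space-time. -/
def phase (f : ℝ → E3 → E3 → ℝ) (z : ℝ × E3 × E3) : ℝ := f z.1 z.2.1 z.2.2

/-- The assumptions of the theorem. -/
structure Model (G : Gas) (I : Set ℝ) (f : ℝ → E3 → E3 → ℝ) (A : Set ℝ) : Prop where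
  openI : IsOpen I
  openD : IsOpen G.D
  σ_pos : 0 < G.σ
  m_pos : 0 < G.m
  Rg_pos : 0 < G.Rg
  Tw_pos : 0 < G.Tw
  A_conn : A.OrdConnected
  A_zero : (0 : ℝ) ∈ A
  S_cont : ContinuousOn G.S A
  S_nonneg : ∀ x ∈ A, 0 ≤ G.S x
  crowd_mem : ∀ t ∈ I, ∀ X ∈ closure G.D, G.crowd f t X ∈ A
  Φ_smooth : ContDiffOn ℝ 1 G.Φ (Ioi 0)
  Φ_int : IntegrableOn (fun r : E3 => (1 + ‖r‖) * (|G.Φ ‖r‖| + |deriv G.Φ ‖r‖|))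
      {r | ∃ X ∈ G.D, ∃ Y ∈ G.D, r = Y - X}
  regular : G.Regular f I
  wall : G.Impermeable f I
  sol : G.SolvesEnskogVlasov f I

variable {G : Gas} {I : Set ℝ} {f : ℝ → E3 → E3 → ℝ} {A : Set ℝ}

namespace Model

theorem isOpen_spaceTime (h : Model G I f A) : IsOpen (spaceTime G I) := h.openI.prod h.openD

theorem isOpen_phase (h : Model G I f A) : IsOpen (I ×ˢ G.D ×ˢ (univ : Set E3)) :=
  h.openI.prod (h.openD.prod isOpen_univ)

theorem phase_contDiffOn (h : Model G I f A) :
    ContDiffOn ℝ 1 (phase f) (I ×ˢ G.D ×ˢ (univ : Set E3)) := h.regular.smooth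

theorem phase_differentiableAt (h : Model G I f A) {z : ℝ × E3} (hz : z ∈ spaceTime G I) (ξ : E3) :
    DifferentiableAt ℝ (phase f) (z.1, z.2, ξ) :=
  (h.phase_contDiffOn.contDiffAt (h.isOpen_phase.mem_nhds ⟨hz.1, hz.2, mem_univ _⟩)).differentiableAt
    one_ne_zero

theorem pos (h : Model G I f A) {z : ℝ × E3} (hz : z ∈ spaceTime G I) (ξ : E3) :
    0 < f z.1 z.2 ξ := h.regular.pos _ hz.1 _ hz.2 _

/-- A form of the decay assumption with the power weight absorbed into a nonnegative majorant and
with a nonnegative constant. -/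
theorem exists_decay (h : Model G I f A) {K : Set ℝ} (hK : IsCompact K) (hKI : K ⊆ I) (r : ℝ) :
    ∃ (k : ℕ) (C : ℝ) (m : E3 → ℝ), 0 ≤ C ∧ Integrable m ∧ (∀ ξ, 0 ≤ m ξ) ∧
      ∀ t ∈ K, ∀ X ∈ G.D, ‖X‖ ≤ r → ∀ ξ, (1 + ‖ξ‖) ^ (k + 3) * f t X ξ ≤ m ξ ∧
        |Real.log (f t X ξ)| ≤ C * (1 + ‖ξ‖) ^ k := by
  obtain ⟨k, C, M, hM, hb⟩ := h.regular.decay K hK hKI r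
  refine ⟨k, |C|, fun ξ => |(1 + ‖ξ‖) ^ (k + 3) * M ξ|, abs_nonneg _, hM.abs,
    fun ξ => abs_nonneg _, fun t ht X hX hr ξ => ⟨?_, ?_⟩⟩
  · refine le_trans ?_ (le_abs_self _)
    gcongr
    exact (hb t ht X hX hr ξ).1
  · refine (hb t ht X hX hr ξ).2.trans ?_
    gcongr
    exact le_abs_self C

theorem exists_decay_deriv (h : Model G I f A) {K : Set ℝ} (hK : IsCompact K) (hKI : K ⊆ I)
    {L : Set E3} (hL : IsCompact L) (hLD : L ⊆ G.D) :
    ∃ (k : ℕ) (C : ℝ) (m : E3 → ℝ), 0 ≤ C ∧ Integrable m ∧ (∀ ξ, 0 ≤ m ξ) ∧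
      ∀ t ∈ K, ∀ X ∈ L, ∀ ξ, (1 + ‖ξ‖) ^ (k + 3) * ‖fderiv ℝ (phase f) (t, X, ξ)‖ ≤ m ξ ∧
        |Real.log (f t X ξ)| ≤ C * (1 + ‖ξ‖) ^ k := by
  obtain ⟨k, C, M, hM, hb⟩ := h.regular.decay_deriv K hK hKI L hL hLD
  refine ⟨k, |C|, fun ξ => |(1 + ‖ξ‖) ^ (k + 3) * M ξ|, abs_nonneg _, hM.abs,
    fun ξ => abs_nonneg _, fun t ht X hX ξ => ⟨?_, ?_⟩⟩
  · refine le_trans ?_ (le_abs_self _)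
    gcongr
    exact (hb t ht X hX ξ).1
  · refine (hb t ht X hX ξ).2.trans ?_
    gcongr
    exact le_abs_self C

end Model

/-- Velocity weights `w` and functions `N` of the distribution function for which the moment
`∫ w N(f)` is well behaved. -/
structure Admissible (w : E3 → ℝ) (N N' : ℝ → ℝ) : Prop where
  smooth : ContDiff ℝ 1 w
  hasDeriv : ∀ x > 0, HasDerivAt N (N' x) x
  cont : ContinuousOn N' (Ioi 0)
  growth : ∀ (k : ℕ) (C : ℝ), 0 ≤ C → ∃ c : ℝ, 0 ≤ c ∧ ∀ (ξ : E3) (x : ℝ), 0 < x →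
    |Real.log x| ≤ C * (1 + ‖ξ‖) ^ k →
      |w ξ| * |N' x| ≤ c * (1 + ‖ξ‖) ^ (k + 3) ∧
      ‖fderiv ℝ w ξ‖ * |N x| ≤ c * ((1 + ‖ξ‖) ^ (k + 3) * x) ∧
      |w ξ| * |N x| ≤ c * ((1 + ‖ξ‖) ^ (k + 3) * x)

/-- When N(f) = f no power is spent on the logarithm, so all three guaranteed powers go to the
weight, even for k = 0. Cubic growth is what the kinetic energy flux needs. -/
theorem Admissible.of_growth_three {w : E3 → ℝ} (hw : ContDiff ℝ 1 w) (c : ℝ)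
    (h1 : ∀ ξ, |w ξ| ≤ c * (1 + ‖ξ‖) ^ 3) (h2 : ∀ ξ, ‖fderiv ℝ w ξ‖ ≤ c * (1 + ‖ξ‖) ^ 3) :
    Admissible w (fun x => x) (fun _ => 1) where
  smooth := hw
  hasDeriv x _ := hasDerivAt_id x
  cont := continuousOn_const
  growth k C _ := by
    have hc : 0 ≤ c := by simpa using (abs_nonneg _).trans (h1 0)
    refine ⟨c, hc, fun ξ x hx _ => ?_⟩
    have hp : (1 + ‖ξ‖) ^ 3 ≤ (1 + ‖ξ‖) ^ (k + 3) :=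
      pow_le_pow_right₀ (by linarith [norm_nonneg ξ]) (by omega)
    rw [abs_one, mul_one, abs_of_pos hx, ← mul_assoc]
    refine ⟨(h1 ξ).trans (by gcongr), ?_, ?_⟩
    · exact mul_le_mul_of_nonneg_right ((h2 ξ).trans (by gcongr)) hx.le
    · exact mul_le_mul_of_nonneg_right ((h1 ξ).trans (by gcongr)) hx.le

/-- The logarithm takes k powers and the weight one, which stays within the available k + 3. Both N'
and N/x are controlled by |ln x| + 1. -/
theorem Admissible.of_growth_one {w : E3 → ℝ} (hw : ContDiff ℝ 1 w) (c : ℝ)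
    (h1 : ∀ ξ, |w ξ| ≤ c * (1 + ‖ξ‖)) (h2 : ∀ ξ, ‖fderiv ℝ w ξ‖ ≤ c * (1 + ‖ξ‖)) :
    Admissible w (fun x => x * Real.log x) (fun x => Real.log x + 1) where
  smooth := hw
  hasDeriv x hx := Real.hasDerivAt_mul_log hx.ne'
  cont := (Real.continuousOn_log.mono fun x (hx : 0 < x) => hx.ne').add continuousOn_const
  growth k C hC := by
    have hc : 0 ≤ c := by simpa using (abs_nonneg _).trans (h1 0)
    refine ⟨c * (C + 1), by positivity, fun ξ x hx hl => ?_⟩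
    have h0 : 1 ≤ 1 + ‖ξ‖ := by linarith [norm_nonneg ξ]
    have hl2 : |Real.log x| + 1 ≤ (C + 1) * (1 + ‖ξ‖) ^ (k + 2) := by
      have e1 : (1 + ‖ξ‖) ^ k ≤ (1 + ‖ξ‖) ^ (k + 2) := pow_le_pow_right₀ h0 (by omega)
      have e2 : 1 ≤ (1 + ‖ξ‖) ^ (k + 2) := one_le_pow₀ h0
      nlinarith
    have key : ∀ y, |y| ≤ c * (1 + ‖ξ‖) → |y| * (|Real.log x| + 1)
        ≤ c * (C + 1) * (1 + ‖ξ‖) ^ (k + 3) := fun y hy =>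
      calc |y| * (|Real.log x| + 1) ≤ (c * (1 + ‖ξ‖)) * ((C + 1) * (1 + ‖ξ‖) ^ (k + 2)) := by gcongr
        _ = _ := by ring
    have hN : |x * Real.log x| ≤ (|Real.log x| + 1) * x := by
      rw [abs_mul, abs_of_pos hx]; nlinarith
    refine ⟨?_, ?_, ?_⟩
    · refine le_trans ?_ (key _ (h1 ξ))
      gcongr
      exact (abs_add_le _ _).trans (by simp)
    · refine (mul_le_mul_of_nonneg_left hN (norm_nonneg _)).trans ?_
      rw [← mul_assoc, ← mul_assoc]
      have := key ‖fderiv ℝ w ξ‖ (by simpa using h2 ξ)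
      rw [abs_norm] at this
      gcongr
    · refine (mul_le_mul_of_nonneg_left hN (abs_nonneg _)).trans ?_
      rw [← mul_assoc, ← mul_assoc]
      have := key (w ξ) (h1 ξ)
      gcongr

/-! ### Moments of the solution and their transport equations. -/

section Moments

/-- The moment `∫ w N(f) dξ`. -/
noncomputable def moment (f : ℝ → E3 → E3 → ℝ) (w : E3 → ℝ) (N : ℝ → ℝ) (z : ℝ × E3) : ℝ :=
  ∫ ξ, w ξ * N (f z.1 z.2 ξ)

variable {w : E3 → ℝ} {N N' : ℝ → ℝ}

namespace Model

/-- The exponent k and the constant C come with the solution and are not known in advance, so the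
bound is demanded for every choice of them. -/
theorem integrable_decay_mul (h : Model G I f A) {z : ℝ × E3} (hz : z ∈ spaceTime G I)
    {ψ : E3 → ℝ} (hψ : Continuous ψ)
    (hb : ∀ (k : ℕ) (C : ℝ), 0 ≤ C → ∃ c : ℝ, ∀ ξ, |Real.log (f z.1 z.2 ξ)| ≤ C * (1 + ‖ξ‖) ^ k →
      |ψ ξ| ≤ c * ((1 + ‖ξ‖) ^ (k + 3) * f z.1 z.2 ξ)) : Integrable ψ := by
  obtain ⟨k, C, m, hC, hm, hm0, hd⟩ := h.exists_decay (isCompact_singleton (x := z.1))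
    (singleton_subset_iff.2 hz.1) ‖z.2‖
  obtain ⟨c, hc⟩ := hb k C hC
  refine (hm.const_mul |c|).mono' hψ.aestronglyMeasurable (Eventually.of_forall fun ξ => ?_)
  obtain ⟨h1, h2⟩ := hd z.1 rfl z.2 hz.2 le_rfl ξ
  have h0 : 0 ≤ (1 + ‖ξ‖) ^ (k + 3) * f z.1 z.2 ξ := by
    have := (h.pos hz ξ).le
    positivity
  calc ‖ψ ξ‖ ≤ c * ((1 + ‖ξ‖) ^ (k + 3) * f z.1 z.2 ξ) := hc ξ h2
    _ ≤ |c| * m ξ := mul_le_mul (le_abs_self c) h1 h0 (abs_nonneg c)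

theorem continuous_velocity (h : Model G I f A) {z : ℝ × E3} (hz : z ∈ spaceTime G I) :
    Continuous (f z.1 z.2) := by
  have h1 : Continuous fun ξ : E3 => ((z.1, z.2, ξ) : ℝ × E3 × E3) := by fun_prop
  exact h.phase_contDiffOn.continuousOn.comp_continuous h1 fun ξ => ⟨hz.1, hz.2, mem_univ _⟩

theorem continuous_fderiv_phase (h : Model G I f A) {z : ℝ × E3} (hz : z ∈ spaceTime G I) :
    Continuous fun ξ => fderiv ℝ (phase f) (z.1, z.2, ξ) := by
  have h1 : Continuous fun ξ : E3 => ((z.1, z.2, ξ) : ℝ × E3 × E3) := by fun_prop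
  exact (h.phase_contDiffOn.continuousOn_fderiv_of_isOpen h.isOpen_phase le_rfl).comp_continuous h1
    fun ξ => ⟨hz.1, hz.2, mem_univ _⟩

theorem continuous_comp_velocity (h : Model G I f A) (hN : ContinuousOn N (Ioi 0)) {z : ℝ × E3}
    (hz : z ∈ spaceTime G I) : Continuous fun ξ => N (f z.1 z.2 ξ) :=
  hN.comp_continuous (h.continuous_velocity hz) fun ξ => h.pos hz ξ

end Model

theorem Admissible.continuousOn (ha : Admissible w N N') : ContinuousOn N (Ioi 0) :=
  fun x hx => (ha.hasDeriv x hx).continuousAt.continuousWithinAt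

theorem Admissible.integrable (ha : Admissible w N N') (h : Model G I f A) {z : ℝ × E3}
    (hz : z ∈ spaceTime G I) : Integrable fun ξ => w ξ * N (f z.1 z.2 ξ) := by
  refine h.integrable_decay_mul hz
    (ha.smooth.continuous.mul (h.continuous_comp_velocity ha.continuousOn hz)) fun k C hC => ?_
  obtain ⟨c, hc0, hc⟩ := ha.growth k C hC
  refine ⟨c, fun ξ hl => ?_⟩
  rw [abs_mul]
  exact (hc ξ _ (h.pos hz ξ) hl).2.2

theorem Admissible.integrable_deriv_weight (ha : Admissible w N N') (h : Model G I f A)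
    {z : ℝ × E3} (hz : z ∈ spaceTime G I) (e : E3) :
    Integrable fun ξ => fderiv ℝ w ξ e * N (f z.1 z.2 ξ) := by
  refine h.integrable_decay_mul hz (((ha.smooth.continuous_fderiv one_ne_zero).clm_apply
    continuous_const).mul (h.continuous_comp_velocity ha.continuousOn hz)) fun k C hC => ?_
  obtain ⟨c, hc0, hc⟩ := ha.growth k C hC
  refine ⟨‖e‖ * c, fun ξ hl => ?_⟩
  rw [abs_mul]
  calc _ ≤ (‖fderiv ℝ w ξ‖ * ‖e‖) * |N (f z.1 z.2 ξ)| := by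
        gcongr
        exact (fderiv ℝ w ξ).le_opNorm e
    _ = ‖e‖ * (‖fderiv ℝ w ξ‖ * |N (f z.1 z.2 ξ)|) := by ring
    _ ≤ ‖e‖ * (c * ((1 + ‖ξ‖) ^ (k + 3) * f z.1 z.2 ξ)) := by
        exact mul_le_mul_of_nonneg_left (hc ξ _ (h.pos hz ξ) hl).2.1 (norm_nonneg e)
    _ = _ := by ring

/-- The derivative of `w(ξ) N(f)` on phase space-time. -/
noncomputable def momentDeriv (f : ℝ → E3 → E3 → ℝ) (w : E3 → ℝ) (N' : ℝ → ℝ) (z : ℝ × E3)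
    (ξ : E3) : ℝ × E3 × E3 →L[ℝ] ℝ :=
  (w ξ * N' (f z.1 z.2 ξ)) • fderiv ℝ (phase f) (z.1, z.2, ξ)

theorem Admissible.exists_bound (ha : Admissible w N N') (h : Model G I f A) {K : Set ℝ}
    (hK : IsCompact K) (hKI : K ⊆ I) {L : Set E3} (hL : IsCompact L) (hLD : L ⊆ G.D) :
    ∃ B : E3 → ℝ, Integrable B ∧ ∀ t ∈ K, ∀ X ∈ L, ∀ ξ, ‖momentDeriv f w N' (t, X) ξ‖ ≤ B ξ := by
  obtain ⟨k, C, m, hC, hm, hm0, hd⟩ := h.exists_decay_deriv hK hKI hL hLD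
  obtain ⟨c, hc0, hc⟩ := ha.growth k C hC
  refine ⟨fun ξ => c * m ξ, hm.const_mul c, fun t ht X hX ξ => ?_⟩
  obtain ⟨h1, h2⟩ := hd t ht X hX ξ
  have h3 := (hc ξ _ (h.regular.pos t (hKI ht) X (hLD hX) ξ) h2).1
  rw [momentDeriv, norm_smul, Real.norm_eq_abs, abs_mul]
  calc _ ≤ c * (1 + ‖ξ‖) ^ (k + 3) * ‖fderiv ℝ (phase f) (t, X, ξ)‖ := by gcongr
    _ = c * ((1 + ‖ξ‖) ^ (k + 3) * ‖fderiv ℝ (phase f) (t, X, ξ)‖) := by ring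
    _ ≤ _ := mul_le_mul_of_nonneg_left h1 hc0

theorem Admissible.continuous_momentDeriv (ha : Admissible w N N') (h : Model G I f A)
    {z : ℝ × E3} (hz : z ∈ spaceTime G I) : Continuous (momentDeriv f w N' z) :=
  (ha.smooth.continuous.mul (h.continuous_comp_velocity ha.cont hz)).smul
    (h.continuous_fderiv_phase hz)

theorem Admissible.integrable_momentDeriv (ha : Admissible w N N') (h : Model G I f A)
    {z : ℝ × E3} (hz : z ∈ spaceTime G I) : Integrable (momentDeriv f w N' z) := by
  obtain ⟨B, hB, hb⟩ := ha.exists_bound h (isCompact_singleton (x := z.1))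
    (singleton_subset_iff.2 hz.1) (isCompact_singleton (x := z.2)) (singleton_subset_iff.2 hz.2)
  exact hB.mono' (ha.continuous_momentDeriv h hz).aestronglyMeasurable
    (Eventually.of_forall fun ξ => hb _ rfl _ rfl ξ)

/-- The inclusion of space-time directions. -/
def inclST : ℝ × E3 →L[ℝ] ℝ × E3 × E3 :=
  (ContinuousLinearMap.fst ℝ ℝ E3).prod
    ((ContinuousLinearMap.snd ℝ ℝ E3).prod (0 : ℝ × E3 →L[ℝ] E3))

theorem Admissible.hasFDerivAt_phase (ha : Admissible w N N') (h : Model G I f A) {z : ℝ × E3}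
    (hz : z ∈ spaceTime G I) (ξ : E3) :
    HasFDerivAt (fun z : ℝ × E3 => w ξ * N (f z.1 z.2 ξ)) ((momentDeriv f w N' z ξ).comp inclST) z := by
  have h1 : HasFDerivAt (fun z : ℝ × E3 => ((z.1, z.2, ξ) : ℝ × E3 × E3)) inclST z :=
    hasFDerivAt_fst.prodMk (hasFDerivAt_snd.prodMk (hasFDerivAt_const ξ z))
  have h2 := (h.phase_differentiableAt hz ξ).hasFDerivAt.comp z h1
  have h3 := ((ha.hasDeriv _ (h.pos hz ξ)).comp_hasFDerivAt z h2).const_mul (w ξ)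
  refine h3.congr_fderiv ?_
  ext v <;> simp [momentDeriv, mul_assoc]

theorem Admissible.hasFDerivAt_moment (ha : Admissible w N N') (h : Model G I f A) :
    (∀ z ∈ spaceTime G I, HasFDerivAt (moment f w N)
      (∫ ξ, (momentDeriv f w N' z ξ).comp inclST) z) ∧
      ContinuousOn (fun z => ∫ ξ, (momentDeriv f w N' z ξ).comp inclST) (spaceTime G I) := by
  refine hasFDerivAt_continuousOn_integral h.isOpen_spaceTime (fun z hz => ha.integrable h hz)
    (fun z hz => ?_) (Eventually.of_forall fun ξ z hz => ha.hasFDerivAt_phase h hz ξ)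
    (Eventually.of_forall fun ξ => ?_) fun z hz => ?_
  · exact ((ha.continuous_momentDeriv h hz).clm_comp continuous_const).aestronglyMeasurable
  · refine ContinuousOn.clm_comp ?_ continuousOn_const
    have h1 : ContinuousOn (fun z : ℝ × E3 => ((z.1, z.2, ξ) : ℝ × E3 × E3)) (spaceTime G I) := by
      fun_prop
    have h2 : MapsTo (fun z : ℝ × E3 => ((z.1, z.2, ξ) : ℝ × E3 × E3)) (spaceTime G I)
      (I ×ˢ G.D ×ˢ univ) := fun z hz => ⟨hz.1, hz.2, mem_univ _⟩
    have h3 := (h.phase_contDiffOn.continuousOn_fderiv_of_isOpen h.isOpen_phase le_rfl).comp h1 h2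
    have h4 : ContinuousOn (fun z : ℝ × E3 => f z.1 z.2 ξ) (spaceTime G I) :=
      h.phase_contDiffOn.continuousOn.comp h1 h2
    exact (continuousOn_const.mul (ha.cont.comp h4 fun z hz => h.pos hz ξ)).smul h3
  · obtain ⟨K, hK, hzK, hKI⟩ := exists_compact_subset h.openI hz.1
    obtain ⟨L, hL, hzL, hLD⟩ := exists_compact_subset h.openD hz.2
    obtain ⟨B, hB, hb⟩ := ha.exists_bound h hK hKI hL hLD
    refine ⟨K ×ˢ L, prod_mem_nhds (mem_interior_iff_mem_nhds.1 hzK)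
      (mem_interior_iff_mem_nhds.1 hzL), fun ξ => B ξ * ‖inclST‖, hB.mul_const _,
      Eventually.of_forall fun ξ y hy => ?_⟩
    refine (ContinuousLinearMap.opNorm_comp_le _ _).trans ?_
    exact mul_le_mul_of_nonneg_right (hb _ hy.1 _ hy.2 ξ) (norm_nonneg _)

theorem Admissible.contDiffOn_moment (ha : Admissible w N N') (h : Model G I f A) :
    ContDiffOn ℝ 1 (moment f w N) (spaceTime G I) :=
  contDiffOn_one_of_hasFDerivAt h.isOpen_spaceTime (ha.hasFDerivAt_moment h).1
    (ha.hasFDerivAt_moment h).2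

theorem Admissible.fderiv_moment (ha : Admissible w N N') (h : Model G I f A) {z : ℝ × E3}
    (hz : z ∈ spaceTime G I) (v : ℝ × E3) :
    fderiv ℝ (moment f w N) z v = ∫ ξ, momentDeriv f w N' z ξ (v.1, v.2, 0) := by
  rw [((ha.hasFDerivAt_moment h).1 z hz).fderiv, ContinuousLinearMap.integral_apply]
  · rfl
  · have : Integrable fun ξ => ((ContinuousLinearMap.compL ℝ (ℝ × E3) (ℝ × E3 × E3) ℝ).flip inclST)
        (momentDeriv f w N' z ξ) :=
      ContinuousLinearMap.integrable_comp _ (ha.integrable_momentDeriv h hz)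
    exact this

/-- Integration by parts in velocity space. There is no compact support, but w N(f) and its
derivative are integrable, which is all that `integral_eq_zero_of_hasDerivAt_line` needs. -/
theorem Admissible.integral_momentDeriv_velocity (ha : Admissible w N N') (h : Model G I f A)
    {z : ℝ × E3} (hz : z ∈ spaceTime G I) (e : E3) :
    ∫ ξ, momentDeriv f w N' z ξ (0, 0, e) = -∫ ξ, fderiv ℝ w ξ e * N (f z.1 z.2 ξ) := by
  have hi1 : Integrable fun ξ => momentDeriv f w N' z ξ (0, 0, e) :=
    (ha.integrable_momentDeriv h hz).apply_continuousLinearMap _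
  have hi2 := ha.integrable_deriv_weight h hz e
  have := integral_eq_zero_of_hasDerivAt_line volume (fun ξ => w ξ * N (f z.1 z.2 ξ))
    (fun ξ => fderiv ℝ w ξ e * N (f z.1 z.2 ξ) + momentDeriv f w N' z ξ (0, 0, e)) e
    (ha.integrable h hz) (hi2.add hi1) (Eventually.of_forall fun ξ τ => ?_)
  · rw [integral_add hi2 hi1] at this
    linarith
  · have h1 : HasDerivAt (fun s : ℝ => ξ + s • e) e τ := by
      simpa using ((hasDerivAt_id τ).smul_const e).const_add ξ
    have h2 : HasDerivAt (fun s : ℝ => ((z.1, z.2, ξ + s • e) : ℝ × E3 × E3)) (0, 0, e) τ :=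
      (hasDerivAt_const τ z.1).prodMk ((hasDerivAt_const τ z.2).prodMk h1)
    have h3 := (h.phase_differentiableAt hz (ξ + τ • e)).hasFDerivAt.comp_hasDerivAt τ h2
    have h4 := (ha.hasDeriv _ (h.pos hz (ξ + τ • e))).comp τ h3
    have h5 := ((ha.smooth.differentiable one_ne_zero (ξ + τ • e)).hasFDerivAt.comp_hasDerivAt τ h1)
    have h6 := h5.mul h4
    refine h6.congr_deriv ?_
    simp [momentDeriv, phase, mul_assoc]

/-- The transport equation of the moments `∫ w N(f)`. -/
theorem Admissible.transport (ha : Admissible w N N') (h : Model G I f A)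
    (hai : ∀ i, Admissible (fun ξ => ξ i * w ξ) N N') {z : ℝ × E3} (hz : z ∈ spaceTime G I) :
    fderiv ℝ (moment f w N) z (1, 0)
      + ∑ i, fderiv ℝ (moment f (fun ξ => ξ i * w ξ) N) z (0, basisVec i)
      = (∫ ξ, w ξ * N' (f z.1 z.2 ξ) * (G.gain f z.1 z.2 ξ - G.loss f z.1 z.2 ξ))
        + ∑ i, G.force f z.1 z.2 i * ∫ ξ, fderiv ℝ w ξ (basisVec i) * N (f z.1 z.2 ξ) := by
  have e0 := ha.fderiv_moment h hz (1, 0)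
  have ei := fun i => (hai i).fderiv_moment h hz (0, basisVec i)
  have ev := fun i => ha.integral_momentDeriv_velocity h hz (basisVec i)
  have hi : ∀ v, Integrable fun ξ => momentDeriv f w N' z ξ v := fun v =>
    (ha.integrable_momentDeriv h hz).apply_continuousLinearMap v
  have hii : ∀ i v, Integrable fun ξ => momentDeriv f (fun ξ => ξ i * w ξ) N' z ξ v := fun i v =>
    ((hai i).integrable_momentDeriv h hz).apply_continuousLinearMap v
  -- This is the kinetic equation multiplied by w N'(f): each term on its left becomes a derivative
  -- of N(f), and the factor ξ_i of the streaming term is absorbed into the weight.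
  have hsol : ∀ ξ, w ξ * N' (f z.1 z.2 ξ) * (G.gain f z.1 z.2 ξ - G.loss f z.1 z.2 ξ)
      = momentDeriv f w N' z ξ (1, 0, 0)
        + ∑ i, momentDeriv f (fun ξ => ξ i * w ξ) N' z ξ (0, basisVec i, 0)
        + ∑ i, G.force f z.1 z.2 i * momentDeriv f w N' z ξ (0, 0, basisVec i) := by
    intro ξ
    have hd := (h.phase_differentiableAt hz ξ).hasFDerivAt
    have d1 : deriv (fun s => f s z.2 ξ) z.1 = fderiv ℝ (phase f) (z.1, z.2, ξ) (1, 0, 0) := by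
      have h2 : HasDerivAt (fun s : ℝ => ((s, z.2, ξ) : ℝ × E3 × E3)) (1, 0, 0) z.1 :=
        (hasDerivAt_id z.1).prodMk ((hasDerivAt_const z.1 z.2).prodMk (hasDerivAt_const z.1 ξ))
      exact (hd.comp_hasDerivAt z.1 h2).deriv
    have d2 : ∀ i, pd i (fun Y => f z.1 Y ξ) z.2
        = fderiv ℝ (phase f) (z.1, z.2, ξ) (0, basisVec i, 0) := by
      intro i
      have h2 : HasFDerivAt (fun Y : E3 => ((z.1, Y, ξ) : ℝ × E3 × E3))
          ((0 : E3 →L[ℝ] ℝ).prod ((ContinuousLinearMap.id ℝ E3).prod 0)) z.2 :=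
        (hasFDerivAt_const z.1 z.2).prodMk ((hasFDerivAt_id z.2).prodMk (hasFDerivAt_const ξ z.2))
      rw [pd, show (fun Y => f z.1 Y ξ) = phase f ∘ fun Y : E3 => ((z.1, Y, ξ) : ℝ × E3 × E3) from rfl,
        (hd.comp z.2 h2).fderiv]
      rfl
    have d3 : ∀ i, pd i (fun η => f z.1 z.2 η) ξ
        = fderiv ℝ (phase f) (z.1, z.2, ξ) (0, 0, basisVec i) := by
      intro i
      have h2 : HasFDerivAt (fun η : E3 => ((z.1, z.2, η) : ℝ × E3 × E3))
          ((0 : E3 →L[ℝ] ℝ).prod ((0 : E3 →L[ℝ] E3).prod (ContinuousLinearMap.id ℝ E3))) ξ :=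
        (hasFDerivAt_const z.1 ξ).prodMk ((hasFDerivAt_const z.2 ξ).prodMk (hasFDerivAt_id ξ))
      rw [pd, show (fun η => f z.1 z.2 η) = phase f ∘ fun η : E3 => ((z.1, z.2, η) : ℝ × E3 × E3)
        from rfl, (hd.comp ξ h2).fderiv]
      rfl
    rw [← h.sol z.1 hz.1 z.2 hz.2 ξ, d1]
    simp only [d2, d3, momentDeriv, smul_apply, smul_eq_mul, mul_add, Finset.mul_sum]
    congr 1
    · congr 1
      refine Finset.sum_congr rfl fun i _ => by ring
    · refine Finset.sum_congr rfl fun i _ => by ring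
  have hs1 : Integrable fun ξ => ∑ i, momentDeriv f (fun ξ => ξ i * w ξ) N' z ξ (0, basisVec i, 0) :=
    integrable_finsetSum _ fun i _ => hii i _
  have hs2 : Integrable fun ξ => ∑ i, G.force f z.1 z.2 i * momentDeriv f w N' z ξ (0, 0, basisVec i) :=
    integrable_finsetSum _ fun i _ => (hi _).const_mul _
  have hs3 : Integrable fun ξ => momentDeriv f w N' z ξ (1, 0, 0)
      + ∑ i, momentDeriv f (fun ξ => ξ i * w ξ) N' z ξ (0, basisVec i, 0) := (hi _).add hs1
  simp only [hsol]
  rw [integral_add hs3 hs2, integral_add (hi _) hs1, integral_finsetSum _ (fun i _ => hii i _),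
    integral_finsetSum _ (fun i _ => (hi _).const_mul _)]
  simp only [integral_const_mul, ev, e0, ei]
  simp

end Moments

end EnskogVlasov

namespace EnskogVlasov

open Filter Topology

theorem abs_integral_le_of_abs_le {α : Type*} [MeasurableSpace α] {μ : Measure α} {u m : α → ℝ}
    (hm : Integrable m μ) (hu : ∀ x, |u x| ≤ m x) : |∫ x, u x ∂μ| ≤ ∫ x, m x ∂μ := by
  rw [← Real.norm_eq_abs]
  exact norm_integral_le_of_norm_le hm (Eventually.of_forall hu)

/-! ### The weights of mass, momentum, energy and entropy. -/

section Weights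

theorem one_le_one_add_norm (ξ : E3) : 1 ≤ 1 + ‖ξ‖ := by linarith [norm_nonneg ξ]

theorem abs_coord_le (ξ : E3) (i : Fin 3) : |ξ i| ≤ ‖ξ‖ := PiLp.norm_apply_le ξ i

theorem contDiff_coord (i : Fin 3) : ContDiff ℝ 1 fun ξ : E3 => ξ i :=
  (EuclideanSpace.proj (𝕜 := ℝ) i).contDiff

theorem fderiv_coord (i : Fin 3) (ξ : E3) :
    fderiv ℝ (fun ξ : E3 => ξ i) ξ = EuclideanSpace.proj (𝕜 := ℝ) i :=
  (EuclideanSpace.proj (𝕜 := ℝ) i).fderiv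

theorem norm_fderiv_coord_le (i : Fin 3) (ξ : E3) : ‖fderiv ℝ (fun ξ : E3 => ξ i) ξ‖ ≤ 1 := by
  rw [fderiv_coord]
  refine ContinuousLinearMap.opNorm_le_bound _ zero_le_one fun η => ?_
  rw [one_mul]
  exact abs_coord_le η i

/-- The kinetic energy `|ξ|² / 2`. -/
noncomputable def halfSq (ξ : E3) : ℝ := 1 / 2 * ‖ξ‖ ^ 2

theorem contDiff_halfSq : ContDiff ℝ 1 halfSq := (contDiff_norm_sq ℝ).const_smul (1 / 2 : ℝ)

theorem fderiv_halfSq (ξ : E3) : fderiv ℝ halfSq ξ = innerSL ℝ ξ := by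
  have h := ((hasStrictFDerivAt_norm_sq ξ).hasFDerivAt.const_mul (1 / 2 : ℝ))
  have h2 := h.fderiv
  unfold halfSq
  rw [h2]
  ext v
  simp

theorem abs_halfSq_le (ξ : E3) : |halfSq ξ| ≤ (1 + ‖ξ‖) ^ 2 := by
  unfold halfSq
  rw [abs_of_nonneg (by positivity)]
  nlinarith [norm_nonneg ξ]

theorem norm_fderiv_halfSq_le (ξ : E3) : ‖fderiv ℝ halfSq ξ‖ ≤ 1 + ‖ξ‖ := by
  rw [fderiv_halfSq, innerSL_apply_norm]
  linarith

theorem admissible_one : Admissible (fun _ => 1) (fun x => x) (fun _ => 1) :=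
  .of_growth_three contDiff_const 1 (fun ξ => by simpa using one_le_pow₀ (one_le_one_add_norm ξ))
    fun ξ => by simp; positivity

theorem admissible_coord (i : Fin 3) :
    Admissible (fun ξ => ξ i * 1) (fun x => x) (fun _ => 1) := by
  simp only [mul_one]
  refine .of_growth_three (contDiff_coord i) 1 (fun ξ => ?_) fun ξ => ?_
  · have := one_le_one_add_norm ξ
    calc |ξ i| ≤ ‖ξ‖ := abs_coord_le ξ i
      _ ≤ (1 + ‖ξ‖) ^ 1 := by simp
      _ ≤ (1 + ‖ξ‖) ^ 3 := pow_le_pow_right₀ this (by norm_num)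
      _ = _ := by ring
  · have := one_le_pow₀ (one_le_one_add_norm ξ) (n := 3)
    linarith [norm_fderiv_coord_le i ξ]

theorem admissible_halfSq : Admissible halfSq (fun x => x) (fun _ => 1) := by
  refine .of_growth_three contDiff_halfSq 1 (fun ξ => ?_) fun ξ => ?_
  · refine (abs_halfSq_le ξ).trans ?_
    rw [one_mul]
    exact pow_le_pow_right₀ (one_le_one_add_norm ξ) (by norm_num)
  · refine (norm_fderiv_halfSq_le ξ).trans ?_
    rw [one_mul]
    exact le_self_pow₀ (one_le_one_add_norm ξ) (by norm_num)

theorem admissible_coord_halfSq (i : Fin 3) :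
    Admissible (fun ξ => ξ i * halfSq ξ) (fun x => x) (fun _ => 1) := by
  refine .of_growth_three ((contDiff_coord i).mul contDiff_halfSq) 2 (fun ξ => ?_) fun ξ => ?_
  · rw [abs_mul]
    calc |ξ i| * |halfSq ξ| ≤ (1 + ‖ξ‖) * (1 + ‖ξ‖) ^ 2 := by
          gcongr
          · linarith [abs_coord_le ξ i]
          · exact abs_halfSq_le ξ
      _ = (1 + ‖ξ‖) ^ 3 := by ring
      _ ≤ _ := by nlinarith [pow_nonneg (zero_le_one.trans (one_le_one_add_norm ξ)) 3]
  · rw [fderiv_fun_mul ((contDiff_coord i).differentiable one_ne_zero ξ)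
      (contDiff_halfSq.differentiable one_ne_zero ξ)]
    refine (norm_add_le _ _).trans ?_
    rw [norm_smul, norm_smul, Real.norm_eq_abs, Real.norm_eq_abs]
    have h1 := one_le_one_add_norm ξ
    calc _ ≤ (1 + ‖ξ‖) * (1 + ‖ξ‖) + (1 + ‖ξ‖) ^ 2 * 1 := by
          gcongr
          · linarith [abs_coord_le ξ i]
          · exact norm_fderiv_halfSq_le ξ
          · exact abs_halfSq_le ξ
          · exact norm_fderiv_coord_le i ξ
      _ = 2 * (1 + ‖ξ‖) ^ 2 := by ring
      _ ≤ 2 * (1 + ‖ξ‖) ^ 3 := by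
          gcongr
          norm_num

theorem admissible_log :
    Admissible (fun _ => 1) (fun x => x * Real.log x) (fun x => Real.log x + 1) :=
  .of_growth_one contDiff_const 1 (fun ξ => by simp) fun ξ => by simp; positivity

theorem admissible_coord_log (i : Fin 3) :
    Admissible (fun ξ => ξ i * 1) (fun x => x * Real.log x) (fun x => Real.log x + 1) := by
  simp only [mul_one]
  refine .of_growth_one (contDiff_coord i) 1 (fun ξ => ?_) fun ξ => ?_
  · linarith [abs_coord_le ξ i]
  · linarith [norm_fderiv_coord_le i ξ, norm_nonneg ξ]

end Weights

/-! ### Extension by zero outside the domain; regularity and bounds of density and Enskog factor. -/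

section Cutoff

variable (G : Gas) (I : Set ℝ) (f : ℝ → E3 → E3 → ℝ)

/-- The distribution function, extended by zero. -/
noncomputable def cut (z : ℝ × E3) (ξ : E3) : ℝ :=
  (spaceTime G I).indicator (fun z => f z.1 z.2 ξ) z

/-- The density, extended by zero. -/
noncomputable def dens (z : ℝ × E3) : ℝ := ∫ ξ, cut G I f z ξ

/-- The momentum density, extended by zero. -/
noncomputable def cur (i : Fin 3) (z : ℝ × E3) : ℝ := ∫ ξ, ξ i * cut G I f z ξ

/-- The time derivative of the density, extended by zero. -/
noncomputable def densDot (z : ℝ × E3) : ℝ :=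
  (spaceTime G I).indicator (fun z => fderiv ℝ (moment f (fun _ => 1) fun x => x) z (1, 0)) z

/-- `S(ℛ)`, extended by zero. -/
noncomputable def enskog (z : ℝ × E3) : ℝ :=
  (spaceTime G I).indicator (fun z => G.S (G.crowd f z.1 z.2)) z

variable {G I f} {A : Set ℝ}

theorem cut_of_mem {z : ℝ × E3} (hz : z ∈ spaceTime G I) (ξ : E3) :
    cut G I f z ξ = f z.1 z.2 ξ := indicator_of_mem hz _

theorem cut_of_notMem {z : ℝ × E3} (hz : z ∉ spaceTime G I) (ξ : E3) : cut G I f z ξ = 0 :=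
  indicator_of_notMem hz _

theorem moment_one_eq (z : ℝ × E3) : moment f (fun _ => 1) (fun x => x) z = Gas.rho f z.1 z.2 := by
  simp [moment, Gas.rho]

theorem dens_of_mem {z : ℝ × E3} (hz : z ∈ spaceTime G I) : dens G I f z = Gas.rho f z.1 z.2 := by
  simp only [dens, cut_of_mem hz, Gas.rho]

theorem dens_of_notMem {z : ℝ × E3} (hz : z ∉ spaceTime G I) : dens G I f z = 0 := by
  simp [dens, cut_of_notMem hz]

theorem cur_of_notMem {z : ℝ × E3} (hz : z ∉ spaceTime G I) (i : Fin 3) : cur G I f i z = 0 := by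
  simp [cur, cut_of_notMem hz]

theorem cur_of_mem {z : ℝ × E3} (hz : z ∈ spaceTime G I) (i : Fin 3) :
    cur G I f i z = moment f (fun ξ => ξ i * 1) (fun x => x) z := by
  simp only [cur, cut_of_mem hz, moment, mul_one]

theorem enskog_of_mem {z : ℝ × E3} (hz : z ∈ spaceTime G I) :
    enskog G I f z = G.S (G.crowd f z.1 z.2) := indicator_of_mem hz _

theorem enskog_of_notMem {z : ℝ × E3} (hz : z ∉ spaceTime G I) : enskog G I f z = 0 :=
  indicator_of_notMem hz _

theorem densDot_of_mem {z : ℝ × E3} (hz : z ∈ spaceTime G I) :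
    densDot G I f z = fderiv ℝ (moment f (fun _ => 1) fun x => x) z (1, 0) := indicator_of_mem hz _

theorem densDot_of_notMem {z : ℝ × E3} (hz : z ∉ spaceTime G I) : densDot G I f z = 0 :=
  indicator_of_notMem hz _

theorem measurable_indicator_of_continuousOn {X : Type*} [TopologicalSpace X] [MeasurableSpace X]
    [BorelSpace X] {U : Set X} (hU : IsOpen U) {u : X → ℝ} (hu : ContinuousOn u U) :
    Measurable (U.indicator u) := by
  classical
  rw [← piecewise_eq_indicator]
  exact hu.measurable_piecewise continuousOn_const hU.measurableSet

namespace Model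

theorem measurable_cut (h : Model G I f A) :
    Measurable fun p : (ℝ × E3) × E3 => cut G I f p.1 p.2 := by
  have h1 : IsOpen ((spaceTime G I) ×ˢ (univ : Set E3)) := h.isOpen_spaceTime.prod isOpen_univ
  have h2 : ContinuousOn (fun p : (ℝ × E3) × E3 => f p.1.1 p.1.2 p.2)
      ((spaceTime G I) ×ˢ (univ : Set E3)) := by
    have h3 : Continuous fun p : (ℝ × E3) × E3 => ((p.1.1, p.1.2, p.2) : ℝ × E3 × E3) := by fun_prop
    exact h.phase_contDiffOn.continuousOn.comp h3.continuousOn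
      fun p hp => ⟨hp.1.1, hp.1.2, mem_univ _⟩
  have h4 := measurable_indicator_of_continuousOn h1 h2
  convert h4 using 2 with p
  by_cases hp : p.1 ∈ spaceTime G I
  · rw [cut_of_mem hp, indicator_of_mem (show p ∈ spaceTime G I ×ˢ univ from ⟨hp, mem_univ _⟩)]
  · rw [cut_of_notMem hp, indicator_of_notMem (fun hh => hp hh.1)]

theorem cut_nonneg (h : Model G I f A) (z : ℝ × E3) (ξ : E3) : 0 ≤ cut G I f z ξ := by
  by_cases hz : z ∈ spaceTime G I
  · rw [cut_of_mem hz]; exact (h.pos hz ξ).le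
  · rw [cut_of_notMem hz]

theorem exists_decay_cut (h : Model G I f A) {K : Set ℝ} (hK : IsCompact K) (hKI : K ⊆ I) (r : ℝ) :
    ∃ (k : ℕ) (C : ℝ) (m : E3 → ℝ), 0 ≤ C ∧ Integrable m ∧ (∀ ξ, 0 ≤ m ξ) ∧
      ∀ z : ℝ × E3, z.1 ∈ K → ‖z.2‖ ≤ r → ∀ ξ, (1 + ‖ξ‖) ^ (k + 3) * cut G I f z ξ ≤ m ξ ∧
        |Real.log (cut G I f z ξ)| ≤ C * (1 + ‖ξ‖) ^ k := by
  obtain ⟨k, C, m, hC, hm, hm0, hd⟩ := h.exists_decay hK hKI r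
  refine ⟨k, C, m, hC, hm, hm0, fun z hz hr ξ => ?_⟩
  by_cases hzU : z ∈ spaceTime G I
  · rw [cut_of_mem hzU]
    exact hd z.1 hz z.2 hzU.2 hr ξ
  · rw [cut_of_notMem hzU]
    refine ⟨by simpa using hm0 ξ, ?_⟩
    -- The convention `Real.log 0 = 0` keeps the logarithmic bound valid outside the domain.
    simp only [Real.log_zero, abs_zero]
    positivity

theorem measurable_dens (h : Model G I f A) : Measurable (dens G I f) :=
  h.measurable_cut.stronglyMeasurable.integral_prod_right.measurable

theorem measurable_cur (h : Model G I f A) (i : Fin 3) : Measurable (cur G I f i) := by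
  have : Measurable fun p : (ℝ × E3) × E3 => p.2 i * cut G I f p.1 p.2 :=
    ((contDiff_coord i).continuous.measurable.comp measurable_snd).mul h.measurable_cut
  exact this.stronglyMeasurable.integral_prod_right.measurable

theorem cut_le_of_decay (h : Model G I f A) {k : ℕ} {m : E3 → ℝ} {z : ℝ × E3} {ξ : E3}
    (hd : (1 + ‖ξ‖) ^ (k + 3) * cut G I f z ξ ≤ m ξ) (p : ℕ) (hp : p ≤ k + 3) :
    (1 + ‖ξ‖) ^ p * cut G I f z ξ ≤ m ξ := by
  refine le_trans ?_ hd
  have := h.cut_nonneg z ξ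
  gcongr
  exact one_le_one_add_norm ξ

theorem exists_bound_dens (h : Model G I f A) {K : Set ℝ} (hK : IsCompact K) (hKI : K ⊆ I) (r : ℝ) :
    ∃ C : ℝ, 0 ≤ C ∧ ∀ z : ℝ × E3, z.1 ∈ K → ‖z.2‖ ≤ r → |dens G I f z| ≤ C ∧
      ∀ i, |cur G I f i z| ≤ C := by
  obtain ⟨k, C, m, hC, hm, hm0, hd⟩ := h.exists_decay_cut hK hKI r
  refine ⟨∫ ξ, m ξ, integral_nonneg hm0, fun z hz hr => ⟨?_, fun i => ?_⟩⟩
  · refine abs_integral_le_of_abs_le hm fun ξ => ?_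
    have := h.cut_le_of_decay (hd z hz hr ξ).1 0 (by omega)
    rw [abs_of_nonneg (h.cut_nonneg z ξ)]
    simpa using this
  · refine abs_integral_le_of_abs_le hm fun ξ => ?_
    have := h.cut_le_of_decay (hd z hz hr ξ).1 1 (by omega)
    rw [abs_mul, abs_of_nonneg (h.cut_nonneg z ξ)]
    refine le_trans ?_ this
    have h0 := h.cut_nonneg z ξ
    gcongr
    rw [pow_one]
    linarith [abs_coord_le ξ i]

/-- A bound uniform over all of D, which may be unbounded; the integrals against the long-range
potential need it. -/
theorem exists_bound_dens_global (h : Model G I f A) {K : Set ℝ} (hK : IsCompact K) (hKI : K ⊆ I) :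
    ∃ C : ℝ, 0 ≤ C ∧ ∀ z : ℝ × E3, z.1 ∈ K → |dens G I f z| ≤ C ∧ |densDot G I f z| ≤ C := by
  obtain ⟨M, hM, hb⟩ := h.regular.bounded K hK hKI
  refine ⟨∫ ξ, |M ξ|, integral_nonneg fun _ => abs_nonneg _, fun z hz => ?_⟩
  have h0 : 0 ≤ ∫ ξ, |M ξ| := integral_nonneg fun _ => abs_nonneg _
  by_cases hzU : z ∈ spaceTime G I
  · constructor
    · refine abs_integral_le_of_abs_le hM.abs fun ξ => ?_
      rw [cut_of_mem hzU, abs_of_pos (h.pos hzU ξ)]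
      exact (hb _ hz _ hzU.2 ξ).1.trans (le_abs_self _)
    · rw [densDot_of_mem hzU, admissible_one.fderiv_moment h hzU]
      refine abs_integral_le_of_abs_le hM.abs fun ξ => ?_
      have hd := (h.phase_differentiableAt hzU ξ).hasFDerivAt
      have d1 : deriv (fun s => f s z.2 ξ) z.1 = fderiv ℝ (phase f) (z.1, z.2, ξ) (1, 0, 0) := by
        have h2 : HasDerivAt (fun s : ℝ => ((s, z.2, ξ) : ℝ × E3 × E3)) (1, 0, 0) z.1 :=
          (hasDerivAt_id z.1).prodMk ((hasDerivAt_const z.1 z.2).prodMk (hasDerivAt_const z.1 ξ))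
        exact (hd.comp_hasDerivAt z.1 h2).deriv
      have := (hb _ hz _ hzU.2 ξ).2
      rw [d1] at this
      simp only [momentDeriv, mul_one, one_smul]
      exact this.trans (le_abs_self _)
  · rw [dens_of_notMem hzU, densDot_of_notMem hzU]
    simpa using h0

theorem dens_pos (h : Model G I f A) {z : ℝ × E3} (hz : z ∈ spaceTime G I) : 0 < dens G I f z := by
  have hi : Integrable (cut G I f z) := by
    have := admissible_one.integrable h hz
    simpa only [one_mul, ← cut_of_mem hz] using this
  refine (integral_pos_iff_support_of_nonneg (h.cut_nonneg z) hi).2 ?_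
  have : Function.support (cut G I f z) = univ := by
    ext ξ
    simp only [Function.mem_support, mem_univ, iff_true]
    rw [cut_of_mem hz]
    exact (h.pos hz ξ).ne'
  rw [this]
  simp

theorem dens_mul_vel (h : Model G I f A) {z : ℝ × E3} (hz : z ∈ spaceTime G I) (i : Fin 3) :
    dens G I f z * Gas.vel f z.1 z.2 i = cur G I f i z := by
  have := (h.dens_pos hz).ne'
  rw [dens_of_mem hz] at this ⊢
  simp only [Gas.vel, cur, cut_of_mem hz]
  field_simp

theorem densDot_measurable (h : Model G I f A) : Measurable (densDot G I f) :=
  measurable_indicator_of_continuousOn h.isOpen_spaceTime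
    (((admissible_one.contDiffOn_moment h).continuousOn_fderiv_of_isOpen h.isOpen_spaceTime
      le_rfl).clm_apply continuousOn_const)

theorem contDiffOn_dens (h : Model G I f A) : ContDiffOn ℝ 1 (dens G I f) (spaceTime G I) :=
  (admissible_one.contDiffOn_moment h).congr fun _ hz => by rw [moment_one_eq, dens_of_mem hz]

theorem contDiffOn_cur (h : Model G I f A) (i : Fin 3) :
    ContDiffOn ℝ 1 (cur G I f i) (spaceTime G I) :=
  ((admissible_coord i).contDiffOn_moment h).congr fun _ hz => cur_of_mem hz i

theorem fderiv_dens (h : Model G I f A) {z : ℝ × E3} (hz : z ∈ spaceTime G I) :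
    fderiv ℝ (dens G I f) z = fderiv ℝ (moment f (fun _ => 1) fun x => x) z := by
  refine Filter.EventuallyEq.fderiv_eq ?_
  filter_upwards [h.isOpen_spaceTime.mem_nhds hz] with y hy
  rw [moment_one_eq, dens_of_mem hy]

theorem fderiv_cur (h : Model G I f A) {z : ℝ × E3} (hz : z ∈ spaceTime G I) (i : Fin 3) :
    fderiv ℝ (cur G I f i) z = fderiv ℝ (moment f (fun ξ => ξ i * 1) fun x => x) z := by
  refine Filter.EventuallyEq.fderiv_eq ?_
  filter_upwards [h.isOpen_spaceTime.mem_nhds hz] with y hy using cur_of_mem hy i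

/-! ### The number of neighbours -/

theorem crowd_eq (h : Model G I f A) {t : ℝ} (ht : t ∈ I) (X : E3) :
    G.crowd f t X = 1 / G.m * ∫ Y, dens G I f (t, Y) * heavi (G.σ - ‖Y - X‖) := by
  rw [Gas.crowd, ← integral_indicator h.openD.measurableSet]
  congr 1
  refine integral_congr_ae (Eventually.of_forall fun Y => ?_)
  by_cases hY : Y ∈ G.D
  · simp only [indicator_of_mem hY, dens_of_mem (show (t, Y) ∈ spaceTime G I from ⟨ht, hY⟩)]
  · simp only [indicator_of_notMem hY, dens_of_notMem (fun hh : (t, Y) ∈ spaceTime G I => hY hh.2),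
      zero_mul]

theorem crowd_nonneg (h : Model G I f A) {t : ℝ} (ht : t ∈ I) (X : E3) : 0 ≤ G.crowd f t X := by
  rw [h.crowd_eq ht]
  have := h.m_pos
  refine mul_nonneg (by positivity) (integral_nonneg fun Y => mul_nonneg ?_ ?_)
  · exact integral_nonneg (h.cut_nonneg _)
  · unfold heavi; split_ifs <;> norm_num

/-- Extension by zero destroys continuity in space only: for fixed Y the point stays in D, or stays
outside D, at all times. -/
theorem continuousAt_dens_time (h : Model G I f A) {t : ℝ} (ht : t ∈ I) (Y : E3) :
    ContinuousAt (fun s => dens G I f (s, Y)) t := by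
  by_cases hY : Y ∈ G.D
  · have h1 : ContinuousAt (dens G I f) (t, Y) :=
      h.contDiffOn_dens.continuousOn.continuousAt (h.isOpen_spaceTime.mem_nhds ⟨ht, hY⟩)
    have h2 : ContinuousAt (fun s : ℝ => (s, Y)) t := by fun_prop
    exact ContinuousAt.comp (f := fun s : ℝ => (s, Y)) h1 h2
  · have : (fun s => dens G I f (s, Y)) = fun _ => 0 :=
      funext fun s => dens_of_notMem fun hh => hY hh.2
    rw [this]
    exact continuousAt_const

/-- Dominated convergence: the integrand fails to be continuous in (t, X) only for Y on the sphere
of radius σ about X, a null set, and of the density only continuity in time is used. -/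
theorem continuousOn_crowd (h : Model G I f A) :
    ContinuousOn (fun z : ℝ × E3 => G.crowd f z.1 z.2) (I ×ˢ univ) := by
  have hcongr : ContinuousOn (fun z : ℝ × E3 => 1 / G.m * ∫ Y, dens G I f (z.1, Y)
      * heavi (G.σ - ‖Y - z.2‖)) (I ×ˢ univ) := by
    intro z hz
    refine ContinuousAt.continuousWithinAt (ContinuousAt.mul continuousAt_const ?_)
    obtain ⟨K, hK, hzK, hKI⟩ := exists_compact_subset h.openI hz.1
    obtain ⟨C, hC0, hC⟩ := h.exists_bound_dens_global hK hKI
    have hKn : K ∈ 𝓝 z.1 := mem_interior_iff_mem_nhds.1 hzK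
    refine continuousAt_of_dominated
      (bound := (Metric.closedBall z.2 (G.σ + 1)).indicator fun _ => C) ?_ ?_ ?_ ?_
    · refine Eventually.of_forall fun y => Measurable.aestronglyMeasurable ?_
      refine (h.measurable_dens.comp (by fun_prop)).mul (measurable_heavi.comp (by fun_prop))
    · have h1 : ∀ᶠ y : ℝ × E3 in 𝓝 z, y.1 ∈ K ∧ dist y.2 z.2 < 1 :=
        (continuousAt_fst.eventually hKn).and
          (continuousAt_snd.eventually (Metric.ball_mem_nhds z.2 one_pos))
      filter_upwards [h1] with y hy
      refine Eventually.of_forall fun Y => ?_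
      by_cases hb : 0 ≤ G.σ - ‖Y - y.2‖
      · have hY : Y ∈ Metric.closedBall z.2 (G.σ + 1) := by
          rw [Metric.mem_closedBall]
          have := dist_triangle Y y.2 z.2
          rw [dist_eq_norm Y y.2] at this
          linarith [hy.2]
        rw [indicator_of_mem hY, heavi, if_pos hb, mul_one]
        exact (hC (y.1, Y) hy.1).1
      · rw [heavi, if_neg hb, mul_zero, norm_zero]
        exact indicator_nonneg (fun _ _ => hC0) _
    · exact (integrable_indicator_iff Metric.isClosed_closedBall.measurableSet).2
        (integrableOn_const (isCompact_closedBall z.2 (G.σ + 1)).measure_lt_top.ne)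
    · have hsphere : ∀ᵐ Y : E3, Y ∉ Metric.sphere z.2 G.σ :=
        measure_eq_zero_iff_ae_notMem.1 (Measure.addHaar_sphere volume z.2 G.σ)
      filter_upwards [hsphere] with Y hY
      have h1 : ContinuousAt (fun y : ℝ × E3 => dens G I f (y.1, Y)) z :=
        ContinuousAt.comp (f := fun y : ℝ × E3 => y.1) (h.continuousAt_dens_time hz.1 Y)
          continuousAt_fst
      refine h1.mul ?_
      have hne : G.σ - ‖Y - z.2‖ ≠ 0 := by
        intro h0
        exact hY (by rw [Metric.mem_sphere, dist_eq_norm]; linarith)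
      have h2 : ContinuousAt (fun y : ℝ × E3 => G.σ - ‖Y - y.2‖) z := by fun_prop
      rcases lt_or_gt_of_ne hne with hlt | hgt
      · refine (continuousAt_const (y := (0 : ℝ))).congr ?_
        filter_upwards [h2.eventually (gt_mem_nhds hlt)] with y hy
        rw [heavi, if_neg (not_le.2 hy)]
      · refine (continuousAt_const (y := (1 : ℝ))).congr ?_
        filter_upwards [h2.eventually (lt_mem_nhds hgt)] with y hy
        rw [heavi, if_pos hy.le]
  exact hcongr.congr fun z hz => h.crowd_eq hz.1 z.2

theorem continuousOn_S_crowd (h : Model G I f A) :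
    ContinuousOn (fun z : ℝ × E3 => G.S (G.crowd f z.1 z.2)) (I ×ˢ closure G.D) :=
  h.S_cont.comp (h.continuousOn_crowd.mono (prod_mono_right (subset_univ _)))
    fun z hz => h.crowd_mem z.1 hz.1 z.2 hz.2

theorem continuousOn_enskog (h : Model G I f A) : ContinuousOn (enskog G I f) (spaceTime G I) :=
  (h.continuousOn_S_crowd.mono (prod_mono_right subset_closure)).congr fun _ hz => enskog_of_mem hz

theorem measurable_enskog (h : Model G I f A) : Measurable (enskog G I f) :=
  measurable_indicator_of_continuousOn h.isOpen_spaceTime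
    (h.continuousOn_S_crowd.mono (prod_mono_right subset_closure))

theorem enskog_nonneg (h : Model G I f A) (z : ℝ × E3) : 0 ≤ enskog G I f z := by
  by_cases hz : z ∈ spaceTime G I
  · rw [enskog_of_mem hz]
    exact h.S_nonneg _ (h.crowd_mem _ hz.1 _ (subset_closure hz.2))
  · rw [enskog_of_notMem hz]

/-- Since ℛ stays in A up to the closure of D, S(ℛ) is continuous on a compact set obtained by
closing a bounded part of D. Thus it is bounded up to ∂D. -/
theorem exists_bound_enskog (h : Model G I f A) {K : Set ℝ} (hK : IsCompact K) (hKI : K ⊆ I) (r : ℝ) :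
    ∃ C : ℝ, 0 ≤ C ∧ ∀ z : ℝ × E3, z.1 ∈ K → ‖z.2‖ ≤ r → enskog G I f z ≤ C := by
  have hc : IsCompact (K ×ˢ (closure G.D ∩ Metric.closedBall (0 : E3) r)) :=
    hK.prod ((isCompact_closedBall 0 r).inter_left isClosed_closure)
  obtain ⟨C, hC⟩ := hc.exists_bound_of_continuousOn
    (h.continuousOn_S_crowd.mono (prod_mono hKI inter_subset_left))
  refine ⟨|C|, abs_nonneg C, fun z hz hr => ?_⟩
  by_cases hzU : z ∈ spaceTime G I
  · rw [enskog_of_mem hzU]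
    refine (le_abs_self _).trans ((hC z ⟨hz, subset_closure hzU.2, ?_⟩).trans (le_abs_self C))
    simpa using hr
  · rw [enskog_of_notMem hzU]
    exact abs_nonneg C

end Model

end Cutoff

end EnskogVlasov

namespace EnskogVlasov

open Filter Topology

/-! ### Locally bounded functions on space-time. -/

section LocallyBounded

/-- Measurable functions on space-time that are bounded on `K × B` for compact `K ⊆ I` and
bounded `B`. -/
structure LocBdd (I : Set ℝ) (u : ℝ × E3 → ℝ) : Prop where
  meas : Measurable u
  bdd : ∀ K : Set ℝ, IsCompact K → K ⊆ I → ∀ r : ℝ, ∃ C : ℝ, 0 ≤ C ∧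
    ∀ z : ℝ × E3, z.1 ∈ K → ‖z.2‖ ≤ r → |u z| ≤ C

variable {I : Set ℝ} {u v : ℝ × E3 → ℝ}

theorem LocBdd.add (hu : LocBdd I u) (hv : LocBdd I v) : LocBdd I fun z => u z + v z where
  meas := hu.meas.add hv.meas
  bdd K hK hKI r := by
    obtain ⟨C, hC0, hC⟩ := hu.bdd K hK hKI r
    obtain ⟨C', hC0', hC'⟩ := hv.bdd K hK hKI r
    exact ⟨C + C', by positivity, fun z hz hr =>
      (abs_add_le _ _).trans (add_le_add (hC z hz hr) (hC' z hz hr))⟩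

theorem LocBdd.mul (hu : LocBdd I u) (hv : LocBdd I v) : LocBdd I fun z => u z * v z where
  meas := hu.meas.mul hv.meas
  bdd K hK hKI r := by
    obtain ⟨C, hC0, hC⟩ := hu.bdd K hK hKI r
    obtain ⟨C', hC0', hC'⟩ := hv.bdd K hK hKI r
    refine ⟨C * C', by positivity, fun z hz hr => ?_⟩
    rw [abs_mul]
    exact mul_le_mul (hC z hz hr) (hC' z hz hr) (abs_nonneg _) hC0

theorem LocBdd.const (c : ℝ) : LocBdd I fun _ => c where
  meas := measurable_const
  bdd _ _ _ _ := ⟨|c|, abs_nonneg c, fun _ _ _ => le_rfl⟩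

theorem LocBdd.sub (hu : LocBdd I u) (hv : LocBdd I v) : LocBdd I fun z => u z - v z := by
  have := hu.add ((LocBdd.const (-1)).mul hv)
  simpa [sub_eq_add_neg] using this

theorem LocBdd.locallyIntegrableOn (hI : IsOpen I) (hu : LocBdd I u) {U : Set (ℝ × E3)}
    (hU : U ⊆ I ×ˢ univ) : LocallyIntegrableOn u U := by
  intro z hz
  obtain ⟨K, hK, hzK, hKI⟩ := exists_compact_subset hI (hU hz).1
  obtain ⟨C, hC0, hC⟩ := hu.bdd K hK hKI (‖z.2‖ + 1)
  have hc : IsCompact (K ×ˢ Metric.closedBall z.2 1) := hK.prod (isCompact_closedBall z.2 1)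
  refine ⟨K ×ˢ Metric.closedBall z.2 1, mem_nhdsWithin_of_mem_nhds
    (prod_mem_nhds (mem_interior_iff_mem_nhds.1 hzK) (Metric.closedBall_mem_nhds _ one_pos)), ?_⟩
  refine Measure.integrableOn_of_bounded (M := C) hc.measure_lt_top.ne
    hu.meas.aestronglyMeasurable ?_
  filter_upwards [ae_restrict_mem hc.measurableSet] with y hy
  refine hC y hy.1 ?_
  have h1 : ‖y.2 - z.2‖ ≤ 1 := by simpa [dist_eq_norm] using hy.2
  calc ‖y.2‖ = ‖z.2 + (y.2 - z.2)‖ := by abel_nf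
    _ ≤ ‖z.2‖ + 1 := (norm_add_le _ _).trans (by linarith)

theorem exists_bound_of_hasCompactSupport {φ : ℝ × E3 → ℝ} (hc : HasCompactSupport φ)
    (hs : tsupport φ ⊆ I ×ˢ univ) : ∃ K : Set ℝ, IsCompact K ∧ K ⊆ I ∧ ∃ r : ℝ,
      ∀ z ∈ tsupport φ, z.1 ∈ K ∧ ‖z.2‖ ≤ r := by
  obtain ⟨r, hr⟩ := hc.isBounded.exists_norm_le
  refine ⟨Prod.fst '' tsupport φ, hc.isCompact.image continuous_fst, ?_, r, fun z hz =>
    ⟨mem_image_of_mem _ hz, (norm_snd_le z).trans (hr z hz)⟩⟩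
  rintro _ ⟨z, hz, rfl⟩
  exact (hs hz).1

theorem LocBdd.integrable_mul (hu : LocBdd I u) {φ : ℝ × E3 → ℝ} (hφ : Continuous φ)
    (hc : HasCompactSupport φ) (hs : tsupport φ ⊆ I ×ˢ univ) : Integrable fun z => φ z * u z := by
  obtain ⟨K, hK, hKI, r, hr⟩ := exists_bound_of_hasCompactSupport hc hs
  obtain ⟨C, hC0, hC⟩ := hu.bdd K hK hKI r
  exact integrable_mul_of_bdd volume hφ hc hu.meas.aestronglyMeasurable C
    fun z hz => hC z (hr z hz).1 (hr z hz).2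

theorem continuous_fderiv_apply_of_contDiff {φ : ℝ × E3 → ℝ} (hφ : ContDiff ℝ 1 φ) (v : ℝ × E3) :
    Continuous fun z => fderiv ℝ φ z v :=
  (hφ.continuous_fderiv one_ne_zero).clm_apply continuous_const

theorem LocBdd.integrable_mul_fderiv (hu : LocBdd I u) {φ : ℝ × E3 → ℝ} (hφ : ContDiff ℝ 1 φ)
    (hc : HasCompactSupport φ) (hs : tsupport φ ⊆ I ×ˢ univ) (v : ℝ × E3) :
    Integrable fun z => u z * fderiv ℝ φ z v := by
  have := hu.integrable_mul (continuous_fderiv_apply_of_contDiff hφ v) (hc.fderiv_apply ℝ v)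
    ((tsupport_fderiv_apply_subset ℝ v).trans hs)
  simpa only [mul_comm] using this

end LocallyBounded

/-! ### Fluxes of jump processes. -/

section Flux

set_option linter.unusedSectionVars false

variable {Ω : Type*} [MeasurableSpace Ω]

/-- Kernels `a` whose translates along the displacement `d` have integrable majorants. -/
structure KernelBdd (I : Set ℝ) (μ : Measure Ω) (d : Ω → E3) (a : ℝ × E3 → Ω → ℝ) : Prop where
  meas_d : Measurable d
  meas : Measurable fun p : (ℝ × E3) × Ω => a p.1 p.2
  bdd : ∀ K : Set ℝ, IsCompact K → K ⊆ I → ∀ r : ℝ, ∃ B : Ω → ℝ, Integrable B μ ∧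
    Integrable (fun w => ‖d w‖ * B w) μ ∧ ∀ z : ℝ × E3, z.1 ∈ K → ‖z.2‖ ≤ r →
      ∀ w, ∀ τ ∈ Icc (0 : ℝ) 1, |a (z + τ • ((0 : ℝ), d w)) w| ≤ B w

/-- The flux of a jump process with displacement `d` and rate `a`. -/
noncomputable def jumpFlux (μ : Measure Ω) (d : Ω → E3) (a : ℝ × E3 → Ω → ℝ) (i : Fin 3)
    (z : ℝ × E3) : ℝ :=
  ∫ w, (∫ τ in (0 : ℝ)..1, d w i * a (z + τ • ((0 : ℝ), d w)) w) ∂μ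

variable {I : Set ℝ} {μ : Measure Ω} {d : Ω → E3} {a : ℝ × E3 → Ω → ℝ}

theorem fderiv_spatial (φ : ℝ × E3 → ℝ) (z : ℝ × E3) (e : E3) :
    fderiv ℝ φ z (0, e) = ∑ i, e i * fderiv ℝ φ z (0, basisVec i) := by
  have he : ((0 : ℝ), e) = ∑ i, e i • ((0 : ℝ), basisVec i) := by
    refine Prod.ext (by simp [Prod.fst_sum]) ?_
    simp only [Prod.snd_sum, Prod.smul_snd]
    ext j
    simp [Finset.sum_apply, Pi.single_apply]
  rw [he, map_sum]
  simp only [map_smul, smul_eq_mul]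

namespace KernelBdd

theorem meas_shift (ha : KernelBdd I μ d a) :
    Measurable fun p : ((ℝ × E3) × Ω) × ℝ => a (p.1.1 + p.2 • ((0 : ℝ), d p.1.2)) p.1.2 := by
  have := ha.meas_d
  exact ha.meas.comp (f := fun p : ((ℝ × E3) × Ω) × ℝ =>
    ((p.1.1 + p.2 • ((0 : ℝ), d p.1.2), p.1.2) : (ℝ × E3) × Ω)) (by fun_prop)

theorem abs_inner_le {B : Ω → ℝ} {z : ℝ × E3} {w : Ω}
    (hB : ∀ τ ∈ Icc (0 : ℝ) 1, |a (z + τ • ((0 : ℝ), d w)) w| ≤ B w) (i : Fin 3) :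
    |∫ τ in (0 : ℝ)..1, d w i * a (z + τ • ((0 : ℝ), d w)) w| ≤ ‖d w‖ * B w := by
  have := intervalIntegral.norm_integral_le_of_norm_le_const (a := (0 : ℝ)) (b := 1)
    (f := fun τ => d w i * a (z + τ • ((0 : ℝ), d w)) w) (C := ‖d w‖ * B w) fun τ hτ => ?_
  · simpa using this
  · rw [uIoc_of_le zero_le_one] at hτ
    rw [norm_mul]
    exact mul_le_mul (abs_coord_le _ i) (hB τ (Ioc_subset_Icc_self hτ)) (norm_nonneg _)
      (norm_nonneg _)

theorem stronglyMeasurable_inner (ha : KernelBdd I μ d a) (i : Fin 3) :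
    StronglyMeasurable fun p : (ℝ × E3) × Ω =>
      ∫ τ in (0 : ℝ)..1, d p.2 i * a (p.1 + τ • ((0 : ℝ), d p.2)) p.2 := by
  simp only [intervalIntegral.integral_of_le zero_le_one]
  have h1 : Measurable fun p : ((ℝ × E3) × Ω) × ℝ =>
      d p.1.2 i * a (p.1.1 + p.2 • ((0 : ℝ), d p.1.2)) p.1.2 :=
    ((contDiff_coord i).continuous.measurable.comp
      (ha.meas_d.comp (measurable_snd.comp measurable_fst))).mul ha.meas_shift
  exact h1.stronglyMeasurable.integral_prod_right

theorem integrable_inner (ha : KernelBdd I μ d a) {z : ℝ × E3} (hz : z.1 ∈ I) (i : Fin 3) :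
    Integrable (fun w => ∫ τ in (0 : ℝ)..1, d w i * a (z + τ • ((0 : ℝ), d w)) w) μ := by
  obtain ⟨B, hB, hdB, hb⟩ := ha.bdd {z.1} isCompact_singleton (singleton_subset_iff.2 hz) ‖z.2‖
  refine hdB.mono' ?_ (Eventually.of_forall fun w => abs_inner_le (hb z rfl le_rfl w) i)
  exact ((ha.stronglyMeasurable_inner i).comp_measurable
    (g := fun w => (z, w)) (by fun_prop)).aestronglyMeasurable

theorem integrable (ha : KernelBdd I μ d a) {z : ℝ × E3} (hz : z.1 ∈ I) : Integrable (a z) μ := by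
  obtain ⟨B, hB, hdB, hb⟩ := ha.bdd {z.1} isCompact_singleton (singleton_subset_iff.2 hz) ‖z.2‖
  refine hB.mono' (ha.meas.comp (f := fun w => (z, w)) (by fun_prop)).aestronglyMeasurable
    (Eventually.of_forall fun w => ?_)
  simpa using hb z rfl le_rfl w 0 (by simp)

variable [SFinite μ]

theorem locBdd_flux (ha : KernelBdd I μ d a) (i : Fin 3) : LocBdd I (jumpFlux μ d a i) where
  meas := (ha.stronglyMeasurable_inner i).integral_prod_right.measurable
  bdd K hK hKI r := by
    obtain ⟨B, hB, hdB, hb⟩ := ha.bdd K hK hKI r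
    refine ⟨|∫ w, ‖d w‖ * B w ∂μ|, abs_nonneg _, fun z hz hr => ?_⟩
    exact (abs_integral_le_of_abs_le hdB fun w => abs_inner_le (hb z hz hr w) i).trans
      (le_abs_self _)

theorem locBdd_integral (ha : KernelBdd I μ d a) : LocBdd I fun z => ∫ w, a z w ∂μ where
  meas := ha.meas.stronglyMeasurable.integral_prod_right.measurable
  bdd K hK hKI r := by
    obtain ⟨B, hB, hdB, hb⟩ := ha.bdd K hK hKI r
    refine ⟨|∫ w, B w ∂μ|, abs_nonneg _, fun z hz hr => ?_⟩
    refine (abs_integral_le_of_abs_le hB fun w => ?_).trans (le_abs_self _)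
    simpa using hb z hz hr w 0 (by simp)

theorem locBdd_integral_translate (ha : KernelBdd I μ d a) :
    LocBdd I fun z => ∫ w, a (z + ((0 : ℝ), d w)) w ∂μ where
  meas := by
    have := ha.meas_d
    have hm : Measurable fun p : (ℝ × E3) × Ω => a (p.1 + ((0 : ℝ), d p.2)) p.2 :=
      ha.meas.comp (f := fun p : (ℝ × E3) × Ω => (p.1 + ((0 : ℝ), d p.2), p.2)) (by fun_prop)
    exact hm.stronglyMeasurable.integral_prod_right.measurable
  bdd K hK hKI r := by
    obtain ⟨B, hB, hdB, hb⟩ := ha.bdd K hK hKI r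
    refine ⟨|∫ w, B w ∂μ|, abs_nonneg _, fun z hz hr => ?_⟩
    refine (abs_integral_le_of_abs_le hB fun w => ?_).trans (le_abs_self _)
    simpa using hb z hz hr w 1 (by simp)

/-- This is `integral_mul_sub_translate` for purely spatial displacements: the difference between
what leaves and what arrives by jumps is the divergence of `jumpFlux`. -/
theorem integral_flux (ha : KernelBdd I μ d a) {φ : ℝ × E3 → ℝ} (hφ : ContDiff ℝ 1 φ)
    (hc : HasCompactSupport φ) (hs : tsupport φ ⊆ I ×ˢ univ) :
    ∫ z, ∑ i, jumpFlux μ d a i z * fderiv ℝ φ z (0, basisVec i)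
      = ∫ z, φ z * ((∫ w, a z w ∂μ) - ∫ w, a (z + ((0 : ℝ), d w)) w ∂μ) := by
  obtain ⟨K, hK, hKI, r, hr⟩ := exists_bound_of_hasCompactSupport hc hs
  obtain ⟨B, hB, hdB, hb⟩ := ha.bdd K hK hKI r
  have hn : ∀ e : E3, ‖((0 : ℝ), e)‖ = ‖e‖ := fun e => by simp
  have hd := ha.meas_d
  rw [integral_mul_sub_translate volume μ (fun w => ((0 : ℝ), d w)) (by fun_prop) a ha.meas φ hφ hc B
    hB (by simpa only [hn] using hdB) fun z hz w τ hτ => hb z (hr z hz).1 (hr z hz).2 w τ hτ]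
  refine integral_congr_ae (Eventually.of_forall fun z => ?_)
  by_cases hz : z ∈ tsupport φ
  · have hzI : z.1 ∈ I := (hs hz).1
    simp only [jumpFlux, ← integral_mul_const]
    rw [← integral_finsetSum _ fun i _ => (ha.integrable_inner hzI i).mul_const _]
    refine integral_congr_ae (Eventually.of_forall fun w => ?_)
    simp only [fderiv_spatial φ z (d w), intervalIntegral.integral_const_mul]
    rw [Finset.sum_mul]
    refine Finset.sum_congr rfl fun i _ => by ring
  · have h0 : fderiv ℝ φ z = 0 :=
      image_eq_zero_of_notMem_tsupport fun hh => hz (tsupport_fderiv_subset ℝ hh)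
    simp [h0]

end KernelBdd

end Flux

/-! ### The collision kernel and the transfer of a quantity in collisions. -/

section Collision

variable (G : Gas) (I : Set ℝ) (f : ℝ → E3 → E3 → ℝ)

/-- The space-time vector from the centre of a molecule to a collision partner. -/
noncomputable def reach (α : S2) : ℝ × E3 := ((0 : ℝ), G.σ • (α : E3))

/-- The density of pairs of molecules in contact, `g(X, X - σα) f_*(X - σα) f(X)`. -/
noncomputable def pairDensity (z : ℝ × E3) (w : Coll) : ℝ :=
  (enskog G I f z + enskog G I f (z - reach G w.2.2)) * cut G I f (z - reach G w.2.2) w.2.1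
    * cut G I f z w.1

/-- The collision kernel `g(X, X - σα) f_*(X - σα) f(X) V θ(V)`. -/
noncomputable def kern (z : ℝ × E3) (w : Coll) : ℝ := pairDensity G I f z w * rate w

/-- Transfer of the quantity `ψ` to a molecule in a collision. -/
noncomputable def transfer (ψ : ℝ × E3 → E3 → ℝ) (z : ℝ × E3) (w : Coll) : ℝ :=
  (ψ z (post w.2.2 w.1 w.2.1) - ψ z w.1) * kern G I f z w

/-- Transfer of the quantity `ψ` to the collision partner. -/
noncomputable def transferStar (ψ : ℝ × E3 → E3 → ℝ) (z : ℝ × E3) (w : Coll) : ℝ :=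
  (ψ (z - reach G w.2.2) (postStar w.2.2 w.1 w.2.1) - ψ (z - reach G w.2.2) w.2.1) * kern G I f z w

/-- Weights whose moments the solution controls. -/
structure CollWeight (ψ : ℝ × E3 → E3 → ℝ) : Prop where
  meas : Measurable fun p : (ℝ × E3) × E3 => ψ p.1 p.2
  growth : ∀ (z : ℝ × E3) (η : E3) (k : ℕ) (C : ℝ), 0 ≤ C →
    |Real.log (cut G I f z η)| ≤ C * (1 + ‖η‖) ^ k → |ψ z η| ≤ (C + 1) * (1 + ‖η‖) ^ (k + 2)

variable {G I f} {A : Set ℝ}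

theorem reach_neg (α : S2) : reach G (-α) = -reach G α := by
  simp [reach, coe_neg_sphere]

theorem norm_reach_snd (hσ : 0 < G.σ) (α : S2) : ‖(reach G α).2‖ = G.σ := by
  simp [reach, norm_smul, abs_of_pos hσ]

theorem continuous_reach : Continuous (reach G) := by
  unfold reach; fun_prop

/-- The same contact described from the other end: seen from X − σα the partner lies in direction
−α, the velocities change roles, V is unchanged and g is symmetric. -/
theorem kern_swap (z : ℝ × E3) (w : Coll) :
    kern G I f (z - reach G w.2.2) (swapPartners w) = kern G I f z w := by
  have hr : rate (swapPartners w) = rate w := by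
    simp only [rate, swapPartners, relV_swap]
  simp only [kern, pairDensity, hr]
  simp only [swapPartners, reach_neg, sub_neg_eq_add, sub_add_cancel]
  ring

theorem transferStar_eq (ψ : ℝ × E3 → E3 → ℝ) (z : ℝ × E3) (w : Coll) :
    transferStar G I f ψ z w = transfer G I f ψ (z - reach G w.2.2) (swapPartners w) := by
  rw [transfer, kern_swap, transferStar]
  simp only [swapPartners, post_swap]

namespace Model

theorem measurable_pairDensity (h : Model G I f A) :
    Measurable fun p : (ℝ × E3) × Coll => pairDensity G I f p.1 p.2 := by
  have hr : Measurable (reach G) := continuous_reach.measurable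
  have h1 := h.measurable_enskog
  have h2 := h.measurable_cut
  unfold pairDensity
  refine Measurable.mul (Measurable.mul ?_ ?_) ?_
  · exact (h1.comp measurable_fst).add (h1.comp (by fun_prop))
  · exact h2.comp (f := fun p : (ℝ × E3) × Coll => (p.1 - reach G p.2.2.2, p.2.2.1)) (by fun_prop)
  · exact h2.comp (f := fun p : (ℝ × E3) × Coll => (p.1, p.2.1)) (by fun_prop)

theorem measurable_kern (h : Model G I f A) :
    Measurable fun p : (ℝ × E3) × Coll => kern G I f p.1 p.2 :=
  h.measurable_pairDensity.mul (continuous_rate.measurable.comp measurable_snd)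

theorem pairDensity_nonneg (h : Model G I f A) (z : ℝ × E3) (w : Coll) :
    0 ≤ pairDensity G I f z w :=
  mul_nonneg (mul_nonneg (add_nonneg (h.enskog_nonneg _) (h.enskog_nonneg _))
    (h.cut_nonneg _ _)) (h.cut_nonneg _ _)

theorem kern_nonneg (h : Model G I f A) (z : ℝ × E3) (w : Coll) : 0 ≤ kern G I f z w :=
  mul_nonneg (h.pairDensity_nonneg z w) (rate_nonneg w)

/-- Both ends of a contact lie in the ball of radius r + σ, so one choice of k, C and majorant
serves both. The rate is left out, because the entropy production also involves V without the factor
θ(V). -/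
theorem exists_bound_hull (h : Model G I f A) {K : Set ℝ} (hK : IsCompact K) (hKI : K ⊆ I) (r : ℝ) :
    ∃ (k : ℕ) (C : ℝ) (B : Coll → ℝ), 0 ≤ C ∧ Integrable B collMeasure ∧ (∀ w, 0 ≤ B w) ∧
      ∀ z : ℝ × E3, z.1 ∈ K → ‖z.2‖ ≤ r → ∀ w : Coll,
        ((1 + ‖w.1‖) * (1 + ‖w.2.1‖)) ^ (k + 3) * pairDensity G I f z w ≤ B w ∧
        (∀ η, |Real.log (cut G I f z η)| ≤ C * (1 + ‖η‖) ^ k) ∧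
        (∀ η, |Real.log (cut G I f (z - reach G w.2.2) η)| ≤ C * (1 + ‖η‖) ^ k) := by
  obtain ⟨k, C, m, hC, hm, hm0, hd⟩ := h.exists_decay_cut hK hKI (r + G.σ)
  obtain ⟨Cs, hCs0, hCs⟩ := h.exists_bound_enskog hK hKI (r + G.σ)
  have hBi : Integrable (fun w : Coll => 2 * Cs * (m w.1 * m w.2.1)) collMeasure := by
    refine Integrable.const_mul ?_ _
    exact hm.mul_prod (hm.comp_fst solidAngle)
  refine ⟨k, C, fun w => 2 * Cs * (m w.1 * m w.2.1), hC, hBi,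
    fun w => mul_nonneg (by positivity) (mul_nonneg (hm0 _) (hm0 _)), fun z hz hr w => ?_⟩
  have hσ := h.σ_pos
  have hr1 : ‖z.2‖ ≤ r + G.σ := by linarith
  have hr2 : ‖(z - reach G w.2.2).2‖ ≤ r + G.σ := by
    rw [Prod.snd_sub]
    refine (norm_sub_le _ _).trans ?_
    rw [norm_reach_snd hσ]
    linarith
  have hz2 : (z - reach G w.2.2).1 ∈ K := by simpa [reach] using hz
  refine ⟨?_, fun η => (hd z hz hr1 η).2, fun η => (hd _ hz2 hr2 η).2⟩
  have e1 := (hd z hz hr1 w.1).1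
  have e2 := (hd _ hz2 hr2 w.2.1).1
  have e3 := hCs z hz hr1
  have e4 := hCs _ hz2 hr2
  have c1 := h.cut_nonneg z w.1
  have c2 := h.cut_nonneg (z - reach G w.2.2) w.2.1
  calc ((1 + ‖w.1‖) * (1 + ‖w.2.1‖)) ^ (k + 3) * pairDensity G I f z w
      ≤ ((1 + ‖w.1‖) * (1 + ‖w.2.1‖)) ^ (k + 3) * ((Cs + Cs) * cut G I f (z - reach G w.2.2) w.2.1
          * cut G I f z w.1) := by
        unfold pairDensity
        gcongr
    _ = 2 * Cs * (((1 + ‖w.1‖) ^ (k + 3) * cut G I f z w.1)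
          * ((1 + ‖w.2.1‖) ^ (k + 3) * cut G I f (z - reach G w.2.2) w.2.1)) := by
        rw [mul_pow]
        ring
    _ ≤ 2 * Cs * (m w.1 * m w.2.1) := by
        have := hm0 w.1
        gcongr

/-- The rate costs one power in each velocity, as |ξ| + |ξ_*| ≤ (1 + |ξ|)(1 + |ξ_*|). The remaining
k + 2 powers are the growth allowed in `CollWeight`. -/
theorem exists_bound_kern (h : Model G I f A) {K : Set ℝ} (hK : IsCompact K) (hKI : K ⊆ I) (r : ℝ) :
    ∃ (k : ℕ) (C : ℝ) (B : Coll → ℝ), 0 ≤ C ∧ Integrable B collMeasure ∧ (∀ w, 0 ≤ B w) ∧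
      ∀ z : ℝ × E3, z.1 ∈ K → ‖z.2‖ ≤ r → ∀ w : Coll,
        ((1 + ‖w.1‖) * (1 + ‖w.2.1‖)) ^ (k + 2) * kern G I f z w ≤ B w ∧
        (∀ η, |Real.log (cut G I f z η)| ≤ C * (1 + ‖η‖) ^ k) ∧
        (∀ η, |Real.log (cut G I f (z - reach G w.2.2) η)| ≤ C * (1 + ‖η‖) ^ k) := by
  obtain ⟨k, C, B, hC, hB, hB0, hb⟩ := h.exists_bound_hull hK hKI r
  refine ⟨k, C, B, hC, hB, hB0, fun z hz hr w => ⟨?_, (hb z hz hr w).2⟩⟩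
  refine le_trans ?_ (hb z hz hr w).1
  have e5 : rate w ≤ (1 + ‖w.1‖) * (1 + ‖w.2.1‖) := by
    refine (rate_le w).trans ?_
    nlinarith [norm_nonneg w.1, norm_nonneg w.2.1, mul_nonneg (norm_nonneg w.1) (norm_nonneg w.2.1)]
  have c1 := h.pairDensity_nonneg z w
  calc _ ≤ ((1 + ‖w.1‖) * (1 + ‖w.2.1‖)) ^ (k + 2) * (pairDensity G I f z w
        * ((1 + ‖w.1‖) * (1 + ‖w.2.1‖))) := by
        unfold kern
        gcongr
    _ = _ := by ring

end Model

theorem one_add_norm_le_mul {a b c : ℝ} (hb : 0 ≤ b) (hc : 0 ≤ c) (h : a ≤ b + c) :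
    1 + a ≤ (1 + b) * (1 + c) := by nlinarith [mul_nonneg hb hc]

namespace CollWeight

variable {ψ : ℝ × E3 → E3 → ℝ}

theorem abs_le (hψ : CollWeight G I f ψ) {z : ℝ × E3} {k : ℕ} {C : ℝ} (hC : 0 ≤ C)
    (hl : ∀ η, |Real.log (cut G I f z η)| ≤ C * (1 + ‖η‖) ^ k) {η : E3} {b c : ℝ} (hb : 0 ≤ b)
    (hc : 0 ≤ c) (h : ‖η‖ ≤ b + c) : |ψ z η| ≤ (C + 1) * ((1 + b) * (1 + c)) ^ (k + 2) := by
  refine (hψ.growth z η k C hC (hl η)).trans ?_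
  gcongr
  exact one_add_norm_le_mul hb hc h

theorem measurable_transfer (hψ : CollWeight G I f ψ) (h : Model G I f A) :
    Measurable fun p : (ℝ × E3) × Coll => transfer G I f ψ p.1 p.2 := by
  have hp := continuous_post.measurable
  refine Measurable.mul (Measurable.sub ?_ ?_) h.measurable_kern
  · exact hψ.meas.comp (f := fun p : (ℝ × E3) × Coll => (p.1, post p.2.2.2 p.2.1 p.2.2.1))
      (measurable_fst.prodMk (hp.comp measurable_snd))
  · exact hψ.meas.comp (f := fun p : (ℝ × E3) × Coll => (p.1, p.2.1)) (by fun_prop)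

theorem exists_bound (hψ : CollWeight G I f ψ) (h : Model G I f A) {K : Set ℝ} (hK : IsCompact K)
    (hKI : K ⊆ I) (r : ℝ) : ∃ B : Coll → ℝ, Integrable B collMeasure ∧
      ∀ z : ℝ × E3, z.1 ∈ K → ‖z.2‖ ≤ r → ∀ w : Coll, kern G I f z w ≤ B w ∧
        |ψ z w.1| * kern G I f z w ≤ B w ∧
        |ψ z (post w.2.2 w.1 w.2.1)| * kern G I f z w ≤ B w ∧
        |transfer G I f ψ z w| ≤ B w ∧ |transferStar G I f ψ z w| ≤ B w := by
  obtain ⟨k, C, B, hC, hB, hB0, hb⟩ := h.exists_bound_kern hK hKI r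
  -- The factor 2 counts the two terms of a difference ψ' − ψ, each of which is bounded by (C + 1)
  -- B.
  refine ⟨fun w => 2 * (C + 1) * B w, hB.const_mul _, fun z hz hr w => ?_⟩
  obtain ⟨h1, h2, h3⟩ := hb z hz hr w
  have hk := h.kern_nonneg z w
  set q := ((1 + ‖w.1‖) * (1 + ‖w.2.1‖)) ^ (k + 2) with hq
  have hq1 : 1 ≤ q := one_le_pow₀ (by
    nlinarith [norm_nonneg w.1, norm_nonneg w.2.1, mul_nonneg (norm_nonneg w.1) (norm_nonneg w.2.1)])
  have key : ∀ x : ℝ, |x| ≤ (C + 1) * q → |x| * kern G I f z w ≤ (C + 1) * B w := fun x hx =>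
    calc |x| * kern G I f z w ≤ ((C + 1) * q) * kern G I f z w := by gcongr
      _ = (C + 1) * (q * kern G I f z w) := by ring
      _ ≤ _ := by gcongr
  have n1 := norm_nonneg w.1
  have n2 := norm_nonneg w.2.1
  have k1 := key _ (hψ.abs_le hC h2 (η := w.1) n1 n2 (by linarith))
  have k2 := key _ (hψ.abs_le hC h2 n1 n2 (norm_post_le w.2.2 w.1 w.2.1))
  have k3 := key _ (hψ.abs_le hC h3 (η := w.2.1) n1 n2 (by linarith))
  have k4 := key _ (hψ.abs_le hC h3 n1 n2 (norm_postStar_le w.2.2 w.1 w.2.1))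
  have hBw := hB0 w
  have hCB : 0 ≤ (C + 1) * B w := by positivity
  refine ⟨?_, by linarith, by linarith, ?_, ?_⟩
  · nlinarith
  · rw [transfer, abs_mul, abs_of_nonneg hk]
    have := mul_le_mul_of_nonneg_right (abs_sub (ψ z (post w.2.2 w.1 w.2.1)) (ψ z w.1)) hk
    rw [add_mul] at this
    linarith
  · rw [transferStar, abs_mul, abs_of_nonneg hk]
    have := mul_le_mul_of_nonneg_right (abs_sub (ψ (z - reach G w.2.2) (postStar w.2.2 w.1 w.2.1))
      (ψ (z - reach G w.2.2) w.2.1)) hk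
    rw [add_mul] at this
    linarith

theorem kernelBdd (hψ : CollWeight G I f ψ) (h : Model G I f A) :
    KernelBdd I collMeasure (fun w => G.σ • (w.2.2 : E3)) (transfer G I f ψ) where
  meas_d := by fun_prop
  meas := hψ.measurable_transfer h
  bdd K hK hKI r := by
    obtain ⟨B, hB, hb⟩ := hψ.exists_bound h hK hKI (r + G.σ)
    have hσ := h.σ_pos
    have hn : ∀ w : Coll, ‖G.σ • (w.2.2 : E3)‖ = G.σ := fun w => norm_reach_snd hσ w.2.2
    refine ⟨B, hB, by simpa only [hn] using hB.const_mul G.σ, fun z hz hr w τ hτ => ?_⟩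
    refine (hb _ (by simpa using hz) ?_ w).2.2.2.1
    rw [Prod.snd_add, Prod.smul_snd]
    refine (norm_add_le _ _).trans ?_
    rw [norm_smul, hn, Real.norm_of_nonneg hτ.1]
    nlinarith [hτ.2]

/-- By exchange of the partners, what the partner receives at X − σα is what the molecule itself
receives, with −α in place of α. The change of variables turns X − σα into X + σα. -/
theorem integral_transferStar (hψ : CollWeight G I f ψ) (h : Model G I f A) (z : ℝ × E3) :
    ∫ w, transferStar G I f ψ z w ∂collMeasure
      = ∫ w, transfer G I f ψ (z + ((0 : ℝ), G.σ • (w.2.2 : E3))) w ∂collMeasure := by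
  have hm : Measurable fun w : Coll => transfer G I f ψ (z + ((0 : ℝ), G.σ • (w.2.2 : E3))) w :=
    (hψ.measurable_transfer h).comp
      (f := fun w : Coll => (z + ((0 : ℝ), G.σ • (w.2.2 : E3)), w)) (by fun_prop)
  rw [← MeasurePreserving.integral_comp_of_aestronglyMeasurable measurePreserving_swapPartners
    hm.aestronglyMeasurable]
  refine integral_congr_ae (Eventually.of_forall fun w => ?_)
  simp only [transferStar_eq]
  congr 1
  have : ((0 : ℝ), G.σ • ((swapPartners w).2.2 : E3)) = -reach G w.2.2 := reach_neg w.2.2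
  rw [this, sub_eq_add_neg]

/-- Exchange of `ψ` in collisions: the part of the transfer that has divergence form. -/
theorem integral_flux (hψ : CollWeight G I f ψ) (h : Model G I f A) {φ : ℝ × E3 → ℝ}
    (hφ : ContDiff ℝ 1 φ) (hc : HasCompactSupport φ) (hs : tsupport φ ⊆ I ×ˢ univ) :
    ∫ z, ∑ i, jumpFlux collMeasure (fun w => G.σ • (w.2.2 : E3)) (transfer G I f ψ) i z
        * fderiv ℝ φ z (0, basisVec i)
      = ∫ z, φ z * ((∫ w, transfer G I f ψ z w ∂collMeasure)
        - ∫ w, transferStar G I f ψ z w ∂collMeasure) := by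
  rw [(hψ.kernelBdd h).integral_flux hφ hc hs]
  simp only [hψ.integral_transferStar h]

end CollWeight

end Collision

end EnskogVlasov

namespace EnskogVlasov

open Filter Topology

variable {G : Gas} {I : Set ℝ} {f : ℝ → E3 → E3 → ℝ} {A : Set ℝ}

/-! ### The weak form of the collision operator and the balances of mass, entropy and energy. -/

section Operator

/-- The indicator functions in g make the values of f outside D irrelevant, so f and S(ℛ) may be
replaced by their extensions by zero, which are measurable. -/
theorem g_mul_mul {t : ℝ} (ht : t ∈ I) (X Y ξ η : E3) :
    G.g f t X Y * f t X ξ * f t Y η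
      = (enskog G I f (t, Y) + enskog G I f (t, X)) * cut G I f (t, X) ξ * cut G I f (t, Y) η := by
  by_cases hX : X ∈ G.D
  · by_cases hY : Y ∈ G.D
    · have h1 : (t, X) ∈ spaceTime G I := ⟨ht, hX⟩
      have h2 : (t, Y) ∈ spaceTime G I := ⟨ht, hY⟩
      simp only [Gas.g, Gas.chi, indicator_of_mem hX, indicator_of_mem hY, enskog_of_mem h1,
        enskog_of_mem h2, cut_of_mem h1, cut_of_mem h2]
      ring
    · have h2 : (t, Y) ∉ spaceTime G I := fun hh => hY hh.2
      simp [Gas.g, Gas.chi, indicator_of_notMem hY, cut_of_notMem h2]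
  · have h2 : (t, X) ∉ spaceTime G I := fun hh => hX hh.2
    simp [Gas.g, Gas.chi, indicator_of_notMem hX, cut_of_notMem h2]

theorem reach_add (z : ℝ × E3) (α : S2) : z + reach G α = (z.1, z.2 + G.σ • (α : E3)) := by
  ext <;> simp [reach]

theorem reach_sub (z : ℝ × E3) (α : S2) : z - reach G α = (z.1, z.2 - G.σ • (α : E3)) := by
  ext <;> simp [reach]

theorem loss_eq {z : ℝ × E3} (hz : z ∈ spaceTime G I) (ξ : E3) :
    G.loss f z.1 z.2 ξ
      = G.σ ^ 2 / G.m * ∫ ξs : E3, ∫ α : S2, kern G I f z (ξ, ξs, α) ∂solidAngle := by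
  simp only [Gas.loss, g_mul_mul (G := G) (f := f) hz.1, kern, pairDensity, rate, reach_sub]

theorem relV_flip_collide (w : Coll) :
    relV (-w.2.2) (post w.2.2 w.1 w.2.1) (postStar w.2.2 w.1 w.2.1) = relV w.2.2 w.1 w.2.1 := by
  rw [relV_neg, relV_post, neg_neg]

/-- The gain integrand is the loss kernel at the post-collisional velocities with α reversed: the
collision and the reversal each change the sign of V, so the rate is kept, and the partner moves
from X − σα to X + σα. -/
theorem kern_flip_collide (z : ℝ × E3) (w : Coll) :
    kern G I f z (flipDir (collide w)) = (enskog G I f z + enskog G I f (z + reach G w.2.2))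
      * cut G I f (z + reach G w.2.2) (postStar w.2.2 w.1 w.2.1)
      * cut G I f z (post w.2.2 w.1 w.2.1) * rate w := by
  simp only [kern, pairDensity, flipDir, collide, reach_neg, sub_neg_eq_add, rate, relV_flip_collide]

theorem gain_eq {z : ℝ × E3} (hz : z ∈ spaceTime G I) (ξ : E3) :
    G.gain f z.1 z.2 ξ = G.σ ^ 2 / G.m *
      ∫ ξs : E3, ∫ α : S2, kern G I f z (flipDir (collide (ξ, ξs, α))) ∂solidAngle := by
  simp only [Gas.gain, g_mul_mul (G := G) (f := f) hz.1, kern_flip_collide, rate, reach_add]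

theorem integral_coll {κ : Coll → ℝ} (hκ : Integrable κ collMeasure) :
    ∫ w, κ w ∂collMeasure = ∫ ξ, ∫ ξs, ∫ α, κ (ξ, ξs, α) ∂solidAngle := by
  rw [collMeasure, integral_prod _ hκ]
  refine integral_congr_ae ?_
  filter_upwards [hκ.prod_right_ae] with ξ hξ
  rw [integral_prod _ hξ]

theorem integral_weight_coll {κ : Coll → ℝ} {ψ : E3 → ℝ} (hκ : Integrable κ collMeasure)
    (hψ : Integrable (fun w : Coll => ψ w.1 * κ w) collMeasure) :
    Integrable (fun ξ => ψ ξ * ∫ ξs, ∫ α, κ (ξ, ξs, α) ∂solidAngle) ∧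
    ∫ ξ, ψ ξ * (∫ ξs, ∫ α, κ (ξ, ξs, α) ∂solidAngle) = ∫ w, ψ w.1 * κ w ∂collMeasure := by
  have e : (fun ξ => ψ ξ * ∫ ξs, ∫ α, κ (ξ, ξs, α) ∂solidAngle) =ᵐ[volume]
      fun ξ => ∫ q, ψ ξ * κ (ξ, q) ∂((volume : Measure E3).prod solidAngle) := by
    filter_upwards [hκ.prod_right_ae] with ξ hξ
    rw [integral_const_mul, integral_prod _ hξ]
  constructor
  · exact (hψ.integral_prod_left).congr e.symm
  · rw [integral_congr_ae e, collMeasure, integral_prod _ hψ]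

theorem measurePreserving_flip_collide :
    MeasurePreserving (fun w => flipDir (collide w)) collMeasure collMeasure :=
  measurePreserving_flipDir.comp measurePreserving_collide

namespace CollWeight

variable {ψ : ℝ × E3 → E3 → ℝ}

theorem integrable_kern (hψ : CollWeight G I f ψ) (h : Model G I f A) {z : ℝ × E3} (hz : z.1 ∈ I) :
    Integrable (kern G I f z) collMeasure ∧
    Integrable (fun w => ψ z w.1 * kern G I f z w) collMeasure ∧
    Integrable (fun w => ψ z (post w.2.2 w.1 w.2.1) * kern G I f z w) collMeasure ∧
    Integrable (transfer G I f ψ z) collMeasure ∧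
    Integrable (transferStar G I f ψ z) collMeasure := by
  obtain ⟨B, hB, hb⟩ := hψ.exists_bound h isCompact_singleton (singleton_subset_iff.2 hz) ‖z.2‖
  have hb' := hb z rfl le_rfl
  have hk : Measurable (kern G I f z) := h.measurable_kern.comp (f := fun w => (z, w)) (by fun_prop)
  have hψz : Measurable (ψ z) := hψ.meas.comp (f := fun w => (z, w)) (by fun_prop)
  have hp := continuous_post.measurable
  have hps := continuous_postStar.measurable
  refine ⟨hB.mono' hk.aestronglyMeasurable ?_, hB.mono' ?_ ?_, hB.mono' ?_ ?_, hB.mono' ?_ ?_,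
    hB.mono' ?_ ?_⟩
  · refine Eventually.of_forall fun w => ?_
    rw [Real.norm_of_nonneg (h.kern_nonneg z w)]
    exact (hb' w).1
  · exact ((hψz.comp measurable_fst).mul hk).aestronglyMeasurable
  · refine Eventually.of_forall fun w => ?_
    rw [norm_mul, Real.norm_of_nonneg (h.kern_nonneg z w)]
    exact (hb' w).2.1
  · exact ((hψz.comp hp).mul hk).aestronglyMeasurable
  · refine Eventually.of_forall fun w => ?_
    rw [norm_mul, Real.norm_of_nonneg (h.kern_nonneg z w)]
    exact (hb' w).2.2.1
  · exact (((hψz.comp hp).sub (hψz.comp measurable_fst)).mul hk).aestronglyMeasurable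
  · exact Eventually.of_forall fun w => (hb' w).2.2.2.1
  · have hr : Measurable fun w : Coll => z - reach G w.2.2 :=
      (continuous_const.sub (continuous_reach.comp (by fun_prop))).measurable
    refine Measurable.aestronglyMeasurable (Measurable.mul (Measurable.sub ?_ ?_) hk)
    · exact hψ.meas.comp (hr.prodMk hps)
    · exact hψ.meas.comp (hr.prodMk (by fun_prop))
  · exact Eventually.of_forall fun w => (hb' w).2.2.2.2

/-- The gain term is transformed by the measure preserving map of `kern_flip_collide`. It takes ξ to
ξ', so the weight of the gain is ψ' and that of the loss is ψ against the same kernel. -/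
theorem integral_collision (hψ : CollWeight G I f ψ) (h : Model G I f A) {z : ℝ × E3}
    (hz : z ∈ spaceTime G I) :
    ∫ ξ, ψ z ξ * (G.gain f z.1 z.2 ξ - G.loss f z.1 z.2 ξ)
      = G.σ ^ 2 / G.m * ∫ w, transfer G I f ψ z w ∂collMeasure := by
  obtain ⟨h1, h2, h3, -, -⟩ := hψ.integrable_kern h hz.1
  have hT := measurePreserving_flip_collide
  have h1' : Integrable (fun w => kern G I f z (flipDir (collide w))) collMeasure :=
    hT.integrable_comp_of_integrable h1
  have e3 : (fun w : Coll => ψ z w.1 * kern G I f z (flipDir (collide w)))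
      = fun w => (fun w : Coll => ψ z (post w.2.2 w.1 w.2.1) * kern G I f z w)
        (flipDir (collide w)) := by
    funext w
    simp only
    congr 2
    simp only [flipDir, collide, post_neg, post_post]
  have h3' : Integrable (fun w : Coll => ψ z w.1 * kern G I f z (flipDir (collide w)))
      collMeasure := by
    rw [e3]
    exact hT.integrable_comp_of_integrable h3
  obtain ⟨g1, g2⟩ := integral_weight_coll h1' h3'
  obtain ⟨l1, l2⟩ := integral_weight_coll h1 h2
  have e4 : ∫ w, ψ z w.1 * kern G I f z (flipDir (collide w)) ∂collMeasure
      = ∫ w, ψ z (post w.2.2 w.1 w.2.1) * kern G I f z w ∂collMeasure := by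
    rw [e3]
    exact MeasurePreserving.integral_comp_of_aestronglyMeasurable hT h3.aestronglyMeasurable
  simp only [gain_eq hz, loss_eq hz]
  rw [e4] at g2
  calc _ = G.σ ^ 2 / G.m * ∫ ξ, (ψ z ξ * (∫ ξs, ∫ α, kern G I f z (flipDir (collide (ξ, ξs, α)))
        ∂solidAngle) - ψ z ξ * ∫ ξs, ∫ α, kern G I f z (ξ, ξs, α) ∂solidAngle) := by
        rw [← integral_const_mul]
        congr 1
        funext ξ
        ring
    _ = _ := by
        rw [integral_sub g1 l1, g2, l2, ← integral_sub h3 h2]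
        simp only [transfer, sub_mul]

end CollWeight

theorem collWeight_one : CollWeight G I f fun _ _ => 1 where
  meas := measurable_const
  growth z η k C hC _ := by
    rw [abs_one]
    have := one_le_pow₀ (one_le_one_add_norm η) (n := k + 2)
    nlinarith

theorem collWeight_halfSq : CollWeight G I f fun _ => halfSq where
  meas := contDiff_halfSq.continuous.measurable.comp measurable_snd
  growth z η k C hC _ := by
    refine (abs_halfSq_le η).trans ?_
    have h1 : (1 + ‖η‖) ^ 2 ≤ (1 + ‖η‖) ^ (k + 2) :=
      pow_le_pow_right₀ (one_le_one_add_norm η) (by omega)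
    have h2 : 0 ≤ (1 + ‖η‖) ^ (k + 2) := by positivity
    nlinarith

variable (G I f) in
/-- The derivative of `x log x` at the distribution function. -/
noncomputable def logWeight (z : ℝ × E3) (η : E3) : ℝ := Real.log (cut G I f z η) + 1

theorem collWeight_log (h : Model G I f A) : CollWeight G I f (logWeight G I f) where
  meas := (Real.measurable_log.comp h.measurable_cut).add measurable_const
  growth z η k C hC hl := by
    have h1 : (1 + ‖η‖) ^ k ≤ (1 + ‖η‖) ^ (k + 2) :=
      pow_le_pow_right₀ (one_le_one_add_norm η) (by omega)
    have h2 : 1 ≤ (1 + ‖η‖) ^ (k + 2) := one_le_pow₀ (one_le_one_add_norm η)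
    refine (abs_add_le _ _).trans ?_
    rw [abs_one]
    nlinarith

namespace Model

theorem continuity (h : Model G I f A) {z : ℝ × E3} (hz : z ∈ spaceTime G I) :
    fderiv ℝ (dens G I f) z (1, 0) + ∑ i, fderiv ℝ (cur G I f i) z (0, basisVec i) = 0 := by
  have h1 := admissible_one.transport h admissible_coord hz
  have h2 := (collWeight_one (G := G) (I := I) (f := f)).integral_collision h hz
  simp only [transfer, sub_self, zero_mul, integral_zero, mul_zero] at h2
  simp only [h.fderiv_dens hz, h.fderiv_cur hz]
  rw [h1]
  simpa using h2

/-- The weight 1 has zero velocity gradient, so the Vlasov force contributes nothing. -/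
theorem entropy_balance (h : Model G I f A) {z : ℝ × E3} (hz : z ∈ spaceTime G I) :
    fderiv ℝ (moment f (fun _ => 1) fun x => x * Real.log x) z (1, 0)
      + ∑ i, fderiv ℝ (moment f (fun ξ => ξ i * 1) fun x => x * Real.log x) z (0, basisVec i)
      = G.σ ^ 2 / G.m * ∫ w, transfer G I f (logWeight G I f) z w ∂collMeasure := by
  rw [admissible_log.transport h admissible_coord_log hz,
    ← (collWeight_log h).integral_collision h hz]
  simp [logWeight, cut_of_mem hz]

/-- The gradient of |ξ|²/2 is ξ, so the force contributes its power. -/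
theorem energy_balance (h : Model G I f A) {z : ℝ × E3} (hz : z ∈ spaceTime G I) :
    fderiv ℝ (moment f halfSq fun x => x) z (1, 0)
      + ∑ i, fderiv ℝ (moment f (fun ξ => ξ i * halfSq ξ) fun x => x) z (0, basisVec i)
      = G.σ ^ 2 / G.m * (∫ w, transfer G I f (fun _ => halfSq) z w ∂collMeasure)
        + ∑ i, G.force f z.1 z.2 i * cur G I f i z := by
  rw [admissible_halfSq.transport h admissible_coord_halfSq hz,
    ← (collWeight_halfSq (G := G) (I := I) (f := f)).integral_collision h hz]
  simp only [mul_one, fderiv_halfSq, cur, cut_of_mem hz]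
  congr 1
  refine Finset.sum_congr rfl fun i _ => ?_
  congr 2
  funext ξ
  simp [EuclideanSpace.inner_single_right]

end Model

end Operator

/-! ### The sign of the entropy production and the part of it that depends on macroscopic fields
only. -/

section Dissipation

variable (G I f)

/-- The nonnegative integrand of the entropy production. -/
noncomputable def diss (z : ℝ × E3) (w : Coll) : ℝ :=
  (enskog G I f z + enskog G I f (z - reach G w.2.2)) * rate w *
    (cut G I f (z - reach G w.2.2) (postStar w.2.2 w.1 w.2.1) * cut G I f z (post w.2.2 w.1 w.2.1)
      - cut G I f (z - reach G w.2.2) w.2.1 * cut G I f z w.1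
      - cut G I f (z - reach G w.2.2) w.2.1 * cut G I f z w.1 *
        (Real.log (cut G I f (z - reach G w.2.2) (postStar w.2.2 w.1 w.2.1))
          + Real.log (cut G I f z (post w.2.2 w.1 w.2.1))
          - Real.log (cut G I f (z - reach G w.2.2) w.2.1) - Real.log (cut G I f z w.1)))

/-- The relative velocity of the fluid at the ends of a contact, weighted with the densities. -/
noncomputable def exch (z : ℝ × E3) (α : S2) : ℝ :=
  ∑ i, (α : E3) i * (dens G I f (z - reach G α) * cur G I f i z
    - dens G I f z * cur G I f i (z - reach G α))

/-- Kernel of the potential part of the entropy flux. -/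
noncomputable def potKernel (z : ℝ × E3) (α : S2) : ℝ := enskog G I f z * exch G I f z α

variable {G I f}

/-- `x log (y / x) ≤ y - x`, with equality only for `x = y`. -/
theorem sub_sub_mul_log_pos {x y : ℝ} (hx : 0 < x) (hy : 0 < y) :
    0 ≤ y - x - x * (Real.log y - Real.log x) ∧
      (y - x - x * (Real.log y - Real.log x) = 0 → x = y) := by
  have hq : 0 < y / x := div_pos hy hx
  have e : y - x - x * (Real.log y - Real.log x) = x * (y / x - 1 - Real.log (y / x)) := by
    rw [Real.log_div hy.ne' hx.ne']
    field_simp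
  rw [e]
  refine ⟨mul_nonneg hx.le (by linarith [Real.log_le_sub_one_of_pos hq]), fun h0 => ?_⟩
  rcases mul_eq_zero.1 h0 with h1 | h1
  · exact absurd h1 hx.ne'
  · by_contra hne
    have hq1 : y / x ≠ 1 := fun hh => hne ((div_eq_one_iff_eq hx.ne').1 hh).symm
    linarith [Real.log_lt_sub_one_of_pos hq hq1]

theorem diss_of_mem {z : ℝ × E3} (w : Coll) (h : Model G I f A) (hz : z ∈ spaceTime G I)
    (hz' : z - reach G w.2.2 ∈ spaceTime G I) :
    diss G I f z w = (enskog G I f z + enskog G I f (z - reach G w.2.2)) * rate w *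
      (f z.1 (z.2 - G.σ • (w.2.2 : E3)) (postStar w.2.2 w.1 w.2.1) * f z.1 z.2 (post w.2.2 w.1 w.2.1)
        - f z.1 (z.2 - G.σ • (w.2.2 : E3)) w.2.1 * f z.1 z.2 w.1
        - f z.1 (z.2 - G.σ • (w.2.2 : E3)) w.2.1 * f z.1 z.2 w.1 *
          (Real.log (f z.1 (z.2 - G.σ • (w.2.2 : E3)) (postStar w.2.2 w.1 w.2.1)
              * f z.1 z.2 (post w.2.2 w.1 w.2.1))
            - Real.log (f z.1 (z.2 - G.σ • (w.2.2 : E3)) w.2.1 * f z.1 z.2 w.1))) := by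
  have p1 := fun ξ => (h.pos hz ξ).ne'
  have p2 := fun ξ => (h.pos hz' ξ).ne'
  rw [diss]
  simp only [cut_of_mem hz, cut_of_mem hz']
  rw [reach_sub] at p2 ⊢
  simp only at p2 ⊢
  rw [Real.log_mul (p2 _) (p1 _), Real.log_mul (p2 _) (p1 _)]
  ring

theorem diss_of_notMem {z : ℝ × E3} (w : Coll)
    (hz : ¬(z ∈ spaceTime G I ∧ z - reach G w.2.2 ∈ spaceTime G I)) : diss G I f z w = 0 := by
  rw [diss]
  by_cases h1 : z ∈ spaceTime G I
  · have h2 : z - reach G w.2.2 ∉ spaceTime G I := fun hh => hz ⟨h1, hh⟩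
    simp [cut_of_notMem h2]
  · simp [cut_of_notMem h1]

theorem diss_nonneg (h : Model G I f A) (z : ℝ × E3) (w : Coll) : 0 ≤ diss G I f z w := by
  by_cases hz : z ∈ spaceTime G I ∧ z - reach G w.2.2 ∈ spaceTime G I
  · rw [diss_of_mem w h hz.1 hz.2]
    have p1 := fun ξ => h.pos hz.1 ξ
    have p2 := fun ξ => h.pos hz.2 ξ
    rw [reach_sub] at p2
    refine mul_nonneg (mul_nonneg (add_nonneg (h.enskog_nonneg _) (h.enskog_nonneg _))
      (rate_nonneg w)) (sub_sub_mul_log_pos (mul_pos (p2 _) (p1 _)) (mul_pos (p2 _) (p1 _))).1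
  · rw [diss_of_notMem w hz]

theorem relV_eq_sum (α : S2) (ξ ξs : E3) : relV α ξ ξs = ∑ i, (α : E3) i * (ξs i - ξ i) := by
  simp only [relV, PiLp.inner_apply, RCLike.inner_apply, conj_trivial, PiLp.sub_apply]

theorem integrable_cut_weights (h : Model G I f A) (z : ℝ × E3) :
    Integrable (cut G I f z) ∧ ∀ i, Integrable fun ξ : E3 => ξ i * cut G I f z ξ := by
  by_cases hzU : z ∈ spaceTime G I
  · have h1 := admissible_one.integrable h hzU
    have h2 := fun i => (admissible_coord i).integrable h hzU
    simp only [one_mul, mul_one, ← cut_of_mem hzU] at h1 h2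
    exact ⟨h1, h2⟩
  · have : cut G I f z = fun _ => 0 := funext fun ξ => cut_of_notMem hzU ξ
    simp [this]

theorem measurePreserving_coll_assoc :
    MeasurePreserving (fun p : (E3 × E3) × S2 => ((p.1.1, p.1.2, p.2) : Coll))
      (((volume : Measure E3).prod (volume : Measure E3)).prod solidAngle) collMeasure :=
  measurePreserving_prodAssoc (volume : Measure E3) (volume : Measure E3) solidAngle

/-- V is the difference of two linear functions of the single velocities. At fixed α the velocity
integral therefore splits into products of ρ and ρv at the two ends, which the factor θ(V) would
prevent. -/
theorem integral_pairDensity_relV (h : Model G I f A) {z : ℝ × E3}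
    (hi : Integrable (fun w : Coll => pairDensity G I f z w * relV w.2.2 w.1 w.2.1) collMeasure) :
    ∫ w, pairDensity G I f z w * relV w.2.2 w.1 w.2.1 ∂collMeasure
      = -∫ α, (enskog G I f z + enskog G I f (z - reach G α)) * exch G I f z α ∂solidAngle := by
  have hT := measurePreserving_coll_assoc
  have hi' : Integrable (fun p : (E3 × E3) × S2 => pairDensity G I f z (p.1.1, p.1.2, p.2)
      * relV p.2 p.1.1 p.1.2) (((volume : Measure E3).prod (volume : Measure E3)).prod solidAngle) :=
    hT.integrable_comp_of_integrable hi
  rw [← MeasurePreserving.integral_comp_of_aestronglyMeasurable hT hi.aestronglyMeasurable]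
  refine (integral_prod_symm _ hi').trans ?_
  rw [← integral_neg]
  refine integral_congr_ae (Eventually.of_forall fun α => ?_)
  simp only [pairDensity, relV_eq_sum]
  obtain ⟨a1, a2⟩ := integrable_cut_weights h z
  obtain ⟨b1, b2⟩ := integrable_cut_weights h (z - reach G α)
  have e : ∀ p : E3 × E3, (enskog G I f z + enskog G I f (z - reach G α))
      * cut G I f (z - reach G α) p.2 * cut G I f z p.1 * ∑ i, (α : E3) i * (p.2 i - p.1 i)
      = (enskog G I f z + enskog G I f (z - reach G α)) * ∑ i, ((α : E3) i *
        (cut G I f z p.1 * (p.2 i * cut G I f (z - reach G α) p.2)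
          - (p.1 i * cut G I f z p.1) * cut G I f (z - reach G α) p.2)) := by
    intro p
    rw [Finset.mul_sum, Finset.mul_sum]
    refine Finset.sum_congr rfl fun i _ => by ring
  simp only [e]
  have i1 := fun i => a1.mul_prod (b2 i)
  have i2 := fun i => (a2 i).mul_prod b1
  have i3 : ∀ i, Integrable (fun p : E3 × E3 => (α : E3) i *
      (cut G I f z p.1 * (p.2 i * cut G I f (z - reach G α) p.2)
        - (p.1 i * cut G I f z p.1) * cut G I f (z - reach G α) p.2))
      ((volume : Measure E3).prod volume) := fun i => ((i1 i).sub (i2 i)).const_mul _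
  rw [integral_const_mul, integral_finsetSum _ fun i _ => i3 i]
  simp only [integral_const_mul]
  rw [← mul_neg]
  congr 1
  rw [exch, ← Finset.sum_neg_distrib]
  refine Finset.sum_congr rfl fun i _ => ?_
  rw [integral_sub (i1 i) (i2 i),
    integral_prod_mul (cut G I f z) (fun ξ : E3 => ξ i * cut G I f (z - reach G α) ξ),
    integral_prod_mul (fun ξ : E3 => ξ i * cut G I f z ξ) (cut G I f (z - reach G α))]
  simp only [dens, cur]
  ring

theorem exch_flip (z : ℝ × E3) (α : S2) : exch G I f (z - reach G α) (-α) = exch G I f z α := by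
  simp only [exch, reach_neg, sub_neg_eq_add, sub_add_cancel, coe_neg_sphere]
  refine Finset.sum_congr rfl fun i _ => ?_
  simp only [PiLp.neg_apply]
  ring

theorem measurable_exch (h : Model G I f A) :
    Measurable fun p : (ℝ × E3) × S2 => exch G I f p.1 p.2 := by
  have hr : Measurable (reach G) := continuous_reach.measurable
  have h1 := h.measurable_dens
  have h2 := h.measurable_cur
  unfold exch
  refine Finset.measurable_sum _ fun i _ => Measurable.mul ?_ (Measurable.sub ?_ ?_)
  · exact ((contDiff_coord i).continuous.comp continuous_subtype_val).measurable.comp measurable_snd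
  · exact (h1.comp (by fun_prop)).mul ((h2 i).comp (by fun_prop))
  · exact (h1.comp (by fun_prop)).mul ((h2 i).comp (by fun_prop))

theorem kernelBdd_pot (h : Model G I f A) :
    KernelBdd I solidAngle (fun α => G.σ • (α : E3)) (potKernel G I f) where
  meas_d := by fun_prop
  meas := (h.measurable_enskog.comp measurable_fst).mul (measurable_exch h)
  bdd K hK hKI r := by
    have hσ := h.σ_pos
    have hn : ∀ α : S2, ‖G.σ • (α : E3)‖ = G.σ := fun α => norm_reach_snd hσ α
    -- One σ is for the displacement along the segment, the other for the partner of the displaced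
    -- point.
    obtain ⟨C, hC0, hC⟩ := h.exists_bound_dens hK hKI (r + G.σ + G.σ)
    obtain ⟨Cs, hCs0, hCs⟩ := h.exists_bound_enskog hK hKI (r + G.σ + G.σ)
    refine ⟨fun _ => Cs * ∑ _i : Fin 3, 1 * (C * C + C * C), integrable_const _, ?_,
      fun z hz hr α τ hτ => ?_⟩
    · simp only [hn]
      exact integrable_const _
    · set y := z + τ • ((0 : ℝ), G.σ • (α : E3)) with hy
      have hy1 : y.1 ∈ K := by simpa [hy] using hz
      have hy2 : ‖y.2‖ ≤ r + G.σ := by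
        rw [hy, Prod.snd_add, Prod.smul_snd]
        refine (norm_add_le _ _).trans ?_
        rw [norm_smul, hn, Real.norm_of_nonneg hτ.1]
        nlinarith [hτ.2]
      have hy1' : (y - reach G α).1 ∈ K := by simpa [reach] using hy1
      have hy2' : ‖(y - reach G α).2‖ ≤ r + G.σ + G.σ := by
        rw [Prod.snd_sub]
        refine (norm_sub_le _ _).trans ?_
        rw [norm_reach_snd hσ]
        linarith
      have b1 := hC y hy1 (by linarith)
      have b2 := hC _ hy1' hy2'
      rw [potKernel, abs_mul, abs_of_nonneg (h.enskog_nonneg y)]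
      refine mul_le_mul (hCs y hy1 (by linarith)) ?_ (abs_nonneg _) hCs0
      refine (Finset.abs_sum_le_sum_abs _ _).trans (Finset.sum_le_sum fun i _ => ?_)
      rw [abs_mul]
      refine mul_le_mul ((abs_coord_le _ i).trans (norm_dir α).le) ?_ (abs_nonneg _) zero_le_one
      refine (abs_sub _ _).trans ?_
      rw [abs_mul, abs_mul]
      exact add_le_add (mul_le_mul b2.1 (b1.2 i) (abs_nonneg _) hC0)
        (mul_le_mul b1.1 (b2.2 i) (abs_nonneg _) hC0)

/-- The half with S at the partner becomes, by α → −α and the symmetry `exch_flip`, the translate of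
the half with S at X. -/
theorem integral_exch (h : Model G I f A) {z : ℝ × E3} (hz : z.1 ∈ I) :
    ∫ α, (enskog G I f z + enskog G I f (z - reach G α)) * exch G I f z α ∂solidAngle
      = (∫ α, potKernel G I f z α ∂solidAngle)
        + ∫ α, potKernel G I f (z + ((0 : ℝ), G.σ • (α : E3))) α ∂solidAngle := by
  have hk := kernelBdd_pot h
  have e : ∀ α : S2, (enskog G I f z + enskog G I f (z - reach G α)) * exch G I f z α
      = potKernel G I f z α + (fun β : S2 => potKernel G I f (z + reach G β) β) (-α) := by
    intro α
    simp only [potKernel]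
    rw [reach_neg, ← sub_eq_add_neg, exch_flip, add_mul]
  simp only [e]
  have i2 : Integrable (fun β : S2 => potKernel G I f (z + reach G β) β) solidAngle := by
    obtain ⟨B, hB, -, hb⟩ := hk.bdd {z.1} isCompact_singleton (singleton_subset_iff.2 hz) ‖z.2‖
    refine hB.mono' ?_ (Eventually.of_forall fun β => ?_)
    · have hr : Measurable (reach G) := continuous_reach.measurable
      exact (hk.meas.comp (f := fun β : S2 => (z + reach G β, β))
        (by fun_prop)).aestronglyMeasurable
    · simpa [reach] using hb z rfl le_rfl β 1 (by simp)
  have i3 : Integrable (fun α : S2 => potKernel G I f (z + reach G (-α)) (-α)) solidAngle :=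
    measurePreserving_neg_sphere.integrable_comp_of_integrable i2
  rw [integral_add (hk.integrable hz) i3]
  congr 1
  exact integral_neg_sphere fun β => potKernel G I f (z + reach G β) β

/-- The production of entropy in collisions. -/
theorem integral_transfer_log (h : Model G I f A) {z : ℝ × E3} (hz : z.1 ∈ I) :
    Integrable (diss G I f z) collMeasure ∧
    (∫ w, transfer G I f (logWeight G I f) z w ∂collMeasure)
      + ∫ w, transferStar G I f (logWeight G I f) z w ∂collMeasure
      = -(∫ w, diss G I f z w ∂collMeasure) + (∫ α, potKernel G I f z α ∂solidAngle)
        + ∫ α, potKernel G I f (z + ((0 : ℝ), G.σ • (α : E3))) α ∂solidAngle := by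
  obtain ⟨i1, -, -, i4, i5⟩ := (collWeight_log h).integrable_kern h hz
  -- the kernel of separating pairs
  obtain ⟨k, C, B, hC, hB, hB0, hb⟩ := h.exists_bound_hull isCompact_singleton
    (singleton_subset_iff.2 hz) ‖z.2‖
  have hpm : Measurable (pairDensity G I f z) :=
    h.measurable_pairDensity.comp (f := fun w => (z, w)) (by fun_prop)
  have hiV : Integrable (fun w : Coll => pairDensity G I f z w * relV w.2.2 w.1 w.2.1)
      collMeasure := by
    refine hB.mono' (hpm.mul continuous_relV.measurable).aestronglyMeasurable
      (Eventually.of_forall fun w => ?_)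
    have hb1 := (hb z rfl le_rfl w).1
    refine le_trans ?_ hb1
    have hp := h.pairDensity_nonneg z w
    rw [norm_mul, Real.norm_of_nonneg hp, mul_comm]
    gcongr
    set q := (1 + ‖w.1‖) * (1 + ‖w.2.1‖) with hq
    have hq1 : ‖relV w.2.2 w.1 w.2.1‖ ≤ q := by
      refine (abs_relV_le _ _ _).trans ?_
      nlinarith [norm_nonneg w.1, norm_nonneg w.2.1, mul_nonneg (norm_nonneg w.1) (norm_nonneg w.2.1)]
    have hq2 : 1 ≤ q := by
      nlinarith [norm_nonneg w.1, norm_nonneg w.2.1, mul_nonneg (norm_nonneg w.1) (norm_nonneg w.2.1)]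
    exact hq1.trans (le_self_pow₀ hq2 (by omega))
  -- After the collision the rate is max(−V, 0) = max(V, 0) − V. The difference from the loss kernel
  -- is thus linear in V.
  have hneg : ∀ w : Coll, pairDensity G I f z w * rate (collide w)
      = kern G I f z w - pairDensity G I f z w * relV w.2.2 w.1 w.2.1 := by
    intro w
    rw [kern, ← mul_sub]
    congr 1
    rw [rate_eq_max, rate_eq_max]
    simp only [collide, relV_post]
    rcases le_total (relV w.2.2 w.1 w.2.1) 0 with h0 | h0
    · rw [max_eq_left (by linarith), max_eq_right h0]; ring
    · rw [max_eq_right (by linarith), max_eq_left h0]; ring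
  have i6 : Integrable (fun w => pairDensity G I f z w * rate (collide w)) collMeasure := by
    simp only [hneg]
    exact i1.sub hiV
  have hT := measurePreserving_collide
  have hTT : ∀ w : Coll, collide (collide w) = w := fun w => by
    simp only [collide, post_post, postStar_post]
  have i7 : Integrable (fun w => pairDensity G I f z (collide w) * rate w) collMeasure := by
    have := hT.integrable_comp_of_integrable i6
    refine this.congr (Eventually.of_forall fun w => ?_)
    simp only [Function.comp_def, hTT]
  have e7 : ∫ w, pairDensity G I f z (collide w) * rate w ∂collMeasure
      = ∫ w, pairDensity G I f z w * rate (collide w) ∂collMeasure := by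
    rw [← MeasurePreserving.integral_comp_of_aestronglyMeasurable hT i6.aestronglyMeasurable]
    simp only [hTT]
  -- The two transfers add up to f f_* ln(f'f'_*/(f f_*)) times g and the rate; the constant 1 in
  -- `logWeight` cancels in each difference.
  have hd : ∀ w, diss G I f z w = pairDensity G I f z (collide w) * rate w - kern G I f z w
      - (transfer G I f (logWeight G I f) z w + transferStar G I f (logWeight G I f) z w) := by
    intro w
    simp only [diss, kern, transfer, transferStar, logWeight, pairDensity, collide]
    ring
  have i45 : Integrable (fun w => transfer G I f (logWeight G I f) z w
      + transferStar G I f (logWeight G I f) z w) collMeasure := i4.add i5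
  have i71 : Integrable (fun w => pairDensity G I f z (collide w) * rate w - kern G I f z w)
      collMeasure := i7.sub i1
  refine ⟨(i71.sub i45).congr (Eventually.of_forall fun w => (hd w).symm), ?_⟩
  have hsum : ∫ w, diss G I f z w ∂collMeasure
      = (∫ w, pairDensity G I f z (collide w) * rate w ∂collMeasure)
        - (∫ w, kern G I f z w ∂collMeasure)
        - ((∫ w, transfer G I f (logWeight G I f) z w ∂collMeasure)
          + ∫ w, transferStar G I f (logWeight G I f) z w ∂collMeasure) := by
    simp only [hd]
    rw [integral_sub i71 i45, integral_sub i7 i1, integral_add i4 i5]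
  have hV := integral_pairDensity_relV h hiV
  rw [integral_exch h hz] at hV
  rw [e7] at hsum
  simp only [hneg] at hsum
  rw [integral_sub i1 hiV, hV] at hsum
  linarith

end Dissipation

end EnskogVlasov

namespace EnskogVlasov

open Filter Topology

/-! ### A smooth approximation of the ball of radius σ and the resulting surface integral. -/

section Edge

/-- Derivative of `Real.smoothTransition`. -/
noncomputable abbrev transSlope (x : ℝ) : ℝ := deriv Real.smoothTransition x

theorem hasDerivAt_smoothTransition (x : ℝ) :
    HasDerivAt Real.smoothTransition (transSlope x) x :=
  ((Real.smoothTransition.contDiff (n := 1)).differentiable one_ne_zero x).hasDerivAt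

theorem continuous_transSlope : Continuous transSlope :=
  (Real.smoothTransition.contDiff (n := 1)).continuous_deriv le_rfl

theorem transSlope_nonneg (x : ℝ) : 0 ≤ transSlope x := Real.smoothTransition.monotone.deriv_nonneg

theorem transSlope_of_nonpos {x : ℝ} (hx : x ≤ 0) : transSlope x = 0 := by
  refine IsLocalMin.deriv_eq_zero (Eventually.of_forall fun y => ?_)
  rw [Real.smoothTransition.zero_of_nonpos hx]
  exact Real.smoothTransition.nonneg y

theorem transSlope_of_one_le {x : ℝ} (hx : 1 ≤ x) : transSlope x = 0 := by
  refine IsLocalMax.deriv_eq_zero (Eventually.of_forall fun y => ?_)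
  rw [Real.smoothTransition.one_of_one_le hx]
  exact Real.smoothTransition.le_one y

/-- Argument of the radial profile of the smoothed ball of radius `σ`. -/
noncomputable def edgeArg (σ : ℝ) (n : ℕ) (u : ℝ) : ℝ := (n + 1) * (σ ^ 2 - u) + 1

/-- Smooth approximation of the indicator function of the closed ball of radius `σ`. -/
noncomputable def edge (σ : ℝ) (n : ℕ) (r : E3) : ℝ :=
  Real.smoothTransition (edgeArg σ n (‖r‖ ^ 2))

/-- Radial derivative of `edge`. -/
noncomputable def edgeSlope (σ : ℝ) (n : ℕ) (s : ℝ) : ℝ :=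
  transSlope (edgeArg σ n (s ^ 2)) * (-(2 * (n + 1) * s))

variable {σ : ℝ} {n : ℕ}

theorem edge_nonneg (r : E3) : 0 ≤ edge σ n r := Real.smoothTransition.nonneg _

theorem edge_le_one (r : E3) : edge σ n r ≤ 1 := Real.smoothTransition.le_one _

/-- The summand 1 places the whole transition outside the closed ball: the profile is one for |r| ≤
σ and reaches zero at |r|² = σ² + 1/(n + 1). The limit is then `heavi` at every point, including the
value one on the sphere itself. -/
theorem one_le_edgeArg {u : ℝ} (hu : u ≤ σ ^ 2) : 1 ≤ edgeArg σ n u := by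
  have : 0 ≤ ((n : ℝ) + 1) * (σ ^ 2 - u) := mul_nonneg (by positivity) (by linarith)
  rw [edgeArg]; linarith

theorem edgeArg_nonpos (hσ : 0 < σ) {s : ℝ} (hs : σ + 1 ≤ s) : edgeArg σ n (s ^ 2) ≤ 0 := by
  have h1 : 1 ≤ s ^ 2 - σ ^ 2 := by nlinarith
  have h2 : (0 : ℝ) ≤ n := n.cast_nonneg
  rw [edgeArg]; nlinarith

theorem edge_of_le {r : E3} (hr : ‖r‖ ≤ σ) : edge σ n r = 1 :=
  Real.smoothTransition.one_of_one_le (one_le_edgeArg (by gcongr))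

theorem edge_of_ge (hσ : 0 < σ) {r : E3} (hr : σ + 1 ≤ ‖r‖) : edge σ n r = 0 :=
  Real.smoothTransition.zero_of_nonpos (edgeArg_nonpos hσ hr)

theorem contDiff_edge : ContDiff ℝ (⊤ : ℕ∞) (edge σ n) := by
  unfold edge edgeArg
  refine Real.smoothTransition.contDiff.comp ?_
  exact (contDiff_const.mul (contDiff_const.sub (contDiff_norm_sq ℝ))).add contDiff_const

theorem hasCompactSupport_edge (hσ : 0 < σ) : HasCompactSupport (edge σ n) := by
  refine HasCompactSupport.intro (isCompact_closedBall (0 : E3) (σ + 1)) fun r hr => ?_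
  rw [mem_closedBall_zero_iff, not_le] at hr
  exact edge_of_ge hσ hr.le

theorem tendsto_edge (hσ : 0 < σ) (r : E3) :
    Tendsto (fun n => edge σ n r) atTop (𝓝 (heavi (σ - ‖r‖))) := by
  rcases le_or_gt ‖r‖ σ with hr | hr
  · simp only [edge_of_le hr, heavi, if_pos (sub_nonneg.2 hr)]
    exact tendsto_const_nhds
  · simp only [heavi, if_neg (not_le.2 (sub_neg.2 hr))]
    refine tendsto_const_nhds.congr' ?_
    have h1 : 0 < ‖r‖ ^ 2 - σ ^ 2 := by nlinarith
    obtain ⟨N, hN⟩ := exists_nat_ge (1 / (‖r‖ ^ 2 - σ ^ 2))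
    filter_upwards [eventually_ge_atTop N] with n hn
    refine (Real.smoothTransition.zero_of_nonpos ?_).symm
    rw [div_le_iff₀ h1] at hN
    have h2 : (N : ℝ) ≤ n := by exact_mod_cast hn
    rw [edgeArg]; nlinarith

theorem fderiv_edge (r v : E3) :
    fderiv ℝ (edge σ n) r v
      = transSlope (edgeArg σ n (‖r‖ ^ 2)) * (-(2 * (n + 1) * inner ℝ r v)) := by
  have h1 : HasFDerivAt (fun r : E3 => edgeArg σ n (‖r‖ ^ 2))
      (-(((n : ℝ) + 1) • (2 • innerSL ℝ r))) r := by
    unfold edgeArg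
    have := (((hasStrictFDerivAt_norm_sq r).hasFDerivAt.const_sub (σ ^ 2)).const_mul
      ((n : ℝ) + 1)).add_const 1
    refine this.congr_fderiv ?_
    simp
  have h2 := ((hasDerivAt_smoothTransition (edgeArg σ n (‖r‖ ^ 2))).comp_hasFDerivAt r h1).fderiv
  have h3 : edge σ n = Real.smoothTransition ∘ fun r : E3 => edgeArg σ n (‖r‖ ^ 2) := rfl
  rw [h3, h2]
  simp only [smul_apply, neg_apply, smul_eq_mul,
    innerSL_apply_apply, nsmul_eq_mul]
  push_cast
  ring

theorem fderiv_edge_smul {s : ℝ} (hs : 0 < s) (α : S2) (i : Fin 3) :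
    fderiv ℝ (edge σ n) (s • (α : E3)) (basisVec i) = edgeSlope σ n s * (α : E3) i := by
  rw [fderiv_edge, norm_smul, norm_dir, Real.norm_of_nonneg hs.le, mul_one, edgeSlope,
    inner_smul_left, EuclideanSpace.inner_single_right]
  simp
  ring

theorem continuous_edgeSlope : Continuous (edgeSlope σ n) := by
  unfold edgeSlope edgeArg
  exact (continuous_transSlope.comp (by fun_prop)).mul (by fun_prop)

theorem edgeSlope_of_lt {s : ℝ} (h0 : 0 ≤ s) (hs : s ≤ σ) : edgeSlope σ n s = 0 := by
  rw [edgeSlope, transSlope_of_one_le (one_le_edgeArg (by gcongr)), zero_mul]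

theorem edgeSlope_of_gt (hσ : 0 < σ) {s : ℝ} (hs : σ + 1 ≤ s) : edgeSlope σ n s = 0 := by
  rw [edgeSlope, transSlope_of_nonpos (edgeArg_nonpos hσ hs), zero_mul]

theorem integral_edgeSlope (hσ : 0 < σ) : ∫ s in (0 : ℝ)..(σ + 1), edgeSlope σ n s = -1 := by
  have h1 : ∀ s ∈ uIcc 0 (σ + 1), HasDerivAt
      (fun s : ℝ => Real.smoothTransition (edgeArg σ n (s ^ 2))) (edgeSlope σ n s) s := by
    intro s _
    refine (hasDerivAt_smoothTransition _).comp s ?_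
    unfold edgeArg
    refine ((((hasDerivAt_pow 2 s).const_sub (σ ^ 2)).const_mul ((n : ℝ) + 1)).add_const
      1).congr_deriv ?_
    push_cast
    ring
  rw [intervalIntegral.integral_eq_sub_of_hasDerivAt h1 (continuous_edgeSlope.intervalIntegrable _ _)]
  rw [Real.smoothTransition.zero_of_nonpos (edgeArg_nonpos hσ le_rfl),
    Real.smoothTransition.one_of_one_le (one_le_edgeArg (by simp; positivity))]
  norm_num

/-- The radial derivative of `edge` approximates minus the Dirac measure at `σ`. -/
theorem abs_integral_edgeSlope_le (hσ : 0 < σ) {H : ℝ → ℝ} (hH : Continuous H) {c ε : ℝ}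
    (hε : ∀ s, σ ≤ s → ((n : ℝ) + 1) * (s ^ 2 - σ ^ 2) ≤ 1 → |H s - c| ≤ ε) :
    |(∫ s in Ioi (0 : ℝ), edgeSlope σ n s * H s) + c| ≤ ε := by
  have hk := continuous_edgeSlope (σ := σ) (n := n)
  have h1 : ∫ s in Ioi (0 : ℝ), edgeSlope σ n s * H s
      = ∫ s in (0 : ℝ)..(σ + 1), edgeSlope σ n s * H s := by
    rw [intervalIntegral.integral_of_le (by positivity)]
    refine (setIntegral_eq_of_subset_of_forall_sdiff_eq_zero measurableSet_Ioi
      Ioc_subset_Ioi_self fun s hs => ?_)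
    have hs2 : σ + 1 ≤ s := by
      by_contra hh
      exact hs.2 ⟨hs.1, (not_le.1 hh).le⟩
    rw [edgeSlope_of_gt hσ hs2, zero_mul]
  have h2 : (∫ s in (0 : ℝ)..(σ + 1), edgeSlope σ n s * H s) + c
      = ∫ s in (0 : ℝ)..(σ + 1), edgeSlope σ n s * (H s - c) := by
    have e : ∀ s, edgeSlope σ n s * (H s - c) = edgeSlope σ n s * H s - c * edgeSlope σ n s :=
      fun s => by ring
    simp only [e]
    have i1 : IntervalIntegrable (fun s => edgeSlope σ n s * H s) volume 0 (σ + 1) :=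
      (hk.mul hH).intervalIntegrable _ _
    have i2 : IntervalIntegrable (fun s => c * edgeSlope σ n s) volume 0 (σ + 1) :=
      (hk.const_mul c).intervalIntegrable _ _
    rw [intervalIntegral.integral_sub i1 i2, intervalIntegral.integral_const_mul,
      integral_edgeSlope hσ]
    ring
  -- The slope vanishes inside the ball and beyond the transition layer, and in the layer |H − c| ≤
  -- ε. As the slope is nonpositive with integral −1, the right-hand side integrates to ε.
  have h0 : ∀ s ∈ Icc 0 (σ + 1), |edgeSlope σ n s * (H s - c)| ≤ -ε * edgeSlope σ n s := by
    intro s hs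
    have hneg : edgeSlope σ n s ≤ 0 :=
      mul_nonpos_of_nonneg_of_nonpos (transSlope_nonneg _)
        (neg_nonpos.2 (mul_nonneg (by positivity) hs.1))
    rcases le_or_gt s σ with h | h
    · simp [edgeSlope_of_lt hs.1 h]
    · rcases le_or_gt (((n : ℝ) + 1) * (s ^ 2 - σ ^ 2)) 1 with h' | h'
      · rw [abs_mul, abs_of_nonpos hneg]
        nlinarith [hε s h.le h']
      · have : edgeArg σ n (s ^ 2) ≤ 0 := by rw [edgeArg]; linarith
        simp [edgeSlope, transSlope_of_nonpos this]
  rw [h1, h2]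
  refine (intervalIntegral.abs_integral_le_integral_abs (by positivity)).trans ?_
  have h3 : ∫ s in (0 : ℝ)..(σ + 1), -ε * edgeSlope σ n s = ε := by
    rw [intervalIntegral.integral_const_mul, integral_edgeSlope hσ]; ring
  rw [← h3]
  refine intervalIntegral.integral_mono_on (by positivity) ?_ ?_ h0
  · exact (hk.mul (hH.sub continuous_const)).abs.intervalIntegrable _ _
  · exact (hk.const_mul _).intervalIntegrable _ _

/-- Gauss' theorem for the ball as the limit of integrals against the gradient of `edge`. -/
theorem tendsto_integral_fderiv_edge (hσ : 0 < σ) {Γ : ℕ → Fin 3 → E3 → ℝ} {Γ₀ : Fin 3 → E3 → ℝ}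
    (hΓ : ∀ n j, Continuous (Γ n j)) (hΓ₀ : ∀ j, Continuous (Γ₀ j))
    (hlim : ∀ j, ∀ ε > 0, ∀ᶠ n in atTop, ∀ r, ‖r‖ ≤ σ + 1 → |Γ n j r - Γ₀ j r| ≤ ε) :
    Tendsto (fun n => ∑ j, ∫ r, fderiv ℝ (edge σ n) r (basisVec j) * Γ n j r) atTop
      (𝓝 (-(σ ^ 2 * ∫ α : S2, ∑ j, (α : E3) j * Γ₀ j (σ • (α : E3)) ∂solidAngle))) := by
  have hcoord : ∀ j : Fin 3, Continuous fun α : S2 => (α : E3) j := fun j =>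
    (contDiff_coord j).continuous.comp continuous_subtype_val
  -- the radial integrands
  set W : ℕ → S2 → ℝ → ℝ := fun n α s => s ^ 2 * ∑ j, (α : E3) j * Γ n j (s • (α : E3)) with hW
  set W₀ : ℝ → S2 → ℝ := fun s α => s ^ 2 * ∑ j, (α : E3) j * Γ₀ j (s • (α : E3)) with hW₀
  have hWc : ∀ n, Continuous fun p : S2 × ℝ => W n p.1 p.2 := by
    intro n
    refine (continuous_snd.pow 2).mul (continuous_finsetSum _ fun j _ => ?_)
    exact ((hcoord j).comp continuous_fst).mul ((hΓ n j).comp (by fun_prop))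
  have hW₀c : Continuous fun p : ℝ × S2 => W₀ p.1 p.2 := by
    refine (continuous_fst.pow 2).mul (continuous_finsetSum _ fun j _ => ?_)
    exact ((hcoord j).comp continuous_snd).mul ((hΓ₀ j).comp (by fun_prop))
  have hpolar : ∀ n, ∑ j, ∫ r, fderiv ℝ (edge σ n) r (basisVec j) * Γ n j r
      = ∫ α : S2, (∫ s in Ioi (0 : ℝ), edgeSlope σ n s * W n α s) ∂solidAngle := by
    intro n
    have hi : ∀ j, Integrable fun r => fderiv ℝ (edge σ n) r (basisVec j) * Γ n j r := by
      intro j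
      have hc1 : Continuous fun r => fderiv ℝ (edge σ n) r (basisVec j) :=
        ((contDiff_edge (σ := σ) (n := n)).continuous_fderiv (by simp)).clm_apply continuous_const
      exact (hc1.mul (hΓ n j)).integrable_of_hasCompactSupport
        (((hasCompactSupport_edge hσ).fderiv_apply ℝ _).mul_right)
    rw [← integral_finsetSum _ fun j _ => hi j,
      integral_eq_integral_sphere (integrable_finsetSum _ fun j _ => hi j)]
    refine integral_congr_ae (Eventually.of_forall fun α => ?_)
    refine setIntegral_congr_fun measurableSet_Ioi fun s hs => ?_
    simp only [fderiv_edge_smul hs, hW, Finset.mul_sum]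
    refine Finset.sum_congr rfl fun j _ => ?_
    ring
  -- On the shrinking layer the radial integrands converge to the value at s = σ uniformly in α:
  -- half of ε is for moving s to σ, where compactness of the sphere enters, and half for replacing
  -- Γ_n by its limit.
  have hlimW : ∀ ε > 0, ∀ᶠ n : ℕ in atTop, ∀ α : S2, ∀ s, σ ≤ s →
      ((n : ℝ) + 1) * (s ^ 2 - σ ^ 2) ≤ 1 → |W n α s - W₀ σ α| ≤ ε := by
    intro ε hε
    have h1 : ∀ᶠ s in 𝓝 σ, ∀ α ∈ (univ : Set S2), |W₀ s α - W₀ σ α| < ε / 2 := by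
      refine isCompact_univ.eventually_forall_of_forall_eventually fun α _ => ?_
      have hc : Continuous fun p : ℝ × S2 => |W₀ p.1 p.2 - W₀ σ p.2| :=
        (hW₀c.sub (hW₀c.comp (by fun_prop : Continuous fun p : ℝ × S2 => (σ, p.2)))).abs
      have := hc.tendsto (σ, α)
      simp only [sub_self, abs_zero] at this
      exact this.eventually (gt_mem_nhds (half_pos hε))
    obtain ⟨δ, hδ, hδ'⟩ := Metric.eventually_nhds_iff.1 h1
    -- Three components and the factor s² ≤ (σ + 1)² turn this tolerance into ε/2.
    have h2 : ∀ j : Fin 3, ∀ᶠ n in atTop, ∀ r, ‖r‖ ≤ σ + 1 →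
        |Γ n j r - Γ₀ j r| ≤ ε / (6 * (σ + 1) ^ 2) := fun j => hlim j _ (by positivity)
    -- For s ≥ σ + δ one has s² − σ² ≥ 2δσ, so with n ≥ 1/(δσ) such an s lies outside the layer.
    obtain ⟨N, hN⟩ := exists_nat_ge (1 / (δ * σ))
    filter_upwards [eventually_all.2 h2, eventually_ge_atTop N] with n hn hnN α s hs hs2
    have hn1 : (N : ℝ) ≤ n := by exact_mod_cast hnN
    have hs1 : s < σ + δ := by
      by_contra hh
      push Not at hh
      rw [div_le_iff₀ (by positivity)] at hN
      have e1 : s ^ 2 - σ ^ 2 ≥ δ * σ + δ * σ := by nlinarith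
      have e2 : (0 : ℝ) ≤ n := n.cast_nonneg
      have e3 : (n : ℝ) * (δ * σ) ≥ N * (δ * σ) := by gcongr
      have e4 : 0 < δ * σ := by positivity
      nlinarith
    have hs3 : s ≤ σ + 1 := by
      by_contra hh
      push Not at hh
      have e2 : (0 : ℝ) ≤ n := n.cast_nonneg
      have e5 : s ^ 2 - σ ^ 2 > 1 := by nlinarith
      nlinarith
    have hs0 : 0 ≤ s := hσ.le.trans hs
    have b1 : |W₀ s α - W₀ σ α| < ε / 2 :=
      hδ' (by rw [Real.dist_eq, abs_of_nonneg (by linarith)]; linarith) α (mem_univ _)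
    have b2 : |W n α s - W₀ s α| ≤ ε / 2 := by
      have e : W n α s - W₀ s α
          = s ^ 2 * ∑ j, (α : E3) j * (Γ n j (s • (α : E3)) - Γ₀ j (s • (α : E3))) := by
        simp only [hW, hW₀, mul_sub, Finset.sum_sub_distrib]
      rw [e, abs_mul, abs_of_nonneg (by positivity)]
      have hr : ‖s • (α : E3)‖ ≤ σ + 1 := by
        rw [norm_smul, norm_dir, Real.norm_of_nonneg hs0, mul_one]; exact hs3
      have e' : |∑ j, (α : E3) j * (Γ n j (s • (α : E3)) - Γ₀ j (s • (α : E3)))|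
          ≤ ∑ _j : Fin 3, 1 * (ε / (6 * (σ + 1) ^ 2)) := by
        refine (Finset.abs_sum_le_sum_abs _ _).trans (Finset.sum_le_sum fun j _ => ?_)
        rw [abs_mul]
        exact mul_le_mul ((abs_coord_le _ j).trans (norm_dir α).le) (hn j _ hr) (abs_nonneg _)
          zero_le_one
      calc s ^ 2 * _ ≤ (σ + 1) ^ 2 * ∑ _j : Fin 3, 1 * (ε / (6 * (σ + 1) ^ 2)) := by gcongr
        _ = ε / 2 := by
          simp only [Finset.sum_const, Finset.card_univ, Fintype.card_fin, nsmul_eq_mul]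
          field_simp
          norm_num
    calc |W n α s - W₀ σ α| = |(W n α s - W₀ s α) + (W₀ s α - W₀ σ α)| := by ring_nf
      _ ≤ _ := abs_add_le _ _
      _ ≤ ε := by linarith
  have hW₀σ : Continuous (W₀ σ) := hW₀c.comp (by fun_prop : Continuous fun α : S2 => (σ, α))
  have hmeas : ∀ n, AEStronglyMeasurable
      (fun α : S2 => ∫ s in Ioi (0 : ℝ), edgeSlope σ n s * W n α s) solidAngle := fun n =>
    (((continuous_edgeSlope.comp continuous_snd).mul (hWc n)).stronglyMeasurable
      |>.integral_prod_right (ν := volume.restrict (Ioi (0 : ℝ)))).aestronglyMeasurable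
  have hiW₀ : Integrable (W₀ σ) solidAngle :=
    hW₀σ.integrable_of_hasCompactSupport (HasCompactSupport.of_compactSpace _)
  have hval : ∫ α : S2, W₀ σ α ∂solidAngle
      = σ ^ 2 * ∫ α : S2, ∑ j, (α : E3) j * Γ₀ j (σ • (α : E3)) ∂solidAngle :=
    integral_const_mul _ _
  rw [← hval, Metric.tendsto_nhds]
  intro ε hε
  set M := solidAngle.real univ with hM
  have hM0 : 0 ≤ M := measureReal_nonneg
  have hε' : 0 < ε / (M + 1) := by positivity
  filter_upwards [hlimW _ hε'] with n hn
  have hb : ∀ α : S2, |(∫ s in Ioi (0 : ℝ), edgeSlope σ n s * W n α s) + W₀ σ α| ≤ ε / (M + 1) :=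
    fun α => abs_integral_edgeSlope_le hσ
      ((hWc n).comp (by fun_prop : Continuous fun s : ℝ => (α, s))) (hn α)
  have hiS : Integrable (fun α => (∫ s in Ioi (0 : ℝ), edgeSlope σ n s * W n α s) + W₀ σ α)
      solidAngle :=
    Integrable.of_bound ((hmeas n).add hW₀σ.aestronglyMeasurable) _ (Eventually.of_forall hb)
  have hiI : Integrable (fun α => ∫ s in Ioi (0 : ℝ), edgeSlope σ n s * W n α s) solidAngle := by
    refine (hiS.sub hiW₀).congr (Eventually.of_forall fun α => ?_)
    simp
  rw [hpolar, Real.dist_eq, sub_neg_eq_add, ← integral_add hiI hiW₀]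
  have h4 := norm_integral_le_of_norm_le_const (μ := solidAngle)
    (f := fun α => (∫ s in Ioi (0 : ℝ), edgeSlope σ n s * W n α s) + W₀ σ α)
    (Eventually.of_forall hb)
  rw [Real.norm_eq_abs, ← hM] at h4
  refine h4.trans_lt ?_
  rw [div_mul_eq_mul_div, div_lt_iff₀ (by positivity)]
  nlinarith

end Edge

end EnskogVlasov

namespace EnskogVlasov

open Filter Topology

variable {G : Gas} {I : Set ℝ} {f : ℝ → E3 → E3 → ℝ} {A : Set ℝ}

/-! ### Mass conservation up to the wall and the smoothed number of neighbours. -/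

section Crowding

namespace Model

theorem hasDerivAt_dens_time (h : Model G I f A) {t : ℝ} (ht : t ∈ I) (Y : E3) :
    HasDerivAt (fun s => dens G I f (s, Y)) (densDot G I f (t, Y)) t := by
  by_cases hY : Y ∈ G.D
  · have hz : (t, Y) ∈ spaceTime G I := ⟨ht, hY⟩
    have h1 : DifferentiableAt ℝ (dens G I f) (t, Y) :=
      ((h.contDiffOn_dens.contDiffAt (h.isOpen_spaceTime.mem_nhds hz)).differentiableAt one_ne_zero)
    rw [densDot_of_mem hz, ← h.fderiv_dens hz]
    exact h1.hasFDerivAt.comp_hasDerivAt t ((hasDerivAt_id t).prodMk (hasDerivAt_const t Y))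
  · have h1 : ∀ s, (s, Y) ∉ spaceTime G I := fun s hs => hY hs.2
    simp only [dens_of_notMem (h1 _), densDot_of_notMem (h1 _)]
    exact hasDerivAt_const t 0

theorem continuousOn_densDot (h : Model G I f A) :
    ContinuousOn (densDot G I f) (spaceTime G I) := by
  refine ContinuousOn.congr (f := fun z => fderiv ℝ (dens G I f) z (1, 0)) ?_ fun z hz => ?_
  · exact (h.contDiffOn_dens.continuousOn_fderiv_of_isOpen h.isOpen_spaceTime le_rfl).clm_apply
      continuousOn_const
  · rw [densDot_of_mem hz, ← h.fderiv_dens hz]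

theorem continuousOn_densDot_time (h : Model G I f A) (Y : E3) :
    ContinuousOn (fun s => densDot G I f (s, Y)) I := by
  by_cases hY : Y ∈ G.D
  · exact h.continuousOn_densDot.comp (f := fun s => (s, Y)) (by fun_prop) fun s hs => ⟨hs, hY⟩
  · have h1 : ∀ s, (s, Y) ∉ spaceTime G I := fun s hs => hY hs.2
    simp only [densDot_of_notMem (h1 _)]
    exact continuousOn_const

theorem densDot_eq_neg_sum (h : Model G I f A) {z : ℝ × E3} (hz : z ∈ spaceTime G I) :
    densDot G I f z = -∑ i, fderiv ℝ (cur G I f i) z (0, basisVec i) := by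
  have := h.continuity hz
  rw [densDot_of_mem hz, ← h.fderiv_dens hz]
  linarith

theorem measurable_dens_right (h : Model G I f A) (t : ℝ) :
    Measurable (fun Y => dens G I f (t, Y)) := h.measurable_dens.comp (by fun_prop)

theorem measurable_cur_right (h : Model G I f A) (j : Fin 3) (t : ℝ) :
    Measurable (fun Y => cur G I f j (t, Y)) := (h.measurable_cur j).comp (by fun_prop)

theorem measurable_densDot_right (h : Model G I f A) (t : ℝ) :
    Measurable (fun Y => densDot G I f (t, Y)) := h.densDot_measurable.comp (by fun_prop)

theorem integrable_of_time_slice (h : Model G I f A) {t : ℝ} (ht : t ∈ I) {ψ : E3 → ℝ}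
    (hψ : Continuous ψ) (hc : HasCompactSupport ψ) :
    Integrable (fun Y => dens G I f (t, Y) * ψ Y) ∧
    Integrable (fun Y => densDot G I f (t, Y) * ψ Y) ∧
    ∀ j, Integrable fun Y => cur G I f j (t, Y) * ψ Y := by
  obtain ⟨r, hr⟩ := hc.isCompact.isBounded.exists_norm_le
  obtain ⟨C, hC0, hC⟩ := h.exists_bound_dens isCompact_singleton (singleton_subset_iff.2 ht) r
  obtain ⟨C', hC0', hC'⟩ := h.exists_bound_dens_global isCompact_singleton
    (singleton_subset_iff.2 ht)
  simp only [mul_comm _ (ψ _)]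
  refine ⟨?_, ?_, fun j => ?_⟩
  · exact integrable_mul_of_bdd _ hψ hc (h.measurable_dens_right t).aestronglyMeasurable C'
      fun Y _ => (hC' (t, Y) rfl).1
  · exact integrable_mul_of_bdd _ hψ hc (h.measurable_densDot_right t).aestronglyMeasurable C'
      fun Y _ => (hC' (t, Y) rfl).2
  · exact integrable_mul_of_bdd _ hψ hc (h.measurable_cur_right j t).aestronglyMeasurable C
      fun Y hY => (hC (t, Y) rfl (hr Y hY)).2 j

/-- Conservation of mass, tested with functions that need not vanish at the boundary. -/
theorem integral_densDot_mul (h : Model G I f A) {t : ℝ} (ht : t ∈ I) {ψ : E3 → ℝ}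
    (hψ : ContDiff ℝ (⊤ : ℕ∞) ψ) (hc : HasCompactSupport ψ) :
    ∫ Y, densDot G I f (t, Y) * ψ Y
      = ∑ j, ∫ Y, cur G I f j (t, Y) * fderiv ℝ ψ Y (basisVec j) := by
  have hi1 := (h.integrable_of_time_slice ht hψ.continuous hc).2.1
  have hi2 : ∀ j, Integrable fun Y => cur G I f j (t, Y) * fderiv ℝ ψ Y (basisVec j) := fun j =>
    (h.integrable_of_time_slice ht
      ((hψ.continuous_fderiv (by simp)).clm_apply continuous_const) (hc.fderiv_apply ℝ _)).2.2 j
  -- Impermeability is Green's formula without a boundary term for test functions that need not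
  -- vanish on ∂D; in D the continuity equation replaces the divergence of ρv by −∂_t ρ.
  have hw := h.wall t ht ψ hψ hc
  rw [← integral_finsetSum _ fun j _ => hi2 j, eq_comm, ← sub_eq_zero,
    ← integral_sub (integrable_finsetSum _ fun j _ => hi2 j) hi1, ← hw,
    ← integral_indicator h.openD.measurableSet]
  refine integral_congr_ae (Eventually.of_forall fun Y => ?_)
  by_cases hY : Y ∈ G.D
  · have hz : (t, Y) ∈ spaceTime G I := ⟨ht, hY⟩
    have hj : ∀ j, Gas.rho f t Y * Gas.vel f t Y j = cur G I f j (t, Y) := fun j => by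
      rw [← h.dens_mul_vel hz j, dens_of_mem hz]
    have hp : ∀ j, pd j (fun Z => Gas.rho f t Z * Gas.vel f t Z j) Y
        = fderiv ℝ (cur G I f j) (t, Y) (0, basisVec j) := by
      intro j
      have e : (fun Z => Gas.rho f t Z * Gas.vel f t Z j) =ᶠ[𝓝 Y] fun Z => cur G I f j (t, Z) := by
        filter_upwards [h.openD.mem_nhds hY] with Z hZ
        have hz' : (t, Z) ∈ spaceTime G I := ⟨ht, hZ⟩
        rw [← h.dens_mul_vel hz' j, dens_of_mem hz']
      have h1 : HasFDerivAt (cur G I f j) (fderiv ℝ (cur G I f j) (t, Y)) (t, Y) :=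
        (((h.contDiffOn_cur j).contDiffAt (h.isOpen_spaceTime.mem_nhds hz)).differentiableAt
          one_ne_zero).hasFDerivAt
      have h2 : HasFDerivAt (fun Z => cur G I f j (t, Z)) _ Y :=
        h1.comp Y (hasFDerivAt_prodMk_right t Y)
      rw [pd, e.fderiv_eq, h2.fderiv]
      simp
    simp only [indicator_of_mem hY, hj, hp, h.densDot_eq_neg_sum hz]
    simp only [pd]
    ring
  · have hz : (t, Y) ∉ spaceTime G I := fun hh => hY hh.2
    simp [indicator_of_notMem hY, cur_of_notMem hz, densDot_of_notMem hz]

end Model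

variable (G I f) in
/-- The number of neighbours, counted with the weight `η`. -/
noncomputable def crowdReg (η : E3 → ℝ) (z : ℝ × E3) : ℝ :=
  1 / G.m * ∫ Y, dens G I f (z.1, Y) * η (Y - z.2)

theorem crowdReg_heavi (h : Model G I f A) {z : ℝ × E3} (hz : z.1 ∈ I) :
    crowdReg G I f (fun r => heavi (G.σ - ‖r‖)) z = G.crowd f z.1 z.2 := (h.crowd_eq hz z.2).symm

theorem measurable_crowdReg (h : Model G I f A) {η : E3 → ℝ} (hη : Measurable η) :
    Measurable (crowdReg G I f η) := by
  have : Measurable fun p : (ℝ × E3) × E3 => dens G I f (p.1.1, p.2) * η (p.2 - p.1.2) :=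
    (h.measurable_dens.comp (by fun_prop)).mul (hη.comp (by fun_prop))
  exact (this.stronglyMeasurable.integral_prod_right.measurable).const_mul _

/-- Weights with values in the unit interval that vanish outside the ball of radius `σ + 1`. -/
structure ContactWeight (σ : ℝ) (η : E3 → ℝ) : Prop where
  meas : Measurable η
  nonneg : ∀ r, 0 ≤ η r
  le : ∀ r, η r ≤ (Metric.closedBall (0 : E3) (σ + 1)).indicator (fun _ => 1) r

theorem contactWeight_edge {σ : ℝ} (hσ : 0 < σ) (n : ℕ) : ContactWeight σ (edge σ n) where
  meas := contDiff_edge.continuous.measurable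
  nonneg := edge_nonneg
  le r := by
    by_cases hr : r ∈ Metric.closedBall (0 : E3) (σ + 1)
    · rw [indicator_of_mem hr]; exact edge_le_one r
    · rw [indicator_of_notMem hr]
      rw [mem_closedBall_zero_iff, not_le] at hr
      exact (edge_of_ge hσ hr.le).le

theorem contactWeight_heavi (σ : ℝ) : ContactWeight σ fun r => heavi (σ - ‖r‖) where
  meas := measurable_heavi.comp (by fun_prop)
  nonneg r := by unfold heavi; split_ifs <;> norm_num
  le r := by
    unfold heavi
    split_ifs with hr
    · rw [indicator_of_mem]
      rw [mem_closedBall_zero_iff]; linarith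
    · exact indicator_nonneg (fun _ _ => zero_le_one) r

theorem integrable_ball_indicator (σ : ℝ) (X : E3) : Integrable fun Y : E3 =>
    (Metric.closedBall (0 : E3) (σ + 1)).indicator (fun _ => (1 : ℝ)) (Y - X) := by
  refine Integrable.comp_sub_right (f := (Metric.closedBall (0 : E3) (σ + 1)).indicator
    fun _ => (1 : ℝ)) ?_ X
  rw [integrable_indicator_iff Metric.isClosed_closedBall.measurableSet]
  exact integrableOn_const (isCompact_closedBall _ _).measure_lt_top.ne

theorem ContactWeight.abs_le {σ : ℝ} {η : E3 → ℝ} (hη : ContactWeight σ η) {C x : ℝ} (hx : |x| ≤ C)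
    (r : E3) : |x * η r| ≤ C * (Metric.closedBall (0 : E3) (σ + 1)).indicator (fun _ => 1) r := by
  rw [abs_mul, abs_of_nonneg (hη.nonneg r)]
  exact mul_le_mul hx (hη.le r) (hη.nonneg r) ((abs_nonneg _).trans hx)

/-- The bound does not depend on the weight, so it serves as a majorant when the smoothing is
removed. -/
theorem exists_bound_crowdReg (h : Model G I f A) {K : Set ℝ} (hK : IsCompact K) (hKI : K ⊆ I) :
    ∃ C : ℝ, 0 ≤ C ∧ ∀ η, ContactWeight G.σ η → ∀ z : ℝ × E3, z.1 ∈ K →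
      |crowdReg G I f η z| ≤ C := by
  obtain ⟨C, hC0, hC⟩ := h.exists_bound_dens_global hK hKI
  refine ⟨1 / G.m * (C * ∫ r, (Metric.closedBall (0 : E3) (G.σ + 1)).indicator (fun _ => 1) r),
    ?_, fun η hη z hz => ?_⟩
  · have := h.m_pos
    have : 0 ≤ ∫ r, (Metric.closedBall (0 : E3) (G.σ + 1)).indicator (fun _ => (1 : ℝ)) r :=
      integral_nonneg fun r => indicator_nonneg (fun _ _ => zero_le_one) r
    positivity
  · have hm := h.m_pos
    rw [crowdReg, abs_mul, abs_of_pos (one_div_pos.2 hm)]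
    gcongr
    refine (abs_integral_le_of_abs_le ((integrable_ball_indicator G.σ z.2).const_mul C)
      fun Y => hη.abs_le (hC (z.1, Y) hz).1 (Y - z.2)).trans_eq ?_
    rw [integral_const_mul]
    congr 1
    exact integral_sub_right_eq_self _ z.2

theorem tendsto_crowdReg (h : Model G I f A) {z : ℝ × E3} (hz : z.1 ∈ I) :
    Tendsto (fun n => crowdReg G I f (edge G.σ n) z) atTop (𝓝 (G.crowd f z.1 z.2)) := by
  obtain ⟨C, hC0, hC⟩ := h.exists_bound_dens_global isCompact_singleton (singleton_subset_iff.2 hz)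
  rw [← crowdReg_heavi h hz]
  refine Tendsto.const_mul _ (tendsto_integral_of_dominated_convergence _ (fun n => ?_)
    ((integrable_ball_indicator G.σ z.2).const_mul C) (fun n => Eventually.of_forall fun Y => ?_)
    (Eventually.of_forall fun Y => ?_))
  · exact ((h.measurable_dens_right z.1).mul
      ((contactWeight_edge h.σ_pos n).meas.comp (by fun_prop))).aestronglyMeasurable
  · exact (contactWeight_edge h.σ_pos n).abs_le (hC (z.1, Y) rfl).1 _
  · exact (tendsto_edge h.σ_pos _).const_mul _

/-- The derivative of the integrand of `crowdReg`. -/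
noncomputable def crowdRegDeriv (G : Gas) (I : Set ℝ) (f : ℝ → E3 → E3 → ℝ) (η : E3 → ℝ)
    (z : ℝ × E3) (Y : E3) : ℝ × E3 →L[ℝ] ℝ :=
  (densDot G I f (z.1, Y) * η (Y - z.2)) • ContinuousLinearMap.fst ℝ ℝ E3
    - dens G I f (z.1, Y) • (fderiv ℝ η (Y - z.2)).comp (ContinuousLinearMap.snd ℝ ℝ E3)

/-- The time derivative falls on the density, which is differentiable in time at every fixed Y, and
the space derivative falls on the weight. Hence the jump of the density at ∂D does no harm. -/
theorem hasFDerivAt_crowdReg (h : Model G I f A) {η : E3 → ℝ} (hη : ContDiff ℝ 1 η)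
    (hc : HasCompactSupport η) :
    (∀ z ∈ I ×ˢ (univ : Set E3), HasFDerivAt
      (fun z : ℝ × E3 => ∫ Y, dens G I f (z.1, Y) * η (Y - z.2))
      (∫ Y, crowdRegDeriv G I f η z Y) z) ∧
    ContinuousOn (fun z => ∫ Y, crowdRegDeriv G I f η z Y) (I ×ˢ univ) := by
  have hη' : Continuous (fderiv ℝ η) := hη.continuous_fderiv one_ne_zero
  refine hasFDerivAt_continuousOn_integral (h.openI.prod isOpen_univ) (fun z hz => ?_)
    (fun z hz => ?_) (Eventually.of_forall fun Y z hz => ?_) (Eventually.of_forall fun Y => ?_)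
    fun z hz => ?_
  · exact (h.integrable_of_time_slice hz.1 (ψ := fun Y => η (Y - z.2)) (by fun_prop)
      (hc.comp_homeomorph (Homeomorph.subRight z.2))).1
  · have m1 : AEStronglyMeasurable (fun Y => densDot G I f (z.1, Y) * η (Y - z.2)) volume :=
      ((h.measurable_densDot_right z.1).mul
        (Continuous.measurable (by fun_prop))).aestronglyMeasurable
    have m2 : AEStronglyMeasurable (fun Y => dens G I f (z.1, Y)
        • (fderiv ℝ η (Y - z.2)).comp (ContinuousLinearMap.snd ℝ ℝ E3)) volume :=
      (h.measurable_dens_right z.1).aestronglyMeasurable.smul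
        (Continuous.aestronglyMeasurable (by fun_prop))
    exact (m1.smul_const _).sub m2
  · have h1 := (h.hasDerivAt_dens_time hz.1 Y).comp_hasFDerivAt z
      (hasFDerivAt_fst (𝕜 := ℝ) (p := z) (E := ℝ) (F := E3))
    have h2 := ((hη.differentiable one_ne_zero) (Y - z.2)).hasFDerivAt.comp z
      ((hasFDerivAt_snd (𝕜 := ℝ) (p := z) (E := ℝ) (F := E3)).const_sub Y)
    refine (h1.mul h2).congr_fderiv ?_
    ext v
    · simp [crowdRegDeriv]
      ring
    · simp [crowdRegDeriv]
  · have h1 : ContinuousOn (fun z : ℝ × E3 => densDot G I f (z.1, Y)) (I ×ˢ univ) :=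
      (h.continuousOn_densDot_time Y).comp continuousOn_fst fun z hz => hz.1
    have h2 : ContinuousOn (fun z : ℝ × E3 => dens G I f (z.1, Y)) (I ×ˢ univ) := fun z hz =>
      ((h.continuousAt_dens_time hz.1 Y).comp (f := fun z : ℝ × E3 => z.1)
        continuousAt_fst).continuousWithinAt
    refine ContinuousOn.sub (ContinuousOn.smul (h1.mul ?_) continuousOn_const) (h2.smul ?_)
    · exact Continuous.continuousOn (by fun_prop)
    · exact Continuous.continuousOn (by fun_prop)
  · obtain ⟨K, hK, hzK, hKI⟩ := exists_compact_subset h.openI hz.1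
    obtain ⟨C, hC0, hC⟩ := h.exists_bound_dens_global hK hKI
    obtain ⟨r, hr⟩ := hc.isCompact.isBounded.exists_norm_le
    obtain ⟨B1, hB1⟩ := hη.continuous.bounded_above_of_compact_support hc
    obtain ⟨B2, hB2⟩ := hη'.bounded_above_of_compact_support (hc.fderiv ℝ)
    have hB10 : 0 ≤ B1 := (norm_nonneg _).trans (hB1 0)
    have hB20 : 0 ≤ B2 := (norm_nonneg _).trans (hB2 0)
    refine ⟨K ×ˢ Metric.closedBall z.2 1, prod_mem_nhds (mem_interior_iff_mem_nhds.1 hzK)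
      (Metric.closedBall_mem_nhds _ one_pos),
      (Metric.closedBall z.2 (r + 1)).indicator fun _ => C * B1 * 1 + C * (B2 * 1), ?_,
      Eventually.of_forall fun Y w hw => ?_⟩
    · rw [integrable_indicator_iff Metric.isClosed_closedBall.measurableSet]
      exact integrableOn_const (isCompact_closedBall _ _).measure_lt_top.ne
    · by_cases hY : Y ∈ Metric.closedBall z.2 (r + 1)
      · rw [indicator_of_mem hY, crowdRegDeriv]
        refine (norm_sub_le _ _).trans (add_le_add ?_ ?_)
        · rw [norm_smul, norm_mul]
          gcongr
          · exact (hC (w.1, Y) hw.1).2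
          · exact hB1 _
          · exact ContinuousLinearMap.norm_fst_le ..
        · rw [norm_smul]
          gcongr
          · exact (hC (w.1, Y) hw.1).1
          · refine (ContinuousLinearMap.opNorm_comp_le _ _).trans ?_
            gcongr
            · exact hB2 _
            · exact ContinuousLinearMap.norm_snd_le ..
      · have hnot : Y - w.2 ∉ tsupport η := by
          intro hh
          apply hY
          have h1 := hr _ hh
          have h2 := hw.2
          rw [Metric.mem_closedBall, dist_eq_norm] at h2 ⊢
          calc ‖Y - z.2‖ = ‖(Y - w.2) + (w.2 - z.2)‖ := by congr 1; abel
            _ ≤ r + 1 := (norm_add_le _ _).trans (add_le_add h1 h2)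
        have e1 : η (Y - w.2) = 0 := image_eq_zero_of_notMem_tsupport hnot
        have e2 : fderiv ℝ η (Y - w.2) = 0 :=
          image_eq_zero_of_notMem_tsupport fun hh => hnot (tsupport_fderiv_subset ℝ hh)
        rw [crowdRegDeriv, e1, e2]
        simp [indicator_of_notMem hY]

theorem contDiffOn_crowdReg (h : Model G I f A) {η : E3 → ℝ} (hη : ContDiff ℝ 1 η)
    (hc : HasCompactSupport η) : ContDiffOn ℝ 1 (crowdReg G I f η) (I ×ˢ univ) := by
  obtain ⟨h1, h2⟩ := hasFDerivAt_crowdReg h hη hc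
  exact contDiffOn_const.mul (contDiffOn_one_of_hasFDerivAt (h.openI.prod isOpen_univ) h1 h2)

end Crowding

end EnskogVlasov

namespace EnskogVlasov

open Filter Topology

variable {G : Gas} {I : Set ℝ} {f : ℝ → E3 → E3 → ℝ} {A : Set ℝ}

/-! ### The rate of change of the smoothed number of neighbours along the flow. -/

section Potential

theorem integrable_prod_of_bdd {Ω Ω' : Type*} [MeasurableSpace Ω] [MeasurableSpace Ω']
    {μ : Measure Ω} {ν : Measure Ω'} [SFinite μ] [SFinite ν] {φ : Ω → ℝ} {k : Ω' → ℝ}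
    (hφ : Integrable φ μ) (hk : Integrable k ν) {b : Ω → Ω' → ℝ}
    (hb : Measurable fun p : Ω × Ω' => b p.1 p.2) {C : ℝ}
    (hC : ∀ z w, φ z ≠ 0 → k w ≠ 0 → |b z w| ≤ C) :
    Integrable (fun p : Ω × Ω' => φ p.1 * k p.2 * b p.1 p.2) (μ.prod ν) := by
  have h1 : Integrable (fun p : Ω × Ω' => φ p.1 * k p.2) (μ.prod ν) := hφ.mul_prod hk
  refine (h1.norm.mul_const C).mono' (h1.aestronglyMeasurable.mul hb.aestronglyMeasurable)
    (Eventually.of_forall fun p => ?_)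
  rw [norm_mul]
  by_cases h0 : φ p.1 * k p.2 = 0
  · simp [h0]
  · replace h0 := mul_ne_zero_iff.1 h0
    exact mul_le_mul_of_nonneg_left (hC _ _ h0.1 h0.2) (norm_nonneg _)

theorem tendsto_integral_mul_of_bdd {Ω : Type*} [MeasurableSpace Ω] {μ : Measure Ω} {w : Ω → ℝ}
    (hw : Integrable w μ) {c : ℕ → Ω → ℝ} {c₀ : Ω → ℝ} (hc : ∀ n, Measurable (c n)) {C : ℝ}
    (hC : ∀ n z, w z ≠ 0 → |c n z| ≤ C)
    (hlim : ∀ z, w z ≠ 0 → Tendsto (fun n => c n z) atTop (𝓝 (c₀ z))) :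
    Tendsto (fun n => ∫ z, w z * c n z ∂μ) atTop (𝓝 (∫ z, w z * c₀ z ∂μ)) := by
  refine tendsto_integral_of_dominated_convergence (fun z => ‖w z‖ * C)
    (fun n => hw.aestronglyMeasurable.mul (hc n).aestronglyMeasurable) (hw.norm.mul_const C)
    (fun n => Eventually.of_forall fun z => ?_) (Eventually.of_forall fun z => ?_)
  · rw [norm_mul]
    by_cases h0 : w z = 0
    · simp [h0]
    · exact mul_le_mul_of_nonneg_left (hC n z h0) (norm_nonneg _)
  · by_cases h0 : w z = 0
    · simp [h0]
    · exact (hlim z h0).const_mul _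

/-- The shift is carried over to the continuous factor `p`, since `u` is only measurable and locally
bounded. -/
theorem continuous_integral_mul_translate {p u : ℝ × E3 → ℝ} (hp : Continuous p)
    (hc : HasCompactSupport p) (hs : tsupport p ⊆ I ×ˢ univ) (hu : LocBdd I u) :
    Continuous fun r : E3 => ∫ z, p z * u (z + ((0 : ℝ), r)) := by
  have e : ∀ r : E3, ∫ z, p z * u (z + ((0 : ℝ), r)) = ∫ z, p (z - ((0 : ℝ), r)) * u z := by
    intro r
    rw [← integral_add_right_eq_self (fun z => p (z - ((0 : ℝ), r)) * u z) ((0 : ℝ), r)]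
    simp only [add_sub_cancel_right]
  simp only [e]
  obtain ⟨K, hK, hKI, R, hR⟩ := exists_bound_of_hasCompactSupport hc hs
  obtain ⟨Cp, hCp⟩ := hp.bounded_above_of_compact_support hc
  refine continuous_iff_continuousAt.2 fun r₀ => ?_
  obtain ⟨C, hC0, hC⟩ := hu.bdd K hK hKI (R + ‖r₀‖ + 1)
  have hCp0 : 0 ≤ Cp := (norm_nonneg _).trans (hCp 0)
  refine continuousAt_of_dominated (bound := (K ×ˢ Metric.closedBall (0 : E3)
    (R + ‖r₀‖ + 1)).indicator fun _ => Cp * C) (Eventually.of_forall fun r => ?_) ?_ ?_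
    (Eventually.of_forall fun z => ?_)
  · exact (Continuous.aestronglyMeasurable (by fun_prop)).mul hu.meas.aestronglyMeasurable
  · filter_upwards [Metric.ball_mem_nhds r₀ one_pos] with r hr
    refine Eventually.of_forall fun z => ?_
    by_cases hz : z - ((0 : ℝ), r) ∈ tsupport p
    · obtain ⟨h1, h2⟩ := hR _ hz
      have h1' : z.1 ∈ K := by simpa using h1
      have h2' : ‖z.2‖ ≤ R + ‖r₀‖ + 1 := by
        have h3 : ‖r - r₀‖ < 1 := by rwa [← dist_eq_norm]
        have h4 : ‖z.2 - r‖ ≤ R := by simpa using h2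
        calc ‖z.2‖ = ‖(z.2 - r) + (r - r₀) + r₀‖ := by congr 1; abel
          _ ≤ ‖z.2 - r‖ + ‖r - r₀‖ + ‖r₀‖ := norm_add₃_le
          _ ≤ _ := by linarith
      have hmem : z ∈ K ×ˢ Metric.closedBall (0 : E3) (R + ‖r₀‖ + 1) :=
        ⟨h1', mem_closedBall_zero_iff.2 h2'⟩
      rw [indicator_of_mem hmem, norm_mul]
      exact mul_le_mul (hCp _) (hC z h1' h2') (norm_nonneg _) hCp0
    · rw [image_eq_zero_of_notMem_tsupport hz, zero_mul, norm_zero]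
      exact indicator_nonneg (fun _ _ => by positivity) _
  · rw [integrable_indicator_iff (hK.measurableSet.prod Metric.isClosed_closedBall.measurableSet)]
    exact integrableOn_const (hK.prod (isCompact_closedBall _ _)).measure_lt_top.ne
  · exact Continuous.continuousAt (by fun_prop)

namespace Model

theorem locBdd_dens (h : Model G I f A) : LocBdd I (dens G I f) where
  meas := h.measurable_dens
  bdd K hK hKI r := by
    obtain ⟨C, hC0, hC⟩ := h.exists_bound_dens hK hKI r
    exact ⟨C, hC0, fun z hz hr => (hC z hz hr).1⟩

theorem locBdd_cur (h : Model G I f A) (i : Fin 3) : LocBdd I (cur G I f i) where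
  meas := h.measurable_cur i
  bdd K hK hKI r := by
    obtain ⟨C, hC0, hC⟩ := h.exists_bound_dens hK hKI r
    exact ⟨C, hC0, fun z hz hr => (hC z hz hr).2 i⟩

end Model

theorem LocBdd.comp_crowdReg (h : Model G I f A) {q : ℝ → ℝ} (hq : Continuous q) {η : E3 → ℝ}
    (hη : ContactWeight G.σ η) : LocBdd I fun z => q (crowdReg G I f η z) where
  meas := hq.measurable.comp (measurable_crowdReg h hη.meas)
  bdd K hK hKI r := by
    obtain ⟨C, hC0, hC⟩ := exists_bound_crowdReg h hK hKI
    obtain ⟨M, hM⟩ := (isCompact_Icc (a := -C) (b := C)).exists_bound_of_continuousOn hq.continuousOn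
    exact ⟨M, (norm_nonneg _).trans (hM 0 ⟨by linarith, hC0⟩),
      fun z hz _ => hM _ (abs_le.1 (hC η hη z hz))⟩

variable (G I f) in
/-- The relative flow of mass between `z` and the point at distance `r`. -/
noncomputable def drift (j : Fin 3) (z : ℝ × E3) (r : E3) : ℝ :=
  dens G I f z * cur G I f j (z + ((0 : ℝ), r)) - cur G I f j z * dens G I f (z + ((0 : ℝ), r))

theorem measurable_drift (h : Model G I f A) (j : Fin 3) :
    Measurable fun p : (ℝ × E3) × E3 => drift G I f j p.1 p.2 :=
  ((h.measurable_dens.comp measurable_fst).mul ((h.measurable_cur j).comp (by fun_prop))).sub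
    (((h.measurable_cur j).comp measurable_fst).mul (h.measurable_dens.comp (by fun_prop)))

theorem exists_bound_drift (h : Model G I f A) {K : Set ℝ} (hK : IsCompact K) (hKI : K ⊆ I)
    (r b : ℝ) (hb : 0 ≤ b) : ∃ C : ℝ, 0 ≤ C ∧ ∀ z : ℝ × E3, z.1 ∈ K → ‖z.2‖ ≤ r → ∀ y : E3, ‖y‖ ≤ b →
      ∀ j, |drift G I f j z y| ≤ C := by
  obtain ⟨C, hC0, hC⟩ := h.exists_bound_dens hK hKI (r + b)
  refine ⟨C * C + C * C, by positivity, fun z hz hr y hy j => ?_⟩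
  have h1 := hC z hz (by linarith)
  have h2 := hC (z + ((0 : ℝ), y)) (by simpa using hz)
    ((norm_add_le _ _).trans (add_le_add hr hy))
  refine (abs_sub _ _).trans ?_
  rw [abs_mul, abs_mul]
  exact add_le_add (mul_le_mul h1.1 (h2.2 j) (abs_nonneg _) hC0)
    (mul_le_mul (h1.2 j) h2.1 (abs_nonneg _) hC0)

/-- Here impermeability enters: conservation of mass tested with the weight itself expresses the
time derivative by the current against the gradient of η, with no loss of mass through ∂D. The space
derivative involves the same gradient with the opposite sign. -/
theorem fderiv_crowdReg (h : Model G I f A) {η : E3 → ℝ} (hη : ContDiff ℝ (⊤ : ℕ∞) η)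
    (hc : HasCompactSupport η) {z : ℝ × E3} (hz : z.1 ∈ I) :
    fderiv ℝ (crowdReg G I f η) z (1, 0)
      = 1 / G.m * ∑ j, ∫ r, fderiv ℝ η r (basisVec j) * cur G I f j (z + ((0 : ℝ), r)) ∧
    ∀ e : E3, fderiv ℝ (crowdReg G I f η) z (0, e)
      = -(1 / G.m * ∫ r, fderiv ℝ η r e * dens G I f (z + ((0 : ℝ), r))) := by
  have hη1 : ContDiff ℝ 1 η := hη.of_le (by simp)
  have hη' : Continuous (fderiv ℝ η) := hη.continuous_fderiv (by simp)
  have hcs : HasCompactSupport fun Y => η (Y - z.2) :=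
    hc.comp_homeomorph (Homeomorph.subRight z.2)
  have hd := ((hasFDerivAt_crowdReg h hη1 hc).1 z ⟨hz, mem_univ _⟩).const_mul (1 / G.m)
  have hsub : ∀ Y, fderiv ℝ (fun Y => η (Y - z.2)) Y = fderiv ℝ η (Y - z.2) := fun Y => by
    simpa [sub_eq_add_neg] using fderiv_comp_add_right (𝕜 := ℝ) (f := η) (x := Y) (-z.2)
  obtain ⟨i1, i2, -⟩ := h.integrable_of_time_slice hz (ψ := fun Y => η (Y - z.2))
    (hη.continuous.comp (by fun_prop)) hcs
  have i3 : Integrable (crowdRegDeriv G I f η z) := by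
    refine Integrable.sub (i2.smul_const _) ?_
    obtain ⟨C, hC0, hC⟩ := h.exists_bound_dens_global isCompact_singleton
      (singleton_subset_iff.2 hz)
    have hcont : Continuous fun Y => (fderiv ℝ η (Y - z.2)).comp
        (ContinuousLinearMap.snd ℝ ℝ E3) := by fun_prop
    have hint : Integrable fun Y => (fderiv ℝ η (Y - z.2)).comp
        (ContinuousLinearMap.snd ℝ ℝ E3) := by
      refine hcont.integrable_of_hasCompactSupport ?_
      have h1 : HasCompactSupport fun Y => fderiv ℝ η (Y - z.2) :=
        (hc.fderiv ℝ).comp_homeomorph (Homeomorph.subRight z.2)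
      exact h1.comp_left (g := fun L : E3 →L[ℝ] ℝ => L.comp (ContinuousLinearMap.snd ℝ ℝ E3))
        (by simp)
    refine (hint.norm.const_mul C).mono' ((h.measurable_dens_right z.1).aestronglyMeasurable.smul
      hcont.aestronglyMeasurable) (Eventually.of_forall fun Y => ?_)
    rw [norm_smul]
    exact mul_le_mul_of_nonneg_right (hC (z.1, Y) rfl).1 (norm_nonneg _)
  have hadd : ∀ r : E3, z + ((0 : ℝ), r) = (z.1, r + z.2) := fun r => by
    ext <;> simp [add_comm]
  have hfd : fderiv ℝ (crowdReg G I f η) z = (1 / G.m) • ∫ Y, crowdRegDeriv G I f η z Y := hd.fderiv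
  constructor
  · rw [hfd, smul_apply, ContinuousLinearMap.integral_apply i3, smul_eq_mul]
    have e1 : ∫ Y, crowdRegDeriv G I f η z Y (1, 0)
        = ∫ Y, densDot G I f (z.1, Y) * η (Y - z.2) := by
      refine integral_congr_ae (Eventually.of_forall fun Y => ?_)
      simp [crowdRegDeriv]
    rw [e1, h.integral_densDot_mul hz (ψ := fun Y => η (Y - z.2))
      (hη.comp (contDiff_id.sub contDiff_const)) hcs]
    congr 1
    refine Finset.sum_congr rfl fun j _ => ?_
    simp only [hsub, hadd]
    rw [← integral_sub_right_eq_self (fun r => fderiv ℝ η r (basisVec j)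
      * cur G I f j (z.1, r + z.2)) z.2]
    simp only [sub_add_cancel, mul_comm]
  · intro e
    rw [hfd, smul_apply, ContinuousLinearMap.integral_apply i3, smul_eq_mul,
      ← mul_neg, ← integral_neg]
    congr 1
    simp only [hadd]
    rw [← integral_sub_right_eq_self (fun r => -(fderiv ℝ η r e * dens G I f (z.1, r + z.2))) z.2]
    refine integral_congr_ae (Eventually.of_forall fun Y => ?_)
    simp [crowdRegDeriv, mul_comm]

/-- The two derivatives combine into the flow of the neighbours relative to the molecule, `drift`,
which is what will appear on the sphere of contact. -/
theorem crowdReg_transport (h : Model G I f A) {η : E3 → ℝ} (hη : ContDiff ℝ (⊤ : ℕ∞) η)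
    (hc : HasCompactSupport η) {z : ℝ × E3} (hz : z.1 ∈ I) :
    dens G I f z * fderiv ℝ (crowdReg G I f η) z (1, 0)
      + ∑ j, cur G I f j z * fderiv ℝ (crowdReg G I f η) z (0, basisVec j)
    = 1 / G.m * ∑ j, ∫ r, fderiv ℝ η r (basisVec j) * drift G I f j z r := by
  obtain ⟨h1, h2⟩ := fderiv_crowdReg h hη hc hz
  have hη' : Continuous (fderiv ℝ η) := hη.continuous_fderiv (by simp)
  have hadd : ∀ r : E3, z + ((0 : ℝ), r) = (z.1, r + z.2) := fun r => by
    ext <;> simp [add_comm]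
  have hi : ∀ j, Integrable (fun r => fderiv ℝ η r (basisVec j) * cur G I f j (z + ((0 : ℝ), r))) ∧
      Integrable (fun r => fderiv ℝ η r (basisVec j) * dens G I f (z + ((0 : ℝ), r))) := by
    intro j
    obtain ⟨i1, -, i3⟩ := h.integrable_of_time_slice hz
      (ψ := fun Y => fderiv ℝ η (Y - z.2) (basisVec j)) (by fun_prop)
      ((hc.fderiv_apply ℝ (basisVec j)).comp_homeomorph (Homeomorph.subRight z.2))
    constructor
    · refine ((i3 j).comp_add_right z.2).congr (Eventually.of_forall fun r => ?_)
      simp [hadd, mul_comm]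
    · refine (i1.comp_add_right z.2).congr (Eventually.of_forall fun r => ?_)
      simp [hadd, mul_comm]
  rw [h1, Finset.mul_sum, Finset.mul_sum, Finset.mul_sum, ← Finset.sum_add_distrib]
  refine Finset.sum_congr rfl fun j _ => ?_
  rw [h2]
  have e : ∫ r, fderiv ℝ η r (basisVec j) * drift G I f j z r
      = dens G I f z * (∫ r, fderiv ℝ η r (basisVec j) * cur G I f j (z + ((0 : ℝ), r)))
        - cur G I f j z * ∫ r, fderiv ℝ η r (basisVec j) * dens G I f (z + ((0 : ℝ), r)) := by
    rw [← integral_const_mul, ← integral_const_mul,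
      ← integral_sub ((hi j).1.const_mul _) ((hi j).2.const_mul _)]
    refine integral_congr_ae (Eventually.of_forall fun r => ?_)
    simp only [drift]
    ring
  rw [e]
  ring

end Potential

end EnskogVlasov

namespace EnskogVlasov

open Filter Topology

variable {G : Gas} {I : Set ℝ} {f : ℝ → E3 → E3 → ℝ} {A : Set ℝ}

/-! ### The chain rule for functions of the number of neighbours, in the weak sense. -/

section ChainRule

variable {φ : ℝ × E3 → ℝ} {q : ℝ → ℝ}

theorem hasDerivAt_primitive (hq : Continuous q) (x : ℝ) :
    HasDerivAt (fun x => ∫ y in (0 : ℝ)..x, q y) (q x) x :=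
  (hq.integral_hasStrictDerivAt 0 x).hasDerivAt

theorem contDiff_primitive (hq : Continuous q) : ContDiff ℝ 1 fun x => ∫ y in (0 : ℝ)..x, q y := by
  rw [show (1 : WithTop ℕ∞) = 0 + 1 from rfl, contDiff_succ_iff_deriv]
  refine ⟨fun x => (hasDerivAt_primitive hq x).differentiableAt, by simp, ?_⟩
  rw [contDiff_zero]
  have : deriv (fun x => ∫ y in (0 : ℝ)..x, q y) = q :=
    funext fun x => (hasDerivAt_primitive hq x).deriv
  rwa [this]

theorem subset_prod_univ : spaceTime G I ⊆ I ×ˢ (univ : Set E3) := fun _ hz => ⟨hz.1, mem_univ _⟩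

/-- The weak transport equation for a function of the smoothed number of neighbours. -/
theorem integral_primitive_crowdReg (h : Model G I f A) (hφ : ContDiff ℝ 1 φ)
    (hc : HasCompactSupport φ) (hs : tsupport φ ⊆ spaceTime G I) (hq : Continuous q)
    {η : E3 → ℝ} (hη : ContDiff ℝ (⊤ : ℕ∞) η) (hηc : HasCompactSupport η) :
    (∫ z, dens G I f z * fderiv ℝ φ z (1, 0) * ∫ y in (0 : ℝ)..(crowdReg G I f η z), q y)
      + ∑ j, ∫ z, cur G I f j z * fderiv ℝ φ z (0, basisVec j)
          * ∫ y in (0 : ℝ)..(crowdReg G I f η z), q y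
    = -(1 / G.m * ∫ z, φ z * q (crowdReg G I f η z)
        * ∑ j, ∫ r, fderiv ℝ η r (basisVec j) * drift G I f j z r) := by
  set R := crowdReg G I f η with hR
  set Q : ℝ → ℝ := fun x => ∫ y in (0 : ℝ)..x, q y with hQ
  have hU := h.isOpen_spaceTime
  have hRc : ContDiffOn ℝ 1 R (spaceTime G I) :=
    (contDiffOn_crowdReg h (hη.of_le (by simp)) hηc).mono subset_prod_univ
  have hQR : ContDiffOn ℝ 1 (fun z => Q (R z)) (spaceTime G I) :=
    (contDiff_primitive hq).comp_contDiffOn hRc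
  have p0 := integral_by_parts (volume : Measure (ℝ × E3)) hU hφ hc hs
    (h.contDiffOn_dens.mul hQR) (1, 0)
  have pj := fun j => integral_by_parts (volume : Measure (ℝ × E3)) hU hφ hc hs
    ((h.contDiffOn_cur j).mul hQR) (0, basisVec j)
  have e0 : ∫ z, dens G I f z * fderiv ℝ φ z (1, 0) * Q (R z)
      = ∫ z, dens G I f z * Q (R z) * fderiv ℝ φ z (1, 0) := by
    congr 1; funext z; ring
  have ej : ∀ j, ∫ z, cur G I f j z * fderiv ℝ φ z (0, basisVec j) * Q (R z)
      = ∫ z, cur G I f j z * Q (R z) * fderiv ℝ φ z (0, basisVec j) := fun j => by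
    congr 1; funext z; ring
  change (∫ z, dens G I f z * fderiv ℝ φ z (1, 0) * Q (R z))
      + ∑ j, ∫ z, cur G I f j z * fderiv ℝ φ z (0, basisVec j) * Q (R z) = _
  simp only [e0, ej]
  rw [p0.2.2, Finset.sum_congr rfl fun j _ => (pj j).2.2, Finset.sum_neg_distrib, ← neg_add,
    ← integral_finsetSum _ fun j _ => (pj j).1,
    ← integral_add p0.1 (integrable_finsetSum _ fun j _ => (pj j).1), ← integral_const_mul]
  congr 1
  refine integral_congr_ae (Eventually.of_forall fun z => ?_)
  by_cases hz : z ∈ tsupport φ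
  · have hzU := hs hz
    have hnhds := hU.mem_nhds hzU
    have d1 : HasFDerivAt (fun z => Q (R z)) (q (R z) • fderiv ℝ R z) z :=
      (hasDerivAt_primitive hq (R z)).comp_hasFDerivAt z
        ((hRc.contDiffAt hnhds).differentiableAt one_ne_zero).hasFDerivAt
    have d2 : HasFDerivAt (dens G I f) (fderiv ℝ (dens G I f) z) z :=
      ((h.contDiffOn_dens.contDiffAt hnhds).differentiableAt one_ne_zero).hasFDerivAt
    have d3 : ∀ j, HasFDerivAt (cur G I f j) (fderiv ℝ (cur G I f j) z) z := fun j =>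
      (((h.contDiffOn_cur j).contDiffAt hnhds).differentiableAt one_ne_zero).hasFDerivAt
    have ht := crowdReg_transport h hη hηc (z := z) hzU.1
    have hcont := h.continuity hzU
    have f0 : fderiv ℝ (fun z => dens G I f z * Q (R z)) z (1, 0)
        = dens G I f z * (q (R z) * fderiv ℝ R z (1, 0))
          + Q (R z) * fderiv ℝ (dens G I f) z (1, 0) := by
      have d4 : HasFDerivAt (fun z => dens G I f z * Q (R z)) _ z := d2.mul d1
      rw [d4.fderiv]; simp
    have fj : ∀ j, fderiv ℝ (fun z => cur G I f j z * Q (R z)) z (0, basisVec j)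
        = cur G I f j z * (q (R z) * fderiv ℝ R z (0, basisVec j))
          + Q (R z) * fderiv ℝ (cur G I f j) z (0, basisVec j) := fun j => by
      have d4 : HasFDerivAt (fun z => cur G I f j z * Q (R z)) _ z := (d3 j).mul d1
      rw [d4.fderiv]; simp
    simp only [← Finset.mul_sum, f0, fj, Finset.sum_add_distrib]
    have hsum : ∑ j, cur G I f j z * (q (R z) * fderiv ℝ R z (0, basisVec j))
        = q (R z) * ∑ j, cur G I f j z * fderiv ℝ R z (0, basisVec j) := by
      rw [Finset.mul_sum]
      exact Finset.sum_congr rfl fun j _ => by ring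
    rw [hsum]
    -- Where the derivative hits the primitive, the transport equation of the smoothed count
    -- applies; where it hits ρ and ρv, the terms cancel by the continuity equation.
    linear_combination (φ z * q (R z)) * ht + (φ z * Q (R z)) * hcont
  · simp [image_eq_zero_of_notMem_tsupport hz]

theorem integrable_drift_kernel (h : Model G I f A) (hφ : Continuous φ)
    (hc : HasCompactSupport φ) (hs : tsupport φ ⊆ I ×ˢ univ) {w : ℝ × E3 → ℝ} (hw : LocBdd I w)
    {k : E3 → ℝ} (hk : Integrable k) {b : ℝ} (hb : 0 ≤ b) (hkb : ∀ r, k r ≠ 0 → ‖r‖ ≤ b) (j : Fin 3) :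
    Integrable (fun p : (ℝ × E3) × E3 => φ p.1 * k p.2 * (w p.1 * drift G I f j p.1 p.2))
      ((volume : Measure (ℝ × E3)).prod volume) := by
  obtain ⟨K, hK, hKI, R, hR⟩ := exists_bound_of_hasCompactSupport hc hs
  obtain ⟨C, hC0, hC⟩ := exists_bound_drift h hK hKI R b hb
  obtain ⟨C', hC0', hC'⟩ := hw.bdd K hK hKI R
  refine integrable_prod_of_bdd (hφ.integrable_of_hasCompactSupport hc) hk (C := C' * C)
    (b := fun z r => w z * drift G I f j z r)
    ((hw.meas.comp measurable_fst).mul (measurable_drift h j)) fun z r hz hr => ?_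
  obtain ⟨h1, h2⟩ := hR z (subset_tsupport φ hz)
  rw [abs_mul]
  exact mul_le_mul (hC' z h1 h2) (hC z h1 h2 r (hkb r hr) j) (abs_nonneg _) hC0'

variable (G I f) in
/-- The drift averaged with the weight `φ w`. -/
noncomputable def driftMean (φ w : ℝ × E3 → ℝ) (j : Fin 3) (r : E3) : ℝ :=
  ∫ z, φ z * (w z * drift G I f j z r)

theorem integral_drift_comm (h : Model G I f A) (hφ : Continuous φ)
    (hc : HasCompactSupport φ) (hs : tsupport φ ⊆ I ×ˢ univ) {w : ℝ × E3 → ℝ} (hw : LocBdd I w)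
    {k : Fin 3 → E3 → ℝ} (hk : ∀ j, Integrable (k j)) {b : ℝ} (hb : 0 ≤ b)
    (hkb : ∀ j r, k j r ≠ 0 → ‖r‖ ≤ b) :
    ∫ z, φ z * w z * ∑ j, ∫ r, k j r * drift G I f j z r
      = ∑ j, ∫ r, k j r * driftMean G I f φ w j r := by
  have hi := fun j => integrable_drift_kernel h hφ hc hs hw (hk j) hb (hkb j) j
  have e : ∀ z, φ z * w z * ∑ j, ∫ r, k j r * drift G I f j z r
      = ∑ j, ∫ r, φ z * k j r * (w z * drift G I f j z r) := by
    intro z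
    rw [Finset.mul_sum]
    refine Finset.sum_congr rfl fun j _ => ?_
    rw [← integral_const_mul]
    congr 1; funext r; ring
  simp only [e]
  rw [integral_finsetSum _ fun j _ => (hi j).integral_prod_left]
  refine Finset.sum_congr rfl fun j _ => ?_
  rw [integral_integral_swap (hi j)]
  congr 1; funext r
  rw [driftMean, ← integral_const_mul]
  congr 1; funext z; ring

/-- The drift may jump in r where X + r crosses ∂D. Averaging over X with a compactly supported
continuous weight removes these jumps, and restriction to a sphere makes sense. -/
theorem continuous_driftMean (h : Model G I f A) (hφ : Continuous φ)
    (hc : HasCompactSupport φ) (hs : tsupport φ ⊆ spaceTime G I) {w : ℝ × E3 → ℝ}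
    (hwc : ContinuousOn w (spaceTime G I)) (j : Fin 3) :
    Continuous (driftMean G I f φ w j) := by
  have hU := h.isOpen_spaceTime
  have hcont : ∀ u : ℝ × E3 → ℝ, LocBdd I u → ContinuousOn u (spaceTime G I) →
      ∀ v : ℝ × E3 → ℝ, LocBdd I v →
      Continuous (fun r : E3 => ∫ z, φ z * (w z * u z) * v (z + ((0 : ℝ), r))) ∧
      ∀ r : E3, Integrable fun z => φ z * (w z * u z) * v (z + ((0 : ℝ), r)) := by
    intro u hu huc v hv
    have hcp := continuous_mul_of_tsupport_subset hU hφ hs (hwc.mul huc)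
    have hts : tsupport (fun z => φ z * (w z * u z)) ⊆ I ×ˢ univ :=
      (tsupport_mul_subset.trans hs).trans subset_prod_univ
    refine ⟨continuous_integral_mul_translate hcp hc.mul_right hts hv, fun r => ?_⟩
    have hvr : LocBdd I fun z => v (z + ((0 : ℝ), r)) := by
      refine ⟨hv.meas.comp (by fun_prop), fun K hK hKI R => ?_⟩
      obtain ⟨C, hC0, hC⟩ := hv.bdd K hK hKI (R + ‖r‖)
      exact ⟨C, hC0, fun z hz hr => hC _ (by simpa using hz)
        ((norm_add_le _ _).trans (add_le_add hr le_rfl))⟩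
    exact hvr.integrable_mul hcp hc.mul_right hts
  obtain ⟨c1, i1⟩ := hcont _ h.locBdd_dens h.contDiffOn_dens.continuousOn _ (h.locBdd_cur j)
  obtain ⟨c2, i2⟩ := hcont _ (h.locBdd_cur j) (h.contDiffOn_cur j).continuousOn _ h.locBdd_dens
  refine (c1.sub c2).congr fun r => ?_
  rw [driftMean, Pi.sub_apply, ← integral_sub (i1 r) (i2 r)]
  congr 1; funext z
  simp only [drift]
  ring

theorem integrable_fderiv_edge {σ : ℝ} (hσ : 0 < σ) (n : ℕ) (j : Fin 3) :
    Integrable fun r => fderiv ℝ (edge σ n) r (basisVec j) :=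
  (((contDiff_edge (σ := σ) (n := n)).continuous_fderiv (by simp)).clm_apply
    continuous_const).integrable_of_hasCompactSupport ((hasCompactSupport_edge hσ).fderiv_apply ℝ _)

theorem norm_le_of_fderiv_edge_ne_zero {σ : ℝ} (hσ : 0 < σ) {n : ℕ} {j : Fin 3} {r : E3}
    (hr : fderiv ℝ (edge σ n) r (basisVec j) ≠ 0) : ‖r‖ ≤ σ + 1 := by
  by_contra hh
  rw [not_le] at hh
  rw [fderiv_edge, transSlope_of_nonpos (edgeArg_nonpos hσ hh.le), zero_mul] at hr
  exact hr rfl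

/-- The weak transport equation for a function of the number of neighbours. -/
theorem integral_primitive_crowd (h : Model G I f A) (hφ : ContDiff ℝ 1 φ)
    (hc : HasCompactSupport φ) (hs : tsupport φ ⊆ spaceTime G I) (hq : Continuous q) :
    (∫ z, dens G I f z * fderiv ℝ φ z (1, 0)
        * ∫ y in (0 : ℝ)..(crowdReg G I f (fun r => heavi (G.σ - ‖r‖)) z), q y)
      + ∑ j, ∫ z, cur G I f j z * fderiv ℝ φ z (0, basisVec j)
          * ∫ y in (0 : ℝ)..(crowdReg G I f (fun r => heavi (G.σ - ‖r‖)) z), q y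
    = G.σ ^ 2 / G.m * ∫ α : S2, ∑ j, (α : E3) j * driftMean G I f φ
        (fun z => q (crowdReg G I f (fun r => heavi (G.σ - ‖r‖)) z)) j (G.σ • (α : E3))
          ∂solidAngle := by
  have hs' : tsupport φ ⊆ I ×ˢ univ := hs.trans subset_prod_univ
  have hσ := h.σ_pos
  set R₀ := crowdReg G I f (fun r => heavi (G.σ - ‖r‖)) with hR₀
  set Q : ℝ → ℝ := fun x => ∫ y in (0 : ℝ)..x, q y with hQ
  have hQc : Continuous Q := (contDiff_primitive hq).continuous
  obtain ⟨K, hK, hKI, r, hr⟩ := exists_bound_of_hasCompactSupport hc hs'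
  have hlimR : ∀ z : ℝ × E3, z.1 ∈ I →
      Tendsto (fun n => crowdReg G I f (edge G.σ n) z) atTop (𝓝 (R₀ z)) := fun z hz => by
    rw [hR₀, crowdReg_heavi h hz]
    exact tendsto_crowdReg h hz
  -- uniform bounds for functions of the number of neighbours
  have hbdd : ∀ F : ℝ → ℝ, Continuous F → ∃ M, ∀ η, ContactWeight G.σ η → ∀ z : ℝ × E3, z.1 ∈ K →
      |F (crowdReg G I f η z)| ≤ M := by
    intro F hF
    obtain ⟨C, hC0, hC⟩ := exists_bound_crowdReg h hK hKI
    obtain ⟨M, hM⟩ := (isCompact_Icc (a := -C) (b := C)).exists_bound_of_continuousOn hF.continuousOn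
    exact ⟨M, fun η hη z hz => hM _ (abs_le.1 (hC η hη z hz))⟩
  have hmeas : ∀ F : ℝ → ℝ, Continuous F → ∀ n,
      Measurable fun z => F (crowdReg G I f (edge G.σ n) z) := fun F hF n =>
    hF.measurable.comp (measurable_crowdReg h (contactWeight_edge hσ n).meas)
  -- passage to the limit on the left
  obtain ⟨MQ, hMQ⟩ := hbdd Q hQc
  have hleft : ∀ u : ℝ × E3 → ℝ, LocBdd I u → ∀ v : ℝ × E3,
      Tendsto (fun n => ∫ z, u z * fderiv ℝ φ z v * Q (crowdReg G I f (edge G.σ n) z)) atTop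
        (𝓝 (∫ z, u z * fderiv ℝ φ z v * Q (R₀ z))) := by
    intro u hu v
    have hsupp : ∀ z, u z * fderiv ℝ φ z v ≠ 0 → z.1 ∈ K := fun z hz =>
      (hr z (tsupport_fderiv_apply_subset ℝ v (subset_tsupport _ (right_ne_zero_of_mul hz)))).1
    exact tendsto_integral_mul_of_bdd (hu.integrable_mul_fderiv hφ hc hs' v) (hmeas Q hQc)
      (fun n z hz => hMQ _ (contactWeight_edge hσ n) z (hsupp z hz))
      fun z hz => (hQc.tendsto _).comp (hlimR z (hKI (hsupp z hz)))
  have hL := (hleft _ h.locBdd_dens (1, 0)).add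
    (tendsto_finsetSum Finset.univ fun j _ => hleft _ (h.locBdd_cur j) (0, basisVec j))
  refine tendsto_nhds_unique hL ?_
  have hn : ∀ n, (∫ z, dens G I f z * fderiv ℝ φ z (1, 0) * Q (crowdReg G I f (edge G.σ n) z))
      + ∑ j, ∫ z, cur G I f j z * fderiv ℝ φ z (0, basisVec j) * Q (crowdReg G I f (edge G.σ n) z)
      = -(1 / G.m * ∑ j, ∫ r, fderiv ℝ (edge G.σ n) r (basisVec j)
          * driftMean G I f φ (fun z => q (crowdReg G I f (edge G.σ n) z)) j r) := by
    intro n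
    rw [integral_primitive_crowdReg h hφ hc hs hq contDiff_edge (hasCompactSupport_edge hσ),
      integral_drift_comm h hφ.continuous hc hs'
        (LocBdd.comp_crowdReg h hq (contactWeight_edge hσ n)) (integrable_fderiv_edge hσ n)
        (b := G.σ + 1) (by positivity) fun j r hr => norm_le_of_fderiv_edge_ne_zero hσ hr]
  simp only [hn]
  -- passage to the limit on the right
  obtain ⟨Mq, hMq⟩ := hbdd q hq
  obtain ⟨C, hC0, hC⟩ := exists_bound_drift h hK hKI r (G.σ + 1) (by positivity)
  have hφi : Integrable φ := hφ.continuous.integrable_of_hasCompactSupport hc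
  have hsupp : ∀ z, φ z ≠ 0 → z.1 ∈ K ∧ ‖z.2‖ ≤ r := fun z hz => hr z (subset_tsupport _ hz)
  have hqR : LocBdd I fun z => q (R₀ z) := LocBdd.comp_crowdReg h hq (contactWeight_heavi G.σ)
  have hqn : ∀ n, LocBdd I fun z => q (crowdReg G I f (edge G.σ n) z) := fun n =>
    LocBdd.comp_crowdReg h hq (contactWeight_edge hσ n)
  -- Convergence in L¹ with weight |φ| is enough: the drift is bounded for |r| ≤ σ + 1, so the means
  -- converge uniformly in r, as `tendsto_integral_fderiv_edge` requires.
  have hL1 : Tendsto (fun n => ∫ z, |φ z| * |q (crowdReg G I f (edge G.σ n) z) - q (R₀ z)|) atTop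
      (𝓝 0) := by
    have := tendsto_integral_mul_of_bdd hφi.abs (C := Mq + Mq)
      (c := fun n z => |q (crowdReg G I f (edge G.σ n) z) - q (R₀ z)|) (c₀ := fun _ => 0)
      (fun n => ((hmeas q hq n).sub hqR.meas).abs) (fun n z hz => ?_) fun z hz => ?_
    · simpa using this
    · rw [abs_abs]
      refine (abs_sub _ _).trans (add_le_add ?_ ?_)
      · exact hMq _ (contactWeight_edge hσ n) z (hsupp z (abs_ne_zero.1 hz)).1
      · exact hMq _ (contactWeight_heavi G.σ) z (hsupp z (abs_ne_zero.1 hz)).1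
    · have h1 := ((hq.tendsto _).comp (hlimR z (hKI (hsupp z (abs_ne_zero.1 hz)).1))).sub_const
        (q (R₀ z))
      rw [sub_self] at h1
      simpa using h1.abs
  have hdrift : ∀ (j : Fin 3) (y : E3), LocBdd I fun z => drift G I f j z y := by
    intro j y
    refine ⟨(measurable_drift h j).comp (f := fun z => (z, y)) (by fun_prop),
      fun K' hK' hKI' r' => ?_⟩
    obtain ⟨C', hC0', hC'⟩ := exists_bound_drift h hK' hKI' r' ‖y‖ (norm_nonneg _)
    exact ⟨C', hC0', fun z hz hzr => hC' z hz hzr y le_rfl j⟩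
  have hcontR : ContinuousOn (fun z => q (R₀ z)) (spaceTime G I) := by
    refine hq.comp_continuousOn (ContinuousOn.congr (f := fun z => G.crowd f z.1 z.2) ?_ fun z hz => ?_)
    · exact h.continuousOn_crowd.mono subset_prod_univ
    · exact crowdReg_heavi h hz.1
  have hlim := tendsto_integral_fderiv_edge hσ
    (Γ := fun n => driftMean G I f φ fun z => q (crowdReg G I f (edge G.σ n) z))
    (Γ₀ := driftMean G I f φ fun z => q (R₀ z))
    (fun n j => continuous_driftMean h hφ.continuous hc hs
      (hq.comp_continuousOn ((contDiffOn_crowdReg h (contDiff_edge.of_le (by simp))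
        (hasCompactSupport_edge hσ)).continuousOn.mono subset_prod_univ)) j)
    (fun j => continuous_driftMean h hφ.continuous hc hs hcontR j) fun j ε hε => ?_
  · have h2 := (hlim.const_mul (1 / G.m)).neg
    convert h2 using 2
    ring
  · have hε' : 0 < ε / (C + 1) := by positivity
    filter_upwards [hL1.eventually (gt_mem_nhds hε')] with n hnε y hy
    have i1 := fun n => ((hqn n).mul (hdrift j y)).integrable_mul hφ.continuous hc hs'
    have i2 := (hqR.mul (hdrift j y)).integrable_mul hφ.continuous hc hs'
    rw [driftMean, driftMean, ← integral_sub (i1 n) i2]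
    have i3 : Integrable fun z => |φ z| * |q (crowdReg G I f (edge G.σ n) z) - q (R₀ z)| := by
      have := (((hqn n).sub hqR).integrable_mul hφ.continuous hc hs').abs
      simpa only [abs_mul] using this
    refine (abs_integral_le_of_abs_le (i3.mul_const C) fun z => ?_).trans ?_
    · rw [← mul_sub, ← sub_mul, abs_mul, abs_mul, ← mul_assoc]
      by_cases hz : φ z = 0
      · simp [hz]
      · exact mul_le_mul_of_nonneg_left (hC z (hsupp z hz).1 (hsupp z hz).2 y hy j) (by positivity)
    · rw [integral_mul_const]
      rw [lt_div_iff₀ (by positivity)] at hnε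
      have h0 : 0 ≤ ∫ z, |φ z| * |q (crowdReg G I f (edge G.σ n) z) - q (R₀ z)| :=
        integral_nonneg fun z => by positivity
      nlinarith

theorem exch_eq_drift (z : ℝ × E3) (α : S2) :
    exch G I f z (-α) = ∑ j, (α : E3) j * drift G I f j z (G.σ • (α : E3)) := by
  simp only [exch, drift, reach_neg, sub_neg_eq_add, coe_neg_sphere]
  refine Finset.sum_congr rfl fun j _ => ?_
  simp only [PiLp.neg_apply, reach]
  ring

/-- Fubini's theorem, with α → −α because `exch` has the partner at X − σα whereas `drift` is taken
at X + σα. -/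
theorem integral_driftMean (h : Model G I f A) (hφ : Continuous φ) (hc : HasCompactSupport φ)
    (hs : tsupport φ ⊆ I ×ˢ univ) {w : ℝ × E3 → ℝ} (hw : LocBdd I w) :
    ∫ α : S2, ∑ j, (α : E3) j * driftMean G I f φ w j (G.σ • (α : E3)) ∂solidAngle
      = ∫ z, φ z * (w z * ∫ α, exch G I f z α ∂solidAngle) := by
  obtain ⟨K, hK, hKI, r, hr⟩ := exists_bound_of_hasCompactSupport hc hs
  obtain ⟨C, hC0, hC⟩ := exists_bound_drift h hK hKI r G.σ h.σ_pos.le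
  obtain ⟨C', hC0', hC'⟩ := hw.bdd K hK hKI r
  have hφi : Integrable φ := hφ.integrable_of_hasCompactSupport hc
  have hcoord : ∀ j : Fin 3, Measurable fun α : S2 => (α : E3) j := fun j =>
    ((contDiff_coord j).continuous.comp continuous_subtype_val).measurable
  have hi : ∀ j, Integrable (fun p : (ℝ × E3) × S2 => φ p.1 * (p.2 : E3) j
      * (w p.1 * drift G I f j p.1 (G.σ • (p.2 : E3))))
      ((volume : Measure (ℝ × E3)).prod solidAngle) := by
    intro j
    refine integrable_prod_of_bdd hφi (k := fun α : S2 => (α : E3) j)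
      (Integrable.of_bound (hcoord j).aestronglyMeasurable 1 (Eventually.of_forall fun α =>
        (abs_coord_le _ j).trans (norm_dir α).le)) (C := C' * C)
      (b := fun z α => w z * drift G I f j z (G.σ • (α : E3)))
      ((hw.meas.comp measurable_fst).mul ((measurable_drift h j).comp
        (f := fun p : (ℝ × E3) × S2 => (p.1, G.σ • (p.2 : E3))) (by fun_prop)))
      fun z α hz _ => ?_
    obtain ⟨h1, h2⟩ := hr z (subset_tsupport φ hz)
    rw [abs_mul]
    refine mul_le_mul (hC' z h1 h2) (hC z h1 h2 _ ?_ j) (abs_nonneg _) hC0'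
    rw [norm_smul, norm_dir, Real.norm_of_nonneg h.σ_pos.le, mul_one]
  have e1 : ∀ z, φ z * (w z * ∫ α, exch G I f z α ∂solidAngle)
      = ∫ α : S2, ∑ j, φ z * (α : E3) j * (w z * drift G I f j z (G.σ • (α : E3))) ∂solidAngle := by
    intro z
    rw [← integral_neg_sphere, ← integral_const_mul, ← integral_const_mul]
    congr 1; funext α
    rw [exch_eq_drift, Finset.mul_sum, Finset.mul_sum]
    exact Finset.sum_congr rfl fun j _ => by ring
  have e2 : ∀ α : S2, ∑ j, (α : E3) j * driftMean G I f φ w j (G.σ • (α : E3))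
      = ∑ j, ∫ z, φ z * (α : E3) j * (w z * drift G I f j z (G.σ • (α : E3))) := by
    intro α
    refine Finset.sum_congr rfl fun j _ => ?_
    rw [driftMean, ← integral_const_mul]
    congr 1; funext z; ring
  have hi2 : Integrable (fun p : (ℝ × E3) × S2 => ∑ j, φ p.1 * (p.2 : E3) j
      * (w p.1 * drift G I f j p.1 (G.σ • (p.2 : E3))))
      ((volume : Measure (ℝ × E3)).prod solidAngle) := integrable_finsetSum _ fun j _ => hi j
  simp only [e1, e2]
  rw [integral_integral_swap hi2]
  refine integral_congr_ae ?_
  filter_upwards [ae_all_iff.2 fun j => (hi j).prod_left_ae] with α hα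
  rw [integral_finsetSum _ fun j _ => hα j]

/-- On a compact part of space-time the function `S` may be replaced by a continuous function. -/
theorem Model.exists_continuous_extension (h : Model G I f A) {L : Set (ℝ × E3)} (hL : IsCompact L)
    (hLU : L ⊆ spaceTime G I) : ∃ q : ℝ → ℝ, Continuous q ∧ ∀ z ∈ L,
      q (G.crowd f z.1 z.2) = enskog G I f z ∧
      ∫ y in (0 : ℝ)..(G.crowd f z.1 z.2), q y = ∫ y in (0 : ℝ)..(G.crowd f z.1 z.2), G.S y := by
  -- Take the largest value of ℛ on the compact set. Since A is an interval containing 0, all of [0,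
  -- b] lies in A, and S is continued from there by constants; the primitive from 0 to ℛ does not
  -- notice the change.
  obtain ⟨b, hbA, hb0, hb⟩ : ∃ b ∈ A, 0 ≤ b ∧ ∀ z ∈ L, G.crowd f z.1 z.2 ≤ b := by
    rcases L.eq_empty_or_nonempty with he | hne
    · exact ⟨0, h.A_zero, le_rfl, fun z hz => by simp [he] at hz⟩
    · obtain ⟨z₀, hz₀, hmax⟩ := hL.exists_isMaxOn hne
        (h.continuousOn_crowd.mono (hLU.trans subset_prod_univ))
      exact ⟨_, h.crowd_mem _ (hLU hz₀).1 _ (subset_closure (hLU hz₀).2),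
        h.crowd_nonneg (hLU hz₀).1 _, hmax⟩
  have hIcc : Icc 0 b ⊆ A := h.A_conn.out h.A_zero hbA
  have hqS : ∀ x ∈ Icc 0 b, IccExtend hb0 (fun x : Icc (0 : ℝ) b => G.S x) x = G.S x :=
    fun x hx => IccExtend_of_mem hb0 _ hx
  refine ⟨IccExtend hb0 (fun x : Icc (0 : ℝ) b => G.S x),
    (continuousOn_iff_continuous_domRestrict.1 (h.S_cont.mono hIcc)).Icc_extend', fun z hz => ?_⟩
  have h0 := h.crowd_nonneg (hLU hz).1 z.2
  rw [enskog_of_mem (hLU hz)]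
  refine ⟨hqS _ ⟨h0, hb z hz⟩, intervalIntegral.integral_congr fun y hy => ?_⟩
  rw [uIcc_of_le h0] at hy
  exact hqS y ⟨hy.1, hy.2.trans (hb z hz)⟩

theorem Model.continuousOn_primitive (h : Model G I f A) :
    ContinuousOn (fun z : ℝ × E3 => ∫ y in (0 : ℝ)..(G.crowd f z.1 z.2), G.S y)
      (spaceTime G I) := by
  intro z hz
  obtain ⟨L, hL, hzL, hLU⟩ := exists_compact_subset h.isOpen_spaceTime hz
  obtain ⟨q, hq, hqL⟩ := h.exists_continuous_extension hL hLU
  have h1 : ContinuousAt (fun z : ℝ × E3 => ∫ y in (0 : ℝ)..(G.crowd f z.1 z.2), q y) z :=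
    (contDiff_primitive hq).continuous.continuousAt.comp (h.continuousOn_crowd.continuousAt
      ((h.openI.prod isOpen_univ).mem_nhds (subset_prod_univ hz)))
  refine (h1.congr ?_).continuousWithinAt
  filter_upwards [mem_interior_iff_mem_nhds.1 hzL] with y hy using (hqL y hy).2

/-- The weak balance of the potential part of the entropy. -/
theorem integral_Hc (h : Model G I f A) (hφ : ContDiff ℝ 1 φ)
    (hc : HasCompactSupport φ) (hs : tsupport φ ⊆ spaceTime G I) :
    (∫ z, dens G I f z * fderiv ℝ φ z (1, 0) * ∫ y in (0 : ℝ)..(G.crowd f z.1 z.2), G.S y)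
      + ∑ j, ∫ z, cur G I f j z * fderiv ℝ φ z (0, basisVec j)
          * ∫ y in (0 : ℝ)..(G.crowd f z.1 z.2), G.S y
    = G.σ ^ 2 / G.m * ∫ z, φ z * ∫ α, potKernel G I f z α ∂solidAngle := by
  have hs' : tsupport φ ⊆ I ×ˢ univ := hs.trans subset_prod_univ
  obtain ⟨q, hqc, hval⟩ := h.exists_continuous_extension hc hs
  have hmain := integral_primitive_crowd h hφ hc hs hqc
  rw [integral_driftMean h hφ.continuous hc hs'
    (LocBdd.comp_crowdReg h hqc (contactWeight_heavi G.σ))] at hmain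
  have e1 : ∀ (u : ℝ × E3 → ℝ) (v : ℝ × E3), ∫ z, u z * fderiv ℝ φ z v
        * ∫ y in (0 : ℝ)..(crowdReg G I f (fun r => heavi (G.σ - ‖r‖)) z), q y
      = ∫ z, u z * fderiv ℝ φ z v * ∫ y in (0 : ℝ)..(G.crowd f z.1 z.2), G.S y := by
    intro u v
    congr 1; funext z
    by_cases hz : z ∈ tsupport φ
    · rw [crowdReg_heavi h (hs hz).1, (hval z hz).2]
    · have : fderiv ℝ φ z v = 0 := by
        rw [image_eq_zero_of_notMem_tsupport fun hh => hz (tsupport_fderiv_subset ℝ hh)]; rfl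
      rw [this, mul_zero, zero_mul, zero_mul]
  simp only [e1] at hmain
  rw [hmain]
  congr 2; funext z
  by_cases hz : z ∈ tsupport φ
  · rw [crowdReg_heavi h (hs hz).1, (hval z hz).1]
    simp only [potKernel]
    rw [integral_const_mul]
  · simp [image_eq_zero_of_notMem_tsupport hz]

end ChainRule

end EnskogVlasov

namespace EnskogVlasov

open Filter Topology

variable {G : Gas} {I : Set ℝ} {f : ℝ → E3 → E3 → ℝ} {A : Set ℝ}

/-! ### From weak balances to balance inequalities. -/

section Pairing

variable {U : Set (ℝ × E3)} {φ : ℝ × E3 → ℝ} {u v : ℝ → E3 → ℝ} {J L : ℝ → E3 → Fin 3 → ℝ}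

theorem deriv_time_eq {φ : ℝ × E3 → ℝ} {z : ℝ × E3} (hφ : DifferentiableAt ℝ φ z) :
    deriv (fun s => φ (s, z.2)) z.1 = fderiv ℝ φ z (1, 0) := by
  have h1 : HasDerivAt (fun s => φ (s, z.2)) (fderiv ℝ φ z (1, 0)) z.1 :=
    HasFDerivAt.comp_hasDerivAt z.1 (l := φ) hφ.hasFDerivAt
      ((hasDerivAt_id z.1).prodMk (hasDerivAt_const z.1 z.2))
  exact h1.deriv

theorem pd_space_eq {φ : ℝ × E3 → ℝ} {z : ℝ × E3} (hφ : DifferentiableAt ℝ φ z) (i : Fin 3) :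
    pd i (fun Y => φ (z.1, Y)) z.2 = fderiv ℝ φ z (0, basisVec i) := by
  have h1 : HasFDerivAt (fun Y => φ (z.1, Y)) _ z.2 :=
    HasFDerivAt.comp z.2 (g := φ) hφ.hasFDerivAt (hasFDerivAt_prodMk_right z.1 z.2)
  rw [pd, h1.fderiv]
  simp

theorem pairing_eq_integral (hφ : ContDiff ℝ 1 φ) :
    pairing u J φ = ∫ z : ℝ × E3, (u z.1 z.2 * fderiv ℝ φ z (1, 0)
      + ∑ i, J z.1 z.2 i * fderiv ℝ φ z (0, basisVec i)) := by
  have hd := hφ.differentiable one_ne_zero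
  simp only [pairing, deriv_time_eq (hd _), pd_space_eq (hd _)]

theorem integrable_mul_fderiv_of_locallyIntegrableOn {w : ℝ × E3 → ℝ} (hφ : ContDiff ℝ 1 φ)
    (hc : HasCompactSupport φ) (hs : tsupport φ ⊆ U) (hw : LocallyIntegrableOn w U)
    (e : ℝ × E3) : Integrable fun z => w z * fderiv ℝ φ z e :=
  integrable_mul_of_locallyIntegrableOn volume (continuous_fderiv_apply_of_contDiff hφ e)
    (hc.fderiv_apply ℝ e) ((tsupport_fderiv_apply_subset ℝ e).trans hs) hw

theorem pairing_eq_sum (hφ : ContDiff ℝ 1 φ) (hc : HasCompactSupport φ) (hs : tsupport φ ⊆ U)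
    (hu : LocallyIntegrableOn (fun z : ℝ × E3 => u z.1 z.2) U)
    (hJ : ∀ i, LocallyIntegrableOn (fun z : ℝ × E3 => J z.1 z.2 i) U) :
    pairing u J φ = (∫ z : ℝ × E3, u z.1 z.2 * fderiv ℝ φ z (1, 0))
      + ∑ i, ∫ z : ℝ × E3, J z.1 z.2 i * fderiv ℝ φ z (0, basisVec i) := by
  have i1 := integrable_mul_fderiv_of_locallyIntegrableOn hφ hc hs hu (1, 0)
  have i2 := fun i => integrable_mul_fderiv_of_locallyIntegrableOn hφ hc hs (hJ i) (0, basisVec i)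
  rw [pairing_eq_integral hφ, integral_add i1 (integrable_finsetSum _ fun i _ => i2 i),
    integral_finsetSum _ fun i _ => i2 i]

/-- A weak balance with nonnegative production is a balance inequality. -/
theorem balanceLE_of_pairing (hU : IsOpen U)
    (hu : LocallyIntegrableOn (fun z : ℝ × E3 => u z.1 z.2) U)
    (hJ : ∀ i, LocallyIntegrableOn (fun z : ℝ × E3 => J z.1 z.2 i) U)
    (hp : ∀ φ, IsTest U φ → (∀ z, 0 ≤ φ z) → 0 ≤ pairing u J φ) : BalanceLE U u J where
  density_int := hu
  flux_int := hJ
  weak := hp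
  classical t X hz hdu hdJ := by
    -- The index `none` stands for the density with the time direction, `some i` for the i-th flux
    -- component.
    have hw := sum_fderiv_nonpos_of_weak (volume : Measure (ℝ × E3)) hU
      (fun k : Option (Fin 3) => k.elim (fun z : ℝ × E3 => u z.1 z.2) fun i z => J z.1 z.2 i)
      (fun k => k.elim ((1 : ℝ), (0 : E3)) fun i => ((0 : ℝ), basisVec i))
      (fun k => by cases k with
        | none => exact hu
        | some i => exact hJ i)
      (fun φ hφ hc hs h0 => by
        have := hp φ ⟨hφ, hc, hs⟩ h0
        rw [pairing_eq_integral (hφ.of_le (by simp))] at this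
        simpa only [Fintype.sum_option, Option.elim] using this) hz
      (fun k => by cases k with
        | none => exact hdu
        | some i => exact hdJ i)
    rw [Fintype.sum_option] at hw
    have e0 := deriv_time_eq hdu
    have e1 := fun i => pd_space_eq (hdJ i) i
    simp only at e0 e1
    simp only [e0, e1]
    exact hw

end Pairing

/-! ### The fluxes of the H function as jump fluxes, and the weak entropy balance. -/

section Entropy

variable {φ : ℝ × E3 → ℝ}

/-- The molecule sits at X + τσα and its partner at X + (τ − 1)σα: for τ between 0 and 1 the point X
runs over the segment joining the two centres. -/
theorem contact_shift (z : ℝ × E3) (α : S2) (τ : ℝ) :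
    z + τ • ((0 : ℝ), G.σ • (α : E3)) = (z.1, z.2 + (τ * G.σ) • (α : E3)) := by
  ext
  · simp
  · simp [mul_assoc]

theorem contact_shift_sub (z : ℝ × E3) (α : S2) (τ : ℝ) :
    z + τ • ((0 : ℝ), G.σ • (α : E3)) - reach G α
      = (z.1, z.2 + ((τ - 1) * G.σ) • (α : E3)) := by
  rw [contact_shift, reach_sub]
  ext
  · simp
  · simp [sub_mul, sub_smul]
    ring

/-- J^(k) transports the antisymmetric half of the entropy transfer along the line of centres. One
factor σ of σ³ belongs to the displacement σα, and the 2 in the denominator is from the splitting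
into halves. -/
theorem Model.jk_eq (h : Model G I f A) {z : ℝ × E3} (hz : z ∈ spaceTime G I) (i : Fin 3) :
    G.Jk f z.1 z.2 i = G.σ ^ 2 / (2 * G.m)
      * jumpFlux collMeasure (fun w => G.σ • (w.2.2 : E3)) (transfer G I f (logWeight G I f)) i z := by
  rw [jumpFlux, integral_coll (((collWeight_log h).kernelBdd h).integrable_inner hz.1 i), Gas.Jk,
    show G.σ ^ 3 / (2 * G.m) = G.σ ^ 2 / (2 * G.m) * G.σ by ring, mul_assoc]
  congr 1
  simp only [← integral_const_mul, ← intervalIntegral.integral_const_mul]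
  congr 1; funext ξ
  congr 1; funext ξs
  congr 1; funext α
  refine intervalIntegral.integral_congr fun τ _ => ?_
  have e1 := contact_shift (G := G) z α τ
  have e2 := contact_shift_sub (G := G) z α τ
  simp only [transfer, kern, pairDensity, logWeight, rate, e2]
  simp only [e1]
  have key := g_mul_mul (G := G) (f := f) hz.1 (z.2 + (τ * G.σ) • (α : E3))
    (z.2 + ((τ - 1) * G.σ) • (α : E3)) ξ ξs
  by_cases h1 : (z.1, z.2 + (τ * G.σ) • (α : E3)) ∈ spaceTime G I
  · have p1 := fun η => (h.pos h1 η).ne'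
    rw [Real.log_div (p1 _) (p1 _)]
    simp only [cut_of_mem h1] at key ⊢
    simp only [PiLp.smul_apply, smul_eq_mul]
    linear_combination (G.σ * (α : E3) i * (Real.log (f z.1 (z.2 + (τ * G.σ) • (α : E3)) (post α ξ ξs))
      - Real.log (f z.1 (z.2 + (τ * G.σ) • (α : E3)) ξ)) * (relV α ξ ξs * heavi (relV α ξ ξs))) * key
  · have hX : z.2 + (τ * G.σ) • (α : E3) ∉ G.D := fun hh => h1 ⟨hz.1, hh⟩
    simp [cut_of_notMem h1, Gas.g, Gas.chi, indicator_of_notMem hX]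

theorem hc_eq {z : ℝ × E3} (hz : z ∈ spaceTime G I) :
    G.Hc f z.1 z.2 = dens G I f z * ∫ y in (0 : ℝ)..(G.crowd f z.1 z.2), G.S y := by
  rw [Gas.Hc, dens_of_mem hz]

/-- The first part convects H^(c); the second carries half the difference of `potKernel` and its
translate, left over when H^(c) cancels the indefinite part of the collision term. -/
theorem Model.jc_eq (h : Model G I f A) {z : ℝ × E3} (hz : z ∈ spaceTime G I) (i : Fin 3) :
    G.Jc f z.1 z.2 i = cur G I f i z * (∫ y in (0 : ℝ)..(G.crowd f z.1 z.2), G.S y)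
      - G.σ ^ 2 / (2 * G.m)
        * jumpFlux solidAngle (fun α => G.σ • (α : E3)) (potKernel G I f) i z := by
  rw [Gas.Jc, hc_eq hz, ← h.dens_mul_vel hz i,
    show G.σ ^ 3 / (2 * G.m) = G.σ ^ 2 / (2 * G.m) * G.σ by ring, mul_assoc (G.σ ^ 2 / (2 * G.m))]
  congr 1
  · ring
  congr 1
  simp only [jumpFlux, ← integral_const_mul, ← intervalIntegral.integral_const_mul]
  congr 1; funext α
  refine intervalIntegral.integral_congr fun τ _ => ?_
  have e1 := contact_shift (G := G) z α τ
  have e2 := contact_shift_sub (G := G) z α τ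
  simp only [potKernel, exch, e2]
  simp only [e1]
  by_cases h1 : (z.1, z.2 + (τ * G.σ) • (α : E3)) ∈ spaceTime G I
  · by_cases h2 : (z.1, z.2 + ((τ - 1) * G.σ) • (α : E3)) ∈ spaceTime G I
    · simp only [← h.dens_mul_vel h1, ← h.dens_mul_vel h2, dens_of_mem h1, dens_of_mem h2,
        enskog_of_mem h1, Gas.chi, indicator_of_mem h1.2, indicator_of_mem h2.2,
        PiLp.smul_apply, smul_eq_mul, Fin.sum_univ_three]
      ring
    · have hX : z.2 + ((τ - 1) * G.σ) • (α : E3) ∉ G.D := fun hh => h2 ⟨hz.1, hh⟩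
      simp [Gas.chi, indicator_of_notMem hX, dens_of_notMem h2, cur_of_notMem h2]
  · have hX : z.2 + (τ * G.σ) • (α : E3) ∉ G.D := fun hh => h1 ⟨hz.1, hh⟩
    simp [Gas.chi, indicator_of_notMem hX, enskog_of_notMem h1]

theorem h_eq {z : ℝ × E3} (hz : z ∈ spaceTime G I) :
    G.H f z.1 z.2 = moment f (fun _ => 1) (fun x => x * Real.log x) z
      + dens G I f z * ∫ y in (0 : ℝ)..(G.crowd f z.1 z.2), G.S y := by
  rw [Gas.H, hc_eq hz, Gas.Hk, moment]
  simp only [one_mul]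

theorem Model.jh_eq (h : Model G I f A) {z : ℝ × E3} (hz : z ∈ spaceTime G I) (i : Fin 3) :
    G.JH f z.1 z.2 i = (moment f (fun ξ => ξ i * 1) (fun x => x * Real.log x) z
      + cur G I f i z * ∫ y in (0 : ℝ)..(G.crowd f z.1 z.2), G.S y)
      + G.σ ^ 2 / (2 * G.m) * (jumpFlux collMeasure (fun w => G.σ • (w.2.2 : E3))
          (transfer G I f (logWeight G I f)) i z
        - jumpFlux solidAngle (fun α => G.σ • (α : E3)) (potKernel G I f) i z) := by
  rw [Gas.JH, h.jk_eq hz, h.jc_eq hz, moment]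
  simp only [mul_one, mul_assoc]
  ring

theorem locallyIntegrableOn_of_eqOn {U : Set (ℝ × E3)} {u v : ℝ × E3 → ℝ} (hU : MeasurableSet U)
    (hv : LocallyIntegrableOn v U) (huv : ∀ z ∈ U, u z = v z) : LocallyIntegrableOn u U :=
  fun z hz => by
    obtain ⟨s, hs, hi⟩ := hv z hz
    refine ⟨s ∩ U, inter_mem hs self_mem_nhdsWithin, ?_⟩
    exact (hi.mono_set inter_subset_left).congr_fun_ae
      (ae_restrict_of_ae_restrict_of_subset inter_subset_right
        (ae_restrict_of_forall_mem hU fun z hz => (huv z hz).symm))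

theorem Model.locallyIntegrableOn_of_continuousOn (h : Model G I f A) {u : ℝ × E3 → ℝ}
    (hu : ContinuousOn u (spaceTime G I)) : LocallyIntegrableOn u (spaceTime G I) :=
  hu.locallyIntegrableOn h.isOpen_spaceTime.measurableSet

theorem Model.locallyIntegrableOn_h (h : Model G I f A) :
    LocallyIntegrableOn (fun z : ℝ × E3 => G.H f z.1 z.2) (spaceTime G I) := by
  refine locallyIntegrableOn_of_eqOn h.isOpen_spaceTime.measurableSet
    (h.locallyIntegrableOn_of_continuousOn ?_) fun z hz => h_eq hz
  exact (admissible_log.contDiffOn_moment h).continuousOn.add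
    (h.contDiffOn_dens.continuousOn.mul h.continuousOn_primitive)

theorem Model.locallyIntegrableOn_jh (h : Model G I f A) (i : Fin 3) :
    LocallyIntegrableOn (fun z : ℝ × E3 => G.JH f z.1 z.2 i) (spaceTime G I) := by
  refine locallyIntegrableOn_of_eqOn h.isOpen_spaceTime.measurableSet
    (LocallyIntegrableOn.add (h.locallyIntegrableOn_of_continuousOn ?_) ?_) fun z hz => h.jh_eq hz i
  · exact ((admissible_coord_log i).contDiffOn_moment h).continuousOn.add
      ((h.contDiffOn_cur i).continuousOn.mul h.continuousOn_primitive)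
  · exact ((LocBdd.const _).mul ((((collWeight_log h).kernelBdd h).locBdd_flux i).sub
      ((kernelBdd_pot h).locBdd_flux i))).locallyIntegrableOn h.openI subset_prod_univ

variable (G I f) in
/-- The production of entropy (with the sign of the production of the H function reversed). -/
noncomputable def production (z : ℝ × E3) : ℝ :=
  G.σ ^ 2 / (2 * G.m) * ∫ w, diss G I f z w ∂collMeasure

theorem mul_congr_of_tsupport {U : Set (ℝ × E3)} (hs : tsupport φ ⊆ U) {u v : ℝ × E3 → ℝ}
    (huv : ∀ z ∈ U, u z = v z) (e : ℝ × E3) (z : ℝ × E3) :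
    u z * fderiv ℝ φ z e = v z * fderiv ℝ φ z e := by
  by_cases hz : z ∈ tsupport φ
  · rw [huv z (hs hz)]
  · have : fderiv ℝ φ z e = 0 := by
      rw [image_eq_zero_of_notMem_tsupport fun hh => hz (tsupport_fderiv_subset ℝ hh)]; rfl
    rw [this, mul_zero, mul_zero]

theorem integral_add_add_mul_sub {Ω : Type*} [MeasurableSpace Ω] {μ : Measure Ω}
    {a b p q : Ω → ℝ} (ha : Integrable a μ) (hb : Integrable b μ) (hp : Integrable p μ)
    (hq : Integrable q μ) (c : ℝ) : ∫ z, (a z + b z + c * (p z - q z)) ∂μ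
      = (∫ z, a z ∂μ) + (∫ z, b z ∂μ) + c * ((∫ z, p z ∂μ) - ∫ z, q z ∂μ) := by
  have h1 : Integrable (fun z => a z + b z) μ := ha.add hb
  have h2 : Integrable (fun z => c * (p z - q z)) μ := (hp.sub hq).const_mul c
  rw [integral_add h1 h2, integral_add ha hb, integral_const_mul, integral_sub hp hq]

/-- The weak entropy balance. -/
theorem pairing_entropy (h : Model G I f A) (hφ : ContDiff ℝ 1 φ) (hc : HasCompactSupport φ)
    (hs : tsupport φ ⊆ spaceTime G I) :
    pairing (G.H f) (G.JH f) φ = ∫ z, φ z * production G I f z := by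
  have hs' : tsupport φ ⊆ I ×ˢ univ := hs.trans subset_prod_univ
  have hU := h.isOpen_spaceTime
  set c := G.σ ^ 2 / (2 * G.m) with hcdef
  have hc2 : G.σ ^ 2 / G.m = 2 * c := by rw [hcdef]; field_simp
  set Ψ : ℝ × E3 → ℝ := fun z => ∫ y in (0 : ℝ)..(G.crowd f z.1 z.2), G.S y with hΨ
  set FT := jumpFlux collMeasure (fun w : Coll => G.σ • (w.2.2 : E3))
    (transfer G I f (logWeight G I f)) with hFT
  set FP := jumpFlux solidAngle (fun α : S2 => G.σ • (α : E3)) (potKernel G I f) with hFP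
  have kT := (collWeight_log h).kernelBdd h
  have kP := kernelBdd_pot h
  -- the kinetic part
  have m0 := integral_by_parts (volume : Measure (ℝ × E3)) hU hφ hc hs
    (admissible_log.contDiffOn_moment h) (1, 0)
  have mj := fun j => integral_by_parts (volume : Measure (ℝ × E3)) hU hφ hc hs
    ((admissible_coord_log j).contDiffOn_moment h) (0, basisVec j)
  have hP0 : ∀ u : ℝ × E3 → ℝ, ContinuousOn u (spaceTime G I) → ∀ e : ℝ × E3,
      Integrable fun z => u z * fderiv ℝ φ z e := fun u hu e =>
    integrable_mul_fderiv_of_locallyIntegrableOn hφ hc hs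
      (h.locallyIntegrableOn_of_continuousOn hu) e
  have hΨc : ContinuousOn Ψ (spaceTime G I) := h.continuousOn_primitive
  have i1 : Integrable fun z => dens G I f z * Ψ z * fderiv ℝ φ z (1, 0) :=
    hP0 _ (h.contDiffOn_dens.continuousOn.mul hΨc) _
  have i2 : ∀ j, Integrable fun z => cur G I f j z * Ψ z * fderiv ℝ φ z (0, basisVec j) := fun j =>
    hP0 _ ((h.contDiffOn_cur j).continuousOn.mul hΨc) _
  have i3 : ∀ j, Integrable fun z => FT j z * fderiv ℝ φ z (0, basisVec j) := fun j =>
    (kT.locBdd_flux j).integrable_mul_fderiv hφ hc hs' _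
  have i4 : ∀ j, Integrable fun z => FP j z * fderiv ℝ φ z (0, basisVec j) := fun j =>
    (kP.locBdd_flux j).integrable_mul_fderiv hφ hc hs' _
  rw [pairing_eq_sum hφ hc hs h.locallyIntegrableOn_h h.locallyIntegrableOn_jh]
  have hJ : ∀ j, ∫ z : ℝ × E3, G.JH f z.1 z.2 j * fderiv ℝ φ z (0, basisVec j)
      = ∫ z, ((moment f (fun ξ => ξ j * 1) (fun x => x * Real.log x) z
        + cur G I f j z * Ψ z) + c * (FT j z - FP j z)) * fderiv ℝ φ z (0, basisVec j) := fun j => by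
    congr 1; funext z
    exact mul_congr_of_tsupport hs (fun z hz => h.jh_eq hz j) _ z
  have hH : ∫ z : ℝ × E3, G.H f z.1 z.2 * fderiv ℝ φ z (1, 0)
      = ∫ z, (moment f (fun _ => 1) (fun x => x * Real.log x) z + dens G I f z * Ψ z)
        * fderiv ℝ φ z (1, 0) := by
    congr 1; funext z
    exact mul_congr_of_tsupport hs (fun z hz => h_eq hz) _ z
  have e0 : ∫ z, (moment f (fun _ => 1) (fun x => x * Real.log x) z + dens G I f z * Ψ z)
        * fderiv ℝ φ z (1, 0)
      = (∫ z, moment f (fun _ => 1) (fun x => x * Real.log x) z * fderiv ℝ φ z (1, 0))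
        + ∫ z, dens G I f z * fderiv ℝ φ z (1, 0) * Ψ z := by
    simp only [add_mul]
    rw [integral_add m0.2.1 i1]
    congr 2; funext z; ring
  have ej : ∀ j, ∫ z, ((moment f (fun ξ => ξ j * 1) (fun x => x * Real.log x) z
        + cur G I f j z * Ψ z) + c * (FT j z - FP j z)) * fderiv ℝ φ z (0, basisVec j)
      = (∫ z, moment f (fun ξ => ξ j * 1) (fun x => x * Real.log x) z
          * fderiv ℝ φ z (0, basisVec j))
        + (∫ z, cur G I f j z * fderiv ℝ φ z (0, basisVec j) * Ψ z)
        + c * ((∫ z, FT j z * fderiv ℝ φ z (0, basisVec j))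
          - ∫ z, FP j z * fderiv ℝ φ z (0, basisVec j)) := by
    intro j
    have e : ∀ z, cur G I f j z * fderiv ℝ φ z (0, basisVec j) * Ψ z
        = cur G I f j z * Ψ z * fderiv ℝ φ z (0, basisVec j) := fun z => by ring
    simp only [e]
    rw [← integral_add_add_mul_sub (mj j).2.1 (i2 j) (i3 j) (i4 j)]
    congr 1; funext z
    ring
  rw [hH, e0, Finset.sum_congr rfl fun j _ => (hJ j).trans (ej j), Finset.sum_add_distrib, Finset.sum_add_distrib,
    ← Finset.mul_sum, Finset.sum_sub_distrib]
  -- the four balances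
  have b1 : (∫ z, moment f (fun _ => 1) (fun x => x * Real.log x) z * fderiv ℝ φ z (1, 0))
      + ∑ j, ∫ z, moment f (fun ξ => ξ j * 1) (fun x => x * Real.log x) z
          * fderiv ℝ φ z (0, basisVec j)
      = -(2 * c * ∫ z, φ z * ∫ w, transfer G I f (logWeight G I f) z w ∂collMeasure) := by
    rw [m0.2.2, Finset.sum_congr rfl fun j _ => (mj j).2.2, Finset.sum_neg_distrib, ← neg_add,
      ← integral_finsetSum _ fun j _ => (mj j).1,
      ← integral_add m0.1 (integrable_finsetSum _ fun j _ => (mj j).1), ← integral_const_mul]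
    congr 2; funext z
    by_cases hz : z ∈ tsupport φ
    · rw [← Finset.mul_sum, ← mul_add, h.entropy_balance (hs hz), hc2]
      ring
    · simp [image_eq_zero_of_notMem_tsupport hz]
  have b2 := integral_Hc h hφ hc hs
  have b3 := (collWeight_log h).integral_flux h hφ hc hs'
  have b4 := kP.integral_flux hφ hc hs'
  rw [integral_finsetSum _ fun j _ => i3 j] at b3
  rw [integral_finsetSum _ fun j _ => i4 j] at b4
  rw [hc2] at b2
  have lT := kT.locBdd_integral
  have lT' : LocBdd I fun z => ∫ w, transferStar G I f (logWeight G I f) z w ∂collMeasure := by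
    simp only [(collWeight_log h).integral_transferStar h]
    exact kT.locBdd_integral_translate
  have lP := kP.locBdd_integral
  have lP' := kP.locBdd_integral_translate
  have jT := lT.integrable_mul hφ.continuous hc hs'
  have jT' := lT'.integrable_mul hφ.continuous hc hs'
  have jP := lP.integrable_mul hφ.continuous hc hs'
  have jP' := lP'.integrable_mul hφ.continuous hc hs'
  simp only [mul_sub] at b3 b4
  rw [integral_sub jT jT'] at b3
  rw [integral_sub jP jP'] at b4
  have hd : ∫ z, φ z * production G I f z
      = (c * ∫ z, φ z * ∫ α, potKernel G I f z α ∂solidAngle)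
        + (c * ∫ z, φ z * ∫ α, potKernel G I f (z + ((0 : ℝ), G.σ • (α : E3))) α ∂solidAngle)
        + c * (-(∫ z, φ z * ∫ w, transfer G I f (logWeight G I f) z w ∂collMeasure)
          - ∫ z, φ z * ∫ w, transferStar G I f (logWeight G I f) z w ∂collMeasure) := by
    rw [← integral_const_mul, ← integral_const_mul, ← integral_neg,
      ← integral_add_add_mul_sub (jP.const_mul c) (jP'.const_mul c) jT.fun_neg jT']
    congr 1; funext z
    by_cases hz : z ∈ tsupport φ
    · have := (integral_transfer_log h (hs hz).1).2
      simp only [production, ← hcdef]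
      linear_combination (c * φ z) * this
    · simp [image_eq_zero_of_notMem_tsupport hz]
  rw [hd]
  -- Write T, T* and P, P⁺ for the averages of the two transfers, of `potKernel` and of its
  -- translate. The kinetic part gives −2cT, H^(c) gives 2cP, and the fluxes give c(T − T*) and −c(P
  -- − P⁺). The sum c(P + P⁺ − T − T*) is the averaged production.
  linear_combination b1 + b2 + c * b3 - c * b4

end Entropy

end EnskogVlasov

namespace EnskogVlasov

open Filter Topology

variable {G : Gas} {I : Set ℝ} {f : ℝ → E3 → E3 → ℝ} {A : Set ℝ}

/-! ### Nonnegativity of the production and the case of equality. -/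

section Equality

theorem production_nonneg (h : Model G I f A) (z : ℝ × E3) : 0 ≤ production G I f z :=
  mul_nonneg (div_nonneg (sq_nonneg _) (by linarith [h.m_pos]))
    (integral_nonneg fun w => diss_nonneg h z w)

theorem locallyIntegrableOn_production (h : Model G I f A) {U : Set (ℝ × E3)} (hU : IsOpen U)
    (hUs : U ⊆ spaceTime G I) : LocallyIntegrableOn (production G I f) U := by
  have kT := (collWeight_log h).kernelBdd h
  have kP := kernelBdd_pot h
  have lT' : LocBdd I fun z => ∫ w, transferStar G I f (logWeight G I f) z w ∂collMeasure := by
    simp only [(collWeight_log h).integral_transferStar h]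
    exact kT.locBdd_integral_translate
  have hl := (LocBdd.const (G.σ ^ 2 / (2 * G.m))).mul ((kP.locBdd_integral.add
    kP.locBdd_integral_translate).sub (kT.locBdd_integral.add lT'))
  refine locallyIntegrableOn_of_eqOn hU.measurableSet
    (hl.locallyIntegrableOn h.openI (hUs.trans subset_prod_univ)) fun z hz => ?_
  have := (integral_transfer_log h (hUs hz).1).2
  rw [production]
  congr 1
  linarith

/-- The detailed balance condition for the pair of velocities `w` in contact at `z`. -/
def Balanced (G : Gas) (f : ℝ → E3 → E3 → ℝ) (z : ℝ × E3) (w : Coll) : Prop :=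
  f z.1 (z.2 - G.σ • (w.2.2 : E3)) (postStar w.2.2 w.1 w.2.1) * f z.1 z.2 (post w.2.2 w.1 w.2.1)
    = f z.1 z.2 w.1 * f z.1 (z.2 - G.σ • (w.2.2 : E3)) w.2.1

theorem g_eq_of_mem {z : ℝ × E3} {α : S2} (hz : z ∈ spaceTime G I)
    (hz' : z - reach G α ∈ spaceTime G I) :
    G.g f z.1 z.2 (z.2 - G.σ • (α : E3)) = enskog G I f z + enskog G I f (z - reach G α) := by
  rw [enskog_of_mem hz, enskog_of_mem hz']
  rw [reach_sub] at hz' ⊢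
  simp [Gas.g, Gas.chi, indicator_of_mem hz.2, indicator_of_mem hz'.2]

theorem mem_of_g_ne_zero {z : ℝ × E3} {α : S2} (hz : z ∈ spaceTime G I)
    (hg : G.g f z.1 z.2 (z.2 - G.σ • (α : E3)) ≠ 0) : z - reach G α ∈ spaceTime G I := by
  rw [reach_sub]
  refine ⟨hz.1, ?_⟩
  by_contra hh
  exact hg (by simp [Gas.g, Gas.chi, indicator_of_notMem hh])

theorem diss_eq_zero_of_balanced (h : Model G I f A) {z : ℝ × E3} (hz : z ∈ spaceTime G I)
    (w : Coll) (hb : G.g f z.1 z.2 (z.2 - G.σ • (w.2.2 : E3)) ≠ 0 → Balanced G f z w) :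
    diss G I f z w = 0 := by
  by_cases hz' : z - reach G w.2.2 ∈ spaceTime G I
  · rw [diss_of_mem w h hz hz']
    by_cases hg : G.g f z.1 z.2 (z.2 - G.σ • (w.2.2 : E3)) = 0
    · rw [g_eq_of_mem hz hz'] at hg
      rw [hg]; ring
    · have := hb hg
      rw [Balanced] at this
      rw [this, mul_comm (f z.1 z.2 w.1)]
      ring
  · exact diss_of_notMem w fun hh => hz' hh.2

/-- The production does not vanish near a collision that violates detailed balance. -/
theorem eventually_production_pos (h : Model G I f A) {z : ℝ × E3} (hz : z ∈ spaceTime G I)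
    {w : Coll} (hg : G.g f z.1 z.2 (z.2 - G.σ • (w.2.2 : E3)) ≠ 0)
    (hV : 0 < relV w.2.2 w.1 w.2.1) (hb : ¬Balanced G f z w) :
    ∀ᶠ y in 𝓝 z, 0 < production G I f y := by
  have hz' := mem_of_g_ne_zero hz hg
  have hU := h.isOpen_spaceTime
  -- continuity of the factors
  have cr : Continuous fun p : (ℝ × E3) × Coll => p.1 - reach G p.2.2.2 :=
    continuous_fst.sub (continuous_reach.comp (by fun_prop))
  have c1 : Tendsto (fun p : (ℝ × E3) × Coll => p.1 - reach G p.2.2.2) (𝓝 (z, w))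
      (𝓝 (z - reach G w.2.2)) := cr.tendsto (z, w)
  have m1 : ∀ᶠ p : (ℝ × E3) × Coll in 𝓝 (z, w), p.1 ∈ spaceTime G I :=
    continuous_fst.continuousAt.eventually_mem (hU.mem_nhds hz)
  have m2 : ∀ᶠ p : (ℝ × E3) × Coll in 𝓝 (z, w), p.1 - reach G p.2.2.2 ∈ spaceTime G I :=
    c1.eventually_mem (hU.mem_nhds hz')
  have cS : ContinuousAt (fun p : (ℝ × E3) × Coll =>
      enskog G I f p.1 + enskog G I f (p.1 - reach G p.2.2.2)) (z, w) := by
    refine ContinuousAt.add ?_ ?_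
    · exact ContinuousAt.comp (f := fun p : (ℝ × E3) × Coll => p.1)
        (h.continuousOn_enskog.continuousAt (hU.mem_nhds hz)) continuousAt_fst
    · exact ContinuousAt.comp (f := fun p : (ℝ × E3) × Coll => p.1 - reach G p.2.2.2)
        (h.continuousOn_enskog.continuousAt (hU.mem_nhds hz')) cr.continuousAt
  have cf : ∀ (y : (ℝ × E3) × Coll → ℝ × E3) (η : (ℝ × E3) × Coll → E3), Continuous y →
      Continuous η → y (z, w) ∈ spaceTime G I →
      ContinuousAt (fun p => f (y p).1 (y p).2 (η p)) (z, w) := by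
    intro y η hy hη hmem
    have hmem' : ((y (z, w)).1, (y (z, w)).2, η (z, w)) ∈ I ×ˢ G.D ×ˢ (univ : Set E3) :=
      ⟨hmem.1, hmem.2, mem_univ _⟩
    exact ContinuousAt.comp (g := phase f) (f := fun p => ((y p).1, (y p).2, η p))
      (h.phase_contDiffOn.continuousOn.continuousAt (h.isOpen_phase.mem_nhds hmem'))
      (by fun_prop)
  have cp := continuous_post
  have cps := continuous_postStar
  have cX : ContinuousAt (fun p : (ℝ × E3) × Coll =>
      f p.1.1 p.1.2 p.2.1 * f p.1.1 (p.1.2 - G.σ • (p.2.2.2 : E3)) p.2.2.1) (z, w) := by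
    have a1 := cf (fun p => p.1) (fun p => p.2.1) (by fun_prop) (by fun_prop) hz
    have a2 := cf (fun p => p.1 - reach G p.2.2.2) (fun p => p.2.2.1) cr (by fun_prop) hz'
    simp only [reach_sub] at a2
    exact a1.mul a2
  have cY : ContinuousAt (fun p : (ℝ × E3) × Coll =>
      f p.1.1 (p.1.2 - G.σ • (p.2.2.2 : E3)) (postStar p.2.2.2 p.2.1 p.2.2.1)
        * f p.1.1 p.1.2 (post p.2.2.2 p.2.1 p.2.2.1)) (z, w) := by
    have a1 := cf (fun p => p.1) (fun p => post p.2.2.2 p.2.1 p.2.2.1) (by fun_prop)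
      (cp.comp continuous_snd) hz
    have a2 := cf (fun p => p.1 - reach G p.2.2.2) (fun p => postStar p.2.2.2 p.2.1 p.2.2.1) cr
      (cps.comp continuous_snd) hz'
    simp only [reach_sub] at a2
    exact a2.mul a1
  have hS0 : 0 < enskog G I f z + enskog G I f (z - reach G w.2.2) := by
    rw [g_eq_of_mem hz hz'] at hg
    exact lt_of_le_of_ne (add_nonneg (h.enskog_nonneg _) (h.enskog_nonneg _)) hg.symm
  have eS := cS.eventually (lt_mem_nhds hS0)
  have eV : ∀ᶠ p : (ℝ × E3) × Coll in 𝓝 (z, w), 0 < relV p.2.2.2 p.2.1 p.2.2.1 :=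
    (continuous_relV.comp continuous_snd).continuousAt.eventually (lt_mem_nhds hV)
  have eXY := (cY.sub cX).eventually_ne (sub_ne_zero.2 hb)
  have hpos : ∀ᶠ p : (ℝ × E3) × Coll in 𝓝 (z, w), p.1 ∈ spaceTime G I ∧ 0 < diss G I f p.1 p.2 := by
    filter_upwards [m1, m2, eS, eV, eXY] with p p1 p2 pS pV pXY
    refine ⟨p1, lt_of_le_of_ne (diss_nonneg h _ _) fun h0 => pXY ?_⟩
    rw [diss_of_mem p.2 h p1 p2, eq_comm, mul_eq_zero, mul_eq_zero] at h0
    have hr : rate p.2 ≠ 0 := by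
      rw [rate_eq_max, max_eq_left pV.le]; exact pV.ne'
    have q1 := fun ξ => h.pos p1 ξ
    have q2 := fun ξ => h.pos p2 ξ
    rw [reach_sub] at q2
    rcases h0 with (h0 | h0) | h0
    · exact absurd h0 pS.ne'
    · exact absurd h0 hr
    · have := (sub_sub_mul_log_pos (mul_pos (q2 p.2.2.1) (q1 p.2.1))
        (mul_pos (q2 (postStar p.2.2.2 p.2.1 p.2.2.1)) (q1 (post p.2.2.2 p.2.1 p.2.2.1)))).2 h0
      rw [Pi.sub_apply, ← this]
      ring
  -- Positivity of `diss` is open jointly in the point and the collision, so it holds on a product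
  -- of neighbourhoods; the factor in the collision variables has positive measure.
  rw [nhds_prod_eq] at hpos
  obtain ⟨P, hP, Q, hQ, hPQ⟩ := eventually_prod_iff.1 hpos
  filter_upwards [hP] with y hy
  have hyI : y.1 ∈ I := (hPQ hy hQ.self_of_nhds).1.1
  obtain ⟨N, hNQ, hNo, hwN⟩ := mem_nhds_iff.1 hQ
  refine mul_pos (div_pos (pow_pos h.σ_pos 2) (by linarith [h.m_pos])) ?_
  rw [integral_pos_iff_support_of_nonneg (fun w => diss_nonneg h y w)
    (integral_transfer_log h hyI).1]
  refine (hNo.measure_pos collMeasure ⟨w, hwN⟩).trans_le (measure_mono fun v hv => ?_)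
  exact (hPQ hy (hNQ hv)).2.ne'

/-- The case of equality in the entropy inequality. -/
theorem balanceEq_iff (h : Model G I f A) {U : Set (ℝ × E3)} (hU : IsOpen U)
    (hUs : U ⊆ spaceTime G I) :
    BalanceEq U (G.H f) (G.JH f) ↔ ∀ z ∈ U, ∀ w : Coll,
      G.g f z.1 z.2 (z.2 - G.σ • (w.2.2 : E3)) ≠ 0 → Balanced G f z w := by
  constructor
  · intro hE
    have hae : ∀ᵐ z, z ∈ U → production G I f z = 0 := by
      refine hU.ae_eq_zero_of_integral_contDiff_smul_eq_zero
        (locallyIntegrableOn_production h hU hUs) fun φ hφ hc hs => ?_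
      have := hE φ ⟨hφ, hc, hs⟩
      rwa [pairing_entropy h (hφ.of_le (by simp)) hc (hs.trans hUs)] at this
    -- A violation would make the production positive on an open set, which cannot be null. Thus the
    -- condition holds at every point of U although the production is known to vanish only almost
    -- everywhere.
    have key : ∀ z ∈ U, ∀ w : Coll, G.g f z.1 z.2 (z.2 - G.σ • (w.2.2 : E3)) ≠ 0 →
        0 < relV w.2.2 w.1 w.2.1 → Balanced G f z w := by
      intro z hz w hg hV
      by_contra hb
      have h1 := eventually_production_pos h (hUs hz) hg hV hb
      obtain ⟨N, hN, hNo, hzN⟩ := mem_nhds_iff.1 (h1.and (hU.mem_nhds hz))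
      have h2 : volume N = 0 := by
        refine measure_mono_null (fun y hy => ?_) (ae_iff.1 hae)
        exact fun hh => (hN hy).1.ne' (hh (hN hy).2)
      exact (hNo.measure_pos volume ⟨z, hzN⟩).ne' h2
    intro z hz w hg
    -- The production sees V > 0 only. For V < 0 the collision map leads to V > 0 and exchanges the
    -- two sides of the condition; for V = 0 the velocities do not change.
    rcases lt_trichotomy (relV w.2.2 w.1 w.2.1) 0 with hV | hV | hV
    · have := key z hz (collide w) hg (by simp only [collide, relV_post]; linarith)
      simp only [Balanced, collide, post_post, postStar_post] at this ⊢
      linarith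
    · simp only [Balanced, post, postStar, hV, zero_smul, add_zero, sub_zero]
      ring
    · exact key z hz w hg hV
  · intro hb φ hφ
    rw [pairing_entropy h (hφ.smooth.of_le (by simp)) hφ.compact (hφ.supp.trans hUs)]
    rw [integral_eq_zero_of_ae]
    refine Eventually.of_forall fun z => ?_
    by_cases hz : z ∈ tsupport φ
    · have h0 : ∀ w, diss G I f z w = 0 := fun w =>
        diss_eq_zero_of_balanced h (hUs (hφ.supp hz)) w (hb z (hφ.supp hz) w)
      simp [production, h0]
    · simp [image_eq_zero_of_notMem_tsupport hz]

/-- The entropy inequality. -/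
theorem balanceLE_entropy (h : Model G I f A) : BalanceLE (spaceTime G I) (G.H f) (G.JH f) :=
  balanceLE_of_pairing h.isOpen_spaceTime h.locallyIntegrableOn_h h.locallyIntegrableOn_jh
    fun φ hφ h0 => by
      rw [pairing_entropy h (hφ.smooth.of_le (by simp)) hφ.compact hφ.supp]
      exact integral_nonneg fun z => mul_nonneg (h0 z) (production_nonneg h z)

end Equality

end EnskogVlasov

namespace EnskogVlasov

open Filter Topology

variable {G : Gas} {I : Set ℝ} {f : ℝ → E3 → E3 → ℝ} {A : Set ℝ}

/-! ### Linearity of the jump flux in its kernel. -/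

section FluxAlgebra

variable {Ω : Type*} [MeasurableSpace Ω] {μ : Measure Ω} {d : Ω → E3} {a : ℝ × E3 → Ω → ℝ}
  {b : Fin 3 → ℝ × E3 → Ω → ℝ}

theorem KernelBdd.intervalIntegrable (ha : KernelBdd I μ d a) {z : ℝ × E3} (hz : z.1 ∈ I) (w : Ω) :
    IntervalIntegrable (fun τ => a (z + τ • ((0 : ℝ), d w)) w) volume 0 1 := by
  obtain ⟨B, -, -, hb⟩ := ha.bdd {z.1} isCompact_singleton (singleton_subset_iff.2 hz) ‖z.2‖
  rw [intervalIntegrable_iff_integrableOn_Ioc_of_le zero_le_one]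
  have hm : Measurable fun τ : ℝ => a (z + τ • ((0 : ℝ), d w)) w :=
    ha.meas.comp (f := fun τ : ℝ => (z + τ • ((0 : ℝ), d w), w)) (by fun_prop)
  refine Measure.integrableOn_of_bounded (by simp) hm.aestronglyMeasurable (M := B w)
    ((ae_restrict_mem measurableSet_Ioc).mono fun τ hτ => ?_)
  exact hb z rfl le_rfl w τ ⟨hτ.1.le, hτ.2⟩

/-- The coefficients are constant along the segment. This suits the collisional heat flow, whose
peculiar velocities refer to v at X rather than at the two ends of the contact. -/
theorem jumpFlux_sub_sum (ha : KernelBdd I μ d a) (hb : ∀ j, KernelBdd I μ d (b j))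
    {z : ℝ × E3} (hz : z.1 ∈ I) (c : Fin 3 → ℝ) (i : Fin 3) :
    Integrable (fun w => ∫ τ in (0 : ℝ)..1, d w i * (a (z + τ • ((0 : ℝ), d w)) w
      - ∑ j, c j * b j (z + τ • ((0 : ℝ), d w)) w)) μ ∧
    jumpFlux μ d (fun z w => a z w - ∑ j, c j * b j z w) i z
      = jumpFlux μ d a i z - ∑ j, c j * jumpFlux μ d (b j) i z := by
  have e : ∀ w, ∫ τ in (0 : ℝ)..1, d w i * (a (z + τ • ((0 : ℝ), d w)) w
      - ∑ j, c j * b j (z + τ • ((0 : ℝ), d w)) w)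
      = (∫ τ in (0 : ℝ)..1, d w i * a (z + τ • ((0 : ℝ), d w)) w)
        - ∑ j, c j * ∫ τ in (0 : ℝ)..1, d w i * b j (z + τ • ((0 : ℝ), d w)) w := by
    intro w
    have i1 := ha.intervalIntegrable hz w
    have i2 := fun j => ((hb j).intervalIntegrable hz w).const_mul (c j)
    have i3 : IntervalIntegrable (fun τ => ∑ j, c j * b j (z + τ • ((0 : ℝ), d w)) w) volume 0 1 :=
      (IntervalIntegrable.sum Finset.univ fun j _ => i2 j).congr
        fun τ _ => by simp only [Finset.sum_apply]
    simp only [intervalIntegral.integral_const_mul]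
    rw [intervalIntegral.integral_sub i1 i3, intervalIntegral.integral_finsetSum fun j _ => i2 j,
      mul_sub, Finset.mul_sum]
    simp only [intervalIntegral.integral_const_mul]
    congr 1
    exact Finset.sum_congr rfl fun j _ => by ring
  have j1 := ha.integrable_inner hz i
  have j2 := fun j => ((hb j).integrable_inner hz i).const_mul (c j)
  have j3 : Integrable (fun w => ∑ j, c j * ∫ τ in (0 : ℝ)..1, d w i
      * b j (z + τ • ((0 : ℝ), d w)) w) μ := integrable_finsetSum _ fun j _ => j2 j
  constructor
  · simp only [e]
    exact j1.sub j3
  · simp only [jumpFlux, e]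
    rw [integral_sub j1 j3, integral_finsetSum _ fun j _ => j2 j]
    simp only [integral_const_mul]

end FluxAlgebra

/-! ### Collisional stress and heat flow as fluxes of momentum and energy. -/

section Energy

theorem collWeight_coord (j : Fin 3) : CollWeight G I f fun _ η => η j where
  meas := (contDiff_coord j).continuous.measurable.comp measurable_snd
  growth z η k C hC _ := by
    have h0 := one_le_one_add_norm η
    have h1 : (1 + ‖η‖) ^ 1 ≤ (1 + ‖η‖) ^ (k + 2) := pow_le_pow_right₀ h0 (by omega)
    have h2 : |η j| ≤ (1 + ‖η‖) ^ (k + 2) := by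
      rw [pow_one] at h1
      exact ((abs_coord_le η j).trans (by linarith)).trans h1
    nlinarith

theorem transfer_coord (z : ℝ × E3) (w : Coll) (j : Fin 3) :
    transfer G I f (fun _ η => η j) z w = (w.2.2 : E3) j * relV w.2.2 w.1 w.2.1 * kern G I f z w := by
  simp only [transfer, post, PiLp.add_apply, PiLp.smul_apply, smul_eq_mul]
  ring

theorem transfer_halfSq (z : ℝ × E3) (w : Coll) :
    transfer G I f (fun _ => halfSq) z w
      = 1 / 2 * inner ℝ (w.1 + w.2.1) (w.2.2 : E3) * relV w.2.2 w.1 w.2.1 * kern G I f z w := by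
  simp only [transfer, halfSq, norm_sq_post]
  ring

theorem transfer_add_transferStar_halfSq (z : ℝ × E3) (w : Coll) :
    transfer G I f (fun _ => halfSq) z w + transferStar G I f (fun _ => halfSq) z w = 0 := by
  simp only [transfer, transferStar, halfSq, norm_sq_post, norm_sq_postStar]
  ring

/-- The substitution l = τσ produces the factor σ, and V²θ(V) is V times the collision rate. -/
theorem contact_integral {z : ℝ × E3} (hz : z.1 ∈ I) (w : Coll) (b : ℝ) :
    ∫ l in (0 : ℝ)..G.σ, b * (relV w.2.2 w.1 w.2.1) ^ 2 * heavi (relV w.2.2 w.1 w.2.1)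
      * G.g f z.1 (z.2 + l • (w.2.2 : E3)) (z.2 + (l - G.σ) • (w.2.2 : E3))
      * f z.1 (z.2 + (l - G.σ) • (w.2.2 : E3)) w.2.1 * f z.1 (z.2 + l • (w.2.2 : E3)) w.1
    = ∫ τ in (0 : ℝ)..1, G.σ * (b * relV w.2.2 w.1 w.2.1
        * kern G I f (z + τ • ((0 : ℝ), G.σ • (w.2.2 : E3))) w) := by
  have hs := intervalIntegral.mul_integral_comp_mul_right (a := 0) (b := 1) (c := G.σ)
    (f := fun l => b * (relV w.2.2 w.1 w.2.1) ^ 2 * heavi (relV w.2.2 w.1 w.2.1)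
      * G.g f z.1 (z.2 + l • (w.2.2 : E3)) (z.2 + (l - G.σ) • (w.2.2 : E3))
      * f z.1 (z.2 + (l - G.σ) • (w.2.2 : E3)) w.2.1 * f z.1 (z.2 + l • (w.2.2 : E3)) w.1)
  rw [zero_mul, one_mul] at hs
  rw [← hs, ← intervalIntegral.integral_const_mul]
  refine intervalIntegral.integral_congr fun τ _ => ?_
  simp only [kern, pairDensity, rate, contact_shift_sub]
  simp only [contact_shift, show τ * G.σ - G.σ = (τ - 1) * G.σ by ring]
  have key := g_mul_mul (G := G) (f := f) hz (z.2 + (τ * G.σ) • (w.2.2 : E3))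
    (z.2 + ((τ - 1) * G.σ) • (w.2.2 : E3)) w.1 w.2.1
  linear_combination (G.σ * b * relV w.2.2 w.1 w.2.1 ^ 2 * heavi (relV w.2.2 w.1 w.2.1)) * key

theorem Model.pc_eq (h : Model G I f A) {z : ℝ × E3} (hz : z.1 ∈ I) (i j : Fin 3) :
    G.pc f z.1 z.2 i j = G.σ ^ 2 / (2 * G.m)
      * jumpFlux collMeasure (fun w => G.σ • (w.2.2 : E3)) (transfer G I f fun _ η => η j) i z := by
  rw [jumpFlux, integral_coll (((collWeight_coord j).kernelBdd h).integrable_inner hz i), Gas.pc]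
  congr 1
  congr 1; funext ξ
  congr 1; funext ξs
  congr 1; funext α
  rw [contact_integral hz (ξ, ξs, α) ((α : E3) i * (α : E3) j)]
  congr 1; funext τ
  rw [transfer_coord]
  simp only [PiLp.smul_apply, smul_eq_mul]
  ring

/-- The energy transferred is ½V(ξ + ξ_*)·α. Subtracting v from both velocities removes Vv·α, which
is v times the momentum transferred; hence the momentum fluxes with coefficients v_j. -/
theorem Model.qc_eq (h : Model G I f A) {z : ℝ × E3} (hz : z.1 ∈ I) (i : Fin 3) :
    G.qc f z.1 z.2 i = G.σ ^ 2 / (2 * G.m)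
      * (jumpFlux collMeasure (fun w => G.σ • (w.2.2 : E3)) (transfer G I f fun _ => halfSq) i z
        - ∑ j, Gas.vel f z.1 z.2 j * jumpFlux collMeasure (fun w => G.σ • (w.2.2 : E3))
          (transfer G I f fun _ η => η j) i z) := by
  obtain ⟨h1, h2⟩ := jumpFlux_sub_sum (collWeight_halfSq.kernelBdd h)
    (fun j => (collWeight_coord j).kernelBdd h) hz (fun j => Gas.vel f z.1 z.2 j) i
  rw [← h2, jumpFlux, integral_coll h1, Gas.qc,
    show G.σ ^ 2 / (4 * G.m) = G.σ ^ 2 / (2 * G.m) * (1 / 2) by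
      have := h.m_pos.ne'
      field_simp
      norm_num, mul_assoc]
  congr 1
  simp only [← integral_const_mul]
  congr 1; funext ξ
  congr 1; funext ξs
  congr 1; funext α
  rw [contact_integral hz (ξ, ξs, α), ← intervalIntegral.integral_const_mul]
  congr 1; funext τ
  simp only [transfer_coord, transfer_halfSq, PiLp.smul_apply, smul_eq_mul]
  simp only [PiLp.inner_apply, RCLike.inner_apply, conj_trivial, Fin.sum_univ_three,
    PiLp.add_apply, PiLp.sub_apply]
  ring

/-- The stress power and the heat flow of collisions combine to the flux of energy. -/
theorem Model.pc_qc (h : Model G I f A) {z : ℝ × E3} (hz : z.1 ∈ I) (i : Fin 3) :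
    (∑ j, G.pc f z.1 z.2 i j * Gas.vel f z.1 z.2 j) + G.qc f z.1 z.2 i
      = G.σ ^ 2 / (2 * G.m) * jumpFlux collMeasure (fun w => G.σ • (w.2.2 : E3))
          (transfer G I f fun _ => halfSq) i z := by
  simp only [h.pc_eq hz, h.qc_eq hz, mul_sub, Finset.mul_sum]
  have e : ∀ j, G.σ ^ 2 / (2 * G.m) * jumpFlux collMeasure (fun w => G.σ • (w.2.2 : E3))
      (transfer G I f fun _ η => η j) i z * Gas.vel f z.1 z.2 j
      = G.σ ^ 2 / (2 * G.m) * (Gas.vel f z.1 z.2 j * jumpFlux collMeasure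
        (fun w => G.σ • (w.2.2 : E3)) (transfer G I f fun _ η => η j) i z) := fun j => by ring
  simp only [e]
  ring

end Energy

end EnskogVlasov

namespace EnskogVlasov

open Filter Topology

variable {G : Gas} {I : Set ℝ} {f : ℝ → E3 → E3 → ℝ} {A : Set ℝ}

/-! ### Kinetic energy flux and free energy in terms of moments. -/

section Kinetic

theorem Model.integrable_cubic (h : Model G I f A) {z : ℝ × E3} (hz : z ∈ spaceTime G I)
    {w : E3 → ℝ} (hw : Continuous w) {c : ℝ} (hc : ∀ ξ, |w ξ| ≤ c * (1 + ‖ξ‖) ^ 3) :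
    Integrable fun ξ => w ξ * f z.1 z.2 ξ := by
  refine h.integrable_decay_mul hz (hw.mul (h.continuous_velocity hz)) fun k C _ => ⟨c, fun ξ _ => ?_⟩
  have hc0 : 0 ≤ c := by simpa using (abs_nonneg _).trans (hc 0)
  have hp : (1 + ‖ξ‖) ^ 3 ≤ (1 + ‖ξ‖) ^ (k + 3) :=
    pow_le_pow_right₀ (one_le_one_add_norm ξ) (by omega)
  rw [abs_mul, abs_of_pos (h.pos hz ξ), ← mul_assoc]
  exact mul_le_mul_of_nonneg_right ((hc ξ).trans (by gcongr)) (h.pos hz ξ).le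

theorem Model.integrable_peculiar (h : Model G I f A) {z : ℝ × E3} (hz : z ∈ spaceTime G I)
    (v : E3) {w : E3 → ℝ} (hw : Continuous w) {k : ℕ} (hk : k ≤ 3)
    (hc : ∀ ξ, |w ξ| ≤ ‖ξ - v‖ ^ k) : Integrable fun ξ => w ξ * f z.1 z.2 ξ := by
  refine h.integrable_cubic hz hw (c := (1 + ‖v‖) ^ 3) fun ξ => (hc ξ).trans ?_
  rw [← mul_pow]
  have h1 : ‖ξ - v‖ ≤ (1 + ‖v‖) * (1 + ‖ξ‖) := by
    have := norm_sub_le ξ v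
    nlinarith [norm_nonneg ξ, norm_nonneg v, mul_nonneg (norm_nonneg v) (norm_nonneg ξ)]
  have h2 : 1 ≤ (1 + ‖v‖) * (1 + ‖ξ‖) := by
    nlinarith [norm_nonneg ξ, norm_nonneg v, mul_nonneg (norm_nonneg v) (norm_nonneg ξ)]
  exact (pow_le_pow_left₀ (norm_nonneg _) h1 k).trans (pow_le_pow_right₀ h2 hk)

/-- The kinetic contributions to the flux of energy. -/
theorem Model.kinetic_flux (h : Model G I f A) {z : ℝ × E3} (hz : z ∈ spaceTime G I) (i : Fin 3) :
    Gas.rho f z.1 z.2 * Gas.vel f z.1 z.2 i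
        * (Gas.ek f z.1 z.2 + 1 / 2 * ‖Gas.vel f z.1 z.2‖ ^ 2)
      + (∑ j, Gas.pk f z.1 z.2 i j * Gas.vel f z.1 z.2 j) + Gas.qk f z.1 z.2 i
      = moment f (fun ξ => ξ i * halfSq ξ) (fun x => x) z := by
  have hρ := (h.dens_pos hz).ne'
  have hcur := fun j => h.dens_mul_vel hz j
  rw [dens_of_mem hz] at hρ hcur
  simp only [cur, cut_of_mem hz] at hcur
  set v := Gas.vel f z.1 z.2 with hv
  set N := f z.1 z.2 with hN
  have hsub : ∀ (ξ : E3) (j : Fin 3), |ξ j - v j| ≤ ‖ξ - v‖ := fun ξ j => by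
    simpa using abs_coord_le (ξ - v) j
  have cco : ∀ j, Continuous fun ξ : E3 => ξ j := fun j => (contDiff_coord j).continuous
  have i0 : Integrable N := by
    have := h.integrable_peculiar hz v (w := fun _ => 1) continuous_const (k := 0) (by omega) (by simp)
    simpa using this
  have i1 : ∀ j, Integrable fun ξ : E3 => (ξ j - v j) * N ξ := fun j =>
    h.integrable_peculiar hz v (k := 1) ((cco j).sub continuous_const) (by omega)
      fun ξ => by simpa using hsub ξ j
  have i2 : Integrable fun ξ : E3 => ‖ξ - v‖ ^ 2 * N ξ :=
    h.integrable_peculiar hz v (k := 2) (by fun_prop) (by omega) fun ξ => by simp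
  have i3 : ∀ j, Integrable fun ξ : E3 => (ξ i - v i) * (ξ j - v j) * N ξ := fun j =>
    h.integrable_peculiar hz v (k := 2) (((cco i).sub continuous_const).mul
      ((cco j).sub continuous_const)) (by omega) fun ξ => by
        rw [abs_mul, pow_two]
        exact mul_le_mul (hsub ξ i) (hsub ξ j) (abs_nonneg _) (norm_nonneg _)
  have i4 : Integrable fun ξ : E3 => (ξ i - v i) * ‖ξ - v‖ ^ 2 * N ξ :=
    h.integrable_peculiar hz v (k := 3) (((cco i).sub continuous_const).mul (by fun_prop)) le_rfl
      fun ξ => by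
        rw [abs_mul, abs_of_nonneg (sq_nonneg ‖ξ - v‖), pow_succ' _ 2]
        exact mul_le_mul_of_nonneg_right (hsub ξ i) (sq_nonneg _)
  -- the peculiar velocity has zero mean
  have m1 : ∀ j, ∫ ξ : E3, (ξ j - v j) * N ξ = 0 := fun j => by
    have a1 : Integrable fun ξ : E3 => ξ j * N ξ := by
      simpa [cut_of_mem hz] using (integrable_cut_weights h z).2 j
    simp only [sub_mul]
    rw [integral_sub a1 (i0.const_mul _), integral_const_mul, ← hcur j, Gas.rho]
    ring
  -- Expansion in the peculiar velocity ξ − v. The first two groups give heat flow, stress power and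
  -- convected energy; the last is linear in ξ − v and has zero mean.
  have e : ∀ ξ : E3, ξ i * halfSq ξ * N ξ = (1 / 2 * ((ξ i - v i) * ‖ξ - v‖ ^ 2 * N ξ)
      + ∑ j, v j * ((ξ i - v i) * (ξ j - v j) * N ξ))
      + (1 / 2 * v i * (‖ξ - v‖ ^ 2 * N ξ) + 1 / 2 * ‖v‖ ^ 2 * v i * N ξ)
      + (1 / 2 * ‖v‖ ^ 2 * ((ξ i - v i) * N ξ) + ∑ j, v i * v j * ((ξ j - v j) * N ξ)) := by
    intro ξ
    simp only [halfSq, EuclideanSpace.real_norm_sq_eq, Fin.sum_univ_three, PiLp.sub_apply]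
    ring
  have s3 : Integrable fun ξ : E3 => ∑ j, v j * ((ξ i - v i) * (ξ j - v j) * N ξ) :=
    integrable_finsetSum _ fun j _ => (i3 j).const_mul _
  have s1 : Integrable fun ξ : E3 => ∑ j, v i * v j * ((ξ j - v j) * N ξ) :=
    integrable_finsetSum _ fun j _ => (i1 j).const_mul _
  have t1 : Integrable fun ξ : E3 => 1 / 2 * ((ξ i - v i) * ‖ξ - v‖ ^ 2 * N ξ)
      + ∑ j, v j * ((ξ i - v i) * (ξ j - v j) * N ξ) := (i4.const_mul _).add s3
  have t2 : Integrable fun ξ : E3 => 1 / 2 * v i * (‖ξ - v‖ ^ 2 * N ξ)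
      + 1 / 2 * ‖v‖ ^ 2 * v i * N ξ := (i2.const_mul _).add (i0.const_mul _)
  have t3 : Integrable fun ξ : E3 => 1 / 2 * ‖v‖ ^ 2 * ((ξ i - v i) * N ξ)
      + ∑ j, v i * v j * ((ξ j - v j) * N ξ) := ((i1 i).const_mul _).add s1
  have t12 : Integrable fun ξ : E3 => (1 / 2 * ((ξ i - v i) * ‖ξ - v‖ ^ 2 * N ξ)
      + ∑ j, v j * ((ξ i - v i) * (ξ j - v j) * N ξ))
      + (1 / 2 * v i * (‖ξ - v‖ ^ 2 * N ξ) + 1 / 2 * ‖v‖ ^ 2 * v i * N ξ) := t1.add t2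
  simp only [moment, ← hN, e]
  rw [integral_add t12 t3, integral_add t1 t2, integral_add (i4.const_mul _) s3,
    integral_add (i2.const_mul _) (i0.const_mul _), integral_add ((i1 i).const_mul _) s1,
    integral_finsetSum _ fun j _ => (i3 j).const_mul _,
    integral_finsetSum _ fun j _ => (i1 j).const_mul _]
  simp only [integral_const_mul, m1, Gas.ek, Gas.pk, Gas.qk, ← hv, ← hN, mul_zero,
    Finset.sum_const_zero]
  have hr : ∫ ξ, N ξ = Gas.rho f z.1 z.2 := rfl
  rw [hr]
  have e2 : ∀ j, (∫ ξ : E3, (ξ i - v i) * (ξ j - v j) * N ξ) * v j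
      = v j * ∫ ξ : E3, (ξ i - v i) * (ξ j - v j) * N ξ := fun j => mul_comm _ _
  simp only [e2]
  field_simp
  ring

/-- The free energy without potential energy: entropy and kinetic energy. -/
theorem Model.f_eq (h : Model G I f A) {z : ℝ × E3} (hz : z ∈ spaceTime G I) :
    G.F f z.1 z.2 = G.Rg * G.Tw * G.H f z.1 z.2 + moment f halfSq (fun x => x) z := by
  have hR := h.Rg_pos.ne'
  have hT := h.Tw_pos.ne'
  have i1 := admissible_log.integrable h hz
  have i2 := admissible_halfSq.integrable h hz
  have e : ∀ ξ, f z.1 z.2 ξ * Real.log (f z.1 z.2 ξ / G.fw ξ)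
      = 1 * (f z.1 z.2 ξ * Real.log (f z.1 z.2 ξ))
        + (G.Rg * G.Tw)⁻¹ * (halfSq ξ * f z.1 z.2 ξ) := fun ξ => by
    rw [Gas.fw, Real.log_div (h.pos hz ξ).ne' (Real.exp_ne_zero _), Real.log_exp, halfSq]
    field_simp
    ring
  rw [Gas.F, Gas.H, Gas.Hk]
  simp only [e]
  rw [integral_add i1 (i2.const_mul _), integral_const_mul, integral_const_mul, one_mul, moment]
  generalize ∫ ξ, halfSq ξ * f z.1 z.2 ξ = q
  field_simp
  ring

end Kinetic

end EnskogVlasov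

namespace EnskogVlasov

open Filter Topology

variable {G : Gas} {I : Set ℝ} {f : ℝ → E3 → E3 → ℝ} {A : Set ℝ}

/-! ### Correlations of the density with an integrable kernel. -/

section Correlation

instance : ((volume : Measure (ℝ × E3)).prod (volume : Measure E3)).IsAddHaarMeasure :=
  Measure.prod.instIsAddHaarMeasure _ _

/-- Measurable functions on space-time that are bounded on `K × ℝ³` for compact `K ⊆ I`. -/
structure SliceBdd (I : Set ℝ) (u : ℝ × E3 → ℝ) : Prop where
  meas : Measurable u
  bdd : ∀ K : Set ℝ, IsCompact K → K ⊆ I → ∃ C : ℝ, 0 ≤ C ∧ ∀ z : ℝ × E3, z.1 ∈ K → |u z| ≤ C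

/-- The spatial correlation of `u` with the kernel `k`. -/
noncomputable def correlate (k : E3 → ℝ) (u : ℝ × E3 → ℝ) (z : ℝ × E3) : ℝ :=
  ∫ r, k r * u (z + ((0 : ℝ), r))

theorem Model.sliceBdd_dens (h : Model G I f A) : SliceBdd I (dens G I f) where
  meas := h.measurable_dens
  bdd K hK hKI := by
    obtain ⟨C, hC0, hC⟩ := h.exists_bound_dens_global hK hKI
    exact ⟨C, hC0, fun z hz => (hC z hz).1⟩

theorem Model.sliceBdd_densDot (h : Model G I f A) : SliceBdd I (densDot G I f) where
  meas := h.densDot_measurable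
  bdd K hK hKI := by
    obtain ⟨C, hC0, hC⟩ := h.exists_bound_dens_global hK hKI
    exact ⟨C, hC0, fun z hz => (hC z hz).2⟩

variable {k : E3 → ℝ} {u : ℝ × E3 → ℝ} {p : ℝ × E3 → ℝ}

theorem SliceBdd.locBdd (hu : SliceBdd I u) : LocBdd I u where
  meas := hu.meas
  bdd K hK hKI _ := by
    obtain ⟨C, hC0, hC⟩ := hu.bdd K hK hKI
    exact ⟨C, hC0, fun z hz _ => hC z hz⟩

theorem SliceBdd.locBdd_correlate (hu : SliceBdd I u) (hk : Integrable k) (hkm : Measurable k) :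
    LocBdd I (correlate k u) where
  meas := by
    have : Measurable fun q : (ℝ × E3) × E3 => k q.2 * u (q.1 + ((0 : ℝ), q.2)) :=
      (hkm.comp measurable_snd).mul (hu.meas.comp (by fun_prop))
    exact this.stronglyMeasurable.integral_prod_right.measurable
  bdd K hK hKI _ := by
    obtain ⟨C, hC0, hC⟩ := hu.bdd K hK hKI
    refine ⟨∫ r, |k r| * C, integral_nonneg fun r => by positivity, fun z hz _ => ?_⟩
    refine abs_integral_le_of_abs_le (hk.abs.mul_const C) fun r => ?_
    rw [abs_mul]
    exact mul_le_mul_of_nonneg_left (hC _ (by simpa using hz)) (abs_nonneg _)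

theorem SliceBdd.integral_mul_correlate (hu : SliceBdd I u) (hk : Integrable k)
    (hp : Continuous p) (hc : HasCompactSupport p) (hs : tsupport p ⊆ I ×ˢ univ) :
    Integrable (fun q : (ℝ × E3) × E3 => p q.1 * k q.2 * u (q.1 + ((0 : ℝ), q.2)))
      (volume.prod volume) ∧
    ∫ q : (ℝ × E3) × E3, p q.1 * k q.2 * u (q.1 + ((0 : ℝ), q.2)) ∂(volume.prod volume)
      = ∫ z, p z * correlate k u z := by
  obtain ⟨K, hK, hKI, r, hr⟩ := exists_bound_of_hasCompactSupport hc hs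
  obtain ⟨C, hC0, hC⟩ := hu.bdd K hK hKI
  have hi := integrable_prod_of_bdd (b := fun z r => u (z + ((0 : ℝ), r))) (C := C)
    (hp.integrable_of_hasCompactSupport hc (μ := volume)) hk (hu.meas.comp (by fun_prop))
    fun z w hz _ => hC _ (by simpa using (hr z (subset_tsupport p hz)).1)
  refine ⟨hi, ?_⟩
  rw [integral_prod _ hi]
  simp only [mul_assoc, integral_const_mul, correlate]

theorem hasDerivAt_comp_line (hp : ContDiff ℝ 1 p) (z v : ℝ × E3) (τ : ℝ) :
    HasDerivAt (fun s : ℝ => p (z + s • v)) (fderiv ℝ p (z + τ • v) v) τ := by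
  have h1 : HasDerivAt (fun s : ℝ => z + s • v) v τ := by
    simpa using ((hasDerivAt_id τ).smul_const v).const_add z
  exact ((hp.differentiable one_ne_zero) (z + τ • v)).hasFDerivAt.comp_hasDerivAt τ h1

/-- The derivative is taken along a line on which t moves while X and r are fixed. The density is
differentiable on it wherever X + r may lie, in D or outside. -/
theorem integral_correlate_time (h : Model G I f A) (hk : Integrable k) (hp : ContDiff ℝ 1 p)
    (hc : HasCompactSupport p) (hs : tsupport p ⊆ I ×ˢ univ) :
    ∫ z, fderiv ℝ p z (1, 0) * correlate k (dens G I f) z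
      = -∫ z, p z * correlate k (densDot G I f) z := by
  obtain ⟨i0, -⟩ := h.sliceBdd_dens.integral_mul_correlate hk hp.continuous hc hs
  obtain ⟨i1, e1⟩ := h.sliceBdd_dens.integral_mul_correlate hk
    (continuous_fderiv_apply_of_contDiff hp (1, 0)) (hc.fderiv_apply ℝ _)
    ((tsupport_fderiv_apply_subset ℝ _).trans hs)
  obtain ⟨i2, e2⟩ := h.sliceBdd_densDot.integral_mul_correlate hk hp.continuous hc hs
  rw [← e1, ← e2, ← add_eq_zero_iff_eq_neg, ← integral_add i1 i2]
  refine integral_eq_zero_of_hasDerivAt_line _ _ _ (((1 : ℝ), (0 : E3)), (0 : E3)) i0 (i1.add i2)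
    (Eventually.of_forall fun q τ => ?_)
  have d1 := hasDerivAt_comp_line hp q.1 ((1 : ℝ), (0 : E3)) τ
  simp only [Prod.fst_add, Prod.snd_add, Prod.smul_fst, Prod.smul_snd, smul_zero, add_zero]
  by_cases hz : q.1 + τ • ((1 : ℝ), (0 : E3)) ∈ tsupport p
  · have ht : q.1.1 + τ ∈ I := by simpa using (hs hz).1
    have d2 : HasDerivAt (fun s : ℝ => dens G I f (q.1 + s • ((1 : ℝ), (0 : E3)) + ((0 : ℝ), q.2)))
        (densDot G I f (q.1 + τ • ((1 : ℝ), (0 : E3)) + ((0 : ℝ), q.2))) τ := by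
      have := (h.hasDerivAt_dens_time ht (q.1.2 + q.2)).comp_const_add q.1.1 τ
      have e : ∀ s : ℝ, q.1 + s • ((1 : ℝ), (0 : E3)) + ((0 : ℝ), q.2)
          = (q.1.1 + s, q.1.2 + q.2) := fun s => by ext <;> simp
      simpa only [e] using this
    exact (d1.mul_const (k q.2)).mul d2
  · have hev : ∀ᶠ s in 𝓝 τ, p (q.1 + s • ((1 : ℝ), (0 : E3))) = 0 := by
      have hcont : Continuous fun s : ℝ => q.1 + s • ((1 : ℝ), (0 : E3)) := by fun_prop
      filter_upwards [hcont.continuousAt.eventually_mem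
        ((isClosed_tsupport p).isOpen_compl.mem_nhds hz)] with s hs
      exact image_eq_zero_of_notMem_tsupport hs
    have h0 : fderiv ℝ p (q.1 + τ • ((1 : ℝ), (0 : E3))) = 0 :=
      image_eq_zero_of_notMem_tsupport fun hh => hz (tsupport_fderiv_subset ℝ hh)
    rw [h0, image_eq_zero_of_notMem_tsupport hz]
    refine ((hasDerivAt_const τ (0 : ℝ)).congr_of_eventuallyEq ?_).congr_deriv (by simp)
    filter_upwards [hev] with s hs
    rw [hs, zero_mul, zero_mul]

end Correlation

/-! ### The pair potential, the self-consistent force and integration by parts in space. -/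

section Interaction

variable (G) in
/-- The differences of points of the domain. -/
def differences : Set E3 := {r | ∃ X ∈ G.D, ∃ Y ∈ G.D, r = Y - X}

variable (G) in
/-- The potential of the pair interaction, cut off outside the differences of points of the
domain. -/
noncomputable def pairPot : E3 → ℝ := (differences G).indicator fun r => G.Φ ‖r‖

variable (G) in
/-- The derivative of the pair potential in the direction `e`. -/
noncomputable def pairForce (e : E3) : E3 → ℝ :=
  (differences G).indicator fun r => fderiv ℝ (fun r : E3 => G.Φ ‖r‖) r e

theorem neg_mem_differences {r : E3} : -r ∈ differences G ↔ r ∈ differences G := by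
  constructor <;> rintro ⟨X, hX, Y, hY, hr⟩ <;> refine ⟨Y, hY, X, hX, ?_⟩
  · rw [← neg_neg r, hr, neg_sub]
  · rw [hr, neg_sub]

theorem pairPot_neg (r : E3) : pairPot G (-r) = pairPot G r := by
  by_cases hr : r ∈ differences G
  · rw [pairPot, indicator_of_mem hr, indicator_of_mem (neg_mem_differences.2 hr), norm_neg]
  · rw [pairPot, indicator_of_notMem hr, indicator_of_notMem (mt neg_mem_differences.1 hr)]

theorem Model.measurableSet_differences (h : Model G I f A) : MeasurableSet (differences G) := by
  have e : differences G = ⋃ X ∈ G.D, (fun r => r + X) ⁻¹' G.D := by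
    ext r
    simp only [differences, mem_ofPred_eq, mem_iUnion, mem_preimage, exists_prop]
    constructor
    · rintro ⟨X, hX, Y, hY, rfl⟩
      exact ⟨X, hX, by simpa using hY⟩
    · rintro ⟨X, hX, hr⟩
      exact ⟨X, hX, r + X, hr, by simp⟩
  rw [e]
  exact (isOpen_biUnion fun X _ => h.openD.preimage (by fun_prop)).measurableSet

theorem Model.hasFDerivAt_pot (h : Model G I f A) {r : E3} (hr : r ≠ 0) :
    HasFDerivAt (fun r : E3 => G.Φ ‖r‖) (deriv G.Φ ‖r‖ • fderiv ℝ (fun r : E3 => ‖r‖) r) r := by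
  have h1 : DifferentiableAt ℝ G.Φ ‖r‖ :=
    (h.Φ_smooth.contDiffAt (Ioi_mem_nhds (norm_pos_iff.2 hr))).differentiableAt one_ne_zero
  have h2 : DifferentiableAt ℝ (fun r : E3 => ‖r‖) r :=
    (contDiffAt_norm ℝ hr (n := 1)).differentiableAt one_ne_zero
  exact h1.hasDerivAt.comp_hasFDerivAt r h2.hasFDerivAt

theorem Model.abs_fderiv_pot_le (h : Model G I f A) {r : E3} (hr : r ≠ 0) (e : E3) :
    |fderiv ℝ (fun r : E3 => G.Φ ‖r‖) r e| ≤ ‖e‖ * |deriv G.Φ ‖r‖| := by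
  rw [(h.hasFDerivAt_pot hr).fderiv, smul_apply, smul_eq_mul, abs_mul, mul_comm]
  refine mul_le_mul_of_nonneg_right ?_ (abs_nonneg _)
  have h1 : ‖fderiv ℝ (fun r : E3 => ‖r‖) r‖ ≤ 1 := by
    simpa using norm_fderiv_le_of_lipschitz ℝ (x₀ := r) (lipschitzWith_one_norm (E := E3))
  calc |fderiv ℝ (fun r : E3 => ‖r‖) r e| ≤ ‖fderiv ℝ (fun r : E3 => ‖r‖) r‖ * ‖e‖ :=
        (fderiv ℝ (fun r : E3 => ‖r‖) r).le_opNorm e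
    _ ≤ ‖e‖ := mul_le_of_le_one_left (norm_nonneg e) h1

theorem Model.measurable_pairPot (h : Model G I f A) : Measurable (pairPot G) := by
  refine Measurable.indicator ?_ h.measurableSet_differences
  refine measurable_of_continuousOn_compl_singleton 0 fun r (hr : r ≠ 0) => ?_
  exact (h.hasFDerivAt_pot hr).continuousAt.continuousWithinAt

theorem Model.measurable_pairForce (h : Model G I f A) (e : E3) : Measurable (pairForce G e) :=
  (measurable_fderiv_apply_const ℝ _ e).indicator h.measurableSet_differences

theorem Model.integrable_pairPot (h : Model G I f A) :
    Integrable (pairPot G) ∧ Integrable fun r => ‖r‖ * |pairPot G r| := by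
  have h0 := (integrable_indicator_iff h.measurableSet_differences).2 h.Φ_int
  constructor
  · refine h0.mono' h.measurable_pairPot.aestronglyMeasurable (Eventually.of_forall fun r => ?_)
    by_cases hr : r ∈ differences G
    · rw [pairPot, indicator_of_mem hr, indicator_of_mem hr, Real.norm_eq_abs]
      nlinarith [norm_nonneg r, abs_nonneg (G.Φ ‖r‖), abs_nonneg (deriv G.Φ ‖r‖),
        mul_nonneg (norm_nonneg r) (abs_nonneg (G.Φ ‖r‖)),
        mul_nonneg (norm_nonneg r) (abs_nonneg (deriv G.Φ ‖r‖))]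
    · simp [pairPot, indicator_of_notMem hr]
  · have hm := h.measurable_pairPot
    refine h0.mono' (by fun_prop) (Eventually.of_forall fun r => ?_)
    rw [Real.norm_eq_abs, abs_mul, abs_norm, abs_abs]
    by_cases hr : r ∈ differences G
    · rw [pairPot, indicator_of_mem hr, indicator_of_mem hr]
      nlinarith [norm_nonneg r, abs_nonneg (G.Φ ‖r‖), abs_nonneg (deriv G.Φ ‖r‖),
        mul_nonneg (norm_nonneg r) (abs_nonneg (deriv G.Φ ‖r‖))]
    · simp [pairPot, indicator_of_notMem hr]

theorem Model.integrable_pairForce (h : Model G I f A) (e : E3) : Integrable (pairForce G e) := by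
  have h0 := ((integrable_indicator_iff h.measurableSet_differences).2 h.Φ_int).const_mul ‖e‖
  refine h0.mono' (h.measurable_pairForce e).aestronglyMeasurable ?_
  filter_upwards [Measure.ae_ne volume (0 : E3)] with r hr0
  by_cases hr : r ∈ differences G
  · rw [pairForce, indicator_of_mem hr, indicator_of_mem hr, Real.norm_eq_abs]
    refine (h.abs_fderiv_pot_le hr0 e).trans (mul_le_mul_of_nonneg_left ?_ (norm_nonneg e))
    nlinarith [norm_nonneg r, abs_nonneg (G.Φ ‖r‖), abs_nonneg (deriv G.Φ ‖r‖),
      mul_nonneg (norm_nonneg r) (abs_nonneg (G.Φ ‖r‖)),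
      mul_nonneg (norm_nonneg r) (abs_nonneg (deriv G.Φ ‖r‖))]
  · simp [pairForce, indicator_of_notMem hr]

theorem integral_domain_eq_correlate (h : Model G I f A) {z : ℝ × E3} (hz : z ∈ spaceTime G I)
    (κ : E3 → ℝ) : ∫ Y in G.D, κ (Y - z.2) * Gas.rho f z.1 Y
      = correlate ((differences G).indicator κ) (dens G I f) z := by
  rw [← integral_indicator h.openD.measurableSet, correlate,
    ← integral_sub_right_eq_self (fun r => (differences G).indicator κ r
      * dens G I f (z + ((0 : ℝ), r))) z.2]
  congr 1; funext Y
  have e : z + ((0 : ℝ), Y - z.2) = (z.1, Y) := by ext <;> simp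
  rw [e]
  by_cases hY : Y ∈ G.D
  · rw [indicator_of_mem hY, indicator_of_mem (show Y - z.2 ∈ differences G from
      ⟨z.2, hz.2, Y, hY, rfl⟩), dens_of_mem (show (z.1, Y) ∈ spaceTime G I from ⟨hz.1, hY⟩)]
  · rw [indicator_of_notMem hY, dens_of_notMem fun hh => hY hh.2, mul_zero]

theorem Model.ev_eq (h : Model G I f A) {z : ℝ × E3} (hz : z ∈ spaceTime G I) :
    G.ev f z.1 z.2 = 1 / 2 * correlate (pairPot G) (dens G I f) z := by
  rw [pairPot, ← integral_domain_eq_correlate h hz, Gas.ev]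

/-- Differentiation with respect to X gives minus the gradient of Φ(|r|) at r = Y − X, which cancels
the sign in the definition of the force. -/
theorem Model.force_eq (h : Model G I f A) {z : ℝ × E3} (hz : z ∈ spaceTime G I) (i : Fin 3) :
    G.force f z.1 z.2 i = correlate (pairForce G (basisVec i)) (dens G I f) z := by
  rw [pairForce, ← integral_domain_eq_correlate h hz, Gas.force, ← integral_neg]
  congr 1; funext Y
  have e : pd i (fun Z => G.Φ ‖Y - Z‖) z.2
      = -fderiv ℝ (fun r : E3 => G.Φ ‖r‖) (Y - z.2) (basisVec i) := by
    have e1 := (ContinuousLinearEquiv.neg ℝ (M := E3)).comp_right_fderiv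
      (f := fun W : E3 => G.Φ ‖W + Y‖) (x := z.2)
    have e2 : (fun Z : E3 => G.Φ ‖Y - Z‖)
        = (fun W : E3 => G.Φ ‖W + Y‖) ∘ ContinuousLinearEquiv.neg ℝ := by
      funext Z
      simp [neg_add_eq_sub]
    rw [pd, e2, e1, fderiv_comp_add_right (f := fun r : E3 => G.Φ ‖r‖)]
    simp [neg_add_eq_sub, basisVec]
  rw [e, neg_mul, neg_neg]

/-- Only multiples of e lie on a line of direction e through the origin, and these form a null set.
Almost every such line thus avoids the possible singularity of Φ(|r|). -/
theorem ae_forall_sub_smul_ne_zero (e : E3) : ∀ᵐ r : E3, ∀ τ : ℝ, r - τ • e ≠ 0 := by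
  have h1 : volume ((Submodule.span ℝ {e} : Submodule ℝ E3) : Set E3) = 0 := by
    refine Measure.addHaar_submodule volume _ fun htop => ?_
    have h2 := finrank_span_le_card (R := ℝ) ({e} : Set E3)
    rw [htop, finrank_top] at h2
    simp at h2
  filter_upwards [measure_eq_zero_iff_ae_notMem.1 h1] with r hr τ h0
  exact hr (Submodule.mem_span_singleton.2 ⟨τ, (sub_eq_zero.1 h0).symm⟩)

/-- Where the other factors do not vanish, X and X + r both lie in D, so r is a difference of points
of D. The cut-off, which could not be differentiated, may therefore be dropped. -/
theorem mul_pairPot_mul {p : ℝ × E3 → ℝ} (hs : tsupport p ⊆ spaceTime G I) (κ : E3 → ℝ)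
    (z : ℝ × E3) (r : E3) : p z * (differences G).indicator κ r * dens G I f (z + ((0 : ℝ), r))
      = p z * κ r * dens G I f (z + ((0 : ℝ), r)) := by
  by_cases hz : z ∈ tsupport p
  · by_cases hr : z + ((0 : ℝ), r) ∈ spaceTime G I
    · rw [indicator_of_mem]
      exact ⟨z.2, (hs hz).2, z.2 + r, hr.2, by simp⟩
    · rw [dens_of_notMem hr, mul_zero, mul_zero]
  · rw [image_eq_zero_of_notMem_tsupport hz, zero_mul, zero_mul, zero_mul, zero_mul]

/-- The derivative is taken along the direction in which X moves by e and r by −e. Then X + r is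
constant, so the density, which may jump at ∂D, is not differentiated; only the test factor and the
potential are. -/
theorem integral_correlate_space (h : Model G I f A) {p : ℝ × E3 → ℝ} (hp : ContDiff ℝ 1 p)
    (hc : HasCompactSupport p) (hs : tsupport p ⊆ spaceTime G I) (e : E3) :
    ∫ z, fderiv ℝ p z (0, e) * correlate (pairPot G) (dens G I f) z
      = ∫ z, p z * correlate (pairForce G e) (dens G I f) z := by
  have hs' : tsupport p ⊆ I ×ˢ univ := hs.trans subset_prod_univ
  have hsd : tsupport (fun z => fderiv ℝ p z ((0 : ℝ), e)) ⊆ spaceTime G I :=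
    (tsupport_fderiv_apply_subset ℝ _).trans hs
  have hk := h.integrable_pairPot.1
  obtain ⟨i0, -⟩ := h.sliceBdd_dens.integral_mul_correlate hk hp.continuous hc hs'
  obtain ⟨i1, e1⟩ := h.sliceBdd_dens.integral_mul_correlate hk
    (continuous_fderiv_apply_of_contDiff hp (0, e)) (hc.fderiv_apply ℝ _)
    (hsd.trans subset_prod_univ)
  obtain ⟨i2, e2⟩ := h.sliceBdd_dens.integral_mul_correlate (h.integrable_pairForce e)
    hp.continuous hc hs'
  rw [← e1, ← e2, ← sub_eq_zero, ← integral_sub i1 i2]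
  have i12 := i1.sub i2
  simp only [pairPot, pairForce, mul_pairPot_mul hs, mul_pairPot_mul hsd] at i0 i12 ⊢
  refine integral_eq_zero_of_hasDerivAt_line _ _ _ (((0 : ℝ), e), -e) i0 i12 ?_
  filter_upwards [Measure.quasiMeasurePreserving_snd.ae (ae_forall_sub_smul_ne_zero e)] with q hq τ
  have d1 := hasDerivAt_comp_line hp q.1 ((0 : ℝ), e) τ
  have d2 : HasDerivAt (fun s : ℝ => G.Φ ‖q.2 + s • -e‖)
      (-fderiv ℝ (fun r : E3 => G.Φ ‖r‖) (q.2 + τ • -e) e) τ := by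
    have hne : q.2 + τ • -e ≠ 0 := by
      rw [smul_neg, ← sub_eq_add_neg]
      exact hq τ
    have h1 : HasDerivAt (fun s : ℝ => q.2 + s • -e) (-e) τ := by
      simpa using ((hasDerivAt_id τ).smul_const (-e)).const_add q.2
    have := (h.hasFDerivAt_pot hne).comp_hasDerivAt τ h1
    rw [map_neg] at this
    rw [(h.hasFDerivAt_pot hne).fderiv]
    exact this
  have e3 : ∀ s : ℝ, q.1 + s • ((0 : ℝ), e) + ((0 : ℝ), q.2 + s • -e) = q.1 + ((0 : ℝ), q.2) :=
    fun s => by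
      ext
      · simp
      · simp
        ring
  simp only [Prod.fst_add, Prod.snd_add, Prod.smul_fst, Prod.smul_snd, e3]
  exact ((d1.mul d2).mul_const _).congr_deriv (by ring)

end Interaction

end EnskogVlasov

namespace EnskogVlasov

open Filter Topology

variable {G : Gas} {I : Set ℝ} {f : ℝ → E3 → E3 → ℝ} {A : Set ℝ}

/-! ### The balance of the potential energy. -/

section Vlasov

variable {φ : ℝ × E3 → ℝ}

theorem fderiv_mul_of_tsupport_subset {U : Set (ℝ × E3)} (hU : IsOpen U) {u : ℝ × E3 → ℝ}
    (hφ : ContDiff ℝ 1 φ) (hs : tsupport φ ⊆ U) (hu : ContDiffOn ℝ 1 u U) (z v : ℝ × E3) :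
    fderiv ℝ (fun z => φ z * u z) z v = φ z * fderiv ℝ u z v + u z * fderiv ℝ φ z v := by
  by_cases hz : z ∈ tsupport φ
  · have d1 := (hφ.differentiable one_ne_zero) z
    have d2 := (hu.contDiffAt (hU.mem_nhds (hs hz))).differentiableAt one_ne_zero
    rw [fderiv_fun_mul d1 d2]
    simp
  · have h0 : fderiv ℝ φ z = 0 :=
      image_eq_zero_of_notMem_tsupport fun hh => hz (tsupport_fderiv_subset ℝ hh)
    have h1 : fderiv ℝ (fun z => φ z * u z) z = 0 :=
      image_eq_zero_of_notMem_tsupport fun hh =>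
        hz (tsupport_mul_subset (tsupport_fderiv_subset ℝ hh))
    simp [h0, h1, image_eq_zero_of_notMem_tsupport hz]

theorem LocBdd.integral_fderiv_mul {W u : ℝ × E3 → ℝ} (hW : LocBdd I W) {U : Set (ℝ × E3)}
    (hU : IsOpen U) (hUI : U ⊆ I ×ˢ univ) (hφ : ContDiff ℝ 1 φ) (hc : HasCompactSupport φ)
    (hs : tsupport φ ⊆ U) (hu : ContDiffOn ℝ 1 u U) (v : ℝ × E3) :
    Integrable (fun z => φ z * fderiv ℝ u z v * W z) ∧
    Integrable (fun z => u z * W z * fderiv ℝ φ z v) ∧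
    ∫ z, fderiv ℝ (fun z => φ z * u z) z v * W z
      = (∫ z, φ z * fderiv ℝ u z v * W z) + ∫ z, u z * W z * fderiv ℝ φ z v := by
  have i1 : Integrable fun z => φ z * fderiv ℝ u z v * W z :=
    hW.integrable_mul (φ := fun z => φ z * fderiv ℝ u z v)
      (continuous_mul_of_tsupport_subset hU hφ.continuous hs
        ((hu.continuousOn_fderiv_of_isOpen hU le_rfl).clm_apply continuousOn_const))
      hc.mul_right (tsupport_mul_subset.trans (hs.trans hUI))
  have hsd := (tsupport_fderiv_apply_subset ℝ v).trans hs
  have i2 : Integrable fun z => u z * W z * fderiv ℝ φ z v := by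
    refine (hW.integrable_mul (φ := fun z => fderiv ℝ φ z v * u z)
      (continuous_mul_of_tsupport_subset hU (continuous_fderiv_apply_of_contDiff hφ v) hsd
        hu.continuousOn) (hc.fderiv_apply ℝ v).mul_right
      (tsupport_mul_subset.trans (hsd.trans hUI))).congr (Eventually.of_forall fun z => ?_)
    simp only
    ring
  refine ⟨i1, i2, ?_⟩
  rw [← integral_add i1 i2]
  congr 1; funext z
  rw [fderiv_mul_of_tsupport_subset hU hφ hs hu]
  ring

variable (G I f) in
/-- The rate of exchange of potential energy between `z` and the point at distance `r`. -/
noncomputable def powerKernel (z : ℝ × E3) (r : E3) : ℝ :=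
  1 / 2 * pairPot G r * densDot G I f (z - ((0 : ℝ), r)) * dens G I f z

/-- The displacement r is unbounded, so the densities are bounded globally and the weight |r| is put
on the potential; the factor 1 + |r| in the integrability assumption provides for this. -/
theorem kernelBdd_power (h : Model G I f A) :
    KernelBdd I volume (fun r : E3 => r) (powerKernel G I f) where
  meas_d := measurable_id
  meas := (((h.measurable_pairPot.comp measurable_snd).const_mul _).mul
    (h.densDot_measurable.comp (by fun_prop))).mul (h.measurable_dens.comp measurable_fst)
  bdd K hK hKI _ := by
    obtain ⟨C, hC0, hC⟩ := h.exists_bound_dens_global hK hKI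
    obtain ⟨k1, k2⟩ := h.integrable_pairPot
    refine ⟨fun r => |pairPot G r| * (C * C), k1.abs.mul_const _, ?_, fun z hz _ r τ _ => ?_⟩
    · simpa only [mul_assoc] using k2.mul_const (C * C)
    · have h1 := (hC (z + τ • ((0 : ℝ), r)) (by simpa using hz)).1
      have h2 := (hC (z + τ • ((0 : ℝ), r) - ((0 : ℝ), r)) (by simpa using hz)).2
      have h3 := mul_le_mul h2 h1 (abs_nonneg _) hC0
      rw [powerKernel, abs_mul, abs_mul, abs_mul, abs_of_pos (one_half_pos (α := ℝ))]
      have h4 := abs_nonneg (pairPot G r)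
      nlinarith [mul_nonneg h4 (mul_nonneg hC0 hC0), mul_le_mul_of_nonneg_left h3 h4]

theorem integral_powerKernel (z : ℝ × E3) :
    ∫ r, powerKernel G I f z r
      = 1 / 2 * (dens G I f z * correlate (pairPot G) (densDot G I f) z) ∧
    ∫ r, powerKernel G I f (z + ((0 : ℝ), r)) r
      = 1 / 2 * (densDot G I f z * correlate (pairPot G) (dens G I f) z) := by
  constructor
  · rw [correlate, ← integral_neg_eq_self, ← integral_const_mul, ← integral_const_mul]
    congr 1; funext r
    have e : z - ((0 : ℝ), -r) = z + ((0 : ℝ), r) := by ext <;> simp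
    rw [powerKernel, pairPot_neg, e]
    ring
  · rw [correlate, ← integral_const_mul, ← integral_const_mul]
    congr 1; funext r
    rw [powerKernel, add_sub_cancel_right]
    ring

theorem Model.deriv_rho (h : Model G I f A) {z : ℝ × E3} (hz : z ∈ spaceTime G I) :
    deriv (fun s => Gas.rho f s z.2) z.1 = densDot G I f z := by
  refine ((h.hasDerivAt_dens_time hz.1 z.2).congr_of_eventuallyEq ?_).deriv
  filter_upwards [h.openI.mem_nhds hz.1] with s hs
  exact (dens_of_mem (show (s, z.2) ∈ spaceTime G I from ⟨hs, hz.2⟩)).symm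

/-- The stress p^(v) cancels between its power and q^(v). What remains is 2ρe^(v)v, whose factor 2
removes the ½ in e^(v), and the flux of exchanged potential energy. -/
theorem Model.qv_eq (h : Model G I f A) {z : ℝ × E3} (hz : z ∈ spaceTime G I) (i : Fin 3) :
    (∑ j, G.pv f z.1 z.2 i j * Gas.vel f z.1 z.2 j) + G.qv f z.1 z.2 i
        + Gas.rho f z.1 z.2 * G.ev f z.1 z.2 * Gas.vel f z.1 z.2 i
      = cur G I f i z * correlate (pairPot G) (dens G I f) z
        + jumpFlux volume (fun r => r) (powerKernel G I f) i z := by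
  have e : 1 / 2 * ∫ r : E3, ∫ l in (0 : ℝ)..1,
      r i * G.Φ ‖r‖ * deriv (fun s => Gas.rho f s (z.2 + (l - 1) • r)) z.1
        * Gas.rho f z.1 (z.2 + l • r) * G.chi (z.2 + (l - 1) • r) * G.chi (z.2 + l • r)
      = jumpFlux volume (fun r => r) (powerKernel G I f) i z := by
    rw [jumpFlux, ← integral_const_mul]
    congr 1; funext r
    rw [← intervalIntegral.integral_const_mul]
    congr 1; funext l
    have e1 : z + l • ((0 : ℝ), r) = (z.1, z.2 + l • r) := by ext <;> simp
    have e2 : z + l • ((0 : ℝ), r) - ((0 : ℝ), r) = (z.1, z.2 + (l - 1) • r) := by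
      ext
      · simp
      · simp
        ring
    rw [powerKernel, e2, e1]
    by_cases h1 : z.2 + l • r ∈ G.D
    · by_cases h2 : z.2 + (l - 1) • r ∈ G.D
      · have hr : r ∈ differences G := ⟨_, h2, _, h1, by
          rw [sub_smul, one_smul]
          abel⟩
        have m1 : (z.1, z.2 + l • r) ∈ spaceTime G I := ⟨hz.1, h1⟩
        have m2 : (z.1, z.2 + (l - 1) • r) ∈ spaceTime G I := ⟨hz.1, h2⟩
        have d := h.deriv_rho m2
        simp only at d
        rw [pairPot, indicator_of_mem hr, dens_of_mem m1, d, Gas.chi, Gas.chi,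
          indicator_of_mem h1, indicator_of_mem h2]
        ring
      · rw [Gas.chi, indicator_of_notMem h2, densDot_of_notMem fun hh => h2 hh.2]
        ring
    · rw [Gas.chi, Gas.chi, indicator_of_notMem h1, dens_of_notMem fun hh => h1 hh.2]
      ring
  rw [Gas.qv, e, ← h.dens_mul_vel hz, h.ev_eq hz, dens_of_mem hz]
  simp only [sub_mul, Finset.sum_sub_distrib, ite_mul, zero_mul, Finset.sum_ite_eq,
    Finset.mem_univ, if_true]
  ring

/-- The weak balance of the potential energy: its production is the power of the force. -/
theorem integral_potential_energy (h : Model G I f A) (hφ : ContDiff ℝ 1 φ)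
    (hc : HasCompactSupport φ) (hs : tsupport φ ⊆ spaceTime G I) :
    (1 / 2 * ∫ z, dens G I f z * correlate (pairPot G) (dens G I f) z * fderiv ℝ φ z (1, 0))
      + (∑ i, ∫ z, cur G I f i z * correlate (pairPot G) (dens G I f) z
          * fderiv ℝ φ z (0, basisVec i))
      + ∑ i, ∫ z, jumpFlux volume (fun r => r) (powerKernel G I f) i z
          * fderiv ℝ φ z (0, basisVec i)
    = ∫ z, φ z * ∑ i, G.force f z.1 z.2 i * cur G I f i z := by
  have hs' : tsupport φ ⊆ I ×ˢ univ := hs.trans subset_prod_univ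
  have hU := h.isOpen_spaceTime
  obtain ⟨hk, -⟩ := h.integrable_pairPot
  have hkm := h.measurable_pairPot
  set W := correlate (pairPot G) (dens G I f) with hW
  set V := correlate (pairPot G) (densDot G I f) with hV
  have lW : LocBdd I W := h.sliceBdd_dens.locBdd_correlate hk hkm
  have lV : LocBdd I V := h.sliceBdd_densDot.locBdd_correlate hk hkm
  have lF : ∀ e, LocBdd I (correlate (pairForce G e) (dens G I f)) := fun e =>
    h.sliceBdd_dens.locBdd_correlate (h.integrable_pairForce e) (h.measurable_pairForce e)
  have kP := kernelBdd_power h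
  -- variation in time
  obtain ⟨-, -, t1⟩ := lW.integral_fderiv_mul hU subset_prod_univ hφ hc hs h.contDiffOn_dens (1, 0)
  rw [integral_correlate_time h hk (contDiff_mul_of_tsupport_subset hU hφ hs h.contDiffOn_dens)
    hc.mul_right (tsupport_mul_subset.trans hs'), ← hV] at t1
  have t2 : ∫ z, φ z * fderiv ℝ (dens G I f) z (1, 0) * W z
      = ∫ z, φ z * (densDot G I f z * W z) := by
    congr 1; funext z
    by_cases hz : z ∈ tsupport φ
    · rw [h.fderiv_dens (hs hz), densDot_of_mem (hs hz), mul_assoc]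
    · simp [image_eq_zero_of_notMem_tsupport hz]
  -- variation in space
  have x1 := fun i => lW.integral_fderiv_mul hU subset_prod_univ hφ hc hs (h.contDiffOn_cur i)
    (0, basisVec i)
  have x2 : ∀ i, ∫ z, cur G I f i z * W z * fderiv ℝ φ z (0, basisVec i)
      = (∫ z, φ z * (correlate (pairForce G (basisVec i)) (dens G I f) z * cur G I f i z))
        - ∫ z, φ z * fderiv ℝ (cur G I f i) z (0, basisVec i) * W z := fun i => by
    have a1 := (x1 i).2.2
    rw [integral_correlate_space h
      (contDiff_mul_of_tsupport_subset hU hφ hs (h.contDiffOn_cur i))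
      hc.mul_right (tsupport_mul_subset.trans hs)] at a1
    have a2 : ∀ z, φ z * (correlate (pairForce G (basisVec i)) (dens G I f) z * cur G I f i z)
        = φ z * cur G I f i z * correlate (pairForce G (basisVec i)) (dens G I f) z :=
      fun z => by ring
    simp only [a2]
    linarith
  have x3 : ∑ i, ∫ z, φ z * fderiv ℝ (cur G I f i) z (0, basisVec i) * W z
      = -∫ z, φ z * (densDot G I f z * W z) := by
    rw [← integral_finsetSum _ fun i _ => (x1 i).1, ← integral_neg]
    congr 1; funext z
    by_cases hz : z ∈ tsupport φ
    · rw [h.densDot_eq_neg_sum (hs hz), ← Finset.sum_mul, ← Finset.mul_sum]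
      ring
    · simp [image_eq_zero_of_notMem_tsupport hz]
  have x4 : ∑ i, ∫ z, φ z * (correlate (pairForce G (basisVec i)) (dens G I f) z * cur G I f i z)
      = ∫ z, φ z * ∑ i, G.force f z.1 z.2 i * cur G I f i z := by
    rw [← integral_finsetSum _ fun i _ =>
      ((lF (basisVec i)).mul (h.locBdd_cur i)).integrable_mul hφ.continuous hc hs']
    congr 1; funext z
    by_cases hz : z ∈ tsupport φ
    · simp only [h.force_eq (hs hz), Finset.mul_sum]
    · simp [image_eq_zero_of_notMem_tsupport hz]
  -- the flux of energy exchange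
  have f1 := kP.integral_flux hφ hc hs'
  rw [integral_finsetSum _ fun i _ => (kP.locBdd_flux i).integrable_mul_fderiv hφ hc hs' _] at f1
  have f2 : ∫ z, φ z * ((∫ r, powerKernel G I f z r) - ∫ r, powerKernel G I f (z + ((0 : ℝ), r)) r)
      = 1 / 2 * (∫ z, φ z * dens G I f z * V z) - 1 / 2 * ∫ z, φ z * (densDot G I f z * W z) := by
    have j1 := (h.sliceBdd_densDot.locBdd.mul lW).integrable_mul hφ.continuous hc hs'
    have j2 : Integrable fun z => φ z * dens G I f z * V z := by
      simpa only [mul_assoc] using (h.locBdd_dens.mul lV).integrable_mul hφ.continuous hc hs'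
    rw [← integral_const_mul, ← integral_const_mul,
      ← integral_sub (j2.const_mul _) (j1.const_mul _)]
    congr 1; funext z
    rw [(integral_powerKernel z).1, (integral_powerKernel z).2]
    ring
  -- With W and V the correlations of the potential with ρ and ∂_t ρ, the density term gives −½ρV −
  -- ½(∂_t ρ)W, the convective term gives the power of the force plus (∂_t ρ)W, and the exchange
  -- flux gives ½ρV − ½(∂_t ρ)W, each averaged with φ. Only the power is left.
  rw [f1, f2, Finset.sum_congr rfl fun i _ => x2 i, Finset.sum_sub_distrib, x3, x4]
  linarith

end Vlasov

/-! ### Conservation of energy and the free energy inequality. -/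

section FreeEnergy

variable {φ : ℝ × E3 → ℝ}

theorem Model.ftilde_eq (h : Model G I f A) {z : ℝ × E3} (hz : z ∈ spaceTime G I) :
    G.Ftilde f z.1 z.2 = G.Rg * G.Tw * G.H f z.1 z.2 + (moment f halfSq (fun x => x) z
      + 1 / 2 * (dens G I f z * correlate (pairPot G) (dens G I f) z)) := by
  rw [Gas.Ftilde, h.f_eq hz, h.ev_eq hz, dens_of_mem hz]
  ring

theorem Model.jftilde_eq (h : Model G I f A) {z : ℝ × E3} (hz : z ∈ spaceTime G I) (i : Fin 3) :
    G.JFtilde f z.1 z.2 i = G.Rg * G.Tw * G.JH f z.1 z.2 i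
      + (moment f (fun ξ => ξ i * halfSq ξ) (fun x => x) z
        + G.σ ^ 2 / (2 * G.m) * jumpFlux collMeasure (fun w => G.σ • (w.2.2 : E3))
          (transfer G I f fun _ => halfSq) i z
        + (cur G I f i z * correlate (pairPot G) (dens G I f) z
          + jumpFlux volume (fun r => r) (powerKernel G I f) i z)) := by
  rw [← h.qv_eq hz, ← h.pc_qc hz.1, ← h.kinetic_flux hz, Gas.JFtilde, Gas.JF]
  simp only [add_mul, Finset.sum_add_distrib]
  ring

theorem Model.locallyIntegrableOn_energy (h : Model G I f A) :
    LocallyIntegrableOn (fun z => moment f halfSq (fun x => x) z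
      + 1 / 2 * (dens G I f z * correlate (pairPot G) (dens G I f) z)) (spaceTime G I) := by
  have lW := h.sliceBdd_dens.locBdd_correlate h.integrable_pairPot.1 h.measurable_pairPot
  exact (h.locallyIntegrableOn_of_continuousOn
    (admissible_halfSq.contDiffOn_moment h).continuousOn).add
    (((LocBdd.const (1 / 2)).mul (h.locBdd_dens.mul lW)).locallyIntegrableOn h.openI
      subset_prod_univ)

theorem Model.locallyIntegrableOn_energyFlux (h : Model G I f A) (i : Fin 3) :
    LocallyIntegrableOn (fun z => moment f (fun ξ => ξ i * halfSq ξ) (fun x => x) z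
        + G.σ ^ 2 / (2 * G.m) * jumpFlux collMeasure (fun w => G.σ • (w.2.2 : E3))
          (transfer G I f fun _ => halfSq) i z
        + (cur G I f i z * correlate (pairPot G) (dens G I f) z
          + jumpFlux volume (fun r => r) (powerKernel G I f) i z)) (spaceTime G I) := by
  have lW := h.sliceBdd_dens.locBdd_correlate h.integrable_pairPot.1 h.measurable_pairPot
  exact ((h.locallyIntegrableOn_of_continuousOn
    ((admissible_coord_halfSq i).contDiffOn_moment h).continuousOn).add
    (((LocBdd.const _).mul ((collWeight_halfSq.kernelBdd h).locBdd_flux i)).locallyIntegrableOn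
      h.openI subset_prod_univ)).add
    ((((h.locBdd_cur i).mul lW).add ((kernelBdd_power h).locBdd_flux i)).locallyIntegrableOn
      h.openI subset_prod_univ)

/-- The weak conservation of energy. -/
theorem energy_conservation (h : Model G I f A) (hφ : ContDiff ℝ 1 φ)
    (hc : HasCompactSupport φ) (hs : tsupport φ ⊆ spaceTime G I) :
    (∫ z, (moment f halfSq (fun x => x) z
      + 1 / 2 * (dens G I f z * correlate (pairPot G) (dens G I f) z)) * fderiv ℝ φ z (1, 0))
    + ∑ i, ∫ z, (moment f (fun ξ => ξ i * halfSq ξ) (fun x => x) z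
        + G.σ ^ 2 / (2 * G.m) * jumpFlux collMeasure (fun w => G.σ • (w.2.2 : E3))
          (transfer G I f fun _ => halfSq) i z
        + (cur G I f i z * correlate (pairPot G) (dens G I f) z
          + jumpFlux volume (fun r => r) (powerKernel G I f) i z))
        * fderiv ℝ φ z (0, basisVec i) = 0 := by
  have hs' : tsupport φ ⊆ I ×ˢ univ := hs.trans subset_prod_univ
  have hU := h.isOpen_spaceTime
  set c := G.σ ^ 2 / (2 * G.m) with hcdef
  have hc2 : G.σ ^ 2 / G.m = 2 * c := by rw [hcdef]; field_simp
  have hV := integral_potential_energy h hφ hc hs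
  have lW := h.sliceBdd_dens.locBdd_correlate h.integrable_pairPot.1 h.measurable_pairPot
  set W := correlate (pairPot G) (dens G I f) with hW
  have kP := kernelBdd_power h
  have kT := (collWeight_halfSq (G := G) (I := I) (f := f)).kernelBdd h
  set FT := jumpFlux collMeasure (fun w : Coll => G.σ • (w.2.2 : E3))
    (transfer G I f fun _ => halfSq) with hFT
  set FP := jumpFlux volume (fun r : E3 => r) (powerKernel G I f) with hFP
  have m0 := integral_by_parts (volume : Measure (ℝ × E3)) hU hφ hc hs
    (admissible_halfSq.contDiffOn_moment h) (1, 0)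
  have mj := fun j => integral_by_parts (volume : Measure (ℝ × E3)) hU hφ hc hs
    ((admissible_coord_halfSq j).contDiffOn_moment h) (0, basisVec j)
  have i1 := (h.locBdd_dens.mul lW).integrable_mul_fderiv hφ hc hs' (1, 0)
  have i2 := fun j => ((h.locBdd_cur j).mul lW).integrable_mul_fderiv hφ hc hs' (0, basisVec j)
  have i3 := fun j => (kT.locBdd_flux j).integrable_mul_fderiv hφ hc hs' (0, basisVec j)
  have i4 := fun j => (kP.locBdd_flux j).integrable_mul_fderiv hφ hc hs' (0, basisVec j)
  have e0 : ∫ z, (moment f halfSq (fun x => x) z + 1 / 2 * (dens G I f z * W z))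
        * fderiv ℝ φ z (1, 0)
      = (∫ z, moment f halfSq (fun x => x) z * fderiv ℝ φ z (1, 0))
        + 1 / 2 * ∫ z, dens G I f z * W z * fderiv ℝ φ z (1, 0) := by
    rw [← integral_const_mul, ← integral_add m0.2.1 (i1.const_mul _)]
    congr 1; funext z
    ring
  have ej : ∀ j, ∫ z, (moment f (fun ξ => ξ j * halfSq ξ) (fun x => x) z + c * FT j z
        + (cur G I f j z * W z + FP j z)) * fderiv ℝ φ z (0, basisVec j)
      = ((∫ z, moment f (fun ξ => ξ j * halfSq ξ) (fun x => x) z * fderiv ℝ φ z (0, basisVec j))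
        + c * ∫ z, FT j z * fderiv ℝ φ z (0, basisVec j))
        + ((∫ z, cur G I f j z * W z * fderiv ℝ φ z (0, basisVec j))
        + ∫ z, FP j z * fderiv ℝ φ z (0, basisVec j)) := by
    intro j
    have s1 : Integrable fun z => moment f (fun ξ => ξ j * halfSq ξ) (fun x => x) z
        * fderiv ℝ φ z (0, basisVec j) + c * (FT j z * fderiv ℝ φ z (0, basisVec j)) :=
      (mj j).2.1.add ((i3 j).const_mul c)
    have s2 : Integrable fun z => cur G I f j z * W z * fderiv ℝ φ z (0, basisVec j)
        + FP j z * fderiv ℝ φ z (0, basisVec j) := (i2 j).add (i4 j)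
    rw [← integral_const_mul, ← integral_add (mj j).2.1 ((i3 j).const_mul c),
      ← integral_add (i2 j) (i4 j), ← integral_add s1 s2]
    congr 1; funext z
    ring
  rw [e0, Finset.sum_congr rfl fun j _ => ej j]
  simp only [Finset.sum_add_distrib, ← Finset.mul_sum]
  have hT := kT.locBdd_integral.integrable_mul hφ.continuous hc hs'
  have lF : LocBdd I fun z => ∑ i, correlate (pairForce G (basisVec i)) (dens G I f) z
      * cur G I f i z := by
    have l := fun i => (h.sliceBdd_dens.locBdd_correlate (h.integrable_pairForce (basisVec i))
      (h.measurable_pairForce (basisVec i))).mul (h.locBdd_cur i)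
    simp only [Fin.sum_univ_three]
    exact ((l 0).add (l 1)).add (l 2)
  have hF : Integrable fun z => φ z * ∑ i, G.force f z.1 z.2 i * cur G I f i z := by
    refine (lF.integrable_mul hφ.continuous hc hs').congr (Eventually.of_forall fun z => ?_)
    by_cases hz : z ∈ tsupport φ
    · simp only [h.force_eq (hs hz)]
    · simp [image_eq_zero_of_notMem_tsupport hz]
  have b1 : (∫ z, moment f halfSq (fun x => x) z * fderiv ℝ φ z (1, 0))
      + ∑ j, ∫ z, moment f (fun ξ => ξ j * halfSq ξ) (fun x => x) z
          * fderiv ℝ φ z (0, basisVec j)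
      = -(2 * c * (∫ z, φ z * ∫ w, transfer G I f (fun _ => halfSq) z w ∂collMeasure)
        + ∫ z, φ z * ∑ i, G.force f z.1 z.2 i * cur G I f i z) := by
    rw [m0.2.2, Finset.sum_congr rfl fun j _ => (mj j).2.2, Finset.sum_neg_distrib, ← neg_add,
      ← integral_finsetSum _ fun j _ => (mj j).1,
      ← integral_add m0.1 (integrable_finsetSum _ fun j _ => (mj j).1), ← integral_const_mul,
      ← integral_add (hT.const_mul _) hF]
    congr 2; funext z
    by_cases hz : z ∈ tsupport φ
    · rw [← Finset.mul_sum, ← mul_add, h.energy_balance (hs hz), hc2]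
      ring
    · simp [image_eq_zero_of_notMem_tsupport hz]
  -- Energy conservation in a collision means T* = −T, so T − T* = 2T and the collisional flux
  -- accounts for the whole energy transfer.
  have b2 : ∑ j, ∫ z, FT j z * fderiv ℝ φ z (0, basisVec j)
      = 2 * ∫ z, φ z * ∫ w, transfer G I f (fun _ => halfSq) z w ∂collMeasure := by
    have := collWeight_halfSq.integral_flux h hφ hc hs'
    rw [integral_finsetSum _ fun i _ => i3 i] at this
    rw [this, ← integral_const_mul]
    congr 1; funext z
    have e1 : ∀ w, transferStar G I f (fun _ => halfSq) z w
        = -transfer G I f (fun _ => halfSq) z w := fun w => by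
      linarith [transfer_add_transferStar_halfSq (G := G) (I := I) (f := f) z w]
    simp only [e1, integral_neg]
    ring
  linear_combination b1 + c * b2 + hV

theorem LocallyIntegrableOn.const_mul_add {U : Set (ℝ × E3)} {u v : ℝ × E3 → ℝ}
    (hu : LocallyIntegrableOn u U) (hv : LocallyIntegrableOn v U) (c : ℝ) :
    LocallyIntegrableOn (fun z => c * u z + v z) U := fun z hz => by
  obtain ⟨s, hs, hi⟩ := hu z hz
  obtain ⟨s', hs', hi'⟩ := hv z hz
  exact ⟨s ∩ s', inter_mem hs hs', ((hi.mono_set inter_subset_left).const_mul c).add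
    (hi'.mono_set inter_subset_right)⟩

theorem Model.locallyIntegrableOn_ftilde (h : Model G I f A) :
    LocallyIntegrableOn (fun z : ℝ × E3 => G.Ftilde f z.1 z.2) (spaceTime G I) :=
  locallyIntegrableOn_of_eqOn h.isOpen_spaceTime.measurableSet
    (LocallyIntegrableOn.const_mul_add h.locallyIntegrableOn_h h.locallyIntegrableOn_energy
      (G.Rg * G.Tw)) fun _ hz => h.ftilde_eq hz

theorem Model.locallyIntegrableOn_jftilde (h : Model G I f A) (i : Fin 3) :
    LocallyIntegrableOn (fun z : ℝ × E3 => G.JFtilde f z.1 z.2 i) (spaceTime G I) :=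
  locallyIntegrableOn_of_eqOn h.isOpen_spaceTime.measurableSet
    (LocallyIntegrableOn.const_mul_add (h.locallyIntegrableOn_jh i)
      (h.locallyIntegrableOn_energyFlux i) (G.Rg * G.Tw)) fun _ hz => h.jftilde_eq hz i

theorem integral_mul_congr_of_tsupport {U : Set (ℝ × E3)} (hφ : ContDiff ℝ 1 φ)
    (hc : HasCompactSupport φ) (hs : tsupport φ ⊆ U) {w u v : ℝ × E3 → ℝ} {c : ℝ}
    (hu : LocallyIntegrableOn u U) (hv : LocallyIntegrableOn v U)
    (hw : ∀ z ∈ U, w z = c * u z + v z) (e : ℝ × E3) :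
    ∫ z, w z * fderiv ℝ φ z e
      = c * (∫ z, u z * fderiv ℝ φ z e) + ∫ z, v z * fderiv ℝ φ z e := by
  rw [← integral_const_mul, ← integral_add
    ((integrable_mul_fderiv_of_locallyIntegrableOn hφ hc hs hu e).const_mul c)
    (integrable_mul_fderiv_of_locallyIntegrableOn hφ hc hs hv e)]
  congr 1; funext z
  rw [mul_congr_of_tsupport hs hw]
  ring

/-- The free energy is produced at the rate of the H function. -/
theorem pairing_freeEnergy (h : Model G I f A) (hφ : ContDiff ℝ 1 φ)
    (hc : HasCompactSupport φ) (hs : tsupport φ ⊆ spaceTime G I) :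
    pairing (G.Ftilde f) (G.JFtilde f) φ = G.Rg * G.Tw * pairing (G.H f) (G.JH f) φ := by
  have hE := energy_conservation h hφ hc hs
  rw [pairing_eq_sum hφ hc hs h.locallyIntegrableOn_ftilde h.locallyIntegrableOn_jftilde,
    pairing_eq_sum hφ hc hs h.locallyIntegrableOn_h h.locallyIntegrableOn_jh,
    integral_mul_congr_of_tsupport hφ hc hs h.locallyIntegrableOn_h h.locallyIntegrableOn_energy
      (fun _ hz => h.ftilde_eq hz) (1, 0),
    Finset.sum_congr rfl fun i _ => integral_mul_congr_of_tsupport hφ hc hs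
      (h.locallyIntegrableOn_jh i) (h.locallyIntegrableOn_energyFlux i)
      (fun _ hz => h.jftilde_eq hz i) (0, basisVec i),
    Finset.sum_add_distrib, ← Finset.mul_sum]
  linear_combination hE

theorem balanceLE_freeEnergy (h : Model G I f A) :
    BalanceLE (spaceTime G I) (G.Ftilde f) (G.JFtilde f) :=
  balanceLE_of_pairing h.isOpen_spaceTime h.locallyIntegrableOn_ftilde
    h.locallyIntegrableOn_jftilde fun φ hφ h0 => by
      rw [pairing_freeEnergy h (hφ.smooth.of_le (by simp)) hφ.compact hφ.supp]
      exact mul_nonneg (mul_nonneg h.Rg_pos.le h.Tw_pos.le)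
        ((balanceLE_entropy h).weak φ hφ h0)

end FreeEnergy

end EnskogVlasov
-- The theorem, assembled from the entropy and free energy balances.
theorem mainTheorem3
    (G : Gas) (I : Set ℝ) (f : ℝ → E3 → E3 → ℝ)
    (hI : IsOpen I) (hD : IsOpen G.D)
    (hσ : 0 < G.σ) (hm : 0 < G.m) (hR : 0 < G.Rg) (hT : 0 < G.Tw)
    -- the Enskog factor: `S` is nonnegative and continuous on an interval of values of `ℛ`
    (A : Set ℝ) (hA : A.OrdConnected) (hA0 : (0 : ℝ) ∈ A)
    (hSc : ContinuousOn G.S A) (hS : ∀ x ∈ A, 0 ≤ G.S x)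
    (hcrowd : ∀ t ∈ I, ∀ X ∈ closure G.D, G.crowd f t X ∈ A)
    -- the attractive isotropic potential, integrable over the differences of points of the domain
    (hΦ : ContDiffOn ℝ 1 G.Φ (Ioi 0)) (hattr : ∀ x > 0, 0 ≤ deriv G.Φ x)
    (hΦint : IntegrableOn (fun r : E3 => (1 + ‖r‖) * (|G.Φ ‖r‖| + |deriv G.Φ ‖r‖|))
      {r | ∃ X ∈ G.D, ∃ Y ∈ G.D, r = Y - X})
    -- the solution
    (hf : G.Regular f I) (hwall : G.Impermeable f I) (hsol : G.SolvesEnskogVlasov f I) :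
    -- the local H theorem, with its case of equality
    BalanceLE (I ×ˢ G.D) (G.H f) (G.JH f) ∧
    (∀ U : Set (ℝ × E3), IsOpen U → U ⊆ I ×ˢ G.D →
      (BalanceEq U (G.H f) (G.JH f) ↔
        ∀ t X, (t, X) ∈ U → ∀ (α : S2) (ξ ξs : E3), G.g f t X (X - G.σ • (α : E3)) ≠ 0 →
          f t (X - G.σ • (α : E3)) (postStar α ξ ξs) * f t X (post α ξ ξs)
            = f t X ξ * f t (X - G.σ • (α : E3)) ξs)) ∧
    -- the local statement for the free energy
    BalanceLE (I ×ˢ G.D) (G.Ftilde f) (G.JFtilde f) := by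
  have h : EnskogVlasov.Model G I f A :=
    ⟨hI, hD, hσ, hm, hR, hT, hA, hA0, hSc, hS, hcrowd, hΦ, hΦint, hf, hwall, hsol⟩
  refine ⟨EnskogVlasov.balanceLE_entropy h, fun U hU hUs => ?_, EnskogVlasov.balanceLE_freeEnergy h⟩
  rw [EnskogVlasov.balanceEq_iff h hU hUs]
  exact ⟨fun hb t X htX α ξ ξs hg => hb (t, X) htX (ξ, ξs, α) hg,
    fun hb z hz w hg => hb z.1 z.2 hz w.2.2 w.1 w.2.1 hg⟩
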